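/- Let $d\ge 1$, $\lambda\ge 0$, $\eta\in\mathbb R$ and $M>0$ satisfy $\kappa:=\lambda+\eta M>0$. Consider on $\mathbb R^{1+d}$ the equations $$2iu_t=-\Delta u+\lambda|x|^2u+\eta\,(|x|^2*|u|^2)\,u,\qquad (H)$$ $$2iv_t=-\Delta v+\lambda|x|^2v+\eta\, v\int_{\mathbb R^d}(|x-y|^2-|y|^2)\,|v(y)|^2\,dy.\qquad (H')$$ For a multi-index $n\in\mathbb Z_{\ge0}^d$ put $|n|=n_1+\dots+n_d$, $n!=\prod_j n_j!$, $$\Omega_n(x)=\frac{1}{\sqrt{\pi^{d/2}\,2^{|n|}\,n!}}\,e^{|x|^2/2}\Big(-\frac{\partial}{\partial x}\Big)^{n}e^{-|x|^2},\qquad \Omega_{n,\kappa}(x)=\kappa^{d/8}\,\Omega_n(\kappa^{1/4}x).$$ For $s\ge0$ let $\Sigma^s=D\big((-\tfrac12\Delta+\tfrac12|x|^2)^{s/2}\big)$, i.e. the space of all $f\in L^2(\mathbb R^d)$ for which the norm $$\|f\|_{\Sigma^s}=\Big(\sum_n\big(|n|+\tfrac d2\big)^{s}\,|(f,\Omega_n)|^2\Big)^{1/2}$$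 is finite. Solutions of (H) are functions in $C(\mathbb R;\Sigma^1)$, and solutions of (H$'$) are functions in $C(\mathbb R;\Sigma^{1/2})$, that satisfy the equation for all $t\in\mathbb R$ in the sense of tempered distributions in $x$. A solution of the form $e^{-i\omega t/2}\phi(x)$ is called a standing wave. It is called (orbitally) stable in $\Sigma^s$ if $\phi\in\Sigma^s$ and for every $\varepsilon>0$ there is $\delta>0$ such that for every $u_0\in\Sigma^s$ with $\|u_0-\phi\|_{\Sigma^s}<\delta$ the equation has a unique solution $u$ with $u(0)=u_0$, and this solution belongs to $C(\mathbb R;\Sigma^s)$ and satisfies $$\sup_{t>0}\ \inf_{\theta\in\mathbb R,\ y\in\mathbb R^d}\ \big\|\phi-e^{i\theta}u(t,\cdot-y)\big\|_{\Sigma^s}<\varepsilon .$$ Then, for every multi-index $n$: (1) with $\omega_1=(2+\eta M\kappa^{-1})\,\kappa^{1/2}\,(|n|+\tfrac d2)$, the function $e^{-i\omega_1t/2}M^{1/2}\Omega_{n,\kappa}(x)$ is a standing wave of (H) and is stable in $\Sigma^s$ for every $s\ge1$; (2) with $\omega_2=2\,\kappa^{1/2}\,(|n|+\tfrac d2)$,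 the function $e^{-i\omega_2t/2}M^{1/2}\Omega_{n,\kappa}(x)$ is a standing wave of (H$'$) and is stable in $\Sigma^s$ for every $s\ge\tfrac12$. -/

import Mathlib

open MeasureTheory Filter Topology
open scoped ENNReal SchwartzMap

noncomputable section

namespace NonlocalNLS

/-- `d`-dimensional Euclidean space. -/
abbrev Space (d : ℕ) : Type := EuclideanSpace ℝ (Fin d)

/-- Length `|n| = n₁ + ⋯ + n_d` of a multi-index. -/
def len {d : ℕ} (n : Fin d → ℕ) : ℕ := ∑ j, n j

/-- The normalized Hermite functions
`Ω_n(x) = (π^{d/2} 2^{|n|} n!)^{-1/2} e^{|x|²/2} (-∂/∂x)^n e^{-|x|²}`.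
Since `e^{-|x|²} = ∏ j, e^{-x_j²}`, the mixed derivative is the product over `j` of the derivatives
`(-d/dr)^{n_j} e^{-r²}` at `r = x_j`. -/
def hermiteFun {d : ℕ} (n : Fin d → ℕ) (x : Space d) : ℝ :=
  (Real.sqrt (Real.pi ^ ((d : ℝ) / 2) * 2 ^ len n * ∏ j, ((n j).factorial : ℝ)))⁻¹
    * Real.exp (‖x‖ ^ 2 / 2)
    * ∏ j, ((-1 : ℝ) ^ n j * iteratedDeriv (n j) (fun r : ℝ => Real.exp (-r ^ 2)) (x j))

/-- The rescaled functions `Ω_{n,κ}(x) = κ^{d/8} Ω_n(κ^{1/4} x)`, for `κ > 0`. -/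
def hermiteFunScaled {d : ℕ} (κ : ℝ) (n : Fin d → ℕ) (x : Space d) : ℝ :=
  κ ^ ((d : ℝ) / 8) * hermiteFun n (κ ^ (1 / 4 : ℝ) • x)

/-- The Hermite coefficient `(f, Ω_n)` (the function `Ω_n` is real valued). -/
def hermiteCoeff {d : ℕ} (f : Space d → ℂ) (n : Fin d → ℕ) : ℂ :=
  ∫ x, f x * (hermiteFun n x : ℂ)

/-- The norm of `Σ^s = D((-½Δ + ½|x|²)^{s/2})`, with values in `[0, ∞]`:
`‖f‖ = (∑ₙ (|n| + d/2)^s |(f, Ω_n)|²)^{1/2}`. -/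
def sigmaNorm {d : ℕ} (s : ℝ) (f : Space d → ℂ) : ℝ≥0∞ :=
  (∑' n : Fin d → ℕ,
    ENNReal.ofReal (((len n : ℝ) + (d : ℝ) / 2) ^ s * ‖hermiteCoeff f n‖ ^ 2)) ^ (1 / 2 : ℝ)

/-- Membership in `Σ^s`, for `s ≥ 0`: the functions in `L²` whose `Σ^s` norm is finite. -/
def MemSigma {d : ℕ} (s : ℝ) (f : Space d → ℂ) : Prop :=
  MemLp f 2 volume ∧ sigmaNorm s f < ∞

/-- `u ∈ C(ℝ; Σ^s)`, for `s ≥ 0`. -/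
def ContinuousInSigma {d : ℕ} (s : ℝ) (u : ℝ → Space d → ℂ) : Prop :=
  (∀ t, MemSigma s (u t)) ∧
    ∀ t₀, Tendsto (fun t => sigmaNorm s (fun x => u t x - u t₀ x)) (𝓝 t₀) (𝓝 0)

/-- The potential `(|x|² * |w|²)(x) = ∫ |x - y|² |w(y)|² dy`. -/
def potentialH {d : ℕ} (w : Space d → ℂ) (x : Space d) : ℝ :=
  ∫ y, ‖x - y‖ ^ 2 * ‖w y‖ ^ 2

/-- The modified potential `∫ (|x - y|² - |y|²) |w(y)|² dy`. -/
def potentialH' {d : ℕ} (w : Space d → ℂ) (x : Space d) : ℝ :=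
  ∫ y, (‖x - y‖ ^ 2 - ‖y‖ ^ 2) * ‖w y‖ ^ 2

/-- `2i u_t = -Δu + lam |x|² u + η W[u] u` for all `t ∈ ℝ`, in the sense of tempered distributions
in `x`: for every Schwartz function `ψ`, the pairing of `u(t)` with `ψ` is differentiable in `t`,
and its derivative is given by the equation, with `Δ` moved to `ψ`. -/
def SolvesEquation {d : ℕ} (lam η : ℝ) (W : (Space d → ℂ) → Space d → ℝ)
    (u : ℝ → Space d → ℂ) : Prop :=
  ∀ (ψ : 𝓢(Space d, ℂ)) (t : ℝ),
    HasDerivAt (fun τ : ℝ => 2 * Complex.I * ∫ x, u τ x * ψ x)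
      (∫ x, u t x * (-(Laplacian.laplacian ψ) x
        + ((lam * ‖x‖ ^ 2 + η * W (u t) x : ℝ) : ℂ) * ψ x)) t

/-- Global solutions, in `C(ℝ; Σ¹)`, of
`2i u_t = -Δu + lam |x|² u + η (|x|² * |u|²) u`. -/
def IsSolutionH {d : ℕ} (lam η : ℝ) (u : ℝ → Space d → ℂ) : Prop :=
  ContinuousInSigma 1 u ∧ SolvesEquation lam η potentialH u

/-- Global solutions, in `C(ℝ; Σ^{1/2})`, of
`2i v_t = -Δv + lam |x|² v + η v ∫ (|x - y|² - |y|²) |v(y)|² dy`. -/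
def IsSolutionH' {d : ℕ} (lam η : ℝ) (v : ℝ → Space d → ℂ) : Prop :=
  ContinuousInSigma (1 / 2) v ∧ SolvesEquation lam η potentialH' v

/-- `e^{-iωt/2} φ(x)` is a solution. -/
def IsStandingWave {d : ℕ} (Sol : (ℝ → Space d → ℂ) → Prop) (ω : ℝ) (φ : Space d → ℂ) : Prop :=
  Sol (fun t x => Complex.exp (-(Complex.I * ω * t / 2)) * φ x)

/-- Orbital stability in `Σ^s` of the standing wave with profile `φ ∈ Σ^s`: for every `ε > 0` there
is `δ > 0` such that every `u₀ ∈ Σ^s` with `‖u₀ - φ‖ < δ` is the initial value of a solution,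
which is unique among all solutions in the class `Sol`, belongs to `C(ℝ; Σ^s)`, and satisfies
`sup_{t > 0} inf_{θ ∈ ℝ, y} ‖φ - e^{iθ} u(t, · - y)‖ < ε`. All norms are those of `Σ^s`. -/
def IsOrbitallyStable {d : ℕ} (Sol : (ℝ → Space d → ℂ) → Prop) (s : ℝ) (φ : Space d → ℂ) : Prop :=
  MemSigma s φ ∧
  ∀ ε : ℝ, 0 < ε → ∃ δ : ℝ, 0 < δ ∧
    ∀ u₀ : Space d → ℂ, MemSigma s u₀ →
      sigmaNorm s (fun x => u₀ x - φ x) < ENNReal.ofReal δ →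
      ∃ u : ℝ → Space d → ℂ,
        Sol u ∧ u 0 =ᵐ[volume] u₀ ∧
        (∀ w : ℝ → Space d → ℂ, Sol w → w 0 =ᵐ[volume] u₀ → ∀ t, w t =ᵐ[volume] u t) ∧
        ContinuousInSigma s u ∧
        (⨆ (t : ℝ) (_ : 0 < t), ⨅ (θ : ℝ) (y : Space d),
          sigmaNorm s (fun x => φ x - Complex.exp (Complex.I * θ) * u t (x - y)))
            < ENNReal.ofReal ε

end NonlocalNLS

end

open NonlocalNLS

/-!
Both potentials are quadratic polynomials in `x`, since `|x - y|² = |x|² - 2 x·y + |y|²`. For a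
solution of the modified equation the mass is conserved, so that with `κ = lam + η ‖v‖²` the
equation is a harmonic oscillator of frequency `√κ`, driven by the force `η ∫ y |v(y)|² dy`. The
convolution equation differs from it by the `x`-independent potential `η ∫ |y|² |u(y)|² dy`, which a
time-dependent phase removes (`IsSolutionH.gauge`, `IsSolutionH'.gauge`).

*Moving frames.* A frame acts by translation, modulation, dilation and a phase. In the frame that
follows a classical trajectory of the driven oscillator, at scale `κ^{1/4}`, the driven equation
becomes the harmonic oscillator group `hoFlow` (`driven_intertwining`, `isWeakFlow_driven`). If the
profile at time `0` has vanishing mean position and momentum (`restProfile`), then the mean position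
of the solution follows the same trajectory, and the force `-κ q + η ‖v‖² q = -lam q` no longer
depends on the solution: the interaction does not act on the centre of mass. This gives existence
(`exists_isSolutionH'`). For uniqueness, the first moment of any solution satisfies the same
classical equation (`IsSolutionH'.exists_isTrajectory`), so that two solutions with the same initial
value solve the same linear equation (`IsSolutionH'.unique`).

*Stability.* For the standing wave the profile at rest is `M^{1/2} Ω_n`, an eigenfunction of the
oscillator group, and this group acts isometrically on `Σ^s`. Hence a profile at rest which starts
close to `M^{1/2} Ω_n` stays close to it up to a phase. The frame adds a translation and a phase,
which the orbit absorbs; a change of scale, which is small since the mass is close to `M`; and a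
momentum, which stays small since `|p|² + lam |q|²` is conserved and `lam ≥ 0`
(`exists_forall_sigmaNorm_le`, `exists_isSolutionH'_near`).

*Low regularity.* Tested against the Hermite functions, a Schrödinger equation with a quadratic
generator is an infinite system for the Hermite coefficients, whose matrix is Hermitian, couples
`n` only to `n ± e_j` and `n ± 2 e_j`, and grows at most like the eigenvalue `|n| + d/2`
(`IsBandedFlow`). The time derivative of a weighted `ℓ²` norm therefore involves only the increments
of the weight, which compensate that growth. Hence the `Σ^s` norm is propagated for every `s ≥ 0`
(`IsBandedFlow.exists_sqSum_le`) and the mass is conserved (`IsBandedFlow.tsum_sq_eq`); conservation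
of the mass of a difference is uniqueness for the linear equation (`IsWeakFlow.unique`). Moving
frames, which are values of such flows, act continuously on `Σ^s` as well
(`Frame.exists_sqSum_act_le`). On `Σ^{1/2}` the first moments are controlled by
averaging a resolvent inequality between `L²` and `Σ¹` (`lintegral_resolvent_weight_le`,
`lintegral_norm_mul_sq_le`), and the mean momentum is defined as the mean position after a
quarter turn `hoFlow (π/2)` in phase space, which needs no derivatives (`moment_hoFlow_boost`).
-/

open MeasureTheory Filter Topology
open scoped ENNReal SchwartzMap

noncomputable section

namespace NonlocalNLS

variable {d : ℕ}

/-! ### Hermite functions and ladder relations -/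

/-- The one-dimensional factor `(-d/dr)^k e^{-r²}`. -/
def gaussDeriv (k : ℕ) (r : ℝ) : ℝ :=
  (-1 : ℝ) ^ k * iteratedDeriv k (fun r : ℝ => Real.exp (-r ^ 2)) r

lemma gaussDeriv_zero (r : ℝ) : gaussDeriv 0 r = Real.exp (-r ^ 2) := by
  simp [gaussDeriv]

lemma hasDerivAt_gaussDeriv (k : ℕ) (r : ℝ) :
    HasDerivAt (gaussDeriv k) (-gaussDeriv (k + 1) r) r := by
  have hs : ContDiff ℝ ⊤ (fun r : ℝ => Real.exp (-r ^ 2)) := by fun_prop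
  have h1 : Differentiable ℝ (iteratedDeriv k (fun r : ℝ => Real.exp (-r ^ 2))) :=
    hs.differentiable_iteratedDeriv k (by exact WithTop.coe_lt_top _)
  have h2 := ((h1 r).hasDerivAt).const_mul ((-1 : ℝ) ^ k)
  refine HasDerivAt.congr_deriv h2 ?_
  simp only [gaussDeriv, iteratedDeriv_succ, pow_succ]
  ring

/-- The three-term recursion of the Hermite polynomials. -/
lemma gaussDeriv_succ (k : ℕ) (r : ℝ) :
    gaussDeriv (k + 1) r = 2 * r * gaussDeriv k r - 2 * k * gaussDeriv (k - 1) r := by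
  induction k generalizing r with
  | zero =>
    have h := (hasDerivAt_gaussDeriv 0 r)
    have h' : HasDerivAt (gaussDeriv 0) (Real.exp (-r ^ 2) * (-(2 * r))) r := by
      have : gaussDeriv 0 = fun r => Real.exp (-r ^ 2) := funext gaussDeriv_zero
      rw [this]
      have := ((hasDerivAt_pow 2 r).neg).exp
      simpa using this
    have := h.unique h'
    rw [gaussDeriv_zero]
    simp only [Nat.cast_zero]
    linarith
  | succ k ih =>
    have hL := hasDerivAt_gaussDeriv (k + 1) r
    have hf : gaussDeriv (k + 1)
        = fun r => 2 * r * gaussDeriv k r - 2 * k * gaussDeriv (k - 1) r := funext ih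
    have hk : 2 * (k : ℝ) * -gaussDeriv (k - 1 + 1) r = - (2 * k * gaussDeriv k r) := by
      rcases k with _ | k
      · simp
      · simp
    have hR : HasDerivAt (fun r => 2 * r * gaussDeriv k r - 2 * k * gaussDeriv (k - 1) r)
        (2 * gaussDeriv k r + 2 * r * (-gaussDeriv (k + 1) r)
          - 2 * k * -gaussDeriv (k - 1 + 1) r) r := by
      have h1 : HasDerivAt (fun r : ℝ => 2 * r) 2 r := by
        simpa using (hasDerivAt_id r).const_mul (2 : ℝ)
      exact (h1.mul (hasDerivAt_gaussDeriv k r)).sub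
        ((hasDerivAt_gaussDeriv (k - 1) r).const_mul (2 * (k : ℝ)))
    rw [← hf] at hR
    have := hL.unique hR
    rw [hk] at this
    simp only [Nat.add_sub_cancel, Nat.cast_add, Nat.cast_one]
    linarith

/-- The normalizing constant of `hermiteFun n`. -/
def hermiteNorm (n : Fin d → ℕ) : ℝ :=
  (Real.sqrt (Real.pi ^ ((d : ℝ) / 2) * 2 ^ len n * ∏ j, ((n j).factorial : ℝ)))⁻¹

lemma hermiteFun_eq (n : Fin d → ℕ) (x : Space d) :
    hermiteFun n x = hermiteNorm n * Real.exp (‖x‖ ^ 2 / 2) * ∏ j, gaussDeriv (n j) (x j) := rfl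

lemma len_add (n m : Fin d → ℕ) : len (n + m) = len n + len m := by
  simp [len, Finset.sum_add_distrib]

lemma len_single (j : Fin d) (k : ℕ) : len (Pi.single j k) = k := by
  simp [len]

lemma hermiteNorm_succ (n : Fin d → ℕ) (j : Fin d) :
    hermiteNorm n = Real.sqrt (2 * (n j + 1)) * hermiteNorm (n + Pi.single j 1) := by
  have hprod : ∏ i, (((n + Pi.single j 1 : Fin d → ℕ) i).factorial : ℝ)
      = (n j + 1) * ∏ i, ((n i).factorial : ℝ) := by
    rw [← Finset.mul_prod_erase _ _ (Finset.mem_univ j),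
      ← Finset.mul_prod_erase (a := j) Finset.univ (fun i => ((n i).factorial : ℝ))
        (Finset.mem_univ j)]
    have : ∀ i ∈ Finset.univ.erase j, (((n + Pi.single j 1 : Fin d → ℕ) i).factorial : ℝ)
        = ((n i).factorial : ℝ) := by
      intro i hi
      simp [Finset.ne_of_mem_erase hi]
    rw [Finset.prod_congr rfl this]
    simp [Nat.factorial_succ]
    ring
  unfold hermiteNorm
  rw [hprod, len_add, len_single, pow_succ]
  have h0 : (0 : ℝ) < n j + 1 := by positivity
  rw [show Real.pi ^ ((d : ℝ) / 2) * (2 ^ len n * 2) * ((n j + 1) * ∏ i, ((n i).factorial : ℝ))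
    = (2 * (n j + 1)) * (Real.pi ^ ((d : ℝ) / 2) * 2 ^ len n * ∏ i, ((n i).factorial : ℝ)) by ring,
    Real.sqrt_mul (x := 2 * ((n j : ℝ) + 1)) (by positivity), mul_inv, ← mul_assoc,
      mul_inv_cancel₀ (by positivity), one_mul]

lemma sub_add_single {n : Fin d → ℕ} {j : Fin d} (h : n j ≠ 0) :
    n - Pi.single j 1 + Pi.single j 1 = n := by
  funext i
  by_cases hi : i = j
  · subst hi
    simp
    omega
  · simp [hi]

lemma prod_gaussDeriv_add (n : Fin d → ℕ) (j : Fin d) (x : Space d) :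
    ∏ i, gaussDeriv ((n + Pi.single j 1 : Fin d → ℕ) i) (x i)
      = gaussDeriv (n j + 1) (x j) * ∏ i ∈ Finset.univ.erase j, gaussDeriv (n i) (x i) := by
  rw [← Finset.mul_prod_erase _ _ (Finset.mem_univ j)]
  congr 1
  · simp
  · refine Finset.prod_congr rfl fun i hi => ?_
    simp [Finset.ne_of_mem_erase hi]

lemma prod_gaussDeriv_sub (n : Fin d → ℕ) (j : Fin d) (x : Space d) :
    ∏ i, gaussDeriv ((n - Pi.single j 1 : Fin d → ℕ) i) (x i)
      = gaussDeriv (n j - 1) (x j) * ∏ i ∈ Finset.univ.erase j, gaussDeriv (n i) (x i) := by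
  rw [← Finset.mul_prod_erase _ _ (Finset.mem_univ j)]
  congr 1
  · simp
  · refine Finset.prod_congr rfl fun i hi => ?_
    simp [Finset.ne_of_mem_erase hi]

/-- Position is the sum of the raising and the lowering operator. The truncated difference `n - e_j`
at `n_j = 0` is harmless, since its coefficient vanishes. -/
lemma hermiteFun_coord_mul (n : Fin d → ℕ) (j : Fin d) (x : Space d) :
    Real.sqrt 2 * (x j * hermiteFun n x)
      = Real.sqrt (n j + 1) * hermiteFun (n + Pi.single j 1) x
        + Real.sqrt (n j) * hermiteFun (n - Pi.single j 1) x := by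
  have h2 : Real.sqrt 2 * Real.sqrt 2 = 2 := Real.mul_self_sqrt (by norm_num)
  have hA := hermiteNorm_succ n j
  rw [Real.sqrt_mul (by norm_num)] at hA
  have hB : Real.sqrt (n j) * hermiteNorm (n - Pi.single j 1)
      = Real.sqrt 2 * (n j) * hermiteNorm n := by
    rcases Nat.eq_zero_or_pos (n j) with h | h
    · simp [h]
    · have := hermiteNorm_succ (n - Pi.single j 1) j
      rw [sub_add_single h.ne'] at this
      rw [this, Real.sqrt_mul (by norm_num)]
      have h3 : (((n - Pi.single j 1 : Fin d → ℕ) j : ℕ) : ℝ) + 1 = n j := by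
        simp [Nat.cast_sub (Nat.succ_le_of_lt h)]
      rw [h3]
      have h4 : Real.sqrt (n j) * Real.sqrt (n j) = n j := Real.mul_self_sqrt (by positivity)
      linear_combination (Real.sqrt 2 * hermiteNorm n) * h4
  simp only [hermiteFun_eq, prod_gaussDeriv_add, prod_gaussDeriv_sub, gaussDeriv_succ]
  rw [← Finset.mul_prod_erase Finset.univ (fun i => gaussDeriv (n i) (x i)) (Finset.mem_univ j)]
  set P := ∏ i ∈ Finset.univ.erase j, gaussDeriv (n i) (x i)
  set E := Real.exp (‖x‖ ^ 2 / 2)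
  linear_combination (E * P * Real.sqrt 2 * x j * gaussDeriv (n j) (x j)) * hA
    - (E * P * gaussDeriv (n j - 1) (x j)) * hB
    + (E * P * (Real.sqrt (n j + 1) * hermiteNorm (n + Pi.single j 1) * x j
      * gaussDeriv (n j) (x j))) * h2
    - (E * P * gaussDeriv (n j - 1) (x j) * (n j)) * (Real.sqrt 2) * hA
    - (E * P * gaussDeriv (n j - 1) (x j) * n j)
      * (Real.sqrt (n j + 1) * hermiteNorm (n + Pi.single j 1)) * h2

/-- The `j`-th standard basis vector. -/
abbrev basisVec (j : Fin d) : Space d := EuclideanSpace.single j (1 : ℝ)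

/-- The raising operator: `∂_j Ω_n = x_j Ω_n - √(2(n_j + 1)) Ω_{n + e_j}`. -/
lemma hasLineDerivAt_hermiteFun (n : Fin d → ℕ) (j : Fin d) (x : Space d) :
    HasLineDerivAt ℝ (hermiteFun n)
      (x j * hermiteFun n x
        - Real.sqrt 2 * (Real.sqrt (n j + 1) * hermiteFun (n + Pi.single j 1) x))
      x (basisVec j) := by
  unfold HasLineDerivAt
  have hfun : (fun t : ℝ => hermiteFun n (x + t • basisVec j)) = fun t =>
      hermiteNorm n * Real.exp ((‖x‖ ^ 2 + 2 * t * x j + t ^ 2) / 2) *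
        (gaussDeriv (n j) (x j + t) * ∏ i ∈ Finset.univ.erase j, gaussDeriv (n i) (x i)) := by
    funext t
    rw [hermiteFun_eq]
    congr 1
    · congr 2
      rw [@norm_add_sq_real, inner_smul_right, norm_smul]
      simp [EuclideanSpace.inner_single_right]
      ring
    · rw [← Finset.mul_prod_erase _ _ (Finset.mem_univ j)]
      congr 1
      · simp
      · refine Finset.prod_congr rfl fun i hi => ?_
        simp [Finset.ne_of_mem_erase hi]
  rw [hfun]
  have h1 : HasDerivAt (fun t : ℝ => (‖x‖ ^ 2 + 2 * t * x j + t ^ 2) / 2) (x j) 0 := by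
    have := ((((hasDerivAt_id (0:ℝ)).const_mul 2).mul_const (x j)).const_add (‖x‖ ^ 2)).add
      (hasDerivAt_pow 2 (0:ℝ))
    have := this.div_const 2
    refine (this.congr_deriv ?_)
    simp
  have h2 : HasDerivAt (fun t : ℝ => gaussDeriv (n j) (x j + t))
      (-gaussDeriv (n j + 1) (x j)) 0 := by
    have h := hasDerivAt_gaussDeriv (n j) (x j + 0)
    simpa using h.comp_const_add (x j) 0
  have h3 := (h1.exp.const_mul (hermiteNorm n)).mul
    (h2.mul_const (∏ i ∈ Finset.univ.erase j, gaussDeriv (n i) (x i)))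
  refine h3.congr_deriv ?_
  have hA := hermiteNorm_succ n j
  rw [Real.sqrt_mul (by norm_num)] at hA
  simp only [hermiteFun_eq, prod_gaussDeriv_add]
  rw [← Finset.mul_prod_erase Finset.univ (fun i => gaussDeriv (n i) (x i)) (Finset.mem_univ j)]
  simp only [mul_zero, zero_mul, add_zero, ne_eq, OfNat.ofNat_ne_zero, not_false_eq_true, zero_pow]
  set P := ∏ i ∈ Finset.univ.erase j, gaussDeriv (n i) (x i)
  set E := Real.exp (‖x‖ ^ 2 / 2)
  linear_combination (-E * P * gaussDeriv (n j + 1) (x j)) * hA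

/-! ### Hermite functions as Schwartz functions -/

/-- A polynomial times a Gaussian is bounded on `[0, ∞)`. -/
lemma exists_pow_mul_gaussian_le (N : ℕ) :
    ∃ C : ℝ, ∀ r : ℝ, 0 ≤ r → (1 + r) ^ N * Real.exp (-(r ^ 2 / 2)) ≤ C := by
  refine ⟨N.factorial * Real.exp (3 / 2), fun r hr => ?_⟩
  have h1 : (1 + r) ^ N ≤ N.factorial * Real.exp (1 + r) := by
    have := Real.pow_div_factorial_le_exp (1 + r) (by linarith) N
    rwa [div_le_iff₀' (by positivity)] at this
  calc (1 + r) ^ N * Real.exp (-(r ^ 2 / 2))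
      ≤ N.factorial * Real.exp (1 + r) * Real.exp (-(r ^ 2 / 2)) := by gcongr
    _ = N.factorial * Real.exp (1 + r - r ^ 2 / 2) := by
        rw [mul_assoc, ← Real.exp_add]; ring_nf
    _ ≤ N.factorial * Real.exp (3 / 2) := by
        gcongr
        nlinarith [sq_nonneg (r - 1)]

lemma exists_schwartzMap_gaussian :
    ∃ ψ : 𝓢(Space d, ℂ), ∀ x, ψ x = (Real.exp (-(‖x‖ ^ 2 / 2)) : ℂ) := by
  have hq : Function.HasTemperateGrowth (fun x : Space d => -(‖x‖ ^ 2 / 2)) := by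
    have h := ((Function.HasTemperateGrowth.const (-(1 / 2 : ℝ))).mul
      (Function.hasTemperateGrowth_norm_sq (H := Space d)))
    have he : (fun x : Space d => -(‖x‖ ^ 2 / 2))
        = (fun _ : Space d => -(1 / 2 : ℝ)) * (fun x : Space d => ‖x‖ ^ 2) := by
      funext x
      simp only [Pi.mul_apply]
      ring
    rw [he]
    exact h
  have hdecay : ∀ k n : ℕ, ∃ C : ℝ, ∀ x : Space d, ‖x‖ ^ k *
      ‖iteratedFDeriv ℝ n (Real.exp ∘ fun x : Space d => -(‖x‖ ^ 2 / 2)) x‖ ≤ C := by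
    intro k n
    obtain ⟨m, C, hC, hb⟩ := hq.norm_iteratedFDeriv_le_uniform n
    obtain ⟨K, hK⟩ := exists_pow_mul_gaussian_le (k + m * n)
    refine ⟨n.factorial * (C + 1) ^ n * K, fun x => ?_⟩
    have hx : (1 : ℝ) ≤ 1 + ‖x‖ := by simp
    have h := norm_iteratedFDeriv_comp_le (n := n) (N := (n : ℕ∞)) Real.contDiff_exp
      (hq.1.of_le (by exact_mod_cast le_top)) le_rfl x
      (C := Real.exp (-(‖x‖ ^ 2 / 2))) (D := (C + 1) * (1 + ‖x‖) ^ m) ?_ ?_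
    · calc _ ≤ (1 + ‖x‖) ^ k * (n.factorial * Real.exp (-(‖x‖ ^ 2 / 2))
            * ((C + 1) * (1 + ‖x‖) ^ m) ^ n) := by
            gcongr
            linarith
        _ = n.factorial * (C + 1) ^ n *
            ((1 + ‖x‖) ^ (k + m * n) * Real.exp (-(‖x‖ ^ 2 / 2))) := by
            rw [mul_pow, pow_add, pow_mul]; ring
        _ ≤ _ := by
            gcongr
            exact hK _ (norm_nonneg _)
    · intro i _
      rw [norm_iteratedFDeriv_eq_norm_iteratedDeriv, iteratedDeriv_eq_iterate, Real.iter_deriv_exp,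
        Real.norm_eq_abs, Real.abs_exp]
    · intro i h1 hi
      have hD : 1 ≤ (C + 1) * (1 + ‖x‖) ^ m := by
        have := one_le_pow₀ (n := m) hx
        nlinarith
      calc _ ≤ C * (1 + ‖x‖) ^ m := hb i hi x
        _ ≤ (C + 1) * (1 + ‖x‖) ^ m := by gcongr; linarith
        _ ≤ _ := le_self_pow₀ hD (by omega)
  let ψ : 𝓢(Space d, ℝ) := ⟨Real.exp ∘ fun x : Space d => -(‖x‖ ^ 2 / 2),
    Real.contDiff_exp.comp hq.1, hdecay⟩
  refine ⟨ψ.postcompCLM Complex.ofRealCLM, fun x => ?_⟩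
  have h : ψ x = Real.exp (-(‖x‖ ^ 2 / 2)) := rfl
  simp [h]

/-- Multiplication by the coordinate `x_j` on Schwartz functions. -/
def coordMul (j : Fin d) : 𝓢(Space d, ℂ) →L[ℂ] 𝓢(Space d, ℂ) :=
  SchwartzMap.smulLeftCLM ℂ (fun x : Space d => ((x j : ℝ) : ℂ))

/-- The partial derivative `∂_j` on Schwartz functions. -/
def partialD (j : Fin d) : 𝓢(Space d, ℂ) →L[ℂ] 𝓢(Space d, ℂ) :=
  LineDeriv.lineDerivOpCLM ℂ 𝓢(Space d, ℂ) (basisVec j)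

lemma hasTemperateGrowth_coord (j : Fin d) :
    Function.HasTemperateGrowth (fun x : Space d => ((x j : ℝ) : ℂ)) :=
  (Complex.ofRealCLM.comp (EuclideanSpace.proj j : Space d →L[ℝ] ℝ)).hasTemperateGrowth

@[simp] lemma coordMul_apply (j : Fin d) (ψ : 𝓢(Space d, ℂ)) (x : Space d) :
    coordMul j ψ x = (x j : ℂ) * ψ x := by
  simp [coordMul, SchwartzMap.smulLeftCLM_apply_apply (hasTemperateGrowth_coord j)]

lemma partialD_apply (j : Fin d) (ψ : 𝓢(Space d, ℂ)) (x : Space d) :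
    partialD j ψ x = lineDeriv ℝ ψ x (basisVec j) := by
  simp [partialD, SchwartzMap.lineDerivOp_apply]

lemma partialD_apply_eq_fderiv (j : Fin d) (ψ : 𝓢(Space d, ℂ)) (x : Space d) :
    partialD j ψ x = fderiv ℝ ψ x (basisVec j) := rfl

/-- By induction on `|n|`: the raising operator maps Schwartz functions to Schwartz functions. -/
lemma exists_schwartzMap_hermiteFun (n : Fin d → ℕ) :
    ∃ ψ : 𝓢(Space d, ℂ), ∀ x, ψ x = (hermiteFun n x : ℂ) := by
  induction h : len n generalizing n with
  | zero =>
    have hn : n = 0 := by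
      funext j
      have := (Finset.sum_eq_zero_iff.mp h) j (Finset.mem_univ j)
      simpa using this
    subst hn
    obtain ⟨ψ, hψ⟩ := exists_schwartzMap_gaussian (d := d)
    refine ⟨(hermiteNorm (0 : Fin d → ℕ) : ℂ) • ψ, fun x => ?_⟩
    rw [smul_apply, hψ, hermiteFun_eq]
    simp only [Pi.zero_apply, gaussDeriv_zero, ← Real.exp_sum, smul_eq_mul]
    rw [Finset.sum_neg_distrib, ← EuclideanSpace.real_norm_sq_eq, mul_assoc, ← Real.exp_add]
    push_cast
    congr 2
    ring
  | succ k ih =>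
    obtain ⟨j, hj⟩ : ∃ j, n j ≠ 0 := by
      by_contra hcon
      push Not at hcon
      simp [len, hcon] at h
    obtain ⟨ψ, hψ⟩ := ih (n - Pi.single j 1) (by
      have := congrArg len (sub_add_single hj)
      rw [len_add, len_single] at this
      omega)
    set m := n - Pi.single j 1 with hm
    have hmn : m + Pi.single j 1 = n := sub_add_single hj
    refine ⟨((Real.sqrt 2 * Real.sqrt (m j + 1) : ℝ) : ℂ)⁻¹ • (coordMul j ψ - partialD j ψ),
      fun x => ?_⟩
    have hd : HasLineDerivAt ℝ ψ ((x j * hermiteFun m x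
        - Real.sqrt 2 * (Real.sqrt (m j + 1) * hermiteFun (m + Pi.single j 1) x) : ℝ) : ℂ) x
        (basisVec j) := by
      have h1 := (hasLineDerivAt_hermiteFun m j x)
      unfold HasLineDerivAt at h1 ⊢
      have := h1.ofReal_comp
      simpa only [hψ] using this
    rw [smul_apply, sub_apply, coordMul_apply, partialD_apply,
      hd.lineDeriv, hψ, smul_eq_mul, hmn]
    have h0 : ((Real.sqrt 2 * Real.sqrt (m j + 1) : ℝ) : ℂ) ≠ 0 := by
      norm_cast; positivity
    rw [inv_mul_eq_iff_eq_mul₀ h0]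
    push_cast
    ring

/-- The Hermite functions as Schwartz functions. -/
def hermiteS (n : Fin d → ℕ) : 𝓢(Space d, ℂ) := (exists_schwartzMap_hermiteFun n).choose

@[simp] lemma hermiteS_apply (n : Fin d → ℕ) (x : Space d) :
    hermiteS n x = (hermiteFun n x : ℂ) := (exists_schwartzMap_hermiteFun n).choose_spec x

lemma coordMul_hermiteS (n : Fin d → ℕ) (j : Fin d) :
    coordMul j (hermiteS n) = ((Real.sqrt 2 : ℝ) : ℂ)⁻¹ •
      ((Real.sqrt (n j + 1) : ℂ) • hermiteS (n + Pi.single j 1)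
        + (Real.sqrt (n j) : ℂ) • hermiteS (n - Pi.single j 1)) := by
  ext x
  have h0 : ((Real.sqrt 2 : ℝ) : ℂ) ≠ 0 := by norm_cast; positivity
  simp only [smul_apply, add_apply, coordMul_apply, hermiteS_apply,
    smul_eq_mul]
  rw [eq_inv_mul_iff_mul_eq₀ h0]
  exact_mod_cast congrArg (fun r : ℝ => (r : ℂ)) (hermiteFun_coord_mul n j x)

/-- Differentiation is the difference of the lowering and the raising operator. -/
lemma partialD_hermiteS (n : Fin d → ℕ) (j : Fin d) :
    partialD j (hermiteS n) = ((Real.sqrt 2 : ℝ) : ℂ)⁻¹ •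
      ((Real.sqrt (n j) : ℂ) • hermiteS (n - Pi.single j 1)
        - (Real.sqrt (n j + 1) : ℂ) • hermiteS (n + Pi.single j 1)) := by
  ext x
  have h0 : ((Real.sqrt 2 : ℝ) : ℂ) ≠ 0 := by norm_cast; positivity
  simp only [smul_apply, sub_apply, hermiteS_apply, smul_eq_mul]
  have hd : HasLineDerivAt ℝ (hermiteS n) ((x j * hermiteFun n x
        - Real.sqrt 2 * (Real.sqrt (n j + 1) * hermiteFun (n + Pi.single j 1) x) : ℝ) : ℂ) x
        (basisVec j) := by
    have h1 := (hasLineDerivAt_hermiteFun n j x)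
    unfold HasLineDerivAt at h1 ⊢
    have := h1.ofReal_comp
    simpa only [hermiteS_apply] using this
  rw [partialD_apply, hd.lineDeriv, eq_inv_mul_iff_mul_eq₀ h0]
  have h2 : Real.sqrt 2 * Real.sqrt 2 = 2 := Real.mul_self_sqrt (by norm_num)
  have key : Real.sqrt 2 * (x j * hermiteFun n x
        - Real.sqrt 2 * (Real.sqrt (n j + 1) * hermiteFun (n + Pi.single j 1) x))
      = Real.sqrt (n j) * hermiteFun (n - Pi.single j 1) x
        - Real.sqrt (n j + 1) * hermiteFun (n + Pi.single j 1) x := by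
    linear_combination hermiteFun_coord_mul n j x
      - (Real.sqrt (n j + 1) * hermiteFun (n + Pi.single j 1) x) * h2
  exact_mod_cast congrArg (fun r : ℝ => (r : ℂ)) key

/-! ### Orthonormality and completeness of the Hermite functions -/

lemma integrable_mul_of_memLp {f g : Space d → ℂ} (hf : MemLp f 2 volume) (hg : MemLp g 2 volume) :
    Integrable (fun x => f x * g x) := by
  exact hf.integrable_mul hg

lemma memLp_schwartz (ψ : 𝓢(Space d, ℂ)) : MemLp ψ 2 volume := ψ.memLp 2 volume

lemma integral_coordMul (j : Fin d) (φ ψ : 𝓢(Space d, ℂ)) :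
    ∫ x, coordMul j φ x * ψ x = ∫ x, φ x * coordMul j ψ x := by
  refine integral_congr_ae (Eventually.of_forall fun x => ?_)
  simp only [coordMul_apply]
  ring

lemma integral_partialD (j : Fin d) (φ ψ : 𝓢(Space d, ℂ)) :
    ∫ x, partialD j φ x * ψ x = -∫ x, φ x * partialD j ψ x := by
  have := SchwartzMap.integral_mul_lineDerivOp_right_eq_neg_left (μ := volume) φ ψ (basisVec j)
  rw [← neg_eq_iff_eq_neg] at this
  exact this.symm

lemma integrable_schwartz_mul (φ ψ : 𝓢(Space d, ℂ)) : Integrable (fun x => φ x * ψ x) :=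
  integrable_mul_of_memLp (memLp_schwartz φ) (memLp_schwartz ψ)

/-- The lowering operator `(x_j + ∂_j)/√2` and the raising operator `(x_j - ∂_j)/√2` are
transposes of one another. -/
lemma integral_hermiteS_lower (n m : Fin d → ℕ) (j : Fin d) :
    (Real.sqrt (n j) : ℂ) * ∫ x, hermiteS (n - Pi.single j 1) x * hermiteS m x
      = (Real.sqrt (m j + 1) : ℂ) * ∫ x, hermiteS n x * hermiteS (m + Pi.single j 1) x := by
  have h0 : ((Real.sqrt 2 : ℝ) : ℂ) ≠ 0 := by norm_cast; positivity
  have h2 : ((Real.sqrt 2 : ℝ) : ℂ) * ((Real.sqrt 2 : ℝ) : ℂ) = 2 := by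
    norm_cast; exact Real.mul_self_sqrt (by norm_num)
  have hlow : ∀ x, (Real.sqrt (n j) : ℂ) * hermiteS (n - Pi.single j 1) x
      = (Real.sqrt 2 : ℂ)⁻¹ * (coordMul j (hermiteS n) x + partialD j (hermiteS n) x) := by
    intro x
    rw [coordMul_hermiteS, partialD_hermiteS]
    simp only [smul_apply, add_apply, sub_apply, smul_eq_mul]
    field_simp
    linear_combination (Real.sqrt (n j) : ℂ) * hermiteS (n - Pi.single j 1) x * h2
  have hup : ∀ x, (Real.sqrt (m j + 1) : ℂ) * hermiteS (m + Pi.single j 1) x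
      = (Real.sqrt 2 : ℂ)⁻¹ * (coordMul j (hermiteS m) x - partialD j (hermiteS m) x) := by
    intro x
    rw [coordMul_hermiteS, partialD_hermiteS]
    simp only [smul_apply, add_apply, sub_apply, smul_eq_mul]
    field_simp
    linear_combination (Real.sqrt (m j + 1) : ℂ) * hermiteS (m + Pi.single j 1) x * h2
  have hL : (Real.sqrt (n j) : ℂ) * ∫ x, hermiteS (n - Pi.single j 1) x * hermiteS m x
      = (Real.sqrt 2 : ℂ)⁻¹ * ((∫ x, coordMul j (hermiteS n) x * hermiteS m x)
        + ∫ x, partialD j (hermiteS n) x * hermiteS m x) := by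
    rw [← integral_add (integrable_schwartz_mul _ _) (integrable_schwartz_mul _ _),
      ← integral_const_mul, ← integral_const_mul]
    refine integral_congr_ae (Eventually.of_forall fun x => ?_)
    simp only
    rw [← mul_assoc, hlow]
    ring
  have hR : (Real.sqrt (m j + 1) : ℂ) * ∫ x, hermiteS n x * hermiteS (m + Pi.single j 1) x
      = (Real.sqrt 2 : ℂ)⁻¹ * ((∫ x, hermiteS n x * coordMul j (hermiteS m) x)
        - ∫ x, hermiteS n x * partialD j (hermiteS m) x) := by
    rw [← integral_sub (integrable_schwartz_mul _ _) (integrable_schwartz_mul _ _),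
      ← integral_const_mul, ← integral_const_mul]
    refine integral_congr_ae (Eventually.of_forall fun x => ?_)
    simp only
    rw [mul_left_comm, hup]
    ring
  rw [hL, hR, integral_coordMul, integral_partialD]
  ring

lemma integral_hermiteS_comm (n m : Fin d → ℕ) :
    ∫ x, hermiteS n x * hermiteS m x = ∫ x, hermiteS m x * hermiteS n x := by
  simp only [mul_comm]

lemma integral_hermiteS_succ (n m : Fin d → ℕ) (j : Fin d) :
    (Real.sqrt (n j + 1) : ℂ) * ∫ x, hermiteS n x * hermiteS m x
      = (Real.sqrt (m j + 1) : ℂ) *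
        ∫ x, hermiteS (n + Pi.single j 1) x * hermiteS (m + Pi.single j 1) x := by
  have h := integral_hermiteS_lower (n + Pi.single j 1) m j
  rw [add_tsub_cancel_right] at h
  simpa using h

lemma integral_hermiteS_ne {n m : Fin d → ℕ} (hnm : n ≠ m) :
    ∫ x, hermiteS n x * hermiteS m x = 0 := by
  obtain ⟨j, hj⟩ := Function.ne_iff.mp hnm
  have h1 := integral_hermiteS_succ n m j
  have h2 := integral_hermiteS_succ m n j
  rw [integral_hermiteS_comm m n, integral_hermiteS_comm (m + _)] at h2
  have hn : (Real.sqrt (n j + 1) : ℂ) * (Real.sqrt (n j + 1) : ℂ) = n j + 1 := by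
    norm_cast; exact Real.mul_self_sqrt (by positivity)
  have hm : (Real.sqrt (m j + 1) : ℂ) * (Real.sqrt (m j + 1) : ℂ) = m j + 1 := by
    norm_cast; exact Real.mul_self_sqrt (by positivity)
  set I := ∫ x, hermiteS n x * hermiteS m x
  have h3 : ((n j : ℂ) - m j) * I = 0 := by
    linear_combination (Real.sqrt (n j + 1) : ℂ) * h1 - (Real.sqrt (m j + 1) : ℂ) * h2
      - I * hn + I * hm
  rcases mul_eq_zero.mp h3 with h | h
  · exact absurd (by exact_mod_cast sub_eq_zero.mp h) hj
  · exact h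

lemma integral_hermiteS_self (n : Fin d → ℕ) : ∫ x, hermiteS n x * hermiteS n x = 1 := by
  induction h : len n generalizing n with
  | zero =>
    have hn : n = 0 := by
      funext j
      have := (Finset.sum_eq_zero_iff.mp h) j (Finset.mem_univ j)
      simpa using this
    subst hn
    have he : ∀ x : Space d, hermiteS 0 x * hermiteS 0 x
        = ((hermiteNorm (0 : Fin d → ℕ) ^ 2 * Real.exp (-1 * ‖x‖ ^ 2) : ℝ) : ℂ) := by
      intro x
      rw [hermiteS_apply, hermiteFun_eq]
      simp only [Pi.zero_apply, gaussDeriv_zero, ← Real.exp_sum]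
      rw [Finset.sum_neg_distrib, ← EuclideanSpace.real_norm_sq_eq, mul_assoc, ← Real.exp_add,
        ← Complex.ofReal_mul]
      congr 1
      rw [mul_mul_mul_comm, ← Real.exp_add, sq]
      ring_nf
    simp_rw [he]
    rw [integral_complex_ofReal, integral_const_mul,
      GaussianFourier.integral_rexp_neg_mul_sq_norm one_pos]
    simp only [hermiteNorm, len, Pi.zero_apply, Finset.sum_const_zero, pow_zero, mul_one,
      Nat.factorial_zero, Nat.cast_one, Finset.prod_const_one, div_one, finrank_euclideanSpace_fin,
      inv_pow]
    rw [Real.sq_sqrt (by positivity), inv_mul_cancel₀ (by positivity)]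
    simp
  | succ k ih =>
    obtain ⟨j, hj⟩ : ∃ j, n j ≠ 0 := by
      by_contra hcon
      push Not at hcon
      simp [len, hcon] at h
    have h1 := ih (n - Pi.single j 1) (by
      have := congrArg len (sub_add_single hj)
      rw [len_add, len_single] at this
      omega)
    have h2 := integral_hermiteS_succ (n - Pi.single j 1) (n - Pi.single j 1) j
    rw [sub_add_single hj, h1] at h2
    have h0 : (Real.sqrt (((n - Pi.single j 1 : Fin d → ℕ) j : ℕ) + 1) : ℂ) ≠ 0 := by
      norm_cast; positivity
    exact (mul_left_cancel₀ h0 h2).symm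

/-- The span of the Hermite functions in Schwartz space. -/
def hermiteSpan (d : ℕ) : Submodule ℂ 𝓢(Space d, ℂ) := Submodule.span ℂ (Set.range hermiteS)

lemma coordMul_mem_hermiteSpan (j : Fin d) {ψ : 𝓢(Space d, ℂ)} (h : ψ ∈ hermiteSpan d) :
    coordMul j ψ ∈ hermiteSpan d := by
  induction h using Submodule.span_induction with
  | mem x hx =>
    obtain ⟨n, rfl⟩ := hx
    rw [coordMul_hermiteS]
    exact Submodule.smul_mem _ _ (Submodule.add_mem _
      (Submodule.smul_mem _ _ (Submodule.subset_span ⟨_, rfl⟩))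
      (Submodule.smul_mem _ _ (Submodule.subset_span ⟨_, rfl⟩)))
  | zero => simp
  | add x y _ _ hx hy => rw [map_add]; exact Submodule.add_mem _ hx hy
  | smul a x _ hx => rw [map_smul]; exact Submodule.smul_mem _ _ hx

lemma integral_mul_eq_zero_of_mem_hermiteSpan {f : Space d → ℂ} (hf : MemLp f 2 volume)
    (h : ∀ n, hermiteCoeff f n = 0) {ψ : 𝓢(Space d, ℂ)} (hψ : ψ ∈ hermiteSpan d) :
    ∫ x, f x * ψ x = 0 := by
  induction hψ using Submodule.span_induction with
  | mem x hx =>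
    obtain ⟨n, rfl⟩ := hx
    simpa [hermiteCoeff] using h n
  | zero => simp
  | add x y _ _ hx hy =>
    simp only [add_apply, mul_add]
    rw [integral_add (integrable_mul_of_memLp hf (memLp_schwartz x))
      (integrable_mul_of_memLp hf (memLp_schwartz y)), hx, hy, add_zero]
  | smul a x _ hx =>
    simp only [smul_apply, smul_eq_mul, mul_left_comm _ a, integral_const_mul, hx, mul_zero]

lemma exists_mem_hermiteSpan_inner_pow (ξ : Space d) (k : ℕ) :
    ∃ ψ ∈ hermiteSpan d, ∀ x, ψ x = (inner ℝ x ξ : ℂ) ^ k * (hermiteFun 0 x : ℂ) := by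
  induction k with
  | zero => exact ⟨hermiteS 0, Submodule.subset_span ⟨0, rfl⟩, fun x => by simp⟩
  | succ k ih =>
    obtain ⟨ψ, hψ, hx⟩ := ih
    refine ⟨∑ j, (ξ j : ℂ) • coordMul j ψ, Submodule.sum_mem _ fun j _ =>
      Submodule.smul_mem _ _ (coordMul_mem_hermiteSpan j hψ), fun x => ?_⟩
    rw [sum_apply]
    simp only [smul_apply, coordMul_apply, hx, smul_eq_mul]
    rw [pow_succ, PiLp.inner_apply]
    push_cast
    simp only [Real.inner_apply]
    push_cast
    set S := ∑ j, (x j : ℂ) * (ξ j : ℂ) with hS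
    rw [show S ^ k * S * (hermiteFun 0 x : ℂ) = S * (S ^ k * (hermiteFun 0 x : ℂ)) by ring]
    nth_rewrite 2 [hS]
    rw [Finset.sum_mul]
    refine Finset.sum_congr rfl fun j _ => ?_
    ring

lemma hermiteFun_zero_eq (x : Space d) :
    hermiteFun 0 x = hermiteNorm (0 : Fin d → ℕ) * Real.exp (-(‖x‖ ^ 2 / 2)) := by
  rw [hermiteFun_eq]
  simp only [Pi.zero_apply, gaussDeriv_zero, ← Real.exp_sum]
  rw [Finset.sum_neg_distrib, ← EuclideanSpace.real_norm_sq_eq, mul_assoc, ← Real.exp_add]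
  ring_nf

lemma hermiteNorm_pos (n : Fin d → ℕ) : 0 < hermiteNorm n := by
  unfold hermiteNorm; positivity

lemma memLp_gaussian_mul_exp (c : ℝ) :
    MemLp (fun x : Space d => ((hermiteFun 0 x * Real.exp (c * ‖x‖) : ℝ) : ℂ)) 2 volume := by
  have hcont : Continuous (fun x : Space d => hermiteFun 0 x * Real.exp (c * ‖x‖)) := by
    simp_rw [hermiteFun_zero_eq]; fun_prop
  have hint : Integrable (fun x : Space d => Real.exp (-(1/2) * ‖x‖ ^ 2)) := by
    have := GaussianFourier.integral_rexp_neg_mul_sq_norm (V := Space d) (b := 1/2) (by norm_num)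
    by_contra hcon
    rw [integral_undef hcon] at this
    have : (0:ℝ) < (Real.pi / (1/2)) ^ ((Module.finrank ℝ (Space d) : ℝ) / 2) := by positivity
    linarith
  have hcont' : Continuous (fun x : Space d => ((hermiteFun 0 x * Real.exp (c * ‖x‖) : ℝ) : ℂ)) :=
    Complex.continuous_ofReal.comp hcont
  rw [memLp_two_iff_integrable_sq_norm hcont'.aestronglyMeasurable]
  refine Integrable.mono' (hint.const_mul (hermiteNorm (0 : Fin d → ℕ) ^ 2 * Real.exp (2 * c ^ 2)))
    (hcont'.norm.pow 2).aestronglyMeasurable (Eventually.of_forall fun x => ?_)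
  rw [Real.norm_eq_abs, abs_of_nonneg (by positivity), Complex.norm_real, Real.norm_eq_abs, sq_abs]
  calc (hermiteFun 0 x * Real.exp (c * ‖x‖)) ^ 2
      = hermiteNorm (0 : Fin d → ℕ) ^ 2 * Real.exp (-‖x‖ ^ 2 + 2 * c * ‖x‖) := by
        rw [hermiteFun_zero_eq, mul_assoc, ← Real.exp_add, mul_pow, ← Real.exp_nat_mul]
        congr 2
        push_cast
        ring
    _ ≤ hermiteNorm (0 : Fin d → ℕ) ^ 2 * Real.exp (2 * c ^ 2 + -(1 / 2) * ‖x‖ ^ 2) := by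
        refine mul_le_mul_of_nonneg_left (Real.exp_le_exp.mpr ?_) (by positivity)
        nlinarith [sq_nonneg (‖x‖ - 2 * c)]
    _ = _ := by rw [Real.exp_add, mul_assoc]

/-- Expand the exponential: the powers of the linear form, times the Gaussian `Ω_0`, lie in the span
of the Hermite functions. -/
lemma integral_mul_exp_eq_zero {f : Space d → ℂ} (hf : MemLp f 2 volume)
    (h : ∀ n, hermiteCoeff f n = 0) (ξ : Space d) :
    ∫ x, f x * (hermiteFun 0 x : ℂ) * Complex.exp ((inner ℝ x ξ : ℝ) * Complex.I) = 0 := by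
  have hpos : ∀ x : Space d, 0 < hermiteFun 0 x := fun x => by
    rw [hermiteFun_zero_eq]; have := hermiteNorm_pos (0 : Fin d → ℕ); positivity
  have key := hasSum_integral_of_dominated_convergence (μ := (volume : Measure (Space d)))
    (F := fun k x => (f x * (hermiteFun 0 x : ℂ)) *
      ((((inner ℝ x ξ : ℝ) * Complex.I) ^ k) / (k.factorial : ℂ)))
    (f := fun x => f x * (hermiteFun 0 x : ℂ) * Complex.exp ((inner ℝ x ξ : ℝ) * Complex.I))
    (fun k x => ‖f x‖ * hermiteFun 0 x * ((‖ξ‖ * ‖x‖) ^ k / k.factorial)) ?_ ?_ ?_ ?_ ?_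
  · have hz : ∀ k : ℕ, ∫ x, (f x * (hermiteFun 0 x : ℂ)) *
      ((((inner ℝ x ξ : ℝ) * Complex.I) ^ k) / (k.factorial : ℂ)) = 0 := by
      intro k
      obtain ⟨ψ, hψ, hx⟩ := exists_mem_hermiteSpan_inner_pow ξ k
      have := integral_mul_eq_zero_of_mem_hermiteSpan hf h hψ
      calc _ = ∫ x, (Complex.I ^ k / (k.factorial : ℂ)) * (f x * ψ x) := by
            refine integral_congr_ae (Eventually.of_forall fun x => ?_)
            simp only [hx]
            rw [mul_pow]
            ring
        _ = 0 := by rw [integral_const_mul, this, mul_zero]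
    simp_rw [hz] at key
    exact key.unique hasSum_zero
  · intro k
    have h1 : AEStronglyMeasurable (fun x => f x * (hermiteFun 0 x : ℂ)) volume := by
      have := (integrable_mul_of_memLp hf (memLp_schwartz (hermiteS (0 : Fin d → ℕ)))).1
      simpa using this
    refine h1.mul (Continuous.aestronglyMeasurable ?_)
    fun_prop
  · intro k
    refine Eventually.of_forall fun x => ?_
    rw [norm_mul, norm_mul, Complex.norm_real, Real.norm_eq_abs, abs_of_pos (hpos x), norm_div,
      norm_pow, norm_mul, Complex.norm_I, mul_one, Complex.norm_natCast, Complex.norm_real]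
    have := hpos x
    gcongr
    rw [mul_comm]
    exact norm_inner_le_norm x ξ
  · refine Eventually.of_forall fun x => ?_
    exact (Real.summable_pow_div_factorial _).mul_left _
  · have := (integrable_mul_of_memLp hf (memLp_gaussian_mul_exp ‖ξ‖)).norm
    refine this.congr (Eventually.of_forall fun x => ?_)
    simp only
    rw [tsum_mul_left, norm_mul, Complex.norm_real, Real.norm_eq_abs, abs_of_pos
      (mul_pos (hpos x) (Real.exp_pos _)), ← mul_assoc]
    congr 1
    rw [Real.exp_eq_exp_ℝ, NormedSpace.exp_eq_tsum_div]
  · refine Eventually.of_forall fun x => ?_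
    refine HasSum.mul_left _ ?_
    rw [Complex.exp_eq_exp_ℂ]
    exact NormedSpace.expSeries_div_hasSum_exp _

/-- Completeness of the Hermite functions: the Fourier transform of `f Ω_0` vanishes. -/
lemma ae_eq_zero_of_hermiteCoeff_eq_zero {f : Space d → ℂ} (hf : MemLp f 2 volume)
    (h : ∀ n, hermiteCoeff f n = 0) : f =ᵐ[volume] 0 := by
  have hpos : ∀ x : Space d, 0 < hermiteFun 0 x := fun x => by
    rw [hermiteFun_zero_eq]; have := hermiteNorm_pos (0 : Fin d → ℕ); positivity
  set F : Space d → ℂ := fun x => f x * (hermiteFun 0 x : ℂ) with hF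
  have hFint : Integrable F := by
    simpa using integrable_mul_of_memLp hf (memLp_schwartz (hermiteS (0 : Fin d → ℕ)))
  have hFour : FourierTransform.fourier F = 0 := by
    funext w
    rw [Real.fourier_eq']
    have := integral_mul_exp_eq_zero hf h ((-2 * Real.pi) • w)
    simp only [inner_smul_right] at this
    simpa [hF, mul_comm] using this
  have hz : ∀ φ : 𝓢(Space d, ℂ), ∫ x, F x * φ x = 0 := by
    intro φ
    obtain ⟨θ, rfl⟩ : ∃ θ : 𝓢(Space d, ℂ), FourierTransform.fourier θ = φ :=
      ⟨FourierTransformInv.fourierInv φ, FourierTransform.fourier_fourierInv_eq φ⟩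
    have := VectorFourier.integral_fourierIntegral_smul_eq_flip (L := innerₗ (Space d))
      (μ := volume) (ν := volume) (e := Real.fourierChar)
      Real.continuous_fourierChar continuous_inner hFint θ.integrable
    have h1 : VectorFourier.fourierIntegral Real.fourierChar volume (innerₗ (Space d)) F = 0 :=
      hFour
    rw [h1, flip_innerₗ] at this
    simp only [Pi.zero_apply, smul_eq_mul, zero_mul, integral_zero] at this
    exact this.symm
  have := ae_eq_zero_of_integral_contDiff_smul_eq_zero hFint.locallyIntegrable (fun g hg hc => by
    have hc' : HasCompactSupport (fun x => (g x : ℂ)) :=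
      hc.comp_left (g := fun r : ℝ => (r : ℂ)) Complex.ofReal_zero
    have hg' : ContDiff ℝ ((⊤ : ℕ∞) : WithTop ℕ∞) (fun x => (g x : ℂ)) :=
      Complex.ofRealCLM.contDiff.comp hg
    have := hz (hc'.toSchwartzMap hg')
    rw [← this]
    refine integral_congr_ae (Eventually.of_forall fun x => ?_)
    simp [HasCompactSupport.toSchwartzMap_toFun, mul_comm])
  filter_upwards [this] with x hx
  have h0 : (hermiteFun 0 x : ℂ) ≠ 0 := by exact_mod_cast (hpos x).ne'
  exact (mul_eq_zero.mp hx).resolve_right h0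

/-! ### The Hermite basis of `L²` -/

/-- The Hermite functions as elements of `L²`. -/
def hermiteL2 (n : Fin d → ℕ) : Lp ℂ 2 (volume : Measure (Space d)) := (hermiteS n).toLp 2 volume

lemma coeFn_hermiteL2 (n : Fin d → ℕ) : hermiteL2 n =ᵐ[volume] fun x => (hermiteFun n x : ℂ) := by
  filter_upwards [(hermiteS n).coeFn_toLp 2 volume] with x hx
  rw [hermiteL2, hx, hermiteS_apply]

lemma inner_hermiteL2 {f : Space d → ℂ} (hf : MemLp f 2 volume) (n : Fin d → ℕ) :
    inner ℂ (hermiteL2 n) (hf.toLp f) = hermiteCoeff f n := by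
  rw [L2.inner_def, hermiteCoeff]
  refine integral_congr_ae ?_
  filter_upwards [coeFn_hermiteL2 n, hf.coeFn_toLp] with x h1 h2
  simp [h1, h2]

lemma orthonormal_hermiteL2 : Orthonormal ℂ (hermiteL2 (d := d)) := by
  classical
  rw [orthonormal_iff_ite]
  intro n m
  have : inner ℂ (hermiteL2 n) (hermiteL2 m) = ∫ x, hermiteS n x * hermiteS m x := by
    rw [L2.inner_def]
    refine integral_congr_ae ?_
    filter_upwards [coeFn_hermiteL2 n, coeFn_hermiteL2 m] with x h1 h2
    simp [h1, h2, mul_comm]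
  rw [this]
  split_ifs with h
  · subst h; exact integral_hermiteS_self n
  · exact integral_hermiteS_ne h

/-- The Hermite functions form a Hilbert basis of `L²`. -/
def hermiteBasis (d : ℕ) : HilbertBasis (Fin d → ℕ) ℂ (Lp ℂ 2 (volume : Measure (Space d))) :=
  HilbertBasis.mkOfOrthogonalEqBot orthonormal_hermiteL2 (by
    rw [Submodule.eq_bot_iff]
    intro f hf
    rw [Submodule.mem_orthogonal] at hf
    have h0 : ∀ n, hermiteCoeff (f : Space d → ℂ) n = 0 := fun n => by
      rw [← inner_hermiteL2 (Lp.memLp f), Lp.toLp_coeFn]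
      exact hf _ (Submodule.subset_span ⟨n, rfl⟩)
    have := ae_eq_zero_of_hermiteCoeff_eq_zero (Lp.memLp f) h0
    exact (Lp.eq_zero_iff_ae_eq_zero).mpr this)

lemma hermiteBasis_apply (n : Fin d → ℕ) : hermiteBasis d n = hermiteL2 n := by
  simp [hermiteBasis]

lemma hermiteBasis_repr {f : Space d → ℂ} (hf : MemLp f 2 volume) (n : Fin d → ℕ) :
    (hermiteBasis d).repr (hf.toLp f) n = hermiteCoeff f n := by
  rw [HilbertBasis.repr_apply_apply, hermiteBasis_apply, inner_hermiteL2]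

lemma hermiteCoeff_congr {f g : Space d → ℂ} (h : f =ᵐ[volume] g) (n : Fin d → ℕ) :
    hermiteCoeff f n = hermiteCoeff g n := by
  refine integral_congr_ae ?_
  filter_upwards [h] with x hx
  rw [hx]

lemma integrable_mul_hermiteFun {f : Space d → ℂ} (hf : MemLp f 2 volume) (n : Fin d → ℕ) :
    Integrable (fun x => f x * (hermiteFun n x : ℂ)) := by
  simpa using integrable_mul_of_memLp hf (memLp_schwartz (hermiteS n))

lemma hermiteCoeff_sub {f g : Space d → ℂ} (hf : MemLp f 2 volume) (hg : MemLp g 2 volume)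
    (n : Fin d → ℕ) : hermiteCoeff (fun x => f x - g x) n = hermiteCoeff f n - hermiteCoeff g n :=
      by
  simp only [hermiteCoeff, sub_mul]
  exact integral_sub (integrable_mul_hermiteFun hf n) (integrable_mul_hermiteFun hg n)

lemma hermiteCoeff_const_mul (a : ℂ) (f : Space d → ℂ) (n : Fin d → ℕ) :
    hermiteCoeff (fun x => a * f x) n = a * hermiteCoeff f n := by
  simp only [hermiteCoeff, mul_assoc, integral_const_mul]

lemma hermiteCoeff_conj (f : Space d → ℂ) (n : Fin d → ℕ) :
    hermiteCoeff (fun x => (starRingEnd ℂ) (f x)) n = (starRingEnd ℂ) (hermiteCoeff f n) := by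
  rw [hermiteCoeff, hermiteCoeff, ← integral_conj]
  simp

lemma hermiteCoeff_hermiteFun [DecidableEq (Fin d → ℕ)] (m n : Fin d → ℕ) :
    hermiteCoeff (fun x => (hermiteFun m x : ℂ)) n = if m = n then 1 else 0 := by
  have : hermiteCoeff (fun x => (hermiteFun m x : ℂ)) n = ∫ x, hermiteS m x * hermiteS n x := by
    simp [hermiteCoeff]
  rw [this]
  split_ifs with h
  · subst h; exact integral_hermiteS_self m
  · exact integral_hermiteS_ne h

lemma memLp_conj {f : Space d → ℂ} (hf : MemLp f 2 volume) :
    MemLp (fun x => (starRingEnd ℂ) (f x)) 2 volume := by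
  refine MemLp.of_le hf (Complex.continuous_conj.comp_aestronglyMeasurable hf.1)
    (Eventually.of_forall fun x => ?_)
  simp

/-- Parseval's identity, in bilinear form. -/
lemma hasSum_hermiteCoeff_mul {f g : Space d → ℂ} (hf : MemLp f 2 volume)
    (hg : MemLp g 2 volume) :
    HasSum (fun n => hermiteCoeff f n * hermiteCoeff g n) (∫ x, f x * g x) := by
  have h := (hermiteBasis d).hasSum_inner_mul_inner ((memLp_conj hf).toLp _) (hg.toLp g)
  have h1 : inner ℂ ((memLp_conj hf).toLp _) (hg.toLp g) = ∫ x, f x * g x := by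
    rw [L2.inner_def]
    refine integral_congr_ae ?_
    filter_upwards [(memLp_conj hf).coeFn_toLp, hg.coeFn_toLp] with x h1 h2
    simp [h1, h2, mul_comm]
  rw [h1] at h
  refine h.congr_fun fun n => ?_
  rw [hermiteBasis_apply, inner_hermiteL2 hg, ← inner_conj_symm, inner_hermiteL2 (memLp_conj hf),
    hermiteCoeff_conj, Complex.conj_conj]

lemma hasSum_sq_hermiteCoeff {f : Space d → ℂ} (hf : MemLp f 2 volume) :
    HasSum (fun n => ‖hermiteCoeff f n‖ ^ 2) (∫ x, ‖f x‖ ^ 2) := by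
  have h := hasSum_hermiteCoeff_mul (memLp_conj hf) hf
  simp only [hermiteCoeff_conj, Complex.conj_mul'] at h
  rw [← Complex.hasSum_ofReal]
  convert h using 1
  · push_cast; rfl
  · rw [← integral_complex_ofReal]
    push_cast; rfl

lemma hasSum_conj_hermiteCoeff_mul {f g : Space d → ℂ} (hf : MemLp f 2 volume)
    (hg : MemLp g 2 volume) :
    HasSum (fun n => (starRingEnd ℂ) (hermiteCoeff f n) * hermiteCoeff g n)
      (∫ x, (starRingEnd ℂ) (f x) * g x) := by
  have h := hasSum_hermiteCoeff_mul (memLp_conj hf) hg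
  simpa only [hermiteCoeff_conj] using h

/-- A square summable family is the family of Hermite coefficients of an `L²` function. -/
lemma exists_hermiteCoeff_eq {c : (Fin d → ℕ) → ℂ} (hc : Summable fun n => ‖c n‖ ^ 2) :
    ∃ f : Space d → ℂ, MemLp f 2 volume ∧ ∀ n, hermiteCoeff f n = c n := by
  have hm : Memℓp c 2 := by
    refine memℓp_gen ?_
    simpa using hc
  let c' : lp (fun _ : Fin d → ℕ => ℂ) 2 := ⟨c, hm⟩
  refine ⟨(hermiteBasis d).repr.symm c', Lp.memLp _, fun n => ?_⟩
  rw [← hermiteBasis_repr (Lp.memLp _), Lp.toLp_coeFn, LinearIsometryEquiv.apply_symm_apply]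

lemma ae_eq_of_hermiteCoeff_eq {f g : Space d → ℂ} (hf : MemLp f 2 volume)
    (hg : MemLp g 2 volume) (h : ∀ n, hermiteCoeff f n = hermiteCoeff g n) : f =ᵐ[volume] g := by
  have := ae_eq_zero_of_hermiteCoeff_eq_zero (hf.sub hg) (fun n => by
    have := hermiteCoeff_sub hf hg n
    rw [h, sub_self] at this
    exact this)
  filter_upwards [this] with x hx
  exact sub_eq_zero.mp hx

/-! ### Energy estimates for banded flows of coefficients -/

/-- The eigenvalue `|n| + d/2` of the harmonic oscillator. -/
def wt (n : Fin d → ℕ) : ℝ := (len n : ℝ) + (d : ℝ) / 2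

lemma half_le_wt [NeZero d] (n : Fin d → ℕ) : 1 / 2 ≤ wt n := by
  have : (1 : ℝ) ≤ d := by exact_mod_cast NeZero.one_le
  have h : (0 : ℝ) ≤ len n := by positivity
  unfold wt
  linarith

lemma wt_pos [NeZero d] (n : Fin d → ℕ) : 0 < wt n := lt_of_lt_of_le (by norm_num) (half_le_wt n)

lemma wt_add (n m : Fin d → ℕ) : wt (n + m) = wt n + len m := by
  simp only [wt, len_add]; push_cast; ring

lemma le_len (n : Fin d → ℕ) (j : Fin d) : n j ≤ len n :=
  Finset.single_le_sum (f := n) (fun _ _ => Nat.zero_le _) (Finset.mem_univ j)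

open Classical in
/-- The right-hand side of an infinite system `c_n' = i (ρ_n c_n + ⋯)` with Hermitian matrix
having the real diagonal `ρ` and, for each `k`, the entries `a k n` in the positions `(n, n + e k)`
and their conjugates in the positions `(n + e k, n)`. -/
def flowField {K : Type*} [Fintype K] (e : K → Fin d → ℕ) (a : K → (Fin d → ℕ) → ℂ)
    (ρ : (Fin d → ℕ) → ℝ) (c : (Fin d → ℕ) → ℂ) (n : Fin d → ℕ) : ℂ :=
  Complex.I * ((ρ n : ℂ) * c n + ∑ k, (a k n * c (n + e k)
    + if e k ≤ n then (starRingEnd ℂ) (a k (n - e k)) * c (n - e k) else 0))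

open Classical in
/-- Reindexing of a sum along the shift `n ↦ n + e`. -/
lemma hasSum_shift {e : Fin d → ℕ} {G : (Fin d → ℕ) → ℝ} {S : ℝ} :
    HasSum (fun n => if e ≤ n then G (n - e) else 0) S ↔ HasSum G S := by
  rw [← (add_left_injective e).hasSum_iff (f := fun n => if e ≤ n then G (n - e) else 0)]
  · have : (fun n => if e ≤ n then G (n - e) else 0) ∘ (fun x => x + e) = G := by
      funext n
      simp
    rw [this]
  · intro n hn
    refine if_neg fun h => hn ⟨n - e, ?_⟩
    exact tsub_add_cancel_of_le h

section Energy
variable {K : Type*} {e : K → Fin d → ℕ} {a : K → (Fin d → ℕ) → ℂ}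
  {ρ : (Fin d → ℕ) → ℝ} {c : (Fin d → ℕ) → ℂ}

/-- The flux of the square modulus through the bond `(n, n + e k)`. -/
def flux (e : K → Fin d → ℕ) (a : K → (Fin d → ℕ) → ℂ) (c : (Fin d → ℕ) → ℂ) (k : K)
    (n : Fin d → ℕ) : ℝ :=
  (a k n * ((starRingEnd ℂ) (c n) * c (n + e k))).im

lemma abs_flux_le {B M : ℝ} (hM : ∀ n, ‖c n‖ ≤ M) (k : K) (n : Fin d → ℕ)
    (ha : ‖a k n‖ ≤ B * wt n) : |flux e a c k n| ≤ B * M ^ 2 * wt n := by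
  have hM0 : 0 ≤ M := (norm_nonneg _).trans (hM 0)
  calc |flux e a c k n| ≤ ‖a k n * ((starRingEnd ℂ) (c n) * c (n + e k))‖ :=
        Complex.abs_im_le_norm _
    _ = ‖a k n‖ * (‖c n‖ * ‖c (n + e k)‖) := by simp
    _ ≤ (B * wt n) * (M * M) := by
        refine mul_le_mul ha (mul_le_mul (hM _) (hM _) (norm_nonneg _) hM0) (by positivity)
          ((norm_nonneg _).trans ha)
    _ = _ := by ring

variable [Fintype K]

open Classical in
/-- The derivative of `|c_n|²` is the net flux into `n`; the real diagonal drops out. -/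
lemma re_conj_mul_flowField (n : Fin d → ℕ) :
    2 * ((starRingEnd ℂ) (c n) * flowField e a ρ c n).re
      = -2 * ∑ k, (flux e a c k n - if e k ≤ n then flux e a c k (n - e k) else 0) := by
  have h1 : (starRingEnd ℂ) (c n) * flowField e a ρ c n
      = Complex.I * ((ρ n * ‖c n‖ ^ 2 : ℝ) + ∑ k, (a k n * ((starRingEnd ℂ) (c n) * c (n + e k))
        + if e k ≤ n then (starRingEnd ℂ) (a k (n - e k) * ((starRingEnd ℂ) (c (n - e k)) * c n))
          else 0)) := by
    unfold flowField
    rw [mul_left_comm, mul_add, Finset.mul_sum]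
    congr 2
    · push_cast
      rw [← Complex.conj_mul']
      ring
    · refine Finset.sum_congr rfl fun k _ => ?_
      split_ifs with h
      · simp only [map_mul, Complex.conj_conj]; ring
      · ring
  rw [h1, Complex.I_mul_re, Complex.add_im, Complex.ofReal_im, zero_add, Complex.im_sum,
    Finset.mul_sum, mul_neg, Finset.mul_sum, ← Finset.sum_neg_distrib]
  refine Finset.sum_congr rfl fun k _ => ?_
  unfold flux
  split_ifs with h
  · rw [Complex.add_im, Complex.conj_im, tsub_add_cancel_of_le h]; ring
  · simp

open Classical in
/-- Summation by parts: only the increments of the weight along the shifts contribute to the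
time derivative of a weighted `ℓ²` norm. -/
lemma hasSum_energy_flux [NeZero d] {W : (Fin d → ℕ) → ℝ} {B M D : ℝ} {V : (Fin d → ℕ) → ℝ}
    (hW0 : ∀ n, 0 ≤ W n) (hWs : Summable fun n => W n * wt n)
    (hM : ∀ n, ‖c n‖ ≤ M) (ha : ∀ k n, ‖a k n‖ ≤ B * wt n) (hB : 0 ≤ B) (hD : 0 ≤ D)
    (hWs' : ∀ k, Summable fun n => W (n + e k) * wt n)
    (hV1 : ∀ k n, |W (n + e k) - W n| * wt n ≤ D * V n)
    (hV2 : ∀ k n, |W (n + e k) - W n| * wt n ≤ D * V (n + e k))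
    (hVs : Summable fun n => V n * ‖c n‖ ^ 2) (hV0 : ∀ n, 0 ≤ V n) :
    |∑' n, W n * (2 * ((starRingEnd ℂ) (c n) * flowField e a ρ c n).re)|
      ≤ 2 * Fintype.card K * B * D * ∑' n, V n * ‖c n‖ ^ 2 := by
  have s1 : ∀ k, Summable fun n => W n * flux e a c k n := fun k => by
    refine Summable.of_norm_bounded (hWs.mul_left (B * M ^ 2)) fun n => ?_
    rw [Real.norm_eq_abs, abs_mul, abs_of_nonneg (hW0 n)]
    calc _ ≤ W n * (B * M ^ 2 * wt n) :=
          mul_le_mul_of_nonneg_left (abs_flux_le hM k n (ha k n)) (hW0 n)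
      _ = _ := by ring
  have s2 : ∀ k, Summable fun n => W (n + e k) * flux e a c k n := fun k => by
    refine Summable.of_norm_bounded ((hWs' k).mul_left (B * M ^ 2)) fun n => ?_
    rw [Real.norm_eq_abs, abs_mul, abs_of_nonneg (hW0 _)]
    calc _ ≤ W (n + e k) * (B * M ^ 2 * wt n) :=
          mul_le_mul_of_nonneg_left (abs_flux_le hM k n (ha k n)) (hW0 _)
      _ = _ := by ring
  have s3 : ∀ k, HasSum (fun n => W n * (flux e a c k n
      - if e k ≤ n then flux e a c k (n - e k) else 0))
      (∑' n, (W n - W (n + e k)) * flux e a c k n) := fun k => by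
    have h2 := (hasSum_shift (e := e k)).mpr (s2 k).hasSum
    have h3 := (s1 k).hasSum.sub h2
    have h4 : ∑' n, (W n - W (n + e k)) * flux e a c k n
        = ∑' n, W n * flux e a c k n - ∑' n, W (n + e k) * flux e a c k n := by
      rw [← (s1 k).tsum_sub (s2 k)]
      simp only [sub_mul]
    rw [h4]
    refine h3.congr_fun fun n => ?_
    split_ifs with h
    · rw [tsub_add_cancel_of_le h]; ring
    · ring
  have s4 : HasSum (fun n => W n * (2 * ((starRingEnd ℂ) (c n) * flowField e a ρ c n).re))
      (-2 * ∑ k, ∑' n, (W n - W (n + e k)) * flux e a c k n) := by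
    refine ((hasSum_sum fun k _ => s3 k).mul_left (-2)).congr_fun fun n => ?_
    rw [re_conj_mul_flowField, ← Finset.mul_sum]
    ring
  rw [s4.tsum_eq, abs_mul, abs_neg, abs_two]
  have hbound : ∀ k, |∑' n, (W n - W (n + e k)) * flux e a c k n|
      ≤ B * D * ∑' n, V n * ‖c n‖ ^ 2 := fun k => by
    have hVs' : Summable fun n => V (n + e k) * ‖c (n + e k)‖ ^ 2 :=
      hVs.comp_injective (add_left_injective (e k))
    have hle : ∑' n, V (n + e k) * ‖c (n + e k)‖ ^ 2 ≤ ∑' n, V n * ‖c n‖ ^ 2 :=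
      tsum_comp_le_tsum_of_inj hVs (fun n => mul_nonneg (hV0 n) (by positivity))
        (add_left_injective (e k))
    have hpt : ∀ n, ‖(W n - W (n + e k)) * flux e a c k n‖
        ≤ B * D / 2 * (V n * ‖c n‖ ^ 2 + V (n + e k) * ‖c (n + e k)‖ ^ 2) := fun n => by
      have hf : |flux e a c k n| ≤ B * wt n * ((‖c n‖ ^ 2 + ‖c (n + e k)‖ ^ 2) / 2) := by
        calc |flux e a c k n| ≤ ‖a k n * ((starRingEnd ℂ) (c n) * c (n + e k))‖ :=
              Complex.abs_im_le_norm _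
          _ = ‖a k n‖ * (‖c n‖ * ‖c (n + e k)‖) := by simp
          _ ≤ (B * wt n) * ((‖c n‖ ^ 2 + ‖c (n + e k)‖ ^ 2) / 2) := by
              refine mul_le_mul (ha k n) ?_ (by positivity) ((norm_nonneg _).trans (ha k n))
              nlinarith [sq_nonneg (‖c n‖ - ‖c (n + e k)‖)]
      rw [Real.norm_eq_abs, abs_mul, abs_sub_comm]
      calc _ ≤ |W (n + e k) - W n| * (B * wt n * ((‖c n‖ ^ 2 + ‖c (n + e k)‖ ^ 2) / 2)) :=
            mul_le_mul_of_nonneg_left hf (abs_nonneg _)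
        _ = B / 2 * ((|W (n + e k) - W n| * wt n) * ‖c n‖ ^ 2
            + (|W (n + e k) - W n| * wt n) * ‖c (n + e k)‖ ^ 2) := by ring
        _ ≤ B / 2 * ((D * V n) * ‖c n‖ ^ 2 + (D * V (n + e k)) * ‖c (n + e k)‖ ^ 2) := by
            have := hV1 k n
            have := hV2 k n
            gcongr
        _ = _ := by ring
    have hs := (hVs.add hVs').mul_left (B * D / 2)
    have h5 := tsum_of_norm_bounded hs.hasSum hpt
    rw [tsum_mul_left, hVs.tsum_add hVs'] at h5
    rw [← Real.norm_eq_abs]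
    refine h5.trans ?_
    have : 0 ≤ B * D / 2 := by positivity
    nlinarith
  calc 2 * |∑ k, ∑' n, (W n - W (n + e k)) * flux e a c k n|
      ≤ 2 * ∑ k, |∑' n, (W n - W (n + e k)) * flux e a c k n| := by
        gcongr; exact Finset.abs_sum_le_sum_abs _ _
    _ ≤ 2 * ∑ _k : K, B * D * ∑' n, V n * ‖c n‖ ^ 2 := by
        gcongr with k _; exact hbound k
    _ = _ := by simp; ring

end Energy

/-! ### Weights -/

/-- The regularized weight `x^s / (1 + εx)^N`. -/
def regWeight (s ε : ℝ) (N : ℕ) (x : ℝ) : ℝ := x ^ s / (1 + ε * x) ^ N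

lemma abs_exp_sub_one_le_mul (Δ : ℝ) : |Real.exp Δ - 1| ≤ |Δ| * Real.exp |Δ| := by
  rcases le_total 0 Δ with h | h
  · rw [abs_of_nonneg h, abs_of_nonneg (by simpa using h)]
    have h1 := Real.add_one_le_exp (-Δ)
    have h2 : Real.exp (-Δ) * Real.exp Δ = 1 := by rw [← Real.exp_add]; simp
    nlinarith [Real.exp_pos Δ]
  · rw [abs_of_nonpos h, abs_of_nonpos (by simpa using h)]
    have h1 := Real.add_one_le_exp Δ
    have h2 : 1 ≤ Real.exp (-Δ) := Real.one_le_exp (by linarith)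
    nlinarith

/-- The logarithmic increment of `regWeight`. -/
lemma exists_regWeight_add {s ε : ℝ} (hs : 0 ≤ s) (hε : 0 < ε) (N : ℕ) {x l : ℝ}
    (hx : 1 / 2 ≤ x) (hl : 0 ≤ l) (hl2 : l ≤ 2) :
    ∃ Δ : ℝ, regWeight s ε N (x + l) = regWeight s ε N x * Real.exp Δ ∧
      |Δ| ≤ 2 * s / x + 2 * N * (ε / (1 + ε * x)) ∧ |Δ| ≤ 4 * (s + N) := by
  have hx0 : 0 < x := by linarith
  have hxl : 0 < x + l := by linarith
  have h1 : 0 < 1 + ε * x := by positivity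
  have h2 : 0 < 1 + ε * (x + l) := by positivity
  set p := Real.log ((x + l) / x)
  set q := Real.log ((1 + ε * (x + l)) / (1 + ε * x))
  have hp0 : 0 ≤ p := Real.log_nonneg (by rw [le_div_iff₀ hx0]; linarith)
  have hq0 : 0 ≤ q := Real.log_nonneg (by rw [le_div_iff₀ h1]; nlinarith)
  have hp1 : p ≤ 2 / x := by
    refine (Real.log_le_sub_one_of_pos (by positivity)).trans ?_
    rw [div_sub_one hx0.ne', add_sub_cancel_left]
    gcongr
  have hq1 : q ≤ 2 * (ε / (1 + ε * x)) := by
    refine (Real.log_le_sub_one_of_pos (by positivity)).trans ?_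
    rw [div_sub_one h1.ne', show 1 + ε * (x + l) - (1 + ε * x) = ε * l by ring, mul_div_assoc',
      mul_comm 2 ε]
    gcongr
  have hq2 : ε / (1 + ε * x) ≤ 2 := by
    rw [div_le_iff₀ h1]; nlinarith
  have hp2 : 2 / x ≤ 4 := by
    rw [div_le_iff₀ hx0]; linarith
  have hN : (0 : ℝ) ≤ N := by positivity
  have habs : |s * p - N * q| ≤ s * p + N * q := by
    rw [abs_le]; constructor <;> nlinarith [mul_nonneg hs hp0, mul_nonneg hN hq0]
  refine ⟨s * p - N * q, ?_, ?_, ?_⟩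
  · unfold regWeight
    rw [Real.exp_sub, mul_comm s, ← Real.rpow_def_of_pos (by positivity), ← Real.log_pow,
      Real.exp_log (by positivity), Real.div_rpow hxl.le hx0.le, div_pow]
    have : 0 < x ^ s := Real.rpow_pos_of_pos hx0 s
    field_simp
  · calc _ ≤ s * p + N * q := habs
      _ ≤ s * (2 / x) + N * (2 * (ε / (1 + ε * x))) := by gcongr
      _ = _ := by ring
  · calc _ ≤ s * p + N * q := habs
      _ ≤ s * 4 + N * 4 := by
        gcongr
        · linarith
        · linarith
      _ = _ := by ring

lemma regWeight_pos {s ε : ℝ} (hε : 0 < ε) (N : ℕ) {x : ℝ} (hx : 0 < x) :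
    0 < regWeight s ε N x := by
  unfold regWeight; positivity

/-- The increments of `regWeight` are controlled by the weight itself, uniformly in `ε`. -/
lemma abs_regWeight_sub_le {s ε : ℝ} (hs : 0 ≤ s) (hε : 0 < ε) (N : ℕ) {x l : ℝ}
    (hx : 1 / 2 ≤ x) (hl : 0 ≤ l) (hl2 : l ≤ 2) :
    |regWeight s ε N (x + l) - regWeight s ε N x| * x
        ≤ 2 * (s + N) * Real.exp (8 * (s + N)) * regWeight s ε N x ∧
    |regWeight s ε N (x + l) - regWeight s ε N x| * x
        ≤ 2 * (s + N) * Real.exp (8 * (s + N)) * regWeight s ε N (x + l) := by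
  obtain ⟨Δ, h1, h2, h3⟩ := exists_regWeight_add hs hε N hx hl hl2
  have hx0 : 0 < x := by linarith
  have hW : 0 < regWeight s ε N x := regWeight_pos hε N hx0
  have h4 : 0 < 1 + ε * x := by positivity
  have h5 : |Δ| * x ≤ 2 * (s + N) := by
    have h6 : ε / (1 + ε * x) * x ≤ 1 := by
      rw [div_mul_eq_mul_div, div_le_one h4]; linarith
    have hN : (0 : ℝ) ≤ N := by positivity
    calc |Δ| * x ≤ (2 * s / x + 2 * N * (ε / (1 + ε * x))) * x := by gcongr
      _ = 2 * s + 2 * N * (ε / (1 + ε * x) * x) := by field_simp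
      _ ≤ 2 * s + 2 * N * 1 := by gcongr
      _ = _ := by ring
  have key : |regWeight s ε N (x + l) - regWeight s ε N x| * x
      ≤ 2 * (s + N) * Real.exp (4 * (s + N)) * regWeight s ε N x := by
    rw [h1, show regWeight s ε N x * Real.exp Δ - regWeight s ε N x
      = regWeight s ε N x * (Real.exp Δ - 1) by ring, abs_mul, abs_of_pos hW]
    calc _ ≤ regWeight s ε N x * (|Δ| * Real.exp |Δ|) * x := by
          gcongr; exact abs_exp_sub_one_le_mul Δ
      _ = (|Δ| * x) * Real.exp |Δ| * regWeight s ε N x := by ring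
      _ ≤ _ := by gcongr
  have hsN : 0 ≤ s + N := by positivity
  constructor
  · refine key.trans ?_
    gcongr
    linarith
  · refine key.trans ?_
    rw [h1]
    have : Real.exp (4 * (s + N)) ≤ Real.exp (8 * (s + N)) * Real.exp Δ := by
      rw [← Real.exp_add]
      refine Real.exp_le_exp.mpr ?_
      have := neg_abs_le Δ
      linarith
    calc _ = 2 * (s + N) * regWeight s ε N x * Real.exp (4 * (s + N)) := by ring
      _ ≤ 2 * (s + N) * regWeight s ε N x * (Real.exp (8 * (s + N)) * Real.exp Δ) := by gcongr
      _ = _ := by ring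

/-- For `s = 0` the increments of the weight tend to zero with `ε`, at the price of a weight of
order one half. -/
lemma abs_regWeight_zero_sub_le {ε : ℝ} (hε : 0 < ε) (N : ℕ) {x l : ℝ}
    (hx : 1 / 2 ≤ x) (hl : 0 ≤ l) (hl2 : l ≤ 2) :
    |regWeight 0 ε N (x + l) - regWeight 0 ε N x| * x
        ≤ 2 * N * Real.exp (4 * N) * ε ^ (1 / 2 : ℝ) * x ^ (1 / 2 : ℝ) := by
  obtain ⟨Δ, h1, h2, h3⟩ := exists_regWeight_add le_rfl hε N hx hl hl2
  have hx0 : 0 < x := by linarith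
  have hW : 0 < regWeight 0 ε N x := regWeight_pos hε N hx0
  have h4 : 0 < 1 + ε * x := by positivity
  have hW1 : regWeight 0 ε N x ≤ 1 := by
    unfold regWeight
    rw [Real.rpow_zero, div_le_one (by positivity)]
    exact one_le_pow₀ (by nlinarith)
  have h6 : ε / (1 + ε * x) * x ≤ ε ^ (1 / 2 : ℝ) * x ^ (1 / 2 : ℝ) := by
    rw [div_mul_eq_mul_div, div_le_iff₀ h4, ← Real.mul_rpow hε.le hx0.le, ← Real.sqrt_eq_rpow]
    have hy : 0 ≤ Real.sqrt (ε * x) := Real.sqrt_nonneg _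
    have hy2 : Real.sqrt (ε * x) * Real.sqrt (ε * x) = ε * x := Real.mul_self_sqrt (by positivity)
    nlinarith [sq_nonneg (Real.sqrt (ε * x) - 1)]
  have hN : (0 : ℝ) ≤ N := by positivity
  rw [h1, show regWeight 0 ε N x * Real.exp Δ - regWeight 0 ε N x
    = regWeight 0 ε N x * (Real.exp Δ - 1) by ring, abs_mul, abs_of_pos hW]
  calc regWeight 0 ε N x * |Real.exp Δ - 1| * x
      ≤ 1 * (|Δ| * Real.exp |Δ|) * x := by
        gcongr; exact abs_exp_sub_one_le_mul Δ
    _ ≤ 1 * ((2 * N * (ε / (1 + ε * x))) * Real.exp (4 * N)) * x := by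
        simp only [mul_zero, zero_div, zero_add] at h2 h3
        gcongr
    _ = 2 * N * Real.exp (4 * N) * (ε / (1 + ε * x) * x) := by ring
    _ ≤ 2 * N * Real.exp (4 * N) * (ε ^ (1 / 2 : ℝ) * x ^ (1 / 2 : ℝ)) := by gcongr
    _ = _ := by ring

lemma summable_prod_inv_sq (d : ℕ) :
    Summable fun n : Fin d → ℕ => ∏ j, (((n j : ℝ) + 1) ^ 2)⁻¹ := by
  induction d with
  | zero => exact Summable.of_finite
  | succ d ih =>
    have h1 : Summable fun k : ℕ => (((k : ℝ) + 1) ^ 2)⁻¹ := by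
      have := (summable_nat_add_iff 1).mpr (Real.summable_nat_pow_inv.mpr (by norm_num : 1 < 2))
      simpa using this
    have h2 := h1.mul_of_nonneg ih (fun k => by positivity) (fun n => by positivity)
    rw [← (Fin.consEquiv (fun _ : Fin (d + 1) => ℕ)).summable_iff]
    refine h2.congr fun p => ?_
    simp [Fin.prod_univ_succ, Fin.consEquiv, mul_comm]

lemma summable_regWeight_mul_wt [NeZero d] {s ε : ℝ} (hs : 0 ≤ s) (hε : 0 < ε) {N : ℕ}
    (hN : s + 1 + 2 * d ≤ N) : Summable fun n : Fin d → ℕ => regWeight s ε N (wt n) * wt n := by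
  set μ := min ε 1
  have hμ : 0 < μ := lt_min hε one_pos
  refine Summable.of_nonneg_of_le (fun n => ?_) (fun n => ?_)
    ((summable_prod_inv_sq d).mul_left (μ ^ N)⁻¹)
  · have := wt_pos n
    exact mul_nonneg (regWeight_pos hε N this).le this.le
  · have hx := wt_pos n
    set x := wt n with hxdef
    have h1 : ∏ j, ((n j : ℝ) + 1) ^ 2 ≤ (1 + x) ^ (2 * d) := by
      calc ∏ j, ((n j : ℝ) + 1) ^ 2 ≤ ∏ _j : Fin d, (1 + x) ^ 2 := by
            refine Finset.prod_le_prod (fun j _ => by positivity) fun j _ => ?_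
            have : (n j : ℝ) ≤ len n := by exact_mod_cast le_len n j
            have h2 : (0 : ℝ) ≤ (d : ℝ) / 2 := by positivity
            have h3 : (n j : ℝ) + 1 ≤ 1 + x := by rw [hxdef, wt]; linarith
            gcongr
        _ = _ := by simp [pow_mul]
    have h2 : x ^ s * x * (1 + x) ^ (2 * d) ≤ (1 + x) ^ N := by
      calc x ^ s * x * (1 + x) ^ (2 * d) ≤ (1 + x) ^ s * (1 + x) * (1 + x) ^ (2 * d) := by
            gcongr <;> linarith
        _ = (1 + x) ^ (s + 1 + (2 * d : ℕ)) := by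
            rw [Real.rpow_add (by positivity), Real.rpow_add (by positivity), Real.rpow_one,
              Real.rpow_natCast]
        _ ≤ (1 + x) ^ (N : ℝ) := by
            refine Real.rpow_le_rpow_of_exponent_le (by linarith) ?_
            push_cast
            exact hN
        _ = _ := Real.rpow_natCast _ _
    have h3 : μ ^ N * (1 + x) ^ N ≤ (1 + ε * x) ^ N := by
      rw [← mul_pow]
      have := min_le_left ε 1
      have := min_le_right ε 1
      gcongr
      nlinarith
    rw [Finset.prod_inv_distrib, ← mul_inv, regWeight, div_mul_eq_mul_div, ← one_div,
      div_le_div_iff₀ (by positivity) (by positivity), one_mul]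
    calc x ^ s * x * (μ ^ N * ∏ j, ((n j : ℝ) + 1) ^ 2)
        ≤ x ^ s * x * (μ ^ N * (1 + x) ^ (2 * d)) := by gcongr
      _ = μ ^ N * (x ^ s * x * (1 + x) ^ (2 * d)) := by ring
      _ ≤ μ ^ N * (1 + x) ^ N := by gcongr
      _ ≤ _ := h3

/-! ### Propagation of weighted norms by banded flows -/

/-- A nonnegative function with `|f'| ≤ L f` grows at most exponentially in both directions. -/
lemma le_exp_mul_of_abs_deriv_le {f f' : ℝ → ℝ} {T L : ℝ}
    (hf : ∀ t ∈ Set.Ioo (-T) T, HasDerivAt f (f' t) t)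
    (hb : ∀ t ∈ Set.Ioo (-T) T, |f' t| ≤ L * f t) {t₀ t₁ : ℝ} (h0 : t₀ ∈ Set.Ioo (-T) T)
    (h1 : t₁ ∈ Set.Ioo (-T) T) : f t₁ ≤ Real.exp (L * |t₁ - t₀|) * f t₀ := by
  have hexp : ∀ (r t : ℝ), HasDerivAt (fun t => Real.exp (r * t)) (Real.exp (r * t) * r) t :=
    fun r t => by simpa using ((hasDerivAt_id t).const_mul r).exp
  have hd : ∀ (r : ℝ), ∀ t ∈ Set.Ioo (-T) T, HasDerivAt (fun t => Real.exp (r * t) * f t)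
      (Real.exp (r * t) * r * f t + Real.exp (r * t) * f' t) t :=
    fun r t ht => (hexp r t).mul (hf t ht)
  have hcont : ∀ r, ContinuousOn (fun t => Real.exp (r * t) * f t) (Set.Ioo (-T) T) :=
    fun r t ht => (hd r t ht).continuousAt.continuousWithinAt
  have hdiff : ∀ r, DifferentiableOn ℝ (fun t => Real.exp (r * t) * f t)
      (interior (Set.Ioo (-T) T)) := fun r t ht => by
    rw [interior_Ioo] at ht ⊢
    exact (hd r t ht).differentiableAt.differentiableWithinAt
  have hanti : AntitoneOn (fun t => Real.exp (-L * t) * f t) (Set.Ioo (-T) T) := by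
    refine antitoneOn_of_deriv_nonpos (convex_Ioo _ _) (hcont _) (hdiff _) fun t ht => ?_
    rw [interior_Ioo] at ht
    rw [(hd _ t ht).deriv]
    have h2 := (abs_le.mp (hb t ht)).2
    nlinarith [Real.exp_pos (-L * t)]
  have hmono : MonotoneOn (fun t => Real.exp (L * t) * f t) (Set.Ioo (-T) T) := by
    refine monotoneOn_of_deriv_nonneg (convex_Ioo _ _) (hcont _) (hdiff _) fun t ht => ?_
    rw [interior_Ioo] at ht
    rw [(hd _ t ht).deriv]
    have h2 := (abs_le.mp (hb t ht)).1
    nlinarith [Real.exp_pos (L * t)]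
  rcases le_total t₀ t₁ with h | h
  · have h2 := hanti h0 h1 h
    simp only at h2
    rw [abs_of_nonneg (by linarith), show L * (t₁ - t₀) = -L * t₀ - (-L * t₁) by ring,
      Real.exp_sub, div_mul_eq_mul_div, le_div_iff₀ (Real.exp_pos _)]
    linarith
  · have h2 := hmono h1 h0 h
    simp only at h2
    rw [abs_of_nonpos (by linarith), show L * -(t₁ - t₀) = L * t₀ - (L * t₁) by ring,
      Real.exp_sub, div_mul_eq_mul_div, le_div_iff₀ (Real.exp_pos _)]
    linarith

/-- The square of the `Σ^s` norm, in terms of Hermite coefficients. -/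
def sqSum (s : ℝ) (c : (Fin d → ℕ) → ℂ) : ℝ≥0∞ := ∑' n, ENNReal.ofReal (wt n ^ s * ‖c n‖ ^ 2)

lemma sigmaNorm_eq (s : ℝ) (f : Space d → ℂ) :
    sigmaNorm s f = (sqSum s (hermiteCoeff f)) ^ (1 / 2 : ℝ) := rfl

/-- `c` solves, for `|t| < T`, the banded Hermitian system `c_n' = i (ρ_n c_n + ⋯)` whose entries
off the diagonal are bounded by `B` times the eigenvalue of the harmonic oscillator; and
the coefficients are bounded by `M`. -/
structure IsBandedFlow {K : Type*} [Fintype K] (e : K → Fin d → ℕ)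
    (a : ℝ → K → (Fin d → ℕ) → ℂ) (ρ : ℝ → (Fin d → ℕ) → ℝ) (T B M : ℝ)
    (c : ℝ → (Fin d → ℕ) → ℂ) : Prop where
  len_le : ∀ k, len (e k) ≤ 2
  nonneg : 0 ≤ B
  bound : ∀ t ∈ Set.Ioo (-T) T, ∀ k n, ‖a t k n‖ ≤ B * wt n
  coeff_bound : ∀ t ∈ Set.Ioo (-T) T, ∀ n, ‖c t n‖ ≤ M
  hasDerivAt : ∀ t ∈ Set.Ioo (-T) T, ∀ n,
    HasDerivAt (fun τ => c τ n) (flowField e (a t) (ρ t) (c t) n) t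

lemma summable_weight_mul_sq [NeZero d] {W : (Fin d → ℕ) → ℝ} {c : (Fin d → ℕ) → ℂ} {M : ℝ}
    (hW0 : ∀ n, 0 ≤ W n) (hWs : Summable fun n => W n * wt n) (hM : ∀ n, ‖c n‖ ≤ M) :
    Summable fun n => W n * ‖c n‖ ^ 2 := by
  refine Summable.of_nonneg_of_le (fun n => mul_nonneg (hW0 n) (by positivity)) (fun n => ?_)
    (hWs.mul_left (2 * M ^ 2))
  have h1 : ‖c n‖ ^ 2 ≤ M ^ 2 := by
    have := hM n
    gcongr
  have h2 := half_le_wt n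
  calc W n * ‖c n‖ ^ 2 ≤ W n * M ^ 2 := mul_le_mul_of_nonneg_left h1 (hW0 n)
    _ = W n * M ^ 2 * 1 := by ring
    _ ≤ W n * M ^ 2 * (2 * wt n) := by
        refine mul_le_mul_of_nonneg_left (by linarith) (mul_nonneg (hW0 n) (by positivity))
    _ = _ := by ring

section Flow
variable {K : Type*} [Fintype K] {e : K → Fin d → ℕ} {a : ℝ → K → (Fin d → ℕ) → ℂ}
  {ρ : ℝ → (Fin d → ℕ) → ℝ} {T B M : ℝ} {c : ℝ → (Fin d → ℕ) → ℂ} [NeZero d]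

open Classical in
/-- Termwise differentiation of a weighted `ℓ²` norm, for weights which decay fast enough. -/
lemma IsBandedFlow.hasDerivAt_energy (h : IsBandedFlow e a ρ T B M c) {W : (Fin d → ℕ) → ℝ}
    (hW0 : ∀ n, 0 ≤ W n) (hWs : Summable fun n => W n * wt n) {t : ℝ} (ht : t ∈ Set.Ioo (-T) T) :
    HasDerivAt (fun τ => ∑' n, W n * ‖c τ n‖ ^ 2)
      (∑' n, W n * (2 * ((starRingEnd ℂ) (c t n) * flowField e (a t) (ρ t) (c t) n).re)) t := by
  have hM0 : 0 ≤ M := (norm_nonneg _).trans (h.coeff_bound t ht 0)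
  have hB := h.nonneg
  refine hasDerivAt_tsum_of_isPreconnected (𝕜 := ℝ) (F := ℝ) (t := Set.Ioo (-T) T) (y₀ := t)
    (g := fun n τ => W n * ‖c τ n‖ ^ 2) (g' := fun n τ =>
      W n * (2 * ((starRingEnd ℂ) (c τ n) * flowField e (a τ) (ρ τ) (c τ) n).re))
    (u := fun n => (4 * Fintype.card K * B * M ^ 2) * (W n * wt n)) (hWs.mul_left _) isOpen_Ioo
    isPreconnected_Ioo (fun n y hy => ?_) (fun n y hy => ?_) ht ?_ ht
  · have h1 : HasDerivAt (fun τ => ‖c τ n‖ ^ 2)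
        (2 * inner ℝ (c y n) (flowField e (a y) (ρ y) (c y) n)) y :=
      (h.hasDerivAt y hy n).norm_sq
    have h2 := h1.const_mul (W n)
    simpa [Complex.inner, mul_comm] using h2
  · rw [re_conj_mul_flowField, Real.norm_eq_abs, abs_mul, abs_of_nonneg (hW0 n), abs_mul, abs_neg,
      abs_two]
    have hfl : ∀ k m, |flux e (a y) (c y) k m| ≤ B * M ^ 2 * wt m := fun k m =>
      abs_flux_le (h.coeff_bound y hy) k m (h.bound y hy k m)
    have hk : ∀ k, |flux e (a y) (c y) k n
        - if e k ≤ n then flux e (a y) (c y) k (n - e k) else 0| ≤ 2 * (B * M ^ 2 * wt n) :=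
          fun k => by
      have hw := (wt_pos n).le
      refine (abs_sub _ _).trans ?_
      have h3 : |if e k ≤ n then flux e (a y) (c y) k (n - e k) else 0| ≤ B * M ^ 2 * wt n := by
        split_ifs with hle
        · refine (hfl k _).trans ?_
          have : wt (n - e k) ≤ wt n := by
            have := wt_add (n - e k) (e k)
            rw [tsub_add_cancel_of_le hle] at this
            have h5 : (0 : ℝ) ≤ len (e k) := by positivity
            linarith
          gcongr
        · rw [abs_zero]; positivity
      linarith [hfl k n]
    calc W n * (2 * |∑ k, (flux e (a y) (c y) k n
          - if e k ≤ n then flux e (a y) (c y) k (n - e k) else 0)|)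
        ≤ W n * (2 * ∑ _k : K, 2 * (B * M ^ 2 * wt n)) := by
          refine mul_le_mul_of_nonneg_left ?_ (hW0 n)
          refine mul_le_mul_of_nonneg_left ?_ (by norm_num)
          exact (Finset.abs_sum_le_sum_abs _ _).trans (Finset.sum_le_sum fun k _ => hk k)
      _ = _ := by simp; ring
  · exact summable_weight_mul_sq hW0 hWs (h.coeff_bound t ht)

/-- A banded flow propagates the `Σ^s` norm with an exponential bound. -/
theorem IsBandedFlow.exists_sqSum_le (K : Type*) [Fintype K] (d : ℕ) [NeZero d] {s : ℝ}
    (hs : 0 ≤ s) : ∃ C : ℝ, 0 ≤ C ∧ ∀ {e : K → Fin d → ℕ} {a : ℝ → K → (Fin d → ℕ) → ℂ}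
      {ρ : ℝ → (Fin d → ℕ) → ℝ} {T B M : ℝ} {c : ℝ → (Fin d → ℕ) → ℂ},
      IsBandedFlow e a ρ T B M c → ∀ t₀ ∈ Set.Ioo (-T) T, ∀ t₁ ∈ Set.Ioo (-T) T,
      sqSum s (c t₁) ≤ ENNReal.ofReal (Real.exp (C * B * |t₁ - t₀|)) * sqSum s (c t₀) := by
  obtain ⟨N, hN⟩ := exists_nat_ge (s + 1 + 2 * d)
  set D := 2 * (s + N) * Real.exp (8 * (s + N)) with hDdef
  have hD : 0 ≤ D := by positivity
  refine ⟨2 * Fintype.card K * D, by positivity, ?_⟩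
  intro e a ρ T B M c h t₀ h0 t₁ h1
  -- The regularized weight makes all sums finite, and the bound is uniform in `ε`.
  have hreg : ∀ ε : ℝ, 0 < ε → ∑' n, regWeight s ε N (wt n) * ‖c t₁ n‖ ^ 2
      ≤ Real.exp (2 * Fintype.card K * D * B * |t₁ - t₀|)
        * ∑' n, regWeight s ε N (wt n) * ‖c t₀ n‖ ^ 2 := fun ε hε => by
    have hW0 : ∀ n : Fin d → ℕ, 0 ≤ regWeight s ε N (wt n) := fun n =>
      (regWeight_pos hε N (wt_pos n)).le
    have hWs := summable_regWeight_mul_wt (d := d) hs hε hN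
    have hl : ∀ k, (0 : ℝ) ≤ len (e k) ∧ (len (e k) : ℝ) ≤ 2 := fun k =>
      ⟨by positivity, by exact_mod_cast h.len_le k⟩
    refine le_exp_mul_of_abs_deriv_le (fun t ht => h.hasDerivAt_energy hW0 hWs ht)
      (fun t ht => ?_) h0 h1
    have hcs := summable_weight_mul_sq hW0 hWs (h.coeff_bound t ht)
    refine (hasSum_energy_flux hW0 hWs (h.coeff_bound t ht) (h.bound t ht) h.nonneg hD
      (fun k => ?_) (fun k n => ?_) (fun k n => ?_) hcs hW0).trans (le_of_eq (by ring))
    · refine Summable.of_nonneg_of_le (fun n => mul_nonneg (hW0 _) (wt_pos n).le) (fun n => ?_)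
        (hWs.comp_injective (add_left_injective (e k)))
      have := (hl k).1
      simp only [Function.comp]
      refine mul_le_mul_of_nonneg_left ?_ (hW0 _)
      rw [wt_add]
      linarith
    · rw [wt_add]
      exact (abs_regWeight_sub_le hs hε N (half_le_wt n) (hl k).1 (hl k).2).1
    · rw [wt_add]
      exact (abs_regWeight_sub_le hs hε N (half_le_wt n) (hl k).1 (hl k).2).2
  set L := Real.exp (2 * Fintype.card K * D * B * |t₁ - t₀|)
  have hL : 0 < L := Real.exp_pos _
  by_cases hfin : sqSum s (c t₀) = ∞
  · rw [hfin, ENNReal.mul_top (by simpa using hL)]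
    exact le_top
  have hsum0 : Summable fun n => wt n ^ s * ‖c t₀ n‖ ^ 2 := by
    have := ENNReal.summable_toReal hfin
    refine this.congr fun n => ENNReal.toReal_ofReal ?_
    have := wt_pos n
    positivity
  have hnn : ∀ (t : ℝ) (n : Fin d → ℕ), 0 ≤ wt n ^ s * ‖c t n‖ ^ 2 := fun t n => by
    have := wt_pos n
    positivity
  have hS0 : sqSum s (c t₀) = ENNReal.ofReal (∑' n, wt n ^ s * ‖c t₀ n‖ ^ 2) :=
    (ENNReal.ofReal_tsum_of_nonneg (hnn t₀) hsum0).symm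
  have hregle : ∀ ε : ℝ, 0 < ε → ∀ n : Fin d → ℕ, regWeight s ε N (wt n) ≤ wt n ^ s :=
    fun ε hε n => by
      have := wt_pos n
      refine div_le_self (by positivity) (one_le_pow₀ ?_)
      nlinarith
  -- Let `ε → 0` in finite partial sums.
  have hfinite : ∀ F : Finset (Fin d → ℕ), ∑ n ∈ F, wt n ^ s * ‖c t₁ n‖ ^ 2
      ≤ L * ∑' n, wt n ^ s * ‖c t₀ n‖ ^ 2 := fun F => by
    have hlim : Tendsto (fun ε : ℝ => ∑ n ∈ F, regWeight s ε N (wt n) * ‖c t₁ n‖ ^ 2) (𝓝[>] 0)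
        (𝓝 (∑ n ∈ F, wt n ^ s * ‖c t₁ n‖ ^ 2)) := by
      refine tendsto_finsetSum _ fun n _ => ?_
      have hc : ContinuousAt (fun ε : ℝ => regWeight s ε N (wt n) * ‖c t₁ n‖ ^ 2) 0 := by
        unfold regWeight
        refine ContinuousAt.mul (ContinuousAt.div continuousAt_const (by fun_prop) ?_)
          continuousAt_const
        simp
      have := hc.tendsto
      simp only [regWeight, zero_mul, add_zero, one_pow, div_one] at this ⊢
      exact this.mono_left nhdsWithin_le_nhds
    refine le_of_tendsto hlim ?_
    filter_upwards [self_mem_nhdsWithin] with ε hε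
    have hε : 0 < ε := hε
    have hs0 : Summable fun n => regWeight s ε N (wt n) * ‖c t₀ n‖ ^ 2 := by
      refine Summable.of_nonneg_of_le (fun n => mul_nonneg (regWeight_pos hε N (wt_pos n)).le
        (by positivity)) (fun n => ?_) hsum0
      have := hregle ε hε n
      gcongr
    have hs1 := summable_weight_mul_sq (fun n => (regWeight_pos (s := s) hε N (wt_pos n)).le)
      (summable_regWeight_mul_wt (d := d) hs hε hN) (h.coeff_bound t₁ h1)
    calc _ ≤ ∑' n, regWeight s ε N (wt n) * ‖c t₁ n‖ ^ 2 :=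
          hs1.sum_le_tsum F fun n _ => mul_nonneg (regWeight_pos hε N (wt_pos n)).le (by positivity)
      _ ≤ L * ∑' n, regWeight s ε N (wt n) * ‖c t₀ n‖ ^ 2 := hreg ε hε
      _ ≤ L * ∑' n, wt n ^ s * ‖c t₀ n‖ ^ 2 := by
          refine mul_le_mul_of_nonneg_left ?_ hL.le
          refine hs0.tsum_le_tsum (fun n => ?_) hsum0
          have := hregle ε hε n
          gcongr
  rw [hS0, ← ENNReal.ofReal_mul hL.le]
  unfold sqSum
  rw [ENNReal.tsum_eq_iSup_sum]
  refine iSup_le fun F => ?_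
  rw [← ENNReal.ofReal_sum_of_nonneg fun n _ => hnn t₁ n]
  exact ENNReal.ofReal_le_ofReal (hfinite F)

/-- A banded flow with locally bounded `Σ^{1/2}` norm preserves the `ℓ²` norm. -/
theorem IsBandedFlow.tsum_sq_eq (h : IsBandedFlow e a ρ T B M c) {S : ℝ}
    (hS : ∀ t ∈ Set.Ioo (-T) T, sqSum (1 / 2) (c t) ≤ ENNReal.ofReal S)
    {t₀ t₁ : ℝ} (h0 : t₀ ∈ Set.Ioo (-T) T) (h1 : t₁ ∈ Set.Ioo (-T) T) :
    ∑' n, ‖c t₁ n‖ ^ 2 = ∑' n, ‖c t₀ n‖ ^ 2 := by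
  obtain ⟨N, hN⟩ := exists_nat_ge ((0 : ℝ) + 1 + 2 * d)
  have hl : ∀ k, (0 : ℝ) ≤ len (e k) ∧ (len (e k) : ℝ) ≤ 2 := fun k =>
    ⟨by positivity, by exact_mod_cast h.len_le k⟩
  have hnn : ∀ (t : ℝ) (n : Fin d → ℕ), 0 ≤ wt n ^ (1 / 2 : ℝ) * ‖c t n‖ ^ 2 := fun t n => by
    have := wt_pos n
    positivity
  have hVs : ∀ t ∈ Set.Ioo (-T) T, Summable fun n => wt n ^ (1 / 2 : ℝ) * ‖c t n‖ ^ 2 :=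
    fun t ht => by
      have hfin : sqSum (1 / 2) (c t) ≠ ∞ := ((hS t ht).trans_lt ENNReal.ofReal_lt_top).ne
      refine (ENNReal.summable_toReal hfin).congr fun n => ENNReal.toReal_ofReal (hnn t n)
  have hVle : ∀ t ∈ Set.Ioo (-T) T, ∑' n, wt n ^ (1 / 2 : ℝ) * ‖c t n‖ ^ 2 ≤ |S| := fun t ht => by
    have := hS t ht
    rw [sqSum, ← ENNReal.ofReal_tsum_of_nonneg (hnn t) (hVs t ht)] at this
    exact (ENNReal.ofReal_le_ofReal_iff (abs_nonneg S)).mp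
      (this.trans (ENNReal.ofReal_le_ofReal (le_abs_self S)))
  have hcs : ∀ t ∈ Set.Ioo (-T) T, Summable fun n => ‖c t n‖ ^ 2 := fun t ht => by
    refine Summable.of_nonneg_of_le (fun n => by positivity) (fun n => ?_) ((hVs t ht).mul_left 2)
    have h1 : (1 / 2 : ℝ) ≤ wt n ^ (1 / 2 : ℝ) := by
      calc (1 / 2 : ℝ) = (1 / 2 : ℝ) ^ (1 : ℝ) := (Real.rpow_one _).symm
        _ ≤ (1 / 2 : ℝ) ^ (1 / 2 : ℝ) :=
            Real.rpow_le_rpow_of_exponent_ge (by norm_num) (by norm_num) (by norm_num)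
        _ ≤ _ := Real.rpow_le_rpow (by norm_num) (half_le_wt n) (by norm_num)
    nlinarith [sq_nonneg ‖c t n‖]
  set A := 2 * Fintype.card K * B * (2 * N * Real.exp (4 * N)) * |S| * |t₁ - t₀|
  have hinc : ∀ ε : ℝ, 0 < ε → |∑' n, regWeight 0 ε N (wt n) * ‖c t₁ n‖ ^ 2
      - ∑' n, regWeight 0 ε N (wt n) * ‖c t₀ n‖ ^ 2| ≤ A * ε ^ (1 / 2 : ℝ) := fun ε hε => by
    have hW0 : ∀ n : Fin d → ℕ, 0 ≤ regWeight 0 ε N (wt n) := fun n =>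
      (regWeight_pos hε N (wt_pos n)).le
    have hWs := summable_regWeight_mul_wt (d := d) le_rfl hε hN
    have hD : 0 ≤ 2 * N * Real.exp (4 * N) * ε ^ (1 / 2 : ℝ) := by positivity
    have hB := h.nonneg
    have := (convex_Ioo (-T) T).norm_image_sub_le_of_norm_hasDerivWithin_le
      (C := 2 * Fintype.card K * B * (2 * N * Real.exp (4 * N) * ε ^ (1 / 2 : ℝ)) * |S|)
      (fun t ht => (h.hasDerivAt_energy hW0 hWs ht).hasDerivWithinAt) (fun t ht => ?_) h0 h1
    · rw [Real.norm_eq_abs, Real.norm_eq_abs] at this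
      exact this.trans (le_of_eq (by simp only [A]; ring))
    · refine (hasSum_energy_flux (V := fun n => wt n ^ (1 / 2 : ℝ)) hW0 hWs (h.coeff_bound t ht)
        (h.bound t ht) h.nonneg hD (fun k => ?_) (fun k n => ?_) (fun k n => ?_) (hVs t ht)
        (fun n => Real.rpow_nonneg (wt_pos n).le _)).trans ?_
      · refine Summable.of_nonneg_of_le (fun n => mul_nonneg (hW0 _) (wt_pos n).le) (fun n => ?_)
          (hWs.comp_injective (add_left_injective (e k)))
        have := (hl k).1
        simp only [Function.comp]
        refine mul_le_mul_of_nonneg_left ?_ (hW0 _)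
        rw [wt_add]
        linarith
      · rw [wt_add]
        exact abs_regWeight_zero_sub_le hε N (half_le_wt n) (hl k).1 (hl k).2
      · have h3 := abs_regWeight_zero_sub_le hε N (half_le_wt n) (hl k).1 (hl k).2
        rw [wt_add]
        refine h3.trans (mul_le_mul_of_nonneg_left ?_ hD)
        exact Real.rpow_le_rpow (wt_pos n).le (by linarith [(hl k).1]) (by norm_num)
      · exact mul_le_mul_of_nonneg_left (hVle t ht) (by positivity)
  have hlim : ∀ t ∈ Set.Ioo (-T) T,
      Tendsto (fun ε : ℝ => ∑' n, regWeight 0 ε N (wt n) * ‖c t n‖ ^ 2) (𝓝[>] 0)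
        (𝓝 (∑' n, ‖c t n‖ ^ 2)) := fun t ht => by
    refine tendsto_tsum_of_dominated_convergence (hcs t ht) (fun n => ?_) ?_
    · have hc : ContinuousAt (fun ε : ℝ => regWeight 0 ε N (wt n) * ‖c t n‖ ^ 2) 0 := by
        unfold regWeight
        refine ContinuousAt.mul (ContinuousAt.div continuousAt_const (by fun_prop) ?_)
          continuousAt_const
        simp
      have := hc.tendsto
      simp only [regWeight, zero_mul, add_zero, one_pow, div_one, Real.rpow_zero, one_mul] at this ⊢
      exact this.mono_left nhdsWithin_le_nhds
    · filter_upwards [self_mem_nhdsWithin] with ε hε n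
      have hε : 0 < ε := hε
      have hw := wt_pos n
      rw [norm_mul, Real.norm_eq_abs, abs_of_pos (regWeight_pos hε N hw), Real.norm_eq_abs,
        abs_of_nonneg (by positivity)]
      refine mul_le_of_le_one_left (by positivity) ?_
      rw [regWeight, Real.rpow_zero, div_le_one (by positivity)]
      exact one_le_pow₀ (by nlinarith)
  have h2 := ((hlim t₁ h1).sub (hlim t₀ h0)).abs
  have h3 : Tendsto (fun ε : ℝ => A * ε ^ (1 / 2 : ℝ)) (𝓝[>] 0) (𝓝 0) := by
    have hc : Continuous fun ε : ℝ => A * ε ^ (1 / 2 : ℝ) :=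
      continuous_const.mul (Real.continuous_rpow_const (by norm_num))
    have := hc.tendsto 0
    simp only [Real.zero_rpow (by norm_num : (1 / 2 : ℝ) ≠ 0), mul_zero] at this
    exact this.mono_left nhdsWithin_le_nhds
  have h4 := le_of_tendsto_of_tendsto h2 h3 (by
    filter_upwards [self_mem_nhdsWithin] with ε hε using hinc ε hε)
  exact sub_eq_zero.mp (abs_nonpos_iff.mp h4)

end Flow

/-! ### Convergence in weighted `ℓ²` -/

lemma sqSum_congr {s : ℝ} {c c' : (Fin d → ℕ) → ℂ} (h : ∀ n, ‖c n‖ = ‖c' n‖) :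
    sqSum s c = sqSum s c' := by
  simp only [sqSum, h]

lemma ofReal_wt_mul_add_le [NeZero d] (s : ℝ) (n : Fin d → ℕ) (a b : ℂ) :
    ENNReal.ofReal (wt n ^ s * ‖a + b‖ ^ 2) ≤ 2 * ENNReal.ofReal (wt n ^ s * ‖a‖ ^ 2)
      + 2 * ENNReal.ofReal (wt n ^ s * ‖b‖ ^ 2) := by
  have hw := wt_pos n
  rw [show (2 : ℝ≥0∞) = ENNReal.ofReal 2 by simp, ← ENNReal.ofReal_mul (by norm_num),
    ← ENNReal.ofReal_mul (by norm_num), ← ENNReal.ofReal_add (by positivity) (by positivity)]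
  refine ENNReal.ofReal_le_ofReal ?_
  have h1 : ‖a + b‖ ^ 2 ≤ 2 * ‖a‖ ^ 2 + 2 * ‖b‖ ^ 2 := by
    have h2 := norm_add_le a b
    have h3 : ‖a + b‖ ^ 2 ≤ (‖a‖ + ‖b‖) ^ 2 := by gcongr
    nlinarith [sq_nonneg (‖a‖ - ‖b‖)]
  have h4 : 0 < wt n ^ s := Real.rpow_pos_of_pos hw s
  nlinarith

lemma sqSum_add_le [NeZero d] (s : ℝ) (c c' : (Fin d → ℕ) → ℂ) :
    sqSum s (fun n => c n + c' n) ≤ 2 * sqSum s c + 2 * sqSum s c' := by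
  unfold sqSum
  rw [← ENNReal.tsum_mul_left, ← ENNReal.tsum_mul_left, ← ENNReal.tsum_add]
  exact ENNReal.tsum_le_tsum fun n => ofReal_wt_mul_add_le s n _ _

lemma sqSum_sub_comm (s : ℝ) (c c' : (Fin d → ℕ) → ℂ) :
    sqSum s (fun n => c n - c' n) = sqSum s (fun n => c' n - c n) :=
  sqSum_congr fun _ => norm_sub_rev _ _

/-- Quasi-triangle inequality for the square of the norm. -/
lemma sqSum_sub_le [NeZero d] (s : ℝ) (c c' c'' : (Fin d → ℕ) → ℂ) :
    sqSum s (fun n => c n - c'' n)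
      ≤ 2 * sqSum s (fun n => c n - c' n) + 2 * sqSum s (fun n => c' n - c'' n) := by
  have := sqSum_add_le s (fun n => c n - c' n) (fun n => c' n - c'' n)
  simpa using this

lemma sqSum_mono [NeZero d] {s s' : ℝ} (h : s ≤ s') (c : (Fin d → ℕ) → ℂ) :
    sqSum s c ≤ ENNReal.ofReal (2 ^ (s' - s)) * sqSum s' c := by
  unfold sqSum
  rw [← ENNReal.tsum_mul_left]
  refine ENNReal.tsum_le_tsum fun n => ?_
  rw [← ENNReal.ofReal_mul (by positivity)]
  refine ENNReal.ofReal_le_ofReal ?_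
  have hw := wt_pos n
  rw [← mul_assoc]
  refine mul_le_mul_of_nonneg_right ?_ (by positivity)
  have h1 : (1 : ℝ) ≤ (2 * wt n) ^ (s' - s) :=
    Real.one_le_rpow (by linarith [half_le_wt n]) (by linarith)
  calc wt n ^ s = 1 * wt n ^ s := (one_mul _).symm
    _ ≤ (2 * wt n) ^ (s' - s) * wt n ^ s := by gcongr
    _ = 2 ^ (s' - s) * (wt n ^ (s' - s) * wt n ^ s) := by
        rw [Real.mul_rpow (by norm_num) hw.le, mul_assoc]
    _ = _ := by rw [← Real.rpow_add hw, sub_add_cancel]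

lemma sqSum_lt_top_mono [NeZero d] {s s' : ℝ} (h : s ≤ s') {c : (Fin d → ℕ) → ℂ}
    (hc : sqSum s' c < ∞) : sqSum s c < ∞ :=
  (sqSum_mono h c).trans_lt (ENNReal.mul_lt_top ENNReal.ofReal_lt_top hc)

lemma norm_sq_le_sqSum_zero (c : (Fin d → ℕ) → ℂ) (n : Fin d → ℕ) :
    ENNReal.ofReal (‖c n‖ ^ 2) ≤ sqSum 0 c := by
  have := ENNReal.le_tsum (f := fun n => ENNReal.ofReal (wt n ^ (0 : ℝ) * ‖c n‖ ^ 2)) n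
  simpa [sqSum] using this

/-- Coordinatewise convergence together with convergence of (upper bounds of) the norms implies
convergence in norm. -/
lemma tendsto_sqSum_sub {α : Type*} {l : Filter α} [NeZero d] {s : ℝ}
    {c : α → (Fin d → ℕ) → ℂ} {c₀ : (Fin d → ℕ) → ℂ} {r : α → ℝ≥0∞}
    (hc : ∀ n, Tendsto (fun x => c x n) l (𝓝 (c₀ n))) (hfin : sqSum s c₀ < ∞)
    (hr : Tendsto r l (𝓝 (sqSum s c₀))) (hle : ∀ᶠ x in l, sqSum s (c x) ≤ r x) :
    Tendsto (fun x => sqSum s (fun n => c x n - c₀ n)) l (𝓝 0) := by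
  set g : (Fin d → ℕ) → ℝ≥0∞ := fun n => ENNReal.ofReal (wt n ^ s * ‖c₀ n‖ ^ 2) with hg
  set f : α → (Fin d → ℕ) → ℝ≥0∞ := fun x n => ENNReal.ofReal (wt n ^ s * ‖c x n‖ ^ 2) with hf
  set h : α → (Fin d → ℕ) → ℝ≥0∞ := fun x n => ENNReal.ofReal (wt n ^ s * ‖c x n - c₀ n‖ ^ 2)
    with hh
  have hhle : ∀ x n, h x n ≤ 2 * f x n + 2 * g n := fun x n => by
    have := ofReal_wt_mul_add_le s n (c x n) (-c₀ n)
    simpa [hh, hf, hg, ← sub_eq_add_neg] using this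
  rw [ENNReal.tendsto_nhds_zero]
  intro ε hε
  have hε5 : 0 < ε / 5 := ENNReal.div_pos hε.ne' (by simp)
  have htail := (ENNReal.tendsto_tsum_compl_atTop_zero (f := g) hfin.ne)
  obtain ⟨F, hF⟩ := ((ENNReal.tendsto_nhds_zero.mp htail (ε / 5 / 2)
    (ENNReal.half_pos hε5.ne')).exists)
  by_cases hεtop : ε = ∞
  · exact Eventually.of_forall fun x => hεtop ▸ le_top
  have hFlt : ∑' n : {n // n ∉ F}, g n < ε / 5 :=
    hF.trans_lt (ENNReal.half_lt_self hε5.ne' (ENNReal.div_ne_top hεtop (by simp)))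
  have hsplit : ∀ k : (Fin d → ℕ) → ℝ≥0∞, ∑' n, k n = ∑ n ∈ F, k n + ∑' n : {n // n ∉ F}, k n :=
    fun k => by
      rw [← ENNReal.sum_add_tsum_compl F k]
      rfl
  have hcoord : ∀ n, Tendsto (fun x => f x n) l (𝓝 (g n)) := fun n => by
    refine ENNReal.tendsto_ofReal (Tendsto.const_mul _ ?_)
    exact ((hc n).norm.pow 2)
  have hcoordh : ∀ n, Tendsto (fun x => h x n) l (𝓝 0) := fun n => by
    have : Tendsto (fun x => wt n ^ s * ‖c x n - c₀ n‖ ^ 2) l (𝓝 (wt n ^ s * ‖c₀ n - c₀ n‖ ^ 2)) :=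
      Tendsto.const_mul _ (((hc n).sub_const (c₀ n)).norm.pow 2)
    have := ENNReal.tendsto_ofReal this
    simpa using this
  have hFf : Tendsto (fun x => ∑ n ∈ F, f x n) l (𝓝 (∑ n ∈ F, g n)) :=
    tendsto_finsetSum _ fun n _ => hcoord n
  have hFh : Tendsto (fun x => ∑ n ∈ F, h x n) l (𝓝 0) := by
    simpa using tendsto_finsetSum F fun n _ => hcoordh n
  have hgF : ∑ n ∈ F, g n ≠ ∞ := (ENNReal.sum_lt_top.mpr fun n _ => ENNReal.ofReal_lt_top).ne
  have hdiff : Tendsto (fun x => r x - ∑ n ∈ F, f x n) l (𝓝 (sqSum s c₀ - ∑ n ∈ F, g n)) :=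
    ENNReal.Tendsto.sub hr hFf (Or.inr hgF)
  have hlim : sqSum s c₀ - ∑ n ∈ F, g n < ε / 5 := by
    have : sqSum s c₀ = ∑ n ∈ F, g n + ∑' n : {n // n ∉ F}, g n := hsplit g
    rw [this, ENNReal.add_sub_cancel_left hgF]
    exact hFlt
  filter_upwards [hdiff.eventually_lt_const hlim, ENNReal.tendsto_nhds_zero.mp hFh (ε / 5) hε5, hle]
    with x h1 h2 h3
  have hfx : ∑' n : {n // n ∉ F}, f x n ≤ ε / 5 := by
    have h4 : sqSum s (c x) = ∑ n ∈ F, f x n + ∑' n : {n // n ∉ F}, f x n := hsplit (f x)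
    have h5 : ∑ n ∈ F, f x n ≠ ∞ := (ENNReal.sum_lt_top.mpr fun n _ => ENNReal.ofReal_lt_top).ne
    have h6 : ∑' n : {n // n ∉ F}, f x n = sqSum s (c x) - ∑ n ∈ F, f x n := by
      rw [h4, ENNReal.add_sub_cancel_left h5]
    rw [h6]
    exact (tsub_le_tsub_right h3 _).trans h1.le
  have htot : sqSum s (fun n => c x n - c₀ n) = ∑ n ∈ F, h x n + ∑' n : {n // n ∉ F}, h x n :=
    hsplit (h x)
  rw [htot]
  have htail2 : ∑' n : {n // n ∉ F}, h x n ≤ 2 * (ε / 5) + 2 * (ε / 5) := by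
    calc _ ≤ ∑' n : {n // n ∉ F}, (2 * f x n + 2 * g n) := ENNReal.tsum_le_tsum fun n => hhle x n
      _ = 2 * ∑' n : {n // n ∉ F}, f x n + 2 * ∑' n : {n // n ∉ F}, g n := by
          rw [ENNReal.tsum_add, ENNReal.tsum_mul_left, ENNReal.tsum_mul_left]
      _ ≤ _ := by gcongr
  calc _ ≤ ε / 5 + (2 * (ε / 5) + 2 * (ε / 5)) := add_le_add h2 htail2
    _ = 5 * (ε / 5) := by ring
    _ = ε := ENNReal.mul_div_cancel (by simp) (by simp)

/-- A banded flow is continuous in time with values in `Σ^s`. -/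
lemma IsBandedFlow.tendsto_sqSum_sub {K : Type*} [Fintype K] {e : K → Fin d → ℕ}
    {a : ℝ → K → (Fin d → ℕ) → ℂ} {ρ : ℝ → (Fin d → ℕ) → ℝ} {T B M : ℝ}
    {c : ℝ → (Fin d → ℕ) → ℂ} [NeZero d] (h : IsBandedFlow e a ρ T B M c) {s : ℝ} (hs : 0 ≤ s)
    {t₀ : ℝ} (h0 : t₀ ∈ Set.Ioo (-T) T) (hfin : sqSum s (c t₀) < ∞) :
    Tendsto (fun t => sqSum s (fun n => c t n - c t₀ n)) (𝓝 t₀) (𝓝 0) := by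
  obtain ⟨C, hC, hle⟩ := IsBandedFlow.exists_sqSum_le K d hs
  refine NonlocalNLS.tendsto_sqSum_sub (fun n => (h.hasDerivAt t₀ h0 n).continuousAt) hfin
    (r := fun t => ENNReal.ofReal (Real.exp (C * B * |t - t₀|)) * sqSum s (c t₀)) ?_ ?_
  · have h1 : Tendsto (fun t => ENNReal.ofReal (Real.exp (C * B * |t - t₀|))) (𝓝 t₀) (𝓝 1) := by
      have hc : Continuous fun t => ENNReal.ofReal (Real.exp (C * B * |t - t₀|)) :=
        ENNReal.continuous_ofReal.comp (by fun_prop)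
      have := hc.tendsto t₀
      simpa using this
    have := ENNReal.Tendsto.mul_const (b := sqSum s (c t₀)) h1 (Or.inr hfin.ne)
    simpa using this
  · filter_upwards [isOpen_Ioo.mem_nhds h0] with t ht using hle h t₀ h0 t ht

/-! ### From coefficients to functions -/

lemma sqSum_zero_hermiteCoeff {f : Space d → ℂ} (hf : MemLp f 2 volume) :
    sqSum 0 (hermiteCoeff f) = ENNReal.ofReal (∫ x, ‖f x‖ ^ 2) := by
  have h := hasSum_sq_hermiteCoeff hf
  rw [← h.tsum_eq, ENNReal.ofReal_tsum_of_nonneg (fun n => by positivity) h.summable]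
  simp [sqSum]

lemma memSigma_iff {s : ℝ} {f : Space d → ℂ} :
    MemSigma s f ↔ MemLp f 2 volume ∧ sqSum s (hermiteCoeff f) < ∞ := by
  unfold MemSigma
  rw [sigmaNorm_eq, ENNReal.rpow_lt_top_iff_of_pos (by norm_num)]

lemma MemSigma.mono [NeZero d] {s s' : ℝ} (h : s ≤ s') {f : Space d → ℂ} (hf : MemSigma s' f) :
    MemSigma s f := by
  rw [memSigma_iff] at hf ⊢
  exact ⟨hf.1, sqSum_lt_top_mono h hf.2⟩

lemma sigmaNorm_sub_eq {s : ℝ} {f g : Space d → ℂ} (hf : MemLp f 2 volume) (hg : MemLp g 2 volume) :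
    sigmaNorm s (fun x => f x - g x)
      = (sqSum s (fun n => hermiteCoeff f n - hermiteCoeff g n)) ^ (1 / 2 : ℝ) := by
  rw [sigmaNorm_eq]
  congr 2
  funext n
  exact hermiteCoeff_sub hf hg n

lemma sigmaNorm_congr {s : ℝ} {f g : Space d → ℂ} (h : f =ᵐ[volume] g) :
    sigmaNorm s f = sigmaNorm s g := by
  rw [sigmaNorm_eq, sigmaNorm_eq]
  congr 2
  funext n
  exact hermiteCoeff_congr h n

lemma tendsto_rpow_half_iff {α : Type*} {l : Filter α} {f : α → ℝ≥0∞} :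
    Tendsto (fun x => f x ^ (1 / 2 : ℝ)) l (𝓝 0) ↔ Tendsto f l (𝓝 0) := by
  constructor
  · intro h
    have := (ENNReal.continuous_rpow_const (y := 2)).tendsto 0 |>.comp h
    simp only [Function.comp_def, ← ENNReal.rpow_mul] at this
    norm_num at this
    exact this
  · intro h
    have := (ENNReal.continuous_rpow_const (y := 1 / 2)).tendsto 0 |>.comp h
    simpa [Function.comp_def] using this

lemma continuousInSigma_iff {s : ℝ} {u : ℝ → Space d → ℂ} :
    ContinuousInSigma s u ↔ (∀ t, MemSigma s (u t)) ∧ ∀ t₀, Tendsto (fun t => sqSum s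
      (fun n => hermiteCoeff (u t) n - hermiteCoeff (u t₀) n)) (𝓝 t₀) (𝓝 0) := by
  unfold ContinuousInSigma
  refine and_congr_right fun h => forall_congr' fun t₀ => ?_
  refine Iff.trans (tendsto_congr fun t => ?_) tendsto_rpow_half_iff
  exact sigmaNorm_sub_eq (h t).1 (h t₀).1

lemma ContinuousInSigma.mono [NeZero d] {s s' : ℝ} (h : s ≤ s') {u : ℝ → Space d → ℂ}
    (hu : ContinuousInSigma s' u) : ContinuousInSigma s u := by
  rw [continuousInSigma_iff] at hu ⊢
  refine ⟨fun t => (hu.1 t).mono h, fun t₀ => ?_⟩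
  refine tendsto_of_tendsto_of_tendsto_of_le_of_le tendsto_const_nhds ?_ (fun _ => zero_le)
    (fun t => sqSum_mono h _)
  have := ENNReal.Tendsto.const_mul (a := ENNReal.ofReal (2 ^ (s' - s))) (hu.2 t₀)
    (Or.inr ENNReal.ofReal_ne_top)
  simpa using this

/-- The `Σ^s` norm of a continuous curve is bounded on bounded time intervals. -/
lemma ContinuousInSigma.exists_sqSum_le [NeZero d] {s : ℝ} {u : ℝ → Space d → ℂ}
    (hu : ContinuousInSigma s u) (T : ℝ) :
    ∃ S : ℝ, ∀ t ∈ Set.Ioo (-T) T, sqSum s (hermiteCoeff (u t)) ≤ ENNReal.ofReal S := by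
  rw [continuousInSigma_iff] at hu
  have hloc : ∀ t₀ ∈ Set.Icc (-T) T, ∃ V ∈ 𝓝[Set.Icc (-T) T] t₀, ∃ S : ℝ, 0 ≤ S ∧
      ∀ t ∈ V, sqSum s (hermiteCoeff (u t)) ≤ ENNReal.ofReal S := fun t₀ _ => by
    have h1 := ENNReal.tendsto_nhds_zero.mp (hu.2 t₀) 1 one_pos
    have hfin := (memSigma_iff.mp (hu.1 t₀)).2
    refine ⟨_, mem_nhdsWithin_of_mem_nhds h1,
      (2 * 1 + 2 * sqSum s (hermiteCoeff (u t₀))).toReal, ENNReal.toReal_nonneg, fun t ht => ?_⟩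
    rw [ENNReal.ofReal_toReal (by
      exact (ENNReal.add_lt_top.mpr ⟨by simp, ENNReal.mul_lt_top (by simp) hfin⟩).ne)]
    have h2 := sqSum_add_le s (fun n => hermiteCoeff (u t) n - hermiteCoeff (u t₀) n)
      (hermiteCoeff (u t₀))
    simp only [sub_add_cancel] at h2
    refine h2.trans ?_
    have h3 : sqSum s (fun n => hermiteCoeff (u t) n - hermiteCoeff (u t₀) n) ≤ 1 := ht
    gcongr
  have := (isCompact_Icc (a := -T) (b := T)).induction_on
    (p := fun A => ∃ S : ℝ, 0 ≤ S ∧ ∀ t ∈ A, sqSum s (hermiteCoeff (u t)) ≤ ENNReal.ofReal S)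
    ⟨0, le_rfl, fun t ht => ht.elim⟩
    (fun A A' hAA' ⟨S, h0, hS⟩ => ⟨S, h0, fun t ht => hS t (hAA' ht)⟩)
    (fun A A' ⟨S, h0, hS⟩ ⟨S', h0', hS'⟩ => ⟨S + S', by positivity, fun t ht => by
      rcases ht with ht | ht
      · exact (hS t ht).trans (ENNReal.ofReal_le_ofReal (by linarith))
      · exact (hS' t ht).trans (ENNReal.ofReal_le_ofReal (by linarith))⟩)
    hloc
  obtain ⟨S, _, hS⟩ := this
  exact ⟨S, fun t ht => hS t (Set.Ioo_subset_Icc_self ht)⟩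

/-! ### Quadratic generators and moving frames -/

/-- The coefficients of a formally skew-adjoint differential operator whose symbol is a quadratic
polynomial; see `QuadGen.op`. -/
structure QuadGen (d : ℕ) where
  h : ℝ
  k : ℝ
  δ : ℝ
  r : ℝ
  β : Space d
  γ : Space d

/-- The operator `i h Δ + i k |x|² + δ (d/2 + x·∇) + i β·x + γ·∇ + i r` on Schwartz functions. -/
def QuadGen.op (G : QuadGen d) (ψ : 𝓢(Space d, ℂ)) : 𝓢(Space d, ℂ) :=
  (Complex.I * G.r) • ψ + ∑ j, ((Complex.I * G.h) • partialD j (partialD j ψ)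
    + (Complex.I * G.k) • coordMul j (coordMul j ψ)
    + (G.δ : ℂ) • (coordMul j (partialD j ψ) + (1 / 2 : ℂ) • ψ)
    + (Complex.I * G.β j) • coordMul j ψ + (G.γ j : ℂ) • partialD j ψ)

lemma QuadGen.op_apply (G : QuadGen d) (ψ : 𝓢(Space d, ℂ)) (x : Space d) :
    G.op ψ x = Complex.I * G.r * ψ x + ∑ j, (Complex.I * G.h * partialD j (partialD j ψ) x
      + Complex.I * G.k * ((x j : ℂ) * ((x j : ℂ) * ψ x))
      + (G.δ : ℂ) * ((x j : ℂ) * partialD j ψ x + (1 / 2 : ℂ) * ψ x)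
      + Complex.I * G.β j * ((x j : ℂ) * ψ x) + (G.γ j : ℂ) * partialD j ψ x) := by
  simp [QuadGen.op, sum_apply, mul_add]

/-- The parameters of a moving frame: position `q`, momentum `p`, phase `α`, and logarithmic
scale `σ`. -/
structure Frame (d : ℕ) where
  q : Space d
  p : Space d
  α : ℝ
  σ : ℝ

/-- The function `f` seen in a moving frame:
`x ↦ e^{i(p·x - α)} e^{σd/2} f(e^σ (x - q))`, unitary on `L²`. -/
def Frame.act (θ : Frame d) (f : Space d → ℂ) (x : Space d) : ℂ :=
  Complex.exp (Complex.I * ((inner ℝ θ.p x - θ.α : ℝ) : ℂ)) * (Real.exp (θ.σ * d / 2) : ℂ)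
    * f (Real.exp θ.σ • (x - θ.q))

lemma hasTemperateGrowth_cexp_I :
    Function.HasTemperateGrowth (fun r : ℝ => Complex.exp (Complex.I * (r : ℂ))) := by
  have hd : ∀ n : ℕ, iteratedDeriv n (fun r : ℝ => Complex.exp (Complex.I * (r : ℂ)))
      = fun r : ℝ => Complex.I ^ n * Complex.exp (Complex.I * (r : ℂ)) := by
    intro n
    induction n with
    | zero => simp
    | succ n ih =>
      rw [iteratedDeriv_succ, ih]
      funext r
      have h1 : HasDerivAt (fun r : ℝ => Complex.I * (r : ℂ)) Complex.I r := by
        simpa using (Complex.ofRealCLM.hasDerivAt (x := r)).const_mul Complex.I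
      have h2 := (h1.cexp).const_mul (Complex.I ^ n)
      rw [h2.deriv]
      ring
  refine ⟨?_, fun n => ⟨0, 1, fun x => ?_⟩⟩
  · exact (contDiff_const.mul Complex.ofRealCLM.contDiff).cexp
  · rw [norm_iteratedFDeriv_eq_norm_iteratedDeriv, hd]
    simp [mul_comm Complex.I, Complex.norm_exp_ofReal_mul_I]

lemma hasTemperateGrowth_phase (p : Space d) (α : ℝ) :
    Function.HasTemperateGrowth
      (fun x : Space d => Complex.exp (Complex.I * ((inner ℝ p x - α : ℝ) : ℂ))) := by
  have h : Function.HasTemperateGrowth (fun x : Space d => inner ℝ p x - α) := by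
    have h1 : Function.HasTemperateGrowth (innerSL ℝ p : Space d → ℝ) := by fun_prop
    exact h1.sub (Function.HasTemperateGrowth.const α)
  exact hasTemperateGrowth_cexp_I.comp h

/-- The dilation `x ↦ e^{-σ} x` as a continuous linear equivalence. -/
def dilation (d : ℕ) (σ : ℝ) : Space d ≃L[ℝ] Space d :=
  ContinuousLinearEquiv.smulLeft (Units.mk0 (Real.exp (-σ)) (Real.exp_ne_zero _))

/-- The transpose of `Frame.act` on Schwartz functions; see `Frame.trans_apply`. -/
def Frame.trans (θ : Frame d) : 𝓢(Space d, ℂ) →L[ℂ] 𝓢(Space d, ℂ) :=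
  (Real.exp (-(θ.σ * d / 2)) : ℂ) •
    (SchwartzMap.compCLMOfContinuousLinearEquiv ℂ (dilation d θ.σ)
      ∘L SchwartzMap.compSubConstCLM ℂ (-θ.q)
      ∘L SchwartzMap.smulLeftCLM ℂ (fun x : Space d =>
        Complex.exp (Complex.I * ((inner ℝ θ.p x - θ.α : ℝ) : ℂ))))

/-- The point which a frame maps to `y`. -/
def Frame.pt (θ : Frame d) (y : Space d) : Space d := Real.exp (-θ.σ) • y + θ.q

lemma Frame.trans_apply (θ : Frame d) (ψ : 𝓢(Space d, ℂ)) (y : Space d) :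
    θ.trans ψ y = (Real.exp (-(θ.σ * d / 2)) : ℂ)
      * (Complex.exp (Complex.I * ((inner ℝ θ.p (θ.pt y) - θ.α : ℝ) : ℂ)) * ψ (θ.pt y)) := by
  have h1 : θ.trans ψ y = (Real.exp (-(θ.σ * d / 2)) : ℂ) * SchwartzMap.smulLeftCLM ℂ
      (fun x : Space d => Complex.exp (Complex.I * ((inner ℝ θ.p x - θ.α : ℝ) : ℂ))) ψ
        (dilation d θ.σ y - -θ.q) := rfl
  have h2 : dilation d θ.σ y - -θ.q = θ.pt y := by
    rw [sub_neg_eq_add]; rfl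
  rw [h1, SchwartzMap.smulLeftCLM_apply_apply (hasTemperateGrowth_phase θ.p θ.α), h2, smul_eq_mul]

lemma Frame.act_pt (θ : Frame d) (y : Space d) : Real.exp θ.σ • (θ.pt y - θ.q) = y := by
  rw [Frame.pt, add_sub_cancel_right, smul_smul, ← Real.exp_add]
  simp

/-- Change of variables `x = e^{-σ} y + q`. -/
lemma Frame.integral_comp {E : Type*} [NormedAddCommGroup E] [NormedSpace ℝ E] (θ : Frame d)
    (F : Space d → E) :
    ∫ x, F (Real.exp θ.σ • (x - θ.q)) = Real.exp (-(θ.σ * d)) • ∫ y, F y := by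
  rw [integral_sub_right_eq_self (fun x => F (Real.exp θ.σ • x)) θ.q, Measure.integral_comp_smul]
  congr 1
  rw [finrank_euclideanSpace, Fintype.card_fin, abs_of_pos (by positivity), ← Real.exp_nat_mul,
    ← Real.exp_neg]
  ring_nf

lemma Frame.integral_act_mul (θ : Frame d) (f : Space d → ℂ) (ψ : 𝓢(Space d, ℂ)) :
    ∫ x, θ.act f x * ψ x = ∫ y, f y * θ.trans ψ y := by
  have h1 : ∀ x, θ.act f x * ψ x = (Real.exp (θ.σ * d) : ℂ) *
      (fun y => f y * θ.trans ψ y) (Real.exp θ.σ • (x - θ.q)) := fun x => by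
    have hx : θ.pt (Real.exp θ.σ • (x - θ.q)) = x := by
      rw [Frame.pt, smul_smul, ← Real.exp_add]; simp
    simp only [Frame.trans_apply, hx, Frame.act]
    have h2 : (Real.exp (θ.σ * d / 2) : ℂ)
        = (Real.exp (θ.σ * d) : ℂ) * (Real.exp (-(θ.σ * d / 2)) : ℂ) := by
      rw [← Complex.ofReal_mul, ← Real.exp_add]; ring_nf
    rw [h2]; ring
  simp only [h1]
  rw [integral_const_mul, θ.integral_comp (fun y => f y * θ.trans ψ y), Complex.real_smul,
    ← mul_assoc, ← Complex.ofReal_mul, ← Real.exp_add]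
  simp

lemma Frame.norm_act (θ : Frame d) (f : Space d → ℂ) (x : Space d) :
    ‖θ.act f x‖ = Real.exp (θ.σ * d / 2) * ‖f (Real.exp θ.σ • (x - θ.q))‖ := by
  rw [Frame.act, norm_mul, norm_mul, mul_comm Complex.I, Complex.norm_exp_ofReal_mul_I, one_mul,
    Complex.norm_real, Real.norm_of_nonneg (Real.exp_pos _).le]

lemma Frame.integral_mul_sq_act (θ : Frame d) (f : Space d → ℂ) (w : Space d → ℝ) :
    ∫ x, w x * ‖θ.act f x‖ ^ 2 = ∫ y, w (θ.pt y) * ‖f y‖ ^ 2 := by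
  have h1 : ∀ x, w x * ‖θ.act f x‖ ^ 2 = Real.exp (θ.σ * d) *
      (fun y => w (θ.pt y) * ‖f y‖ ^ 2) (Real.exp θ.σ • (x - θ.q)) := fun x => by
    have hx : θ.pt (Real.exp θ.σ • (x - θ.q)) = x := by
      rw [Frame.pt, smul_smul, ← Real.exp_add]; simp
    simp only [θ.norm_act, hx]
    rw [mul_pow, ← Real.exp_nat_mul]
    have : ((2 : ℕ) : ℝ) * (θ.σ * d / 2) = θ.σ * d := by push_cast; ring
    rw [this]; ring
  simp only [h1]
  rw [integral_const_mul, θ.integral_comp (fun y => w (θ.pt y) * ‖f y‖ ^ 2), smul_eq_mul,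
    ← mul_assoc, ← Real.exp_add]
  simp

lemma Frame.quasiMeasurePreserving (θ : Frame d) :
    Measure.QuasiMeasurePreserving (fun x : Space d => Real.exp θ.σ • (x - θ.q)) volume volume := by
  have h1 : Measure.QuasiMeasurePreserving (fun x : Space d => Real.exp θ.σ • x) volume volume := by
    refine ⟨by fun_prop, ?_⟩
    rw [Measure.map_addHaar_smul _ (Real.exp_ne_zero _)]
    exact Measure.smul_absolutelyContinuous
  exact h1.comp (measurePreserving_sub_right volume θ.q).quasiMeasurePreserving

lemma Frame.act_congr (θ : Frame d) {f g : Space d → ℂ} (h : f =ᵐ[volume] g) :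
    θ.act f =ᵐ[volume] θ.act g := by
  filter_upwards [θ.quasiMeasurePreserving.ae h] with x hx
  simp only [Frame.act, hx]

lemma Frame.memLp_act (θ : Frame d) {f : Space d → ℂ} (hf : MemLp f 2 volume) :
    MemLp (θ.act f) 2 volume := by
  have hm : AEStronglyMeasurable (θ.act f) volume := by
    have h1 : AEStronglyMeasurable (fun x => f (Real.exp θ.σ • (x - θ.q))) volume :=
      hf.1.comp_quasiMeasurePreserving θ.quasiMeasurePreserving
    refine AEStronglyMeasurable.mul (Continuous.aestronglyMeasurable ?_) h1
    fun_prop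
  rw [memLp_two_iff_integrable_sq_norm hm]
  have h1 : Integrable (fun y => ‖f y‖ ^ 2) := (memLp_two_iff_integrable_sq_norm hf.1).mp hf
  have h2 : Integrable (fun x => ‖f (Real.exp θ.σ • (x - θ.q))‖ ^ 2) := by
    have := (integrable_comp_smul_iff volume (fun y => ‖f y‖ ^ 2) (Real.exp_ne_zero θ.σ)).mpr h1
    exact this.comp_sub_right θ.q
  refine (h2.const_mul (Real.exp (θ.σ * d / 2) ^ 2)).congr (Eventually.of_forall fun x => ?_)
  simp only [θ.norm_act, mul_pow]

lemma Frame.integral_sq_act (θ : Frame d) (f : Space d → ℂ) :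
    ∫ x, ‖θ.act f x‖ ^ 2 = ∫ y, ‖f y‖ ^ 2 := by
  simpa using θ.integral_mul_sq_act f (fun _ => 1)

lemma Frame.hermiteCoeff_act (θ : Frame d) (f : Space d → ℂ) (n : Fin d → ℕ) :
    hermiteCoeff (θ.act f) n = ∫ y, f y * θ.trans (hermiteS n) y := by
  rw [← θ.integral_act_mul]
  simp [hermiteCoeff]

lemma Frame.act_sub (θ : Frame d) (f g : Space d → ℂ) :
    θ.act (fun x => f x - g x) = fun x => θ.act f x - θ.act g x := by
  funext x; simp only [Frame.act, mul_sub]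

lemma Frame.act_const_mul (θ : Frame d) (a : ℂ) (f : Space d → ℂ) :
    θ.act (fun x => a * f x) = fun x => a * θ.act f x := by
  funext x; simp only [Frame.act]; ring

/-! ### Paths of frames -/

lemma Frame.coordMul_trans (θ : Frame d) (j : Fin d) (ψ : 𝓢(Space d, ℂ)) :
    coordMul j (θ.trans ψ)
      = (Real.exp θ.σ : ℂ) • θ.trans (coordMul j ψ - (θ.q j : ℂ) • ψ) := by
  ext y
  have hy : y j = Real.exp θ.σ * (θ.pt y j - θ.q j) := by
    conv_lhs => rw [← θ.act_pt y]
    simp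
  simp only [coordMul_apply, smul_apply, smul_eq_mul, Frame.trans_apply, sub_apply, hy]
  push_cast
  ring

/-- The time derivatives of the parameters of a path of frames. -/
structure Frame.HasDeriv (θ θ' : ℝ → Frame d) (t : ℝ) : Prop where
  q : HasDerivAt (fun τ => (θ τ).q) (θ' t).q t
  p : HasDerivAt (fun τ => (θ τ).p) (θ' t).p t
  α : HasDerivAt (fun τ => (θ τ).α) (θ' t).α t
  σ : HasDerivAt (fun τ => (θ τ).σ) (θ' t).σ t

/-- The velocity of a path of frames at `θ` with derivative `θ'`, as a quadratic generator. -/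
def Frame.gen (θ θ' : Frame d) : QuadGen d where
  h := 0
  k := 0
  δ := -θ'.σ
  r := inner ℝ θ.p (θ'.q + θ'.σ • θ.q) - θ'.α
  β := θ'.p - θ'.σ • θ.p
  γ := θ'.q + θ'.σ • θ.q

lemma sum_mul_partialD (v x : Space d) (ψ : 𝓢(Space d, ℂ)) :
    ∑ j, (v j : ℂ) * partialD j ψ x = fderiv ℝ ψ x v := by
  have hv : v = ∑ j, v j • basisVec j := by
    ext i
    simp [Finset.sum_apply, Pi.single_apply]
  conv_rhs => rw [hv]
  rw [map_sum]
  refine Finset.sum_congr rfl fun j _ => ?_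
  rw [map_smul, partialD_apply_eq_fderiv, Complex.real_smul]

/-- The operator of `Frame.gen`, as multiplication by a function plus differentiation along the
velocity field `q' - σ' (x - q)`. -/
lemma Frame.gen_op_apply (θ θ' : Frame d) (ψ : 𝓢(Space d, ℂ)) (x : Space d) :
    (θ.gen θ').op ψ x = (-(θ'.σ * d / 2 : ℝ) + Complex.I * ((inner ℝ θ'.p x
        + inner ℝ θ.p (θ'.q - θ'.σ • (x - θ.q)) - θ'.α : ℝ) : ℂ)) * ψ x
      + fderiv ℝ ψ x (θ'.q - θ'.σ • (x - θ.q)) := by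
  rw [QuadGen.op_apply, ← sum_mul_partialD]
  have hin : ∀ u v : Space d, ((inner ℝ u v : ℝ) : ℂ) = ∑ j, (u j : ℂ) * (v j : ℂ) := fun u v => by
    rw [PiLp.inner_apply]
    simp [mul_comm]
  have hd : ((θ'.σ * d / 2 : ℝ) : ℂ) = ∑ _j : Fin d, (θ'.σ / 2 : ℂ) := by
    simp; ring
  simp only [Frame.gen]
  rw [Complex.ofReal_sub, Complex.ofReal_sub, Complex.ofReal_add, hin, hin, hin]
  push_cast at hd ⊢
  rw [hd]
  have hL : ∀ (S α ψ T : ℂ), Complex.I * (S - α) * ψ + T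
      = -(Complex.I * α * ψ) + (Complex.I * S * ψ + T) := fun _ _ _ _ => by ring
  have hR : ∀ (A B D α ψ T : ℂ), (-A + Complex.I * (B + D - α)) * ψ + T
      = -(Complex.I * α * ψ) + (-(A * ψ) + Complex.I * B * ψ + Complex.I * D * ψ + T) :=
    fun _ _ _ _ _ _ => by ring
  rw [hL, hR]
  simp only [Finset.mul_sum, Finset.sum_mul, ← Finset.sum_neg_distrib, ← Finset.sum_add_distrib]
  congr 1
  refine Finset.sum_congr rfl fun j _ => ?_
  simp only [PiLp.sub_apply, PiLp.add_apply, PiLp.smul_apply, smul_eq_mul]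
  push_cast
  ring

/-- Along a path of frames, `Frame.trans` moves with the velocity `Frame.gen`. -/
lemma Frame.hasDerivAt_trans {θ θ' : ℝ → Frame d} {t : ℝ} (h : Frame.HasDeriv θ θ' t)
    (ψ : 𝓢(Space d, ℂ)) (y : Space d) :
    HasDerivAt (fun τ => (θ τ).trans ψ y) ((θ t).trans (((θ t).gen (θ' t)).op ψ) y) t := by
  simp only [Frame.trans_apply]
  set x' : Space d := (θ' t).q - (θ' t).σ • ((θ t).pt y - (θ t).q) with hx'
  have hpt : HasDerivAt (fun τ => (θ τ).pt y) x' t := by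
    have h1 : HasDerivAt (fun τ => Real.exp (-(θ τ).σ) • y + (θ τ).q)
        ((Real.exp (-(θ t).σ) * (-(θ' t).σ)) • y + (θ' t).q) t :=
      (h.σ.neg.exp.smul_const y).add h.q
    refine h1.congr_deriv ?_
    rw [hx', Frame.pt, add_sub_cancel_right, smul_smul]
    module
  have h1 : HasDerivAt (fun τ => (Real.exp (-((θ τ).σ * d / 2)) : ℂ))
      ((Real.exp (-((θ t).σ * d / 2)) * -((θ' t).σ * d / 2) : ℝ) : ℂ) t :=
    (((h.σ.mul_const (d : ℝ)).div_const 2).neg.exp).ofReal_comp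
  have h2 : HasDerivAt (fun τ => Complex.exp (Complex.I *
      ((inner ℝ (θ τ).p ((θ τ).pt y) - (θ τ).α : ℝ) : ℂ)))
      (Complex.exp (Complex.I * ((inner ℝ (θ t).p ((θ t).pt y) - (θ t).α : ℝ) : ℂ))
        * (Complex.I * ((inner ℝ (θ t).p x' + inner ℝ (θ' t).p ((θ t).pt y) - (θ' t).α : ℝ) : ℂ)))
      t :=
    (((h.p.inner ℝ hpt).sub h.α).ofReal_comp.const_mul Complex.I).cexp
  have h3 : HasDerivAt (fun τ => ψ ((θ τ).pt y)) (fderiv ℝ ψ ((θ t).pt y) x') t :=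
    (ψ.differentiableAt.hasFDerivAt (x := (θ t).pt y)).comp_hasDerivAt t hpt
  refine (h1.mul (h2.mul h3)).congr_deriv ?_
  rw [Frame.gen_op_apply, ← hx', Pi.mul_apply]
  push_cast
  ring

lemma Frame.partialD_trans (θ : Frame d) (j : Fin d) (ψ : 𝓢(Space d, ℂ)) :
    partialD j (θ.trans ψ)
      = (Real.exp (-θ.σ) : ℂ) • θ.trans ((Complex.I * θ.p j) • ψ + partialD j ψ) := by
  ext y
  have hd : ∀ z : Space d, (θ.trans ψ) z = (Real.exp (-(θ.σ * d / 2)) : ℂ)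
      * (Complex.exp (Complex.I * ((inner ℝ θ.p (θ.pt z) - θ.α : ℝ) : ℂ)) * ψ (θ.pt z)) :=
    fun z => θ.trans_apply ψ z
  have hpt : HasDerivAt (fun τ : ℝ => θ.pt (y + τ • basisVec j))
      (Real.exp (-θ.σ) • basisVec j) 0 := by
    have h1 : HasDerivAt (fun τ : ℝ => y + τ • basisVec j) ((1 : ℝ) • basisVec j) 0 :=
      ((hasDerivAt_id (0 : ℝ)).smul_const (basisVec j)).const_add y
    have h2 := (h1.const_smul (Real.exp (-θ.σ))).add_const θ.q
    rwa [one_smul] at h2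
  have h2 : HasDerivAt (fun τ : ℝ => Complex.exp (Complex.I *
      ((inner ℝ θ.p (θ.pt (y + τ • basisVec j)) - θ.α : ℝ) : ℂ)))
      (Complex.exp (Complex.I * ((inner ℝ θ.p (θ.pt y) - θ.α : ℝ) : ℂ))
        * (Complex.I * ((Real.exp (-θ.σ) * θ.p j : ℝ) : ℂ))) 0 := by
    have := (((hasDerivAt_const (0 : ℝ) θ.p).inner ℝ hpt).sub_const θ.α).ofReal_comp.const_mul
      Complex.I |>.cexp
    refine this.congr_deriv ?_
    simp [inner_smul_right, EuclideanSpace.inner_single_right]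
  have h3 : HasDerivAt (fun τ : ℝ => ψ (θ.pt (y + τ • basisVec j)))
      ((Real.exp (-θ.σ) : ℂ) * partialD j ψ (θ.pt y)) 0 := by
    have h4 : HasFDerivAt ψ (fderiv ℝ ψ (θ.pt y)) (θ.pt (y + (0 : ℝ) • basisVec j)) := by
      simpa using ψ.differentiableAt.hasFDerivAt (x := θ.pt y)
    refine (h4.comp_hasDerivAt (0 : ℝ) hpt).congr_deriv ?_
    rw [map_smul, partialD_apply_eq_fderiv, Complex.real_smul]
  have h5 := (h2.mul h3).const_mul (Real.exp (-(θ.σ * d / 2)) : ℂ)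
  rw [partialD_apply, lineDeriv]
  simp only [hd]
  erw [h5.deriv]
  simp only [smul_apply, smul_eq_mul, Frame.trans_apply, add_apply, zero_smul, add_zero]
  push_cast
  ring

/-! ### Decay estimates and differentiation of pairings -/

lemma exists_norm_schwartz_le (ψ : 𝓢(Space d, ℂ)) (k : ℕ) :
    ∃ C : ℝ, 0 ≤ C ∧ ∀ x, (1 + ‖x‖) ^ k * ‖ψ x‖ ≤ C := by
  have h := fun x => SchwartzMap.one_add_le_sup_seminorm_apply (𝕜 := ℂ) (m := (k, 0)) le_rfl le_rfl
    ψ x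
  simp only [norm_iteratedFDeriv_zero] at h
  exact ⟨_, (by positivity : (0 : ℝ) ≤ (1 + ‖(0 : Space d)‖) ^ k * ‖ψ 0‖).trans (h 0), h⟩

lemma Frame.one_add_norm_le (θ : Frame d) {R : ℝ} (hq : ‖θ.q‖ ≤ R) (hσ : |θ.σ| ≤ R) (y : Space d) :
    1 + ‖y‖ ≤ (1 + Real.exp R * (1 + R)) * (1 + ‖θ.pt y‖) := by
  have hR : 0 ≤ R := (norm_nonneg _).trans hq
  have h1 : ‖y‖ = Real.exp θ.σ * ‖θ.pt y - θ.q‖ := by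
    conv_lhs => rw [← θ.act_pt y]
    rw [norm_smul, Real.norm_of_nonneg (Real.exp_pos _).le]
  have h2 : ‖θ.pt y - θ.q‖ ≤ ‖θ.pt y‖ + R := (norm_sub_le _ _).trans (by linarith)
  have h3 : Real.exp θ.σ ≤ Real.exp R := Real.exp_le_exp.mpr ((le_abs_self _).trans hσ)
  have h4 : ‖y‖ ≤ Real.exp R * (‖θ.pt y‖ + R) := by
    rw [h1]; gcongr
  have h5 := Real.exp_pos R
  have h6 := norm_nonneg (θ.pt y)
  nlinarith [mul_nonneg h5.le (mul_nonneg hR h6)]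

lemma Frame.norm_trans (θ : Frame d) (ψ : 𝓢(Space d, ℂ)) (y : Space d) :
    ‖θ.trans ψ y‖ = Real.exp (-(θ.σ * d / 2)) * ‖ψ (θ.pt y)‖ := by
  rw [θ.trans_apply, norm_mul, norm_mul, mul_comm Complex.I, Complex.norm_exp_ofReal_mul_I, one_mul,
    Complex.norm_real, Real.norm_of_nonneg (Real.exp_pos _).le]

/-- Schwartz decay, uniform over bounded families of frames. -/
lemma exists_norm_trans_le (ψ : 𝓢(Space d, ℂ)) (R : ℝ) (k : ℕ) :
    ∃ C : ℝ, 0 ≤ C ∧ ∀ θ : Frame d, ‖θ.q‖ ≤ R → |θ.σ| ≤ R →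
      ∀ y, ‖θ.trans ψ y‖ ≤ C / (1 + ‖y‖) ^ k := by
  obtain ⟨C, hC, h⟩ := exists_norm_schwartz_le ψ k
  by_cases hR : R < 0
  · exact ⟨0, le_rfl, fun θ hq => absurd ((norm_nonneg _).trans hq) (by linarith)⟩
  push Not at hR
  refine ⟨Real.exp (R * d / 2) * ((1 + Real.exp R * (1 + R)) ^ k * C), by positivity,
    fun θ hq hσ y => ?_⟩
  rw [le_div_iff₀ (by positivity), θ.norm_trans, mul_assoc]
  have h1 : Real.exp (-(θ.σ * d / 2)) ≤ Real.exp (R * d / 2) := by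
    refine Real.exp_le_exp.mpr ?_
    have := (neg_le_abs _).trans hσ
    have hd : (0 : ℝ) ≤ d := by positivity
    nlinarith
  have h2 : ‖ψ (θ.pt y)‖ * (1 + ‖y‖) ^ k ≤ (1 + Real.exp R * (1 + R)) ^ k * C := by
    calc ‖ψ (θ.pt y)‖ * (1 + ‖y‖) ^ k
        ≤ ‖ψ (θ.pt y)‖ * ((1 + Real.exp R * (1 + R)) * (1 + ‖θ.pt y‖)) ^ k := by
          gcongr; exact θ.one_add_norm_le hq hσ y
      _ = (1 + Real.exp R * (1 + R)) ^ k * ((1 + ‖θ.pt y‖) ^ k * ‖ψ (θ.pt y)‖) := by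
          rw [mul_pow]; ring
      _ ≤ _ := by gcongr; exact h _
  gcongr

/-- The sum of the absolute values of the parameters of a generator. -/
def QuadGen.size (G : QuadGen d) : ℝ := |G.h| + |G.k| + |G.δ| + |G.r| + ‖G.β‖ + ‖G.γ‖

lemma abs_coord_le (v : Space d) (j : Fin d) : |v j| ≤ ‖v‖ := PiLp.norm_apply_le v j

/-- Decay of `G.op ψ` seen in a frame, uniform over bounded generators and frames. -/
lemma exists_op_bound (ψ : 𝓢(Space d, ℂ)) (R : ℝ) (k : ℕ) :
    ∃ C : ℝ, 0 ≤ C ∧ ∀ (θ : Frame d) (G : QuadGen d), ‖θ.q‖ ≤ R → |θ.σ| ≤ R → G.size ≤ R →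
      ∀ y, ‖θ.trans (G.op ψ) y‖ ≤ C / (1 + ‖y‖) ^ k := by
  obtain ⟨C0, hC0, h0⟩ := exists_norm_trans_le ψ R k
  choose C1 hC1 h1 using fun j => exists_norm_trans_le (partialD j (partialD j ψ)) R k
  choose C2 hC2 h2 using fun j => exists_norm_trans_le (coordMul j (coordMul j ψ)) R k
  choose C3 hC3 h3 using fun j => exists_norm_trans_le
    (coordMul j (partialD j ψ) + (1 / 2 : ℂ) • ψ) R k
  choose C4 hC4 h4 using fun j => exists_norm_trans_le (coordMul j ψ) R k
  choose C5 hC5 h5 using fun j => exists_norm_trans_le (partialD j ψ) R k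
  by_cases hR : R < 0
  · exact ⟨0, le_rfl, fun θ G hq => absurd ((norm_nonneg _).trans hq) (by linarith)⟩
  push Not at hR
  refine ⟨R * C0 + ∑ j, (R * C1 j + R * C2 j + R * C3 j + R * C4 j + R * C5 j),
    add_nonneg (by positivity) (Finset.sum_nonneg fun j _ => ?_), fun θ G hq hσ hG y => ?_⟩
  · have := hC1 j; have := hC2 j; have := hC3 j; have := hC4 j; have := hC5 j
    positivity
  have a1 := abs_nonneg G.h
  have a2 := abs_nonneg G.k
  have a3 := abs_nonneg G.δ
  have a4 := abs_nonneg G.r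
  have a5 := norm_nonneg G.β
  have a6 := norm_nonneg G.γ
  unfold QuadGen.size at hG
  have key : ∀ (z : ℂ) (χ : 𝓢(Space d, ℂ)) (C : ℝ), ‖z‖ ≤ R → (‖θ.trans χ y‖ ≤ C / (1 + ‖y‖) ^ k) →
      ‖z * θ.trans χ y‖ ≤ R * C / (1 + ‖y‖) ^ k := fun z χ C hz hχ => by
    rw [norm_mul, mul_div_assoc]
    gcongr
  simp only [QuadGen.op, map_add, map_sum, map_smul, add_apply, sum_apply, smul_apply,
    smul_eq_mul]
  rw [add_div, Finset.sum_div]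
  have hI : ∀ r : ℝ, ‖Complex.I * (r : ℂ)‖ = |r| := fun r => by simp
  refine (norm_add_le _ _).trans (add_le_add (key _ _ _ ?_ (h0 θ hq hσ y))
    ((norm_sum_le _ _).trans (Finset.sum_le_sum fun j _ => ?_)))
  · rw [hI]; linarith
  have b1 := abs_coord_le G.β j
  have b2 := abs_coord_le G.γ j
  have k1 := key (Complex.I * G.h) _ _ (by rw [hI]; linarith) (h1 j θ hq hσ y)
  have k2 := key (Complex.I * G.k) _ _ (by rw [hI]; linarith) (h2 j θ hq hσ y)
  have k3 := key (G.δ : ℂ) _ _ (by rw [Complex.norm_real, Real.norm_eq_abs]; linarith)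
    (h3 j θ hq hσ y)
  have k4 := key (Complex.I * G.β j) _ _ (by rw [hI]; linarith) (h4 j θ hq hσ y)
  have k5 := key (G.γ j : ℂ) _ _ (by rw [Complex.norm_real, Real.norm_eq_abs]; linarith)
    (h5 j θ hq hσ y)
  simp only [map_add, map_smul, add_apply, smul_apply, smul_eq_mul] at k3
  rw [add_div, add_div, add_div, add_div]
  refine (norm_add_le _ _).trans (add_le_add ((norm_add_le _ _).trans (add_le_add
    ((norm_add_le _ _).trans (add_le_add ((norm_add_le _ _).trans (add_le_add k1 k2)) k3)) k4)) k5)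

lemma memLp_div_one_add_norm (C : ℝ) :
    MemLp (fun y : Space d => (C / (1 + ‖y‖) ^ (d + 1) : ℝ)) 2 volume := by
  have hc : Continuous (fun y : Space d => (C / (1 + ‖y‖) ^ (d + 1) : ℝ)) := by
    refine Continuous.div continuous_const (by fun_prop) fun y => by positivity
  rw [memLp_two_iff_integrable_sq_norm hc.aestronglyMeasurable]
  have h := integrable_one_add_norm (E := Space d) (μ := volume) (r := 2 * (d + 1)) (by
    rw [finrank_euclideanSpace, Fintype.card_fin]; linarith)
  refine (h.const_mul (C ^ 2)).congr (Eventually.of_forall fun y => ?_)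
  simp only
  rw [Real.norm_eq_abs, sq_abs, div_pow, ← pow_mul, Real.rpow_neg (by positivity), div_eq_mul_inv]
  congr 2
  rw [← Real.rpow_natCast]
  congr 1
  push_cast; ring

/-- The Cauchy–Schwarz inequality. -/
lemma integral_norm_mul_norm_le {E F : Type*} [NormedAddCommGroup E] [NormedAddCommGroup F]
    {f : Space d → E} {g : Space d → F} (hf : MemLp f 2 volume) (hg : MemLp g 2 volume) :
    ∫ x, ‖f x‖ * ‖g x‖ ≤ Real.sqrt (∫ x, ‖f x‖ ^ 2) * Real.sqrt (∫ x, ‖g x‖ ^ 2) := by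
  have h2 : ENNReal.ofReal 2 = 2 := by simp
  have h := integral_mul_le_Lp_mul_Lq_of_nonneg (μ := (volume : Measure (Space d)))
    (p := 2) (q := 2) Real.HolderConjugate.two_two (f := fun x => ‖f x‖) (g := fun x => ‖g x‖)
    (Eventually.of_forall fun x => norm_nonneg _) (Eventually.of_forall fun x => norm_nonneg _)
    (by rw [h2]; exact hf.norm) (by rw [h2]; exact hg.norm)
  simpa [Real.sqrt_eq_rpow] using h

/-- Product rule for the pairing of a weakly differentiable, strongly continuous curve in `L²` with
a curve of Schwartz functions. -/
lemma hasDerivAt_integral_mul {g : ℝ → Space d → ℂ} {ψ ψ' : ℝ → 𝓢(Space d, ℂ)} {t C r : ℝ} {L : ℂ}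
    (hr : 0 < r) (hg : ∀ τ, MemLp (g τ) 2 volume)
    (hgc : Tendsto (fun τ => ∫ x, ‖g τ x - g t x‖ ^ 2) (𝓝 t) (𝓝 0))
    (hgd : HasDerivAt (fun τ => ∫ x, g τ x * ψ t x) L t)
    (hψ : ∀ τ ∈ Metric.ball t r, ∀ y, HasDerivAt (fun τ => ψ τ y) (ψ' τ y) τ)
    (hC : ∀ τ ∈ Metric.ball t r, ∀ y, ‖ψ' τ y‖ ≤ C / (1 + ‖y‖) ^ (d + 1)) :
    HasDerivAt (fun τ => ∫ x, g τ x * ψ τ x) (L + ∫ x, g t x * ψ' t x) t := by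
  set D : Space d → ℝ := fun y => C / (1 + ‖y‖) ^ (d + 1) with hD
  have hDm : MemLp D 2 volume := memLp_div_one_add_norm C
  have hball : Metric.ball t r ∈ 𝓝 t := Metric.ball_mem_nhds t hr
  have ht : t ∈ Metric.ball t r := Metric.mem_ball_self hr
  have hD0 : ∀ y, 0 ≤ D y := fun y => (norm_nonneg _).trans (hC t ht y)
  have hB : HasDerivAt (fun τ => ∫ x, g t x * ψ τ x) (∫ x, g t x * ψ' t x) t := by
    refine (hasDerivAt_integral_of_dominated_loc_of_deriv_le (F := fun τ x => g t x * ψ τ x)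
      (F' := fun τ x => g t x * ψ' τ x) (bound := fun x => ‖g t x‖ * D x) hball
      (Eventually.of_forall fun τ => ((hg t).1.mul (ψ τ).continuous.aestronglyMeasurable))
      (integrable_mul_of_memLp (hg t) (memLp_schwartz _))
      ((hg t).1.mul (ψ' t).continuous.aestronglyMeasurable)
      (Eventually.of_forall fun x τ hτ => ?_) ((hg t).norm.integrable_mul hDm)
      (Eventually.of_forall fun x τ hτ => ?_)).2
    · rw [norm_mul]
      exact mul_le_mul_of_nonneg_left (hC τ hτ x) (norm_nonneg _)
    · exact (hψ τ hτ x).const_mul _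
  have hlip : ∀ τ ∈ Metric.ball t r, ∀ y, ‖ψ τ y - ψ t y‖ ≤ D y * ‖τ - t‖ := fun τ hτ y =>
    (convex_ball t r).norm_image_sub_le_of_norm_hasDerivWithin_le
      (fun s hs => (hψ s hs y).hasDerivWithinAt) (fun s hs => hC s hs y) ht hτ
  have hR : HasDerivAt (fun τ => ∫ x, (g τ x - g t x) * (ψ τ x - ψ t x)) 0 t := by
    rw [hasDerivAt_iff_isLittleO]
    simp only [sub_self, zero_mul, integral_zero, smul_zero, sub_zero]
    have hz : Tendsto (fun τ => Real.sqrt (∫ x, ‖g τ x - g t x‖ ^ 2)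
        * Real.sqrt (∫ x, ‖D x‖ ^ 2)) (𝓝 t) (𝓝 0) := by
      have := (Real.continuous_sqrt.tendsto 0).comp hgc
      simpa [-Real.norm_eq_abs] using this.mul_const (Real.sqrt (∫ x, ‖D x‖ ^ 2))
    rw [Asymptotics.isLittleO_iff]
    intro ε hε
    filter_upwards [hball, (hz.eventually (gt_mem_nhds hε))] with τ hτ hlt
    have hgm : MemLp (fun x => g τ x - g t x) 2 volume := (hg τ).sub (hg t)
    calc ‖∫ x, (g τ x - g t x) * (ψ τ x - ψ t x)‖
        ≤ ∫ x, ‖(g τ x - g t x) * (ψ τ x - ψ t x)‖ := norm_integral_le_integral_norm _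
      _ ≤ ∫ x, ‖g τ x - g t x‖ * ‖D x‖ * ‖τ - t‖ := by
          refine integral_mono_of_nonneg (Eventually.of_forall fun x => norm_nonneg _)
            ((hgm.norm.integrable_mul hDm.norm).mul_const _) (Eventually.of_forall fun x => ?_)
          simp only [norm_mul]
          rw [Real.norm_of_nonneg (hD0 x), mul_assoc]
          exact mul_le_mul_of_nonneg_left (hlip τ hτ x) (norm_nonneg _)
      _ = (∫ x, ‖g τ x - g t x‖ * ‖D x‖) * ‖τ - t‖ := integral_mul_const _ _
      _ ≤ ε * ‖τ - t‖ := by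
          gcongr
          exact (integral_norm_mul_norm_le hgm hDm).trans hlt.le
  have hsum := (hgd.add hB).add hR
  have hval : ∀ τ, ∫ x, g τ x * ψ τ x = (∫ x, g τ x * ψ t x) + (∫ x, g t x * ψ τ x)
      + (∫ x, (g τ x - g t x) * (ψ τ x - ψ t x)) - ∫ x, g t x * ψ t x := fun τ => by
    have i1 := integrable_mul_of_memLp (hg τ) (memLp_schwartz (ψ t))
    have i2 := integrable_mul_of_memLp (hg t) (memLp_schwartz (ψ τ))
    have i3 := integrable_mul_of_memLp ((hg τ).sub (hg t)) ((memLp_schwartz (ψ τ)).sub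
      (memLp_schwartz (ψ t)))
    have i4 := integrable_mul_of_memLp (hg t) (memLp_schwartz (ψ t))
    simp only [Pi.sub_apply] at i3
    have i12 : Integrable (fun x => g τ x * ψ t x + g t x * ψ τ x) := i1.add i2
    have i123 : Integrable (fun x => g τ x * ψ t x + g t x * ψ τ x
      + (g τ x - g t x) * (ψ τ x - ψ t x)) := i12.add i3
    rw [← integral_add i1 i2, ← integral_add i12 i3, ← integral_sub i123 i4]
    refine integral_congr_ae (Eventually.of_forall fun x => ?_)
    simp only
    ring
  refine ((hsum.sub_const (∫ x, g t x * ψ t x)).congr_deriv (add_zero _)).congr_of_eventuallyEq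
    (Eventually.of_forall hval)

/-! ### Quadratic generators in the Hermite basis -/

section HermiteAction

lemma sqrt_mul_self_cast (m : ℕ) : (Real.sqrt m : ℂ) * (Real.sqrt m : ℂ) = m := by
  norm_cast
  exact Real.mul_self_sqrt (by positivity)

lemma sub_single_single (n : Fin d → ℕ) (j : Fin d) :
    n - Pi.single j 1 - Pi.single j 1 = n - Pi.single j 2 := by
  rw [tsub_tsub, ← Pi.single_add]

lemma add_single_single (n : Fin d → ℕ) (j : Fin d) :
    n + Pi.single j 1 + Pi.single j 1 = n + Pi.single j 2 := by
  rw [add_assoc, ← Pi.single_add]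

lemma sqrt_mul_sqrt_succ (m : ℕ) : (Real.sqrt (m + 1) : ℂ) * (Real.sqrt (m + 1 + 1) : ℂ)
    = (Real.sqrt ((m + 1) * (m + 2)) : ℂ) := by
  rw [← Complex.ofReal_mul, ← Real.sqrt_mul (by positivity)]
  ring_nf

lemma sqrt_two_inv_mul_self : ((Real.sqrt 2 : ℝ) : ℂ)⁻¹ * ((Real.sqrt 2 : ℝ) : ℂ)⁻¹ = 1 / 2 := by
  rw [← mul_inv]
  norm_cast
  rw [Real.mul_self_sqrt (by norm_num)]
  norm_num

lemma smul_hermiteS_sub_single (n : Fin d → ℕ) (j : Fin d) (x : Space d) :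
    (Real.sqrt (n j) : ℂ) * ((Real.sqrt ((((n - Pi.single j 1 : Fin d → ℕ) j : ℕ) : ℝ) + 1) : ℂ)
        * hermiteS (n - Pi.single j 1 + Pi.single j 1) x) = (n j : ℂ) * hermiteS n x := by
  by_cases h : n j = 0
  · simp [h]
  · rw [tsub_add_cancel_of_le]
    · have : (((n - Pi.single j 1 : Fin d → ℕ) j : ℕ) : ℝ) + 1 = n j := by
        have : (n - Pi.single j 1 : Fin d → ℕ) j = n j - 1 := by simp
        rw [this]
        have h1 : 1 ≤ n j := Nat.one_le_iff_ne_zero.mpr h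
        push_cast [h1]
        ring
      rw [this, ← mul_assoc, sqrt_mul_self_cast]
    · intro i
      by_cases hi : i = j
      · subst hi; simpa using Nat.one_le_iff_ne_zero.mpr h
      · simp [Pi.single_eq_of_ne hi]

lemma sqrt_mul_sqrt_sub_single (n : Fin d → ℕ) (j : Fin d) :
    ((Real.sqrt (n j) : ℂ) * (Real.sqrt (((n - Pi.single j 1 : Fin d → ℕ) j : ℕ) : ℝ) : ℂ))
      = (Real.sqrt (n j * (n j - 1)) : ℂ) := by
  by_cases h : n j = 0
  · simp [h]
  · have h1 : 1 ≤ n j := Nat.one_le_iff_ne_zero.mpr h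
    have : (((n - Pi.single j 1 : Fin d → ℕ) j : ℕ) : ℝ) = n j - 1 := by
      have : (n - Pi.single j 1 : Fin d → ℕ) j = n j - 1 := by simp
      rw [this]
      push_cast [h1]
      ring
    rw [this, ← Complex.ofReal_mul, ← Real.sqrt_mul (by positivity)]

lemma coordMul_coordMul_hermiteS (n : Fin d → ℕ) (j : Fin d) :
    coordMul j (coordMul j (hermiteS n)) = (1 / 2 : ℂ) •
      ((Real.sqrt ((n j + 1) * (n j + 2)) : ℂ) • hermiteS (n + Pi.single j 2)
        + (2 * n j + 1 : ℂ) • hermiteS n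
        + (Real.sqrt (n j * (n j - 1)) : ℂ) • hermiteS (n - Pi.single j 2)) := by
  have e1 : (((n + Pi.single j 1 : Fin d → ℕ) j : ℕ) : ℝ) = n j + 1 := by simp
  have h4 := sqrt_mul_self_cast (n j + 1)
  rw [coordMul_hermiteS, map_smul, map_add, map_smul, map_smul, coordMul_hermiteS,
    coordMul_hermiteS, sub_single_single, add_single_single, add_tsub_cancel_right, e1]
  ext x
  have h1 := smul_hermiteS_sub_single n j x
  simp only [smul_apply, add_apply, smul_eq_mul]
  push_cast at h4
  linear_combination ((Real.sqrt (n j + 1) : ℂ) * (Real.sqrt (n j + 1 + 1) : ℂ)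
      * hermiteS (n + Pi.single j 2) x + (Real.sqrt (n j + 1) : ℂ) * (Real.sqrt (n j + 1) : ℂ)
      * hermiteS n x + (Real.sqrt (n j) : ℂ)
        * ((Real.sqrt ((((n - Pi.single j 1 : Fin d → ℕ) j : ℕ) : ℝ) + 1) : ℂ)
        * hermiteS (n - Pi.single j 1 + Pi.single j 1) x)
      + (Real.sqrt (n j) : ℂ) * (Real.sqrt (((n - Pi.single j 1 : Fin d → ℕ) j : ℕ) : ℝ) : ℂ)
        * hermiteS (n - Pi.single j 2) x) * sqrt_two_inv_mul_self
    + 1 / 2 * (hermiteS (n + Pi.single j 2) x * sqrt_mul_sqrt_succ (n j) + hermiteS n x * h4 + h1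
      + hermiteS (n - Pi.single j 2) x * sqrt_mul_sqrt_sub_single n j)

lemma partialD_partialD_hermiteS (n : Fin d → ℕ) (j : Fin d) :
    partialD j (partialD j (hermiteS n)) = (1 / 2 : ℂ) •
      ((Real.sqrt ((n j + 1) * (n j + 2)) : ℂ) • hermiteS (n + Pi.single j 2)
        - (2 * n j + 1 : ℂ) • hermiteS n
        + (Real.sqrt (n j * (n j - 1)) : ℂ) • hermiteS (n - Pi.single j 2)) := by
  have e1 : (((n + Pi.single j 1 : Fin d → ℕ) j : ℕ) : ℝ) = n j + 1 := by simp
  have h4 := sqrt_mul_self_cast (n j + 1)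
  rw [partialD_hermiteS, map_smul, map_sub, map_smul, map_smul, partialD_hermiteS,
    partialD_hermiteS, sub_single_single, add_single_single, add_tsub_cancel_right, e1]
  ext x
  have h1 := smul_hermiteS_sub_single n j x
  simp only [smul_apply, add_apply, sub_apply, smul_eq_mul]
  push_cast at h4
  linear_combination ((Real.sqrt (n j + 1) : ℂ) * (Real.sqrt (n j + 1 + 1) : ℂ)
      * hermiteS (n + Pi.single j 2) x - (Real.sqrt (n j + 1) : ℂ) * (Real.sqrt (n j + 1) : ℂ)
      * hermiteS n x - (Real.sqrt (n j) : ℂ)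
        * ((Real.sqrt ((((n - Pi.single j 1 : Fin d → ℕ) j : ℕ) : ℝ) + 1) : ℂ)
        * hermiteS (n - Pi.single j 1 + Pi.single j 1) x)
      + (Real.sqrt (n j) : ℂ) * (Real.sqrt (((n - Pi.single j 1 : Fin d → ℕ) j : ℕ) : ℝ) : ℂ)
        * hermiteS (n - Pi.single j 2) x) * sqrt_two_inv_mul_self
    + 1 / 2 * (hermiteS (n + Pi.single j 2) x * sqrt_mul_sqrt_succ (n j) - hermiteS n x * h4 - h1
      + hermiteS (n - Pi.single j 2) x * sqrt_mul_sqrt_sub_single n j)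

lemma coordMul_partialD_hermiteS (n : Fin d → ℕ) (j : Fin d) :
    coordMul j (partialD j (hermiteS n)) + (1 / 2 : ℂ) • hermiteS n = (1 / 2 : ℂ) •
      ((Real.sqrt (n j * (n j - 1)) : ℂ) • hermiteS (n - Pi.single j 2)
        - (Real.sqrt ((n j + 1) * (n j + 2)) : ℂ) • hermiteS (n + Pi.single j 2)) := by
  have e1 : (((n + Pi.single j 1 : Fin d → ℕ) j : ℕ) : ℝ) = n j + 1 := by simp
  have h4 := sqrt_mul_self_cast (n j + 1)
  rw [partialD_hermiteS, map_smul, map_sub, map_smul, map_smul, coordMul_hermiteS,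
    coordMul_hermiteS, sub_single_single, add_single_single, add_tsub_cancel_right, e1]
  ext x
  have h1 := smul_hermiteS_sub_single n j x
  simp only [smul_apply, add_apply, sub_apply, smul_eq_mul]
  push_cast at h4
  linear_combination (-(Real.sqrt (n j + 1) : ℂ) * (Real.sqrt (n j + 1 + 1) : ℂ)
      * hermiteS (n + Pi.single j 2) x - (Real.sqrt (n j + 1) : ℂ) * (Real.sqrt (n j + 1) : ℂ)
      * hermiteS n x + (Real.sqrt (n j) : ℂ)
        * ((Real.sqrt ((((n - Pi.single j 1 : Fin d → ℕ) j : ℕ) : ℝ) + 1) : ℂ)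
        * hermiteS (n - Pi.single j 1 + Pi.single j 1) x)
      + (Real.sqrt (n j) : ℂ) * (Real.sqrt (((n - Pi.single j 1 : Fin d → ℕ) j : ℕ) : ℝ) : ℂ)
        * hermiteS (n - Pi.single j 2) x) * sqrt_two_inv_mul_self
    + 1 / 2 * (-hermiteS (n + Pi.single j 2) x * sqrt_mul_sqrt_succ (n j) - hermiteS n x * h4 + h1
      + hermiteS (n - Pi.single j 2) x * sqrt_mul_sqrt_sub_single n j)

end HermiteAction

/-- The bonds of a quadratic generator in the Hermite basis: `n ~ n + 2e_j` and `n ~ n + e_j`. -/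
def bond : Fin d ⊕ Fin d → Fin d → ℕ
  | .inl j => Pi.single j 2
  | .inr j => Pi.single j 1

/-- The matrix entries of a quadratic generator in the Hermite basis, off the diagonal. -/
def QuadGen.entry (G : QuadGen d) : Fin d ⊕ Fin d → (Fin d → ℕ) → ℂ
  | .inl j => fun n => (1 / 2 : ℂ) * ((G.h + G.k : ℝ) + Complex.I * G.δ)
      * (Real.sqrt ((n j + 1) * (n j + 2)) : ℂ)
  | .inr j => fun n => ((Real.sqrt 2 : ℝ) : ℂ)⁻¹ * (G.β j + Complex.I * G.γ j)
      * (Real.sqrt (n j + 1) : ℂ)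

/-- The diagonal matrix entries of a quadratic generator in the Hermite basis. -/
def QuadGen.diag (G : QuadGen d) (n : Fin d → ℕ) : ℝ :=
  G.r + ∑ j, (G.k - G.h) * (n j + 1 / 2)

/-- Integration of Schwartz functions against a function in `L²`. -/
def pairing {f : Space d → ℂ} (hf : MemLp f 2 volume) : 𝓢(Space d, ℂ) →ₗ[ℂ] ℂ where
  toFun ψ := ∫ x, f x * ψ x
  map_add' φ ψ := by
    simp only [add_apply, mul_add]
    exact integral_add (integrable_mul_of_memLp hf (memLp_schwartz φ))
      (integrable_mul_of_memLp hf (memLp_schwartz ψ))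
  map_smul' a ψ := by
    simp only [smul_apply, smul_eq_mul, RingHom.id_apply, ← integral_const_mul]
    congr 1; funext x; ring

lemma pairing_apply {f : Space d → ℂ} (hf : MemLp f 2 volume) (ψ : 𝓢(Space d, ℂ)) :
    pairing hf ψ = ∫ x, f x * ψ x := rfl

lemma pairing_hermiteS {f : Space d → ℂ} (hf : MemLp f 2 volume) (n : Fin d → ℕ) :
    pairing hf (hermiteS n) = hermiteCoeff f n := by
  simp [pairing_apply, hermiteCoeff]

lemma single_le_iff (n : Fin d → ℕ) (j : Fin d) (m : ℕ) : Pi.single j m ≤ n ↔ m ≤ n j := by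
  constructor
  · intro h; simpa using h j
  · intro h i
    by_cases hi : i = j
    · subst hi; simpa using h
    · simp [Pi.single_eq_of_ne hi]

lemma conj_entry_inl (G : QuadGen d) (j : Fin d) (n : Fin d → ℕ) (z : ℂ)
    [Decidable (bond (.inl j) ≤ n)] :
    (if bond (.inl j) ≤ n then (starRingEnd ℂ) (G.entry (.inl j) (n - bond (.inl j))) * z else 0)
      = (1 / 2 : ℂ) * ((G.h + G.k : ℝ) - Complex.I * G.δ)
        * (Real.sqrt (n j * (n j - 1)) : ℂ) * z := by
  split_ifs with h
  · rw [bond, single_le_iff] at h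
    simp only [bond, QuadGen.entry]
    have h1 : (((n - Pi.single j 2 : Fin d → ℕ) j : ℕ) : ℝ) = n j - 2 := by
      have : (n - Pi.single j 2 : Fin d → ℕ) j = n j - 2 := by simp
      rw [this]; push_cast [h]; ring
    rw [h1]
    simp only [map_mul, map_add, Complex.conj_ofReal, Complex.conj_I, map_div₀, map_one, map_ofNat]
    rw [show ((n j : ℝ) - 2 + 1) * (n j - 2 + 2) = n j * (n j - 1) by ring]
    ring
  · rw [bond, single_le_iff] at h
    have h1 : n j = 0 ∨ n j = 1 := by omega
    rcases h1 with h1 | h1 <;> simp [h1]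

lemma conj_entry_inr (G : QuadGen d) (j : Fin d) (n : Fin d → ℕ) (z : ℂ)
    [Decidable (bond (.inr j) ≤ n)] :
    (if bond (.inr j) ≤ n then (starRingEnd ℂ) (G.entry (.inr j) (n - bond (.inr j))) * z else 0)
      = ((Real.sqrt 2 : ℝ) : ℂ)⁻¹ * (G.β j - Complex.I * G.γ j)
        * (Real.sqrt (n j) : ℂ) * z := by
  split_ifs with h
  · rw [bond, single_le_iff] at h
    simp only [bond, QuadGen.entry]
    have h1 : (((n - Pi.single j 1 : Fin d → ℕ) j : ℕ) : ℝ) = n j - 1 := by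
      have : (n - Pi.single j 1 : Fin d → ℕ) j = n j - 1 := by simp
      rw [this]; push_cast [h]; ring
    rw [h1, sub_add_cancel]
    simp only [map_mul, map_add, Complex.conj_ofReal, Complex.conj_I, map_inv₀]
    ring
  · rw [bond, single_le_iff] at h
    have h1 : n j = 0 := by omega
    simp [h1]

/-- In the Hermite basis, a quadratic generator is a banded Hermitian system. -/
lemma integral_mul_op_hermiteS (G : QuadGen d) {f : Space d → ℂ} (hf : MemLp f 2 volume)
    (n : Fin d → ℕ) :
    ∫ x, f x * G.op (hermiteS n) x = flowField bond G.entry G.diag (hermiteCoeff f) n := by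
  classical
  rw [← pairing_apply hf, QuadGen.op]
  simp only [coordMul_partialD_hermiteS, coordMul_coordMul_hermiteS, partialD_partialD_hermiteS]
  simp only [coordMul_hermiteS, partialD_hermiteS, map_add, map_sum, map_smul, map_sub,
    pairing_hermiteS, smul_eq_mul]
  rw [flowField, QuadGen.diag, Fintype.sum_sum_type]
  simp only [conj_entry_inl, conj_entry_inr]
  simp only [bond, QuadGen.entry]
  push_cast
  have hR : ∀ (r c : ℂ) (D B E : Fin d → ℂ),
      Complex.I * ((r + ∑ j, D j) * c + (∑ j, B j + ∑ j, E j))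
      = Complex.I * r * c + ∑ j, Complex.I * (D j * c + B j + E j) := fun r c D B E => by
    rw [← Finset.mul_sum, Finset.sum_add_distrib, Finset.sum_add_distrib, ← Finset.sum_mul]
    ring
  rw [hR]
  congr 1
  refine Finset.sum_congr rfl fun j _ => ?_
  linear_combination (-((G.γ j : ℂ) * ((Real.sqrt 2 : ℝ) : ℂ)⁻¹ * ((Real.sqrt (n j + 1) : ℂ)
      * hermiteCoeff f (n + Pi.single j 1) - (Real.sqrt (n j) : ℂ)
      * hermiteCoeff f (n - Pi.single j 1)) + (G.δ : ℂ) / 2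
      * ((Real.sqrt ((n j + 1) * (n j + 2)) : ℂ)
      * hermiteCoeff f (n + Pi.single j 2) - (Real.sqrt (n j * (n j - 1)) : ℂ)
      * hermiteCoeff f (n - Pi.single j 2)))) * Complex.I_mul_I

/-! ### Weak solutions of quadratic Schrödinger equations -/

lemma sqrt_le_two_mul_wt [NeZero d] (n : Fin d → ℕ) (j : Fin d) :
    Real.sqrt (n j + 1) ≤ 2 * wt n ∧ Real.sqrt ((n j + 1) * (n j + 2)) ≤ 4 * wt n := by
  have h1 : (n j : ℝ) ≤ len n := by exact_mod_cast le_len n j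
  have hd : (1 : ℝ) ≤ d := by exact_mod_cast NeZero.one_le
  have h0 : (0 : ℝ) ≤ n j := by positivity
  have hw : (n j : ℝ) + 1 / 2 ≤ wt n := by unfold wt; linarith
  constructor
  · rw [Real.sqrt_le_left (by linarith)]
    nlinarith
  · rw [Real.sqrt_le_left (by linarith)]
    nlinarith

lemma QuadGen.norm_entry_le [NeZero d] (G : QuadGen d) (k : Fin d ⊕ Fin d) (n : Fin d → ℕ) :
    ‖G.entry k n‖ ≤ 2 * G.size * wt n := by
  have a1 := abs_nonneg G.h
  have a2 := abs_nonneg G.k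
  have a3 := abs_nonneg G.δ
  have a4 := abs_nonneg G.r
  have a5 := norm_nonneg G.β
  have a6 := norm_nonneg G.γ
  have hw := wt_pos n
  have hG : 0 ≤ G.size := by unfold QuadGen.size; positivity
  rcases k with j | j
  · have h1 : ‖((G.h + G.k : ℝ) : ℂ) + Complex.I * G.δ‖ ≤ G.size := by
      refine (norm_add_le _ _).trans ?_
      rw [norm_mul, Complex.norm_I, one_mul, Complex.norm_real, Complex.norm_real, Real.norm_eq_abs,
        Real.norm_eq_abs, QuadGen.size]
      have := abs_add_le G.h G.k
      linarith
    rw [QuadGen.entry, norm_mul, norm_mul, Complex.norm_real,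
      Real.norm_of_nonneg (Real.sqrt_nonneg _)]
    calc ‖(1 / 2 : ℂ)‖ * ‖((G.h + G.k : ℝ) : ℂ) + Complex.I * G.δ‖
          * Real.sqrt ((n j + 1) * (n j + 2))
        ≤ 1 / 2 * G.size * (4 * wt n) := by
          gcongr
          · simp
          · exact (sqrt_le_two_mul_wt n j).2
      _ = _ := by ring
  · have h1 : ‖((G.β j : ℝ) : ℂ) + Complex.I * G.γ j‖ ≤ G.size := by
      refine (norm_add_le _ _).trans ?_
      rw [norm_mul, Complex.norm_I, one_mul, Complex.norm_real, Complex.norm_real, Real.norm_eq_abs,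
        Real.norm_eq_abs, QuadGen.size]
      have := abs_coord_le G.β j
      have := abs_coord_le G.γ j
      linarith
    rw [QuadGen.entry, norm_mul, norm_mul, Complex.norm_real,
      Real.norm_of_nonneg (Real.sqrt_nonneg _),
      norm_inv, Complex.norm_real, Real.norm_of_nonneg (Real.sqrt_nonneg _)]
    calc (Real.sqrt 2)⁻¹ * ‖((G.β j : ℝ) : ℂ) + Complex.I * G.γ j‖ * Real.sqrt (n j + 1)
        ≤ 1 * G.size * (2 * wt n) := by
          gcongr
          · exact inv_le_one_of_one_le₀ (Real.one_le_sqrt.mpr (by norm_num))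
          · exact (sqrt_le_two_mul_wt n j).1
      _ = _ := by ring

/-- `u` solves `∂ₜ⟨u, ψ⟩ = ⟨u, G(t) ψ⟩` for all Schwartz functions `ψ`, where `⟨·,·⟩` is the
bilinear pairing; it is locally bounded in `L²`. -/
structure IsWeakFlow (G : ℝ → QuadGen d) (u : ℝ → Space d → ℂ) : Prop where
  memLp : ∀ t, MemLp (u t) 2 volume
  bounded : ∀ T : ℝ, ∃ S : ℝ, ∀ t ∈ Set.Ioo (-T) T, ∫ x, ‖u t x‖ ^ 2 ≤ S
  hasDerivAt : ∀ (ψ : 𝓢(Space d, ℂ)) (t : ℝ),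
    HasDerivAt (fun τ => ∫ x, u τ x * ψ x) (∫ x, u t x * (G t).op ψ x) t

lemma norm_sq_hermiteCoeff_le {f : Space d → ℂ} (hf : MemLp f 2 volume) (n : Fin d → ℕ) :
    ‖hermiteCoeff f n‖ ^ 2 ≤ ∫ x, ‖f x‖ ^ 2 :=
  le_hasSum (hasSum_sq_hermiteCoeff hf) n fun _ _ => by positivity

lemma IsWeakFlow.exists_isBandedFlow [NeZero d] {G : ℝ → QuadGen d} {u : ℝ → Space d → ℂ}
    (hu : IsWeakFlow G u) {T B : ℝ} (hB : 0 ≤ B) (hG : ∀ t ∈ Set.Ioo (-T) T, (G t).size ≤ B) :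
    ∃ M, IsBandedFlow bond (fun t => (G t).entry) (fun t => (G t).diag) T (2 * B) M
      (fun t => hermiteCoeff (u t)) := by
  obtain ⟨S, hS⟩ := hu.bounded T
  refine ⟨Real.sqrt S, fun k => ?_, by positivity, fun t ht k n => ?_, fun t ht n => ?_,
    fun t ht n => ?_⟩
  · rcases k with j | j <;> simp [bond, len_single]
  · have := wt_pos n
    exact ((G t).norm_entry_le k n).trans (by have := hG t ht; gcongr)
  · exact Real.le_sqrt_of_sq_le ((norm_sq_hermiteCoeff_le (hu.memLp t) n).trans (hS t ht))
  · have h := hu.hasDerivAt (hermiteS n) t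
    rw [integral_mul_op_hermiteS _ (hu.memLp t)] at h
    simpa [hermiteCoeff] using h

/-- Propagation of the `Σ^s` norm by weak solutions, with a constant depending only on the size of
the generator. -/
lemma IsWeakFlow.exists_sqSum_le (d : ℕ) [NeZero d] {s : ℝ} (hs : 0 ≤ s) :
    ∃ C : ℝ, 0 ≤ C ∧ ∀ {G : ℝ → QuadGen d} {u : ℝ → Space d → ℂ} {T B : ℝ}, IsWeakFlow G u →
      0 ≤ B → (∀ t ∈ Set.Ioo (-T) T, (G t).size ≤ B) →
      ∀ t₀ ∈ Set.Ioo (-T) T, ∀ t₁ ∈ Set.Ioo (-T) T,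
      sqSum s (hermiteCoeff (u t₁))
        ≤ ENNReal.ofReal (Real.exp (C * B * |t₁ - t₀|)) * sqSum s (hermiteCoeff (u t₀)) := by
  obtain ⟨C, hC, h⟩ := IsBandedFlow.exists_sqSum_le (Fin d ⊕ Fin d) d hs
  refine ⟨C * 2, by positivity, fun {G u T B} hu hB hG t₀ h0 t₁ h1 => ?_⟩
  obtain ⟨M, hM⟩ := hu.exists_isBandedFlow hB hG
  have := h hM t₀ h0 t₁ h1
  rwa [mul_assoc C 2 B]

/-- Local boundedness in time of a time-dependent generator. -/
def QuadGen.LocallyBounded (G : ℝ → QuadGen d) : Prop :=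
  ∀ T : ℝ, ∃ B : ℝ, 0 ≤ B ∧ ∀ t ∈ Set.Ioo (-T) T, (G t).size ≤ B

lemma QuadGen.locallyBounded_of_continuous {G : ℝ → QuadGen d}
    (hG : Continuous fun t => (G t).size) :
    QuadGen.LocallyBounded G := fun T => by
  obtain ⟨B, hB⟩ := (isCompact_Icc (a := -T) (b := T)).bddAbove_image hG.continuousOn
  refine ⟨max B 0, le_max_right _ _, fun t ht => le_max_of_le_left ?_⟩
  exact hB (Set.mem_image_of_mem _ (Set.Ioo_subset_Icc_self ht))

lemma IsWeakFlow.sub {G : ℝ → QuadGen d} {u v : ℝ → Space d → ℂ}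
    (hu : IsWeakFlow G u) (hv : IsWeakFlow G v) :
    IsWeakFlow G (fun t x => u t x - v t x) := by
  have hm : ∀ t, MemLp (fun x => u t x - v t x) 2 volume := fun t => (hu.memLp t).sub (hv.memLp t)
  have hI : ∀ t (ψ : 𝓢(Space d, ℂ)), ∫ x, (u t x - v t x) * ψ x
      = (∫ x, u t x * ψ x) - ∫ x, v t x * ψ x := fun t ψ => by
    simp only [sub_mul]
    exact integral_sub (integrable_mul_of_memLp (hu.memLp t) (memLp_schwartz ψ))
      (integrable_mul_of_memLp (hv.memLp t) (memLp_schwartz ψ))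
  refine ⟨hm, fun T => ?_, fun ψ t => ?_⟩
  · obtain ⟨S, hS⟩ := hu.bounded T
    obtain ⟨S', hS'⟩ := hv.bounded T
    refine ⟨2 * S + 2 * S', fun t ht => ?_⟩
    have i1 := (memLp_two_iff_integrable_sq_norm (hu.memLp t).1).mp (hu.memLp t)
    have i2 := (memLp_two_iff_integrable_sq_norm (hv.memLp t).1).mp (hv.memLp t)
    have i3 := (memLp_two_iff_integrable_sq_norm (hm t).1).mp (hm t)
    calc ∫ x, ‖u t x - v t x‖ ^ 2 ≤ ∫ x, (2 * ‖u t x‖ ^ 2 + 2 * ‖v t x‖ ^ 2) := by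
          refine integral_mono i3 ((i1.const_mul 2).add (i2.const_mul 2)) fun x => ?_
          have h1 := norm_sub_le (u t x) (v t x)
          have h2 : ‖u t x - v t x‖ ^ 2 ≤ (‖u t x‖ + ‖v t x‖) ^ 2 := by gcongr
          simp only
          nlinarith [sq_nonneg (‖u t x‖ - ‖v t x‖)]
      _ = 2 * (∫ x, ‖u t x‖ ^ 2) + 2 * ∫ x, ‖v t x‖ ^ 2 := by
          rw [integral_add (i1.const_mul 2) (i2.const_mul 2), integral_const_mul,
            integral_const_mul]
      _ ≤ _ := by
          have := hS t ht
          have := hS' t ht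
          linarith
  · simp only [hI]
    exact (hu.hasDerivAt ψ t).sub (hv.hasDerivAt ψ t)

section Flow
variable [NeZero d] {G : ℝ → QuadGen d} {u v : ℝ → Space d → ℂ}

lemma mem_Ioo_max (t₀ t₁ : ℝ) : t₀ ∈ Set.Ioo (-(|t₀| + |t₁| + 1)) (|t₀| + |t₁| + 1) ∧
    t₁ ∈ Set.Ioo (-(|t₀| + |t₁| + 1)) (|t₀| + |t₁| + 1) := by
  have := abs_nonneg t₀
  have := abs_nonneg t₁
  have := neg_abs_le t₀
  have := neg_abs_le t₁
  have := le_abs_self t₀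
  have := le_abs_self t₁
  refine ⟨⟨by linarith, by linarith⟩, ⟨by linarith, by linarith⟩⟩

/-- Weak solutions with initial value in `Σ^s` are continuous curves in `Σ^s`. -/
lemma IsWeakFlow.continuousInSigma (hu : IsWeakFlow G u) (hG : QuadGen.LocallyBounded G) {s : ℝ}
    (hs : 0 ≤ s) (h0 : MemSigma s (u 0)) : ContinuousInSigma s u := by
  have hmem : ∀ t, MemSigma s (u t) := fun t => by
    rw [memSigma_iff] at h0 ⊢
    obtain ⟨C, -, hC⟩ := IsWeakFlow.exists_sqSum_le d hs
    obtain ⟨B, hB0, hB⟩ := hG (|0| + |t| + 1)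
    exact ⟨hu.memLp t, (hC hu hB0 hB 0 (mem_Ioo_max 0 t).1 t (mem_Ioo_max 0 t).2).trans_lt
      (ENNReal.mul_lt_top ENNReal.ofReal_lt_top h0.2)⟩
  rw [continuousInSigma_iff]
  refine ⟨hmem, fun t₀ => ?_⟩
  obtain ⟨B, hB0, hB⟩ := hG (|t₀| + |t₀| + 1)
  obtain ⟨M, hM⟩ := hu.exists_isBandedFlow hB0 hB
  exact hM.tendsto_sqSum_sub hs (mem_Ioo_max t₀ t₀).1 (memSigma_iff.mp (hmem t₀)).2

/-- Conservation of the mass. -/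
lemma IsWeakFlow.integral_sq_eq (hu : IsWeakFlow G u) (hG : QuadGen.LocallyBounded G)
    (hc : ContinuousInSigma (1 / 2) u) (t : ℝ) : ∫ x, ‖u t x‖ ^ 2 = ∫ x, ‖u 0 x‖ ^ 2 := by
  obtain ⟨B, hB0, hB⟩ := hG (|0| + |t| + 1)
  obtain ⟨M, hM⟩ := hu.exists_isBandedFlow hB0 hB
  obtain ⟨S, hS⟩ := hc.exists_sqSum_le (|0| + |t| + 1)
  have := hM.tsum_sq_eq hS (mem_Ioo_max 0 t).1 (mem_Ioo_max 0 t).2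
  rwa [(hasSum_sq_hermiteCoeff (hu.memLp t)).tsum_eq,
    (hasSum_sq_hermiteCoeff (hu.memLp 0)).tsum_eq] at this

/-- Weak solutions are determined by their initial values. -/
lemma IsWeakFlow.unique (hu : IsWeakFlow G u) (hv : IsWeakFlow G v) (hG : QuadGen.LocallyBounded G)
    (h0 : u 0 =ᵐ[volume] v 0) (t : ℝ) : u t =ᵐ[volume] v t := by
  obtain ⟨C, -, hC⟩ := IsWeakFlow.exists_sqSum_le d (le_refl (0 : ℝ))
  obtain ⟨B, hB0, hB⟩ := hG (|0| + |t| + 1)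
  have h := hC (hu.sub hv) hB0 hB 0 (mem_Ioo_max 0 t).1 t (mem_Ioo_max 0 t).2
  refine ae_eq_of_hermiteCoeff_eq (hu.memLp t) (hv.memLp t) fun n => ?_
  have hz : hermiteCoeff (fun x => u 0 x - v 0 x) = fun _ => 0 := by
    funext m
    rw [hermiteCoeff_sub (hu.memLp 0) (hv.memLp 0), hermiteCoeff_congr h0, sub_self]
  rw [hz] at h
  have h2 : sqSum 0 (fun _ : Fin d → ℕ => (0 : ℂ)) = 0 := by simp [sqSum]
  rw [h2, mul_zero] at h
  have h3 := (norm_sq_le_sqSum_zero _ n).trans h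
  rw [nonpos_iff_eq_zero, ENNReal.ofReal_eq_zero] at h3
  rw [hermiteCoeff_sub (hu.memLp t) (hv.memLp t)] at h3
  have h4 : ‖hermiteCoeff (u t) n - hermiteCoeff (v t) n‖ = 0 :=
    pow_eq_zero_iff (two_ne_zero) |>.mp (le_antisymm h3 (by positivity))
  exact sub_eq_zero.mp (norm_eq_zero.mp h4)

end Flow

/-! ### Moving frames act on weak solutions and on `Σ^s` -/

lemma memSigma_zero_iff {f : Space d → ℂ} : MemSigma 0 f ↔ MemLp f 2 volume := by
  rw [memSigma_iff]
  exact ⟨fun h => h.1, fun h => ⟨h, by rw [sqSum_zero_hermiteCoeff h]; exact ENNReal.ofReal_lt_top⟩⟩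

lemma sqSum_zero_sub {f g : Space d → ℂ} (hf : MemLp f 2 volume) (hg : MemLp g 2 volume) :
    sqSum 0 (fun n => hermiteCoeff f n - hermiteCoeff g n)
      = ENNReal.ofReal (∫ x, ‖f x - g x‖ ^ 2) := by
  rw [← sqSum_zero_hermiteCoeff (f := fun x => f x - g x) (hf.sub hg)]
  congr 1
  funext n
  exact (hermiteCoeff_sub hf hg n).symm

lemma ContinuousInSigma.tendsto_integral_sq_sub [NeZero d] {s : ℝ} (hs : 0 ≤ s)
    {u : ℝ → Space d → ℂ} (hu : ContinuousInSigma s u) (t : ℝ) :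
    Tendsto (fun τ => ∫ x, ‖u τ x - u t x‖ ^ 2) (𝓝 t) (𝓝 0) := by
  have h := (continuousInSigma_iff.mp (hu.mono hs)).2 t
  simp only [fun τ => sqSum_zero_sub (hu.1 τ).1 (hu.1 t).1] at h
  have h2 := (ENNReal.tendsto_toReal ENNReal.zero_ne_top).comp h
  simp only [ENNReal.toReal_zero, Function.comp_def] at h2
  refine h2.congr fun τ => ENNReal.toReal_ofReal (integral_nonneg fun x => by positivity)

/-- A weak solution seen in a moving frame is a weak solution for the transformed generator. -/
lemma IsWeakFlow.act [NeZero d] {G G' : ℝ → QuadGen d} {g : ℝ → Space d → ℂ}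
    (hg : IsWeakFlow G g) (hG : QuadGen.LocallyBounded G) {θ θ' : ℝ → Frame d}
    (hθ : ∀ t, Frame.HasDeriv θ θ' t)
    (hgen : QuadGen.LocallyBounded fun t => (θ t).gen (θ' t))
    (hGG : ∀ t ψ, (G t).op ((θ t).trans ψ) + (θ t).trans (((θ t).gen (θ' t)).op ψ)
      = (θ t).trans ((G' t).op ψ)) :
    IsWeakFlow G' (fun t => (θ t).act (g t)) := by
  refine ⟨fun t => (θ t).memLp_act (hg.memLp t), fun T => ?_, fun ψ t => ?_⟩
  · simp only [Frame.integral_sq_act]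
    exact hg.bounded T
  · simp only [Frame.integral_act_mul]
    have hgc := (hg.continuousInSigma hG le_rfl
      (memSigma_zero_iff.mpr (hg.memLp 0))).tendsto_integral_sq_sub le_rfl t
    obtain ⟨B, -, hB⟩ := hgen (|t| + 1)
    have hq : Continuous fun τ => (θ τ).q :=
      continuous_iff_continuousAt.mpr fun τ => (hθ τ).q.continuousAt
    have hσ : Continuous fun τ => (θ τ).σ :=
      continuous_iff_continuousAt.mpr fun τ => (hθ τ).σ.continuousAt
    obtain ⟨R, hR⟩ := (isCompact_closedBall t 1).bddAbove_image
      ((hq.norm.add hσ.abs)).continuousOn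
    set R' := max R B
    obtain ⟨C, -, hC⟩ := exists_op_bound ψ R' (d + 1)
    have key := hasDerivAt_integral_mul (g := g) (ψ := fun τ => (θ τ).trans ψ)
      (ψ' := fun τ => (θ τ).trans (((θ τ).gen (θ' τ)).op ψ)) (t := t) (C := C) zero_lt_one
      hg.memLp hgc (hg.hasDerivAt _ t) (fun τ _ y => Frame.hasDerivAt_trans (hθ τ) ψ y)
      (fun τ hτ y => ?_)
    · refine key.congr_deriv ?_
      rw [← integral_add (integrable_mul_of_memLp (hg.memLp t) (memLp_schwartz _))
        (integrable_mul_of_memLp (hg.memLp t) (memLp_schwartz _)), ← hGG]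
      simp only [add_apply, mul_add]
    · have h1 : ‖(θ τ).q‖ + |(θ τ).σ| ≤ R :=
        hR (Set.mem_image_of_mem _ (Metric.ball_subset_closedBall hτ))
      have h2 := abs_nonneg (θ τ).σ
      have h3 := norm_nonneg (θ τ).q
      have h4 : R ≤ R' := le_max_left _ _
      refine hC _ _ (by linarith) (by linarith) ((hB τ ?_).trans (le_max_right _ _)) y
      rw [Metric.mem_ball, Real.dist_eq, abs_lt] at hτ
      have := neg_abs_le t
      have := le_abs_self t
      exact ⟨by linarith, by linarith⟩

/-- The zero generator. -/
def QuadGen.zero (d : ℕ) : QuadGen d := ⟨0, 0, 0, 0, 0, 0⟩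

lemma QuadGen.zero_op (ψ : 𝓢(Space d, ℂ)) : (QuadGen.zero d).op ψ = 0 := by
  simp [QuadGen.op, QuadGen.zero]

lemma isWeakFlow_const {f : Space d → ℂ} (hf : MemLp f 2 volume) :
    IsWeakFlow (fun _ => QuadGen.zero d) (fun _ => f) := by
  refine ⟨fun _ => hf, fun T => ⟨_, fun t _ => le_rfl⟩, fun ψ t => ?_⟩
  simpa [QuadGen.zero_op] using hasDerivAt_const t (∫ x, f x * ψ x)

/-- The distance of the parameters of two frames. -/
def Frame.dist (θ₀ θ : Frame d) : ℝ :=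
  ‖θ.q - θ₀.q‖ + ‖θ.p - θ₀.p‖ + |θ.α - θ₀.α| + |θ.σ - θ₀.σ|

/-- The size of the parameters of a frame. -/
def Frame.size (θ : Frame d) : ℝ := ‖θ.q‖ + ‖θ.p‖ + |θ.α| + |θ.σ|

/-- The straight path of frames from `θ₀` to `θ`. -/
def Frame.line (θ₀ θ : Frame d) (τ : ℝ) : Frame d :=
  ⟨θ₀.q + τ • (θ.q - θ₀.q), θ₀.p + τ • (θ.p - θ₀.p), θ₀.α + τ * (θ.α - θ₀.α),
    θ₀.σ + τ * (θ.σ - θ₀.σ)⟩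

/-- The velocity of `Frame.line`. -/
def Frame.vel (θ₀ θ : Frame d) : Frame d := ⟨θ.q - θ₀.q, θ.p - θ₀.p, θ.α - θ₀.α, θ.σ - θ₀.σ⟩

lemma Frame.hasDeriv_line (θ₀ θ : Frame d) (t : ℝ) :
    Frame.HasDeriv (θ₀.line θ) (fun _ => θ₀.vel θ) t where
  q := (((hasDerivAt_id t).smul_const (θ.q - θ₀.q)).const_add θ₀.q).congr_deriv (one_smul ℝ _)
  p := (((hasDerivAt_id t).smul_const (θ.p - θ₀.p)).const_add θ₀.p).congr_deriv (one_smul ℝ _)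
  α := (((hasDerivAt_id t).mul_const (θ.α - θ₀.α)).const_add θ₀.α).congr_deriv (one_mul _)
  σ := (((hasDerivAt_id t).mul_const (θ.σ - θ₀.σ)).const_add θ₀.σ).congr_deriv (one_mul _)

/-- The velocity of the straight path is proportional to the distance of its end points. -/
lemma Frame.size_gen_line_le {θ₀ θ : Frame d} {R : ℝ} (h0 : θ₀.size ≤ R) (h1 : θ.size ≤ R) {τ : ℝ}
    (hτ : τ ∈ Set.Ioo (-2 : ℝ) 2) :
    ((θ₀.line θ τ).gen (θ₀.vel θ)).size ≤ (2 + 15 * R + 25 * R ^ 2) * θ₀.dist θ := by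
  unfold Frame.size at h0 h1
  have hτ' : |τ| ≤ 2 := abs_le.mpr ⟨hτ.1.le, hτ.2.le⟩
  have hv : ∀ v w : Space d, ‖v‖ ≤ R → ‖w‖ ≤ R → ‖v + τ • (w - v)‖ ≤ 5 * R := fun v w hv hw => by
    calc ‖v + τ • (w - v)‖ ≤ ‖v‖ + |τ| * ‖w - v‖ := by
          refine (norm_add_le _ _).trans ?_
          rw [norm_smul, Real.norm_eq_abs]
      _ ≤ R + 2 * (R + R) := by
          gcongr
          exact (norm_sub_le _ _).trans (add_le_add hw hv)
      _ = 5 * R := by ring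
  have b1 := norm_nonneg θ₀.q
  have b2 := norm_nonneg θ₀.p
  have b3 := abs_nonneg θ₀.α
  have b4 := abs_nonneg θ₀.σ
  have c1 := norm_nonneg θ.q
  have c2 := norm_nonneg θ.p
  have c3 := abs_nonneg θ.α
  have c4 := abs_nonneg θ.σ
  have hq := hv θ₀.q θ.q (by linarith) (by linarith)
  have hp := hv θ₀.p θ.p (by linarith) (by linarith)
  have hR : 0 ≤ R := by linarith
  simp only [QuadGen.size, Frame.gen, Frame.line, Frame.vel, Frame.dist, abs_zero, abs_neg]
  set P := θ₀.p + τ • (θ.p - θ₀.p)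
  set Q := θ₀.q + τ • (θ.q - θ₀.q)
  set a := ‖θ.q - θ₀.q‖ with ha
  set b := ‖θ.p - θ₀.p‖ with hb
  set c := |θ.α - θ₀.α| with hc
  set e := |θ.σ - θ₀.σ| with he
  have ha0 : 0 ≤ a := norm_nonneg _
  have hb0 : 0 ≤ b := norm_nonneg _
  have hc0 : 0 ≤ c := abs_nonneg _
  have he0 : 0 ≤ e := abs_nonneg _
  have g1 : ‖θ.q - θ₀.q + (θ.σ - θ₀.σ) • Q‖ ≤ a + e * (5 * R) := by
    refine (norm_add_le _ _).trans ?_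
    rw [norm_smul, Real.norm_eq_abs]
    gcongr
  have g2 : ‖θ.p - θ₀.p - (θ.σ - θ₀.σ) • P‖ ≤ b + e * (5 * R) := by
    refine (norm_sub_le _ _).trans ?_
    rw [norm_smul, Real.norm_eq_abs]
    gcongr
  have g3 : |inner ℝ P (θ.q - θ₀.q + (θ.σ - θ₀.σ) • Q) - (θ.α - θ₀.α)|
      ≤ 5 * R * (a + e * (5 * R)) + c := by
    refine (abs_sub _ _).trans (add_le_add ((abs_real_inner_le_norm _ _).trans ?_) le_rfl)
    gcongr
  have m1 := mul_nonneg hR ha0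
  have m2 := mul_nonneg hR hb0
  have m3 := mul_nonneg hR hc0
  have m4 := mul_nonneg hR he0
  have n1 := mul_nonneg hR m1
  have n2 := mul_nonneg hR m2
  have n3 := mul_nonneg hR m3
  nlinarith

/-- Moving frames are bounded on `Σ^s`, and depend continuously on their parameters. -/
lemma Frame.exists_sqSum_act_le [NeZero d] {s : ℝ} (hs : 0 ≤ s) (R : ℝ) :
    ∃ K : ℝ, 0 ≤ K ∧ ∀ θ₀ θ : Frame d, θ₀.size ≤ R → θ.size ≤ R → ∀ f : Space d → ℂ,
      MemLp f 2 volume → sqSum s (hermiteCoeff (θ.act f))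
        ≤ ENNReal.ofReal (Real.exp (K * θ₀.dist θ)) * sqSum s (hermiteCoeff (θ₀.act f)) := by
  obtain ⟨C, hC0, hC⟩ := IsWeakFlow.exists_sqSum_le d hs
  by_cases hR : R < 0
  · refine ⟨0, le_rfl, fun θ₀ θ h0 => absurd h0 (not_le.mpr (hR.trans_le ?_))⟩
    unfold Frame.size; positivity
  push Not at hR
  refine ⟨C * (2 + 15 * R + 25 * R ^ 2), by positivity, fun θ₀ θ h0 h1 f hf => ?_⟩
  have hd : 0 ≤ θ₀.dist θ := by unfold Frame.dist; positivity
  have hcont : Continuous fun τ => ((θ₀.line θ τ).gen (θ₀.vel θ)).size := by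
    simp only [QuadGen.size, Frame.gen, Frame.line, Frame.vel]
    fun_prop
  -- A constant curve, seen in the frames along the straight path from `θ₀` to `θ`, is a weak flow.
  have hflow : IsWeakFlow (fun τ => (θ₀.line θ τ).gen (θ₀.vel θ)) (fun τ => (θ₀.line θ τ).act f) :=
    (isWeakFlow_const hf).act (fun T => ⟨0, le_rfl, fun t _ => by
        simp [QuadGen.size, QuadGen.zero]⟩)
      (θ₀.hasDeriv_line θ) (QuadGen.locallyBounded_of_continuous hcont)
      (fun t ψ => by rw [QuadGen.zero_op, zero_add])
  have h := hC hflow (B := (2 + 15 * R + 25 * R ^ 2) * θ₀.dist θ) (T := 2) (by positivity)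
    (fun τ hτ => Frame.size_gen_line_le h0 h1 hτ) 0 (by norm_num) 1 (by norm_num)
  have e0 : θ₀.line θ 0 = θ₀ := by simp [Frame.line]
  have e1 : θ₀.line θ 1 = θ := by simp [Frame.line]
  rw [e0, e1] at h
  simpa [mul_assoc] using h

/-- By dominated convergence, after moving the frame to the Hermite function. -/
lemma Frame.tendsto_hermiteCoeff_act {ι : Type*} {l : Filter ι} [l.IsCountablyGenerated]
    {θ : ι → Frame d} {θ₀ : Frame d} (hθ : Tendsto (fun i => θ₀.dist (θ i)) l (𝓝 0))
    {f : Space d → ℂ} (hf : MemLp f 2 volume) (n : Fin d → ℕ) :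
    Tendsto (fun i => hermiteCoeff ((θ i).act f) n) l (𝓝 (hermiteCoeff (θ₀.act f) n)) := by
  have hq : Tendsto (fun i => (θ i).q) l (𝓝 θ₀.q) := by
    rw [tendsto_iff_norm_sub_tendsto_zero]
    refine squeeze_zero (fun _ => norm_nonneg _) (fun i => ?_) hθ
    unfold Frame.dist; linarith [norm_nonneg ((θ i).p - θ₀.p), abs_nonneg ((θ i).α - θ₀.α),
      abs_nonneg ((θ i).σ - θ₀.σ)]
  have hp : Tendsto (fun i => (θ i).p) l (𝓝 θ₀.p) := by
    rw [tendsto_iff_norm_sub_tendsto_zero]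
    refine squeeze_zero (fun _ => norm_nonneg _) (fun i => ?_) hθ
    unfold Frame.dist; linarith [norm_nonneg ((θ i).q - θ₀.q), abs_nonneg ((θ i).α - θ₀.α),
      abs_nonneg ((θ i).σ - θ₀.σ)]
  have hα : Tendsto (fun i => (θ i).α) l (𝓝 θ₀.α) := by
    rw [tendsto_iff_norm_sub_tendsto_zero]
    refine squeeze_zero (fun _ => norm_nonneg _) (fun i => ?_) hθ
    unfold Frame.dist; linarith [norm_nonneg ((θ i).q - θ₀.q), norm_nonneg ((θ i).p - θ₀.p),
      abs_nonneg ((θ i).σ - θ₀.σ), Real.norm_eq_abs ((θ i).α - θ₀.α)]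
  have hσ : Tendsto (fun i => (θ i).σ) l (𝓝 θ₀.σ) := by
    rw [tendsto_iff_norm_sub_tendsto_zero]
    refine squeeze_zero (fun _ => norm_nonneg _) (fun i => ?_) hθ
    unfold Frame.dist; linarith [norm_nonneg ((θ i).q - θ₀.q), norm_nonneg ((θ i).p - θ₀.p),
      abs_nonneg ((θ i).α - θ₀.α), Real.norm_eq_abs ((θ i).σ - θ₀.σ)]
  simp only [Frame.hermiteCoeff_act]
  set R := θ₀.size + 1
  obtain ⟨C, hC0, hC⟩ := exists_norm_trans_le (hermiteS n) R (d + 1)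
  refine tendsto_integral_filter_of_dominated_convergence
    (fun y => ‖f y‖ * (C / (1 + ‖y‖) ^ (d + 1)))
    (Eventually.of_forall fun i => hf.1.mul ((θ i).trans _).continuous.aestronglyMeasurable) ?_
    (hf.norm.integrable_mul (memLp_div_one_add_norm C)) (Eventually.of_forall fun y => ?_)
  · have e1 : ∀ᶠ i in l, ‖(θ i).q‖ < R := hq.norm.eventually (gt_mem_nhds (by
      simp only [R, Frame.size]
      linarith [norm_nonneg θ₀.p, abs_nonneg θ₀.α, abs_nonneg θ₀.σ]))
    have e2 : ∀ᶠ i in l, |(θ i).σ| < R := hσ.abs.eventually (gt_mem_nhds (by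
      simp only [R, Frame.size]
      linarith [norm_nonneg θ₀.p, abs_nonneg θ₀.α, norm_nonneg θ₀.q]))
    filter_upwards [e1, e2] with i h1 h2
    refine Eventually.of_forall fun y => ?_
    rw [norm_mul]
    exact mul_le_mul_of_nonneg_left (hC _ h1.le h2.le y) (norm_nonneg _)
  · refine Tendsto.const_mul _ ?_
    simp only [Frame.trans_apply]
    have hpt : Tendsto (fun i => (θ i).pt y) l (𝓝 (θ₀.pt y)) :=
      ((Real.continuous_exp.tendsto _).comp hσ.neg |>.smul_const y).add hq
    refine Tendsto.mul ?_ (Tendsto.mul ?_ ((hermiteS n).continuous.tendsto _ |>.comp hpt))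
    · exact (Complex.continuous_ofReal.tendsto _).comp ((Real.continuous_exp.tendsto _).comp
        ((hσ.mul_const _).div_const _).neg)
    · exact (Complex.continuous_exp.tendsto _).comp
        (((Complex.continuous_ofReal.tendsto _).comp ((hp.inner hpt).sub hα)).const_mul _)

/-- Moving frames depend strongly continuously on their parameters in `Σ^s`. -/
lemma Frame.tendsto_sqSum_act_sub [NeZero d] {s : ℝ} (hs : 0 ≤ s) {ι : Type*} {l : Filter ι}
    [l.IsCountablyGenerated] {θ : ι → Frame d} {θ₀ : Frame d}
    (hθ : Tendsto (fun i => θ₀.dist (θ i)) l (𝓝 0)) {f : Space d → ℂ}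
    (hf : MemSigma s (θ₀.act f)) (hf2 : MemLp f 2 volume) :
    Tendsto (fun i => sqSum s (fun n => hermiteCoeff ((θ i).act f) n - hermiteCoeff (θ₀.act f) n)) l
      (𝓝 0) := by
  obtain ⟨K, hK0, hK⟩ := Frame.exists_sqSum_act_le (d := d) hs (θ₀.size + 1)
  rw [memSigma_iff] at hf
  refine tendsto_sqSum_sub (fun n => Frame.tendsto_hermiteCoeff_act hθ hf2 n) hf.2
    (r := fun i => ENNReal.ofReal (Real.exp (K * θ₀.dist (θ i)))
      * sqSum s (hermiteCoeff (θ₀.act f)))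
    ?_ ?_
  · have h1 : Tendsto (fun i => ENNReal.ofReal (Real.exp (K * θ₀.dist (θ i)))) l (𝓝 1) := by
      have hc : Continuous fun r : ℝ => ENNReal.ofReal (Real.exp (K * r)) :=
        ENNReal.continuous_ofReal.comp (by fun_prop)
      have := (hc.tendsto 0).comp hθ
      simpa [Function.comp_def] using this
    have := ENNReal.Tendsto.mul_const (b := sqSum s (hermiteCoeff (θ₀.act f))) h1 (Or.inr hf.2.ne)
    simpa using this
  · filter_upwards [hθ.eventually (gt_mem_nhds zero_lt_one)] with i hi
    refine hK θ₀ (θ i) (by linarith) ?_ f hf2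
    have h1 : ‖(θ i).q‖ ≤ ‖θ₀.q‖ + ‖(θ i).q - θ₀.q‖ := by
      simpa using norm_add_le θ₀.q ((θ i).q - θ₀.q)
    have h2 : ‖(θ i).p‖ ≤ ‖θ₀.p‖ + ‖(θ i).p - θ₀.p‖ := by
      simpa using norm_add_le θ₀.p ((θ i).p - θ₀.p)
    have h3 : |(θ i).α| ≤ |θ₀.α| + |(θ i).α - θ₀.α| := by
      simpa using abs_add_le θ₀.α ((θ i).α - θ₀.α)
    have h4 : |(θ i).σ| ≤ |θ₀.σ| + |(θ i).σ - θ₀.σ| := by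
      simpa using abs_add_le θ₀.σ ((θ i).σ - θ₀.σ)
    unfold Frame.dist at hi
    unfold Frame.size
    linarith

/-- The identity frame. -/
def Frame.one (d : ℕ) : Frame d := ⟨0, 0, 0, 0⟩

lemma Frame.one_act (f : Space d → ℂ) : (Frame.one d).act f = f := by
  funext x; simp [Frame.act, Frame.one]

/-- Moving frames are uniformly bounded on `Σ^s` for bounded parameters. -/
lemma Frame.exists_sqSum_act_le_self [NeZero d] {s : ℝ} (hs : 0 ≤ s) (R : ℝ) :
    ∃ K : ℝ, 0 ≤ K ∧ ∀ θ : Frame d, θ.size ≤ R → ∀ f : Space d → ℂ, MemLp f 2 volume →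
      sqSum s (hermiteCoeff (θ.act f)) ≤ ENNReal.ofReal K * sqSum s (hermiteCoeff f) := by
  obtain ⟨K, hK0, hK⟩ := Frame.exists_sqSum_act_le (d := d) hs (max R 0)
  refine ⟨Real.exp (K * max R 0), by positivity, fun θ hθ f hf => ?_⟩
  have h := hK (Frame.one d) θ (by simp [Frame.one, Frame.size]) (hθ.trans (le_max_left _ _)) f hf
  rw [Frame.one_act] at h
  refine h.trans ?_
  gcongr
  have : (Frame.one d).dist θ = θ.size := by simp [Frame.one, Frame.dist, Frame.size]
  rw [this]
  exact hθ.trans (le_max_left _ _)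

lemma Frame.memSigma_act [NeZero d] {s : ℝ} (hs : 0 ≤ s) (θ : Frame d) {f : Space d → ℂ}
    (hf : MemSigma s f) : MemSigma s (θ.act f) := by
  obtain ⟨K, hK0, hK⟩ := Frame.exists_sqSum_act_le_self (d := d) hs θ.size
  rw [memSigma_iff] at hf ⊢
  exact ⟨θ.memLp_act hf.1, (hK θ le_rfl f hf.1).trans_lt
    (ENNReal.mul_lt_top ENNReal.ofReal_lt_top hf.2)⟩

/-! ### The harmonic oscillator and its driven versions -/

lemma exists_hoFlow (τ : ℝ) {f : Space d → ℂ} (hf : MemLp f 2 volume) :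
    ∃ g : Space d → ℂ, MemLp g 2 volume ∧ ∀ n, hermiteCoeff g n
      = Complex.exp (-(Complex.I * ((τ * wt n : ℝ) : ℂ))) * hermiteCoeff f n := by
  refine exists_hermiteCoeff_eq ?_
  refine (hasSum_sq_hermiteCoeff hf).summable.congr fun n => ?_
  rw [norm_mul, ← mul_neg, ← Complex.ofReal_neg, mul_comm Complex.I, Complex.norm_exp_ofReal_mul_I,
    one_mul]

open Classical in
/-- The unitary group `e^{-iτ(-Δ + |x|²)/2}` of the harmonic oscillator (with the value `0` outside
of `L²`). -/
def hoFlow (τ : ℝ) (f : Space d → ℂ) : Space d → ℂ :=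
  if hf : MemLp f 2 volume then (exists_hoFlow τ hf).choose else 0

lemma memLp_hoFlow (τ : ℝ) {f : Space d → ℂ} (hf : MemLp f 2 volume) :
    MemLp (hoFlow τ f) 2 volume := by
  rw [hoFlow, dif_pos hf]; exact (exists_hoFlow τ hf).choose_spec.1

lemma hermiteCoeff_hoFlow (τ : ℝ) {f : Space d → ℂ} (hf : MemLp f 2 volume) (n : Fin d → ℕ) :
    hermiteCoeff (hoFlow τ f) n
      = Complex.exp (-(Complex.I * ((τ * wt n : ℝ) : ℂ))) * hermiteCoeff f n := by
  rw [hoFlow, dif_pos hf]; exact (exists_hoFlow τ hf).choose_spec.2 n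

lemma norm_hermiteCoeff_hoFlow (τ : ℝ) {f : Space d → ℂ} (hf : MemLp f 2 volume) (n : Fin d → ℕ) :
    ‖hermiteCoeff (hoFlow τ f) n‖ = ‖hermiteCoeff f n‖ := by
  rw [hermiteCoeff_hoFlow τ hf, norm_mul, ← mul_neg, ← Complex.ofReal_neg, mul_comm Complex.I,
    Complex.norm_exp_ofReal_mul_I, one_mul]

lemma sqSum_hoFlow (s τ : ℝ) {f : Space d → ℂ} (hf : MemLp f 2 volume) :
    sqSum s (hermiteCoeff (hoFlow τ f)) = sqSum s (hermiteCoeff f) :=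
  sqSum_congr fun n => norm_hermiteCoeff_hoFlow τ hf n

lemma sqSum_hoFlow_sub (s τ : ℝ) {f g : Space d → ℂ} (hf : MemLp f 2 volume)
    (hg : MemLp g 2 volume) :
    sqSum s (fun n => hermiteCoeff (hoFlow τ f) n - hermiteCoeff (hoFlow τ g) n)
      = sqSum s (fun n => hermiteCoeff f n - hermiteCoeff g n) :=
  sqSum_congr fun n => by
    rw [hermiteCoeff_hoFlow τ hf, hermiteCoeff_hoFlow τ hg, ← mul_sub, norm_mul, ← mul_neg,
      ← Complex.ofReal_neg, mul_comm Complex.I, Complex.norm_exp_ofReal_mul_I, one_mul]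

lemma memSigma_hoFlow {s : ℝ} (τ : ℝ) {f : Space d → ℂ} (hf : MemSigma s f) :
    MemSigma s (hoFlow τ f) := by
  rw [memSigma_iff] at hf ⊢
  exact ⟨memLp_hoFlow τ hf.1, by rw [sqSum_hoFlow s τ hf.1]; exact hf.2⟩

lemma hoFlow_zero {f : Space d → ℂ} (hf : MemLp f 2 volume) : hoFlow 0 f =ᵐ[volume] f :=
  ae_eq_of_hermiteCoeff_eq (memLp_hoFlow 0 hf) hf fun n => by
    rw [hermiteCoeff_hoFlow 0 hf]; simp

lemma integral_sq_hoFlow (τ : ℝ) {f : Space d → ℂ} (hf : MemLp f 2 volume) :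
    ∫ x, ‖hoFlow τ f x‖ ^ 2 = ∫ x, ‖f x‖ ^ 2 := by
  rw [← (hasSum_sq_hermiteCoeff (memLp_hoFlow τ hf)).tsum_eq, ← (hasSum_sq_hermiteCoeff hf).tsum_eq]
  simp only [norm_hermiteCoeff_hoFlow τ hf]

/-- The generator `-iω(-Δ + |x|²)/2` of the harmonic oscillator with speed `ω`. -/
def QuadGen.harmonic (d : ℕ) (ω : ℝ) : QuadGen d := ⟨ω / 2, -(ω / 2), 0, 0, 0, 0⟩

lemma QuadGen.harmonic_op (ω : ℝ) (ψ : 𝓢(Space d, ℂ)) :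
    (QuadGen.harmonic d ω).op ψ = ∑ j, ((Complex.I * (ω / 2)) • partialD j (partialD j ψ)
      - (Complex.I * (ω / 2)) • coordMul j (coordMul j ψ)) := by
  simp [QuadGen.op, QuadGen.harmonic, sub_eq_add_neg]

/-- Hermite functions are eigenfunctions of the harmonic oscillator. -/
lemma hermiteCoeff_harmonic_op (ω : ℝ) (ψ : 𝓢(Space d, ℂ)) (n : Fin d → ℕ) :
    hermiteCoeff ((QuadGen.harmonic d ω).op ψ) n
      = -(Complex.I * ((ω * wt n : ℝ) : ℂ)) * hermiteCoeff ψ n := by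
  have h1 : hermiteCoeff ((QuadGen.harmonic d ω).op ψ) n
      = ∫ x, ψ x * (QuadGen.harmonic d ω).op (hermiteS n) x := by
    have hL : ∀ φ : 𝓢(Space d, ℂ), hermiteCoeff φ n = pairing (memLp_schwartz (hermiteS n)) φ :=
      fun φ => by simp [hermiteCoeff, pairing_apply, mul_comm]
    have hs : ∀ φ χ : 𝓢(Space d, ℂ), pairing (memLp_schwartz φ) χ = pairing (memLp_schwartz χ) φ :=
      fun φ χ => by simp [pairing_apply, mul_comm]
    rw [hL, ← pairing_apply (memLp_schwartz ψ), QuadGen.harmonic_op, QuadGen.harmonic_op, map_sum,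
      map_sum]
    refine Finset.sum_congr rfl fun j _ => ?_
    simp only [map_sub, map_smul]
    congr 2
    · rw [hs, hs _ (partialD j (partialD j (hermiteS n))), hs _ ψ]
      simp only [pairing_apply]
      rw [integral_partialD, integral_partialD, neg_neg]
    · rw [hs, hs _ (coordMul j (coordMul j (hermiteS n))), hs _ ψ]
      simp only [pairing_apply]
      rw [integral_coordMul, integral_coordMul]
  rw [h1, integral_mul_op_hermiteS _ (memLp_schwartz ψ), flowField]
  have he : ∀ k m, (QuadGen.harmonic d ω).entry k m = 0 := fun k m => by
    rcases k with j | j <;> simp [QuadGen.entry, QuadGen.harmonic]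
  have hd : (QuadGen.harmonic d ω).diag n = -(ω * wt n) := by
    simp only [QuadGen.diag, QuadGen.harmonic, wt, len, ← Finset.mul_sum, Finset.sum_add_distrib]
    simp
    ring
  simp [he, hd]
  ring

lemma summable_norm_mul {f g : Space d → ℂ} (hf : MemLp f 2 volume) (hg : MemLp g 2 volume) :
    Summable fun n => ‖hermiteCoeff f n‖ * ‖hermiteCoeff g n‖ := by
  refine Summable.of_nonneg_of_le (fun n => by positivity) (fun n => ?_)
    ((hasSum_sq_hermiteCoeff hf).summable.add (hasSum_sq_hermiteCoeff hg).summable)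
  nlinarith [sq_nonneg (‖hermiteCoeff f n‖ - ‖hermiteCoeff g n‖), sq_nonneg ‖hermiteCoeff f n‖,
    sq_nonneg ‖hermiteCoeff g n‖]

/-- The unitary group of the harmonic oscillator solves its Schrödinger equation. -/
lemma isWeakFlow_hoFlow (ω : ℝ) {f : Space d → ℂ} (hf : MemLp f 2 volume) :
    IsWeakFlow (fun _ => QuadGen.harmonic d ω) (fun t => hoFlow (ω * t) f) := by
  refine ⟨fun t => memLp_hoFlow _ hf, fun T => ⟨∫ x, ‖f x‖ ^ 2, fun t _ =>
    (integral_sq_hoFlow _ hf).le⟩, fun ψ t => ?_⟩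
  have hψ := memLp_schwartz ψ
  have hop := memLp_schwartz ((QuadGen.harmonic d ω).op ψ)
  have e1 : ∀ τ, ∫ x, hoFlow (ω * τ) f x * ψ x = ∑' n,
      Complex.exp (-(Complex.I * ((ω * τ * wt n : ℝ) : ℂ))) * hermiteCoeff f n * hermiteCoeff ψ n :=
    fun τ => by
      rw [← (hasSum_hermiteCoeff_mul (memLp_hoFlow (ω * τ) hf) hψ).tsum_eq]
      simp only [hermiteCoeff_hoFlow _ hf]
  have e2 : ∫ x, hoFlow (ω * t) f x * (QuadGen.harmonic d ω).op ψ x = ∑' n,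
      Complex.exp (-(Complex.I * ((ω * t * wt n : ℝ) : ℂ))) * hermiteCoeff f n
        * hermiteCoeff ((QuadGen.harmonic d ω).op ψ) n := by
    rw [← (hasSum_hermiteCoeff_mul (memLp_hoFlow (ω * t) hf) hop).tsum_eq]
    simp only [hermiteCoeff_hoFlow _ hf]
  have hnorm : ∀ r : ℝ, ‖Complex.exp (-(Complex.I * (r : ℂ)))‖ = 1 := fun r => by
    rw [← mul_neg, ← Complex.ofReal_neg, mul_comm Complex.I, Complex.norm_exp_ofReal_mul_I]
  simp only [e1]
  rw [e2]
  refine hasDerivAt_tsum (g := fun n τ => Complex.exp (-(Complex.I * ((ω * τ * wt n : ℝ) : ℂ)))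
      * hermiteCoeff f n * hermiteCoeff ψ n)
    (g' := fun n τ => Complex.exp (-(Complex.I * ((ω * τ * wt n : ℝ) : ℂ))) * hermiteCoeff f n
        * hermiteCoeff ((QuadGen.harmonic d ω).op ψ) n)
    (summable_norm_mul hf hop) (fun n τ => ?_) (fun n τ => ?_) (y₀ := t) ?_ t
  · have h1 : HasDerivAt (fun τ : ℝ => -(Complex.I * ((ω * τ * wt n : ℝ) : ℂ)))
        (-(Complex.I * ((ω * wt n : ℝ) : ℂ))) τ := by
      have := (((hasDerivAt_id τ).const_mul ω).mul_const (wt n)).ofReal_comp.const_mul Complex.I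
      refine this.neg.congr_deriv ?_
      simp
    refine ((h1.cexp.mul_const (hermiteCoeff f n)).mul_const (hermiteCoeff ψ n)).congr_deriv ?_
    rw [hermiteCoeff_harmonic_op]
    ring
  · rw [norm_mul, norm_mul, hnorm, one_mul]
  · refine Summable.of_norm_bounded (summable_norm_mul hf hψ) fun n => ?_
    rw [norm_mul, norm_mul, hnorm, one_mul]

/-- The generator of `i u_t = (-Δ u + κ|x|² u)/2 - F·x u`. -/
def QuadGen.driven (κ : ℝ) (F : Space d) : QuadGen d := ⟨1 / 2, -(κ / 2), 0, 0, F, 0⟩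

lemma QuadGen.locallyBounded_driven {κ : ℝ → ℝ} {F : ℝ → Space d} (hκ : Continuous κ)
    (hF : Continuous F) : QuadGen.LocallyBounded fun t => QuadGen.driven (κ t) (F t) := by
  refine QuadGen.locallyBounded_of_continuous ?_
  simp only [QuadGen.size, QuadGen.driven]
  fun_prop

lemma exp_log_div_four {κ : ℝ} (hκ : 0 < κ) :
    Real.exp (Real.log κ / 4) * Real.exp (Real.log κ / 4) = Real.sqrt κ := by
  rw [← Real.exp_add, Real.sqrt_eq_rpow, Real.rpow_def_of_pos hκ]
  ring_nf

/-- A frame following a classical trajectory of the driven oscillator intertwines the quantum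
evolutions. -/
lemma driven_intertwining {κ : ℝ} (hκ : 0 < κ) (q p F : Space d) (α : ℝ) (ψ : 𝓢(Space d, ℂ)) :
    let θ : Frame d := ⟨q, p, α, Real.log κ / 4⟩
    let θ' : Frame d := ⟨p, F - κ • q, (‖p‖ ^ 2 - κ * ‖q‖ ^ 2) / 2, 0⟩
    (QuadGen.harmonic d (Real.sqrt κ)).op (θ.trans ψ) + θ.trans ((θ.gen θ').op ψ)
      = θ.trans ((QuadGen.driven κ F).op ψ) := by
  intro θ θ'
  have hr : (θ.gen θ').r = ∑ j, (p j * p j + κ * (q j * q j)) / 2 := by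
    simp only [Frame.gen, θ, θ', zero_smul, add_zero, real_inner_self_eq_norm_sq]
    rw [← Finset.sum_div, Finset.sum_add_distrib, ← Finset.mul_sum,
      EuclideanSpace.real_norm_sq_eq, EuclideanSpace.real_norm_sq_eq]
    simp only [pow_two]
    ring
  have hσ : θ.σ = Real.log κ / 4 := rfl
  have hp : θ.p = p := rfl
  have hq : θ.q = q := rfl
  have hω := exp_log_div_four hκ
  set E := Real.exp (Real.log κ / 4) with hE
  have hE0 : E ≠ 0 := Real.exp_ne_zero _
  have hEi : Real.exp (-(Real.log κ / 4)) = E⁻¹ := Real.exp_neg _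
  have hκ2 : (κ : ℂ) = (E : ℂ) * E * (E * E) := by
    rw [← Complex.ofReal_mul, ← Complex.ofReal_mul, hω, Real.mul_self_sqrt hκ.le]
  have hE0' : (E : ℂ) ≠ 0 := by exact_mod_cast hE0
  rw [QuadGen.harmonic_op]
  simp only [QuadGen.op]
  rw [hr]
  ext y
  simp only [Frame.gen, QuadGen.driven, θ', Frame.partialD_trans, Frame.coordMul_trans, map_add,
    map_sub,
    map_smul, map_sum, add_apply, sub_apply, smul_apply, sum_apply, smul_eq_mul, hσ, hp, hq]
  simp only [← hE, hEi, ← hω, zero_smul, sub_zero, add_zero, PiLp.sub_apply,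
    PiLp.smul_apply, smul_eq_mul, PiLp.zero_apply, neg_zero]
  push_cast
  rw [Finset.mul_sum, Finset.sum_mul, ← Finset.sum_add_distrib, ← Finset.sum_add_distrib]
  rw [mul_zero, zero_mul, zero_add]
  refine Finset.sum_congr rfl fun j _ => ?_
  rw [hκ2]
  have h3 : Complex.I ^ 3 = -Complex.I := Complex.I_pow_three
  field_simp
  ring_nf
  simp only [h3, Complex.I_sq]
  ring

/-- Moving frames along classical trajectories solve the driven Schrödinger equation. -/
lemma isWeakFlow_driven [NeZero d] {κ : ℝ} (hκ : 0 < κ) {q p F : ℝ → Space d} {α : ℝ → ℝ}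
    (hF : Continuous F) (hq : ∀ t, HasDerivAt q (p t) t)
    (hp : ∀ t, HasDerivAt p (F t - κ • q t) t)
    (hα : ∀ t, HasDerivAt α ((‖p t‖ ^ 2 - κ * ‖q t‖ ^ 2) / 2) t) {g : Space d → ℂ}
    (hg : MemLp g 2 volume) :
    IsWeakFlow (fun t => QuadGen.driven κ (F t))
      (fun t => (Frame.mk (q t) (p t) (α t) (Real.log κ / 4)).act (hoFlow (Real.sqrt κ * t) g)) :=
        by
  have hqc : Continuous q := continuous_iff_continuousAt.mpr fun t => (hq t).continuousAt
  have hpc : Continuous p := continuous_iff_continuousAt.mpr fun t => (hp t).continuousAt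
  refine (isWeakFlow_hoFlow (Real.sqrt κ) hg).act
    (θ := fun t => Frame.mk (q t) (p t) (α t) (Real.log κ / 4))
    (θ' := fun t => Frame.mk (p t) (F t - κ • q t) ((‖p t‖ ^ 2 - κ * ‖q t‖ ^ 2) / 2) 0)
    (QuadGen.locallyBounded_of_continuous continuous_const)
    (fun t => ⟨hq t, hp t, hα t, hasDerivAt_const t _⟩) ?_
    (fun t ψ => driven_intertwining hκ (q t) (p t) (F t) (α t) ψ)
  refine QuadGen.locallyBounded_of_continuous ?_
  simp only [QuadGen.size, Frame.gen]
  fun_prop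

/-! ### Moments of functions in `Σ^s` -/

lemma hermiteCoeff_coordMul {f : Space d → ℂ} (hf : MemLp f 2 volume) (j : Fin d) (n : Fin d → ℕ) :
    hermiteCoeff (fun x => (x j : ℂ) * f x) n = ((Real.sqrt 2 : ℝ) : ℂ)⁻¹ *
      ((Real.sqrt (n j + 1) : ℂ) * hermiteCoeff f (n + Pi.single j 1)
        + (Real.sqrt (n j) : ℂ) * hermiteCoeff f (n - Pi.single j 1)) := by
  have h1 : hermiteCoeff (fun x => (x j : ℂ) * f x) n = pairing hf (coordMul j (hermiteS n)) := by
    rw [pairing_apply, hermiteCoeff]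
    refine integral_congr_ae (Eventually.of_forall fun x => ?_)
    simp only [coordMul_apply, hermiteS_apply]
    ring
  rw [h1, coordMul_hermiteS]
  simp only [map_smul, map_add, pairing_hermiteS, smul_eq_mul]

lemma norm_sq_lower_raise_le (n : Fin d → ℕ) (j : Fin d) (a b : ℂ) :
    ‖((Real.sqrt 2 : ℝ) : ℂ)⁻¹ * ((Real.sqrt (n j + 1) : ℂ) * a + (Real.sqrt (n j) : ℂ) * b)‖ ^ 2
      ≤ (n j + 1) * ‖a‖ ^ 2 + n j * ‖b‖ ^ 2 := by
  rw [norm_mul, mul_pow, norm_inv, Complex.norm_real, Real.norm_of_nonneg (Real.sqrt_nonneg _),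
    inv_pow, Real.sq_sqrt (by norm_num)]
  have h1 : ‖(Real.sqrt (n j + 1) : ℂ) * a + (Real.sqrt (n j) : ℂ) * b‖ ^ 2
      ≤ (Real.sqrt (n j + 1) * ‖a‖ + Real.sqrt (n j) * ‖b‖) ^ 2 := by
    gcongr
    refine (norm_add_le _ _).trans ?_
    rw [norm_mul, norm_mul, Complex.norm_real, Complex.norm_real,
      Real.norm_of_nonneg (Real.sqrt_nonneg _), Real.norm_of_nonneg (Real.sqrt_nonneg _)]
  have h2 := Real.sq_sqrt (show (0 : ℝ) ≤ n j + 1 by positivity)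
  have h3 := Real.sq_sqrt (show (0 : ℝ) ≤ n j by positivity)
  nlinarith [sq_nonneg (Real.sqrt (n j + 1) * ‖a‖ - Real.sqrt (n j) * ‖b‖)]

open Classical in
/-- The position operator is bounded by the harmonic oscillator:
`‖x_j f‖² ≤ ∑ (2 n_j + 1)|c_n|²`. -/
lemma lintegral_coord_sq_le {f : Space d → ℂ} (hf : MemLp f 2 volume) (j : Fin d)
    (hxf : MemLp (fun x => (x j : ℂ) * f x) 2 volume) :
    ENNReal.ofReal (∫ x, ‖(x j : ℂ) * f x‖ ^ 2)
      ≤ ∑' n : Fin d → ℕ, ENNReal.ofReal ((2 * n j + 1) * ‖hermiteCoeff f n‖ ^ 2) := by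
  have h0 := (hasSum_sq_hermiteCoeff hxf)
  rw [← h0.tsum_eq, ENNReal.ofReal_tsum_of_nonneg (fun n => by positivity) h0.summable]
  set c := hermiteCoeff f
  have h1 : ∀ n : Fin d → ℕ, ENNReal.ofReal (‖hermiteCoeff (fun x => (x j : ℂ) * f x) n‖ ^ 2)
      ≤ ENNReal.ofReal ((n j + 1) * ‖c (n + Pi.single j 1)‖ ^ 2)
        + ENNReal.ofReal (n j * ‖c (n - Pi.single j 1)‖ ^ 2) := fun n => by
    rw [← ENNReal.ofReal_add (by positivity) (by positivity), hermiteCoeff_coordMul hf]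
    exact ENNReal.ofReal_le_ofReal (norm_sq_lower_raise_le n j _ _)
  refine (ENNReal.tsum_le_tsum h1).trans ?_
  rw [ENNReal.tsum_add]
  have h2 : ∑' n : Fin d → ℕ, ENNReal.ofReal ((n j + 1) * ‖c (n + Pi.single j 1)‖ ^ 2)
      ≤ ∑' m : Fin d → ℕ, ENNReal.ofReal (m j * ‖c m‖ ^ 2) := by
    have := ENNReal.tsum_comp_le_tsum_of_injective (add_left_injective (Pi.single j 1 : Fin d → ℕ))
      (fun m : Fin d → ℕ => ENNReal.ofReal (m j * ‖c m‖ ^ 2))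
    simpa using this
  have h3 : ∑' n : Fin d → ℕ, ENNReal.ofReal (n j * ‖c (n - Pi.single j 1)‖ ^ 2)
      ≤ ∑' m : Fin d → ℕ, ENNReal.ofReal ((m j + 1) * ‖c m‖ ^ 2) := by
    have hinj := (add_left_injective (Pi.single j 1 : Fin d → ℕ))
    have hsupp : Function.support (fun n : Fin d → ℕ =>
        ENNReal.ofReal (n j * ‖c (n - Pi.single j 1)‖ ^ 2))
        ⊆ Set.range (fun x : Fin d → ℕ => x + Pi.single j 1) := by
      intro n hn
      refine ⟨n - Pi.single j 1, tsub_add_cancel_of_le ((single_le_iff n j 1).mpr ?_)⟩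
      by_contra hlt
      have : n j = 0 := by omega
      simp [this] at hn
    rw [← hinj.tsum_eq hsupp]
    simp
  refine (add_le_add h2 h3).trans ?_
  rw [← ENNReal.tsum_add]
  refine ENNReal.tsum_le_tsum fun m => ?_
  rw [← ENNReal.ofReal_add (by positivity) (by positivity)]
  exact ENNReal.ofReal_le_ofReal (by linarith)

/-- The operator inequality `|x|² ≤ -Δ + |x|²`. -/
lemma lintegral_norm_sq_schwartz_le (ψ : 𝓢(Space d, ℂ)) :
    ∫⁻ x, ENNReal.ofReal (‖x‖ ^ 2 * ‖ψ x‖ ^ 2)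
      ≤ ∑' n : Fin d → ℕ, ENNReal.ofReal (2 * wt n * ‖hermiteCoeff ψ n‖ ^ 2) := by
  have hm : ∀ j, MemLp (fun x : Space d => (x j : ℂ) * ψ x) 2 volume := fun j =>
    (memLp_congr_ae (Eventually.of_forall fun x => coordMul_apply j ψ x)).mp
      (memLp_schwartz (coordMul j ψ))
  have h1 : ∀ x : Space d, ENNReal.ofReal (‖x‖ ^ 2 * ‖ψ x‖ ^ 2)
      = ∑ j, ENNReal.ofReal (‖(x j : ℂ) * ψ x‖ ^ 2) := fun x => by
    rw [← ENNReal.ofReal_sum_of_nonneg fun j _ => by positivity, EuclideanSpace.real_norm_sq_eq,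
      Finset.sum_mul]
    congr 1
    refine Finset.sum_congr rfl fun j _ => ?_
    rw [norm_mul, mul_pow, Complex.norm_real, Real.norm_eq_abs, sq_abs]
  simp only [h1]
  rw [lintegral_finsetSum' _ fun j _ =>
    ((hm j).1.norm.aemeasurable.pow_const 2).ennreal_ofReal]
  have h2 : ∀ n : Fin d → ℕ, ENNReal.ofReal (2 * wt n * ‖hermiteCoeff ψ n‖ ^ 2)
      = ∑ j, ENNReal.ofReal ((2 * n j + 1) * ‖hermiteCoeff ψ n‖ ^ 2) := fun n => by
    rw [← ENNReal.ofReal_sum_of_nonneg fun j _ => by positivity, ← Finset.sum_mul]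
    congr 2
    rw [wt, len, Finset.sum_add_distrib, ← Finset.mul_sum]
    simp; ring
  simp only [h2]
  rw [Summable.tsum_finsetSum fun _ _ => ENNReal.summable]
  refine Finset.sum_le_sum fun j _ => ?_
  rw [← ofReal_integral_eq_lintegral_ofReal
    ((memLp_two_iff_integrable_sq_norm (hm j).1).mp (hm j))
    (Eventually.of_forall fun x => by positivity)]
  exact lintegral_coord_sq_le (memLp_schwartz ψ) j (hm j)

/-- The resolvent weights: an interpolation inequality between `L²` and `Σ¹`, obtained by splitting
`f` into `f - g` and `g`, where the coefficients of `g` are those of `(1 + s²(-Δ+|x|²))⁻¹ f`. -/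
lemma lintegral_resolvent_weight_le [NeZero d] {f : Space d → ℂ} (hf : MemLp f 2 volume) {s : ℝ}
    (hs : s ≠ 0) :
    ∫⁻ x, ENNReal.ofReal (‖x‖ ^ 2 / (1 + s ^ 2 * ‖x‖ ^ 2) * ‖f x‖ ^ 2)
      ≤ ∑' n : Fin d → ℕ, ENNReal.ofReal (2 * wt n / (1 + s ^ 2 * (2 * wt n))
        * ‖hermiteCoeff f n‖ ^ 2) := by
  classical
  set c := hermiteCoeff f with hc
  have hs2 : 0 < s ^ 2 := by positivity
  set F : (Fin d → ℕ) → ℝ≥0∞ := fun n => ENNReal.ofReal (2 * wt n / (1 + s ^ 2 * (2 * wt n))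
    * ‖c n‖ ^ 2)
  set H : (Fin d → ℕ) → ℝ≥0∞ := fun n => ENNReal.ofReal ((s ^ 2)⁻¹ * ‖c n‖ ^ 2)
  have hH : ∑' n, H n ≠ ∞ := by
    have := (hasSum_sq_hermiteCoeff hf).summable.mul_left (s ^ 2)⁻¹
    rw [← ENNReal.ofReal_tsum_of_nonneg (fun n => by positivity) this]
    exact ENNReal.ofReal_ne_top
  have key : ∀ S : Finset (Fin d → ℕ),
      ∫⁻ x, ENNReal.ofReal (‖x‖ ^ 2 / (1 + s ^ 2 * ‖x‖ ^ 2) * ‖f x‖ ^ 2)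
        ≤ ∑' n, F n + ∑' n : {n // n ∉ S}, H n := fun S => by
    set g : 𝓢(Space d, ℂ) :=
      ∑ n ∈ S, (c n / ((1 + s ^ 2 * (2 * wt n) : ℝ) : ℂ)) • hermiteS n with hg
    have hgm := memLp_schwartz g
    have hgc : ∀ n, hermiteCoeff g n
        = if n ∈ S then c n / ((1 + s ^ 2 * (2 * wt n) : ℝ) : ℂ) else 0 := fun n => by
      have h1 : hermiteCoeff g n = pairing (memLp_schwartz (hermiteS n)) g := by
        simp [hermiteCoeff, pairing_apply, mul_comm]
      rw [h1, hg, map_sum]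
      have h2 : ∀ m, pairing (memLp_schwartz (hermiteS n)) (hermiteS m) = if m = n then 1 else 0 :=
        fun m => by
          rw [← hermiteCoeff_hermiteFun m n]
          simp [pairing_apply, hermiteCoeff, mul_comm]
      simp only [map_smul, h2, smul_eq_mul, mul_ite, mul_one, mul_zero, Finset.sum_ite_eq']
    have hpt : ∀ x, ENNReal.ofReal (‖x‖ ^ 2 / (1 + s ^ 2 * ‖x‖ ^ 2) * ‖f x‖ ^ 2)
        ≤ ENNReal.ofReal ((s ^ 2)⁻¹ * ‖f x - g x‖ ^ 2) + ENNReal.ofReal (‖x‖ ^ 2 * ‖g x‖ ^ 2) :=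
      fun x => by
        rw [← ENNReal.ofReal_add (by positivity) (by positivity)]
        refine ENNReal.ofReal_le_ofReal ?_
        have h1 : ‖f x‖ ≤ ‖f x - g x‖ + ‖g x‖ := by simpa using norm_add_le (f x - g x) (g x)
        have h2 : ‖f x‖ ^ 2 ≤ (‖f x - g x‖ + ‖g x‖) ^ 2 := by gcongr
        have hX : 0 ≤ ‖x‖ ^ 2 := by positivity
        set a := ‖f x - g x‖
        set b := ‖g x‖
        set X := ‖x‖ ^ 2
        calc X / (1 + s ^ 2 * X) * ‖f x‖ ^ 2 ≤ X / (1 + s ^ 2 * X) * (a + b) ^ 2 := by gcongr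
          _ ≤ (s ^ 2)⁻¹ * a ^ 2 + X * b ^ 2 := by
              rw [div_mul_eq_mul_div, div_le_iff₀ (by positivity)]
              have : ((s ^ 2)⁻¹ * a ^ 2 + X * b ^ 2) * (1 + s ^ 2 * X) - X * (a + b) ^ 2
                  = (s ^ 2)⁻¹ * (a - s ^ 2 * X * b) ^ 2 := by
                field_simp; ring
              have h3 : 0 ≤ (s ^ 2)⁻¹ * (a - s ^ 2 * X * b) ^ 2 := by positivity
              linarith
    have hdm : MemLp (fun x => f x - g x) 2 volume := hf.sub hgm
    have hI1 : ∫⁻ x, ENNReal.ofReal ((s ^ 2)⁻¹ * ‖f x - g x‖ ^ 2)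
        = ∑' n, ENNReal.ofReal ((s ^ 2)⁻¹ * ‖c n - hermiteCoeff g n‖ ^ 2) := by
      have hsum := (hasSum_sq_hermiteCoeff hdm).mul_left (s ^ 2)⁻¹
      rw [← ofReal_integral_eq_lintegral_ofReal
        (((memLp_two_iff_integrable_sq_norm hdm.1).mp hdm).const_mul _)
        (Eventually.of_forall fun x => by positivity), integral_const_mul, ← hsum.tsum_eq,
        ENNReal.ofReal_tsum_of_nonneg (fun n => by positivity) hsum.summable]
      simp only [hermiteCoeff_sub hf hgm, hc]
    calc ∫⁻ x, ENNReal.ofReal (‖x‖ ^ 2 / (1 + s ^ 2 * ‖x‖ ^ 2) * ‖f x‖ ^ 2)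
        ≤ ∫⁻ x, (ENNReal.ofReal ((s ^ 2)⁻¹ * ‖f x - g x‖ ^ 2)
          + ENNReal.ofReal (‖x‖ ^ 2 * ‖g x‖ ^ 2)) := lintegral_mono hpt
      _ = (∫⁻ x, ENNReal.ofReal ((s ^ 2)⁻¹ * ‖f x - g x‖ ^ 2))
          + ∫⁻ x, ENNReal.ofReal (‖x‖ ^ 2 * ‖g x‖ ^ 2) := by
          refine lintegral_add_left' ?_ _
          exact ((hdm.1.norm.aemeasurable.pow_const 2).const_mul _).ennreal_ofReal
      _ ≤ ∑' n, (ENNReal.ofReal ((s ^ 2)⁻¹ * ‖c n - hermiteCoeff g n‖ ^ 2)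
          + ENNReal.ofReal (2 * wt n * ‖hermiteCoeff g n‖ ^ 2)) := by
          rw [ENNReal.tsum_add, hI1]
          gcongr
          exact lintegral_norm_sq_schwartz_le g
      _ ≤ ∑' n, (F n + if n ∈ S then 0 else H n) := by
          refine ENNReal.tsum_le_tsum fun n => ?_
          rw [hgc]
          have hw := wt_pos n
          split_ifs with hn
          · rw [add_zero, ← ENNReal.ofReal_add (by positivity) (by positivity)]
            refine ENNReal.ofReal_le_ofReal (le_of_eq ?_)
            have hD : 0 < 1 + s ^ 2 * (2 * wt n) := by positivity
            have e1 : c n - c n / ((1 + s ^ 2 * (2 * wt n) : ℝ) : ℂ)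
                = ((s ^ 2 * (2 * wt n) / (1 + s ^ 2 * (2 * wt n)) : ℝ) : ℂ) * c n := by
              have : ((1 + s ^ 2 * (2 * wt n) : ℝ) : ℂ) ≠ 0 := by exact_mod_cast hD.ne'
              rw [show s ^ 2 * (2 * wt n) = (1 + s ^ 2 * (2 * wt n)) - 1 by ring]
              rw [show (1 : ℝ) + (1 + s ^ 2 * (2 * wt n) - 1) = 1 + s ^ 2 * (2 * wt n) by ring]
              set D := 1 + s ^ 2 * (2 * wt n)
              rw [Complex.ofReal_div, Complex.ofReal_sub]
              field_simp
              push_cast; ring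
            rw [e1, norm_mul, norm_div, Complex.norm_real, Complex.norm_real,
              Real.norm_of_nonneg (by positivity), Real.norm_of_nonneg hD.le]
            field_simp
            ring
          · simp only [sub_zero, norm_zero, H]
            simp
      _ = ∑' n, F n + ∑' n : {n // n ∉ S}, H n := by
          rw [ENNReal.tsum_add]
          congr 1
          refine Eq.trans ?_ (tsum_subtype {n | n ∉ S} H).symm
          refine tsum_congr fun n => ?_
          by_cases hn : n ∈ S <;> simp [hn, Set.indicator]
  have hlim := ENNReal.tendsto_tsum_compl_atTop_zero hH
  have := hlim.const_add (∑' n, F n)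
  rw [add_zero] at this
  exact ge_of_tendsto' this key

/-! ### Moments as continuous functionals -/

/-- `∫ a²/(1 + s² a²) ds = π a`: the square root as an average of resolvents. -/
lemma lintegral_resolvent {a : ℝ} (ha : 0 ≤ a) :
    ∫⁻ s : ℝ, ENNReal.ofReal (a ^ 2 / (1 + s ^ 2 * a ^ 2)) = ENNReal.ofReal (Real.pi * a) := by
  rcases ha.eq_or_lt with rfl | ha
  · simp
  have h1 : ∀ s : ℝ, a ^ 2 / (1 + s ^ 2 * a ^ 2) = a ^ 2 * (1 + (a * s) ^ 2)⁻¹ := fun s => by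
    rw [mul_pow, mul_comm (s ^ 2), div_eq_mul_inv]
  have hint : Integrable fun s : ℝ => (1 + (a * s) ^ 2)⁻¹ :=
    integrable_inv_one_add_sq.comp_mul_left' ha.ne'
  simp only [h1]
  rw [← ofReal_integral_eq_lintegral_ofReal (hint.const_mul _)
    (Eventually.of_forall fun s => by positivity), integral_const_mul,
    Measure.integral_comp_mul_left (fun s : ℝ => (1 + s ^ 2)⁻¹) a, integral_univ_inv_one_add_sq,
    abs_of_pos (by positivity), smul_eq_mul]
  congr 1
  field_simp

/-- The first moment is controlled by the norm of `Σ^{1/2}`. -/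
lemma lintegral_norm_mul_sq_le [NeZero d] {f : Space d → ℂ} (hf : MemLp f 2 volume) :
    ∫⁻ x, ENNReal.ofReal (‖x‖ * ‖f x‖ ^ 2) ≤ 2 * sqSum (1 / 2) (hermiteCoeff f) := by
  have hpi : ENNReal.ofReal Real.pi ≠ 0 := by simp [Real.pi_pos]
  have hX : ∀ x : Space d, ENNReal.ofReal Real.pi * ENNReal.ofReal (‖x‖ * ‖f x‖ ^ 2)
      = ∫⁻ s : ℝ, ENNReal.ofReal (‖x‖ ^ 2 / (1 + s ^ 2 * ‖x‖ ^ 2) * ‖f x‖ ^ 2) := fun x => by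
    simp only [fun s : ℝ => ENNReal.ofReal_mul (q := ‖f x‖ ^ 2)
      (show 0 ≤ ‖x‖ ^ 2 / (1 + s ^ 2 * ‖x‖ ^ 2) by positivity)]
    rw [lintegral_mul_const' _ _ ENNReal.ofReal_ne_top, lintegral_resolvent (norm_nonneg x),
      ← ENNReal.ofReal_mul (by positivity), ← ENNReal.ofReal_mul (by positivity), mul_assoc]
  have hW : ∀ n : Fin d → ℕ, ∫⁻ s : ℝ, ENNReal.ofReal (2 * wt n / (1 + s ^ 2 * (2 * wt n))
        * ‖hermiteCoeff f n‖ ^ 2)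
      = ENNReal.ofReal (Real.pi * Real.sqrt (2 * wt n) * ‖hermiteCoeff f n‖ ^ 2) := fun n => by
    have hw := wt_pos n
    have h2 := Real.sq_sqrt (show 0 ≤ 2 * wt n by positivity)
    have h3 := lintegral_resolvent (Real.sqrt_nonneg (2 * wt n))
    rw [h2] at h3
    simp only [fun s : ℝ => ENNReal.ofReal_mul (q := ‖hermiteCoeff f n‖ ^ 2)
      (show 0 ≤ 2 * wt n / (1 + s ^ 2 * (2 * wt n)) by positivity)]
    rw [lintegral_mul_const' _ _ ENNReal.ofReal_ne_top, h3, ← ENNReal.ofReal_mul (by positivity)]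
  have hmeas : AEMeasurable (Function.uncurry fun (x : Space d) (s : ℝ) =>
      ENNReal.ofReal (‖x‖ ^ 2 / (1 + s ^ 2 * ‖x‖ ^ 2) * ‖f x‖ ^ 2))
      ((volume : Measure (Space d)).prod volume) := by
    refine AEMeasurable.ennreal_ofReal (AEMeasurable.mul ?_ ?_)
    · refine Measurable.aemeasurable ?_
      fun_prop
    · exact (hf.1.norm.aemeasurable.pow_const 2).comp_fst
  -- Both `|x|` and `√(2 wt n)` are averages over `s` of the weights in the resolvent inequality.
  have h : ENNReal.ofReal Real.pi * ∫⁻ x, ENNReal.ofReal (‖x‖ * ‖f x‖ ^ 2)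
      ≤ ENNReal.ofReal Real.pi * (2 * sqSum (1 / 2) (hermiteCoeff f)) := by
    calc ENNReal.ofReal Real.pi * ∫⁻ x, ENNReal.ofReal (‖x‖ * ‖f x‖ ^ 2)
        = ∫⁻ s : ℝ, ∫⁻ x : Space d,
            ENNReal.ofReal (‖x‖ ^ 2 / (1 + s ^ 2 * ‖x‖ ^ 2) * ‖f x‖ ^ 2) := by
          rw [← lintegral_const_mul' _ _ ENNReal.ofReal_ne_top]
          simp only [hX]
          exact lintegral_lintegral_swap hmeas
      _ ≤ ∫⁻ s : ℝ, ∑' n : Fin d → ℕ, ENNReal.ofReal (2 * wt n / (1 + s ^ 2 * (2 * wt n))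
            * ‖hermiteCoeff f n‖ ^ 2) := by
          refine lintegral_mono_ae ?_
          have : ∀ᵐ s : ℝ, s ≠ 0 := by simp [ae_iff]
          filter_upwards [this] with s hs
          exact lintegral_resolvent_weight_le hf hs
      _ = ∑' n : Fin d → ℕ,
            ENNReal.ofReal (Real.pi * Real.sqrt (2 * wt n) * ‖hermiteCoeff f n‖ ^ 2) := by
          rw [lintegral_tsum fun n => by fun_prop]
          simp only [hW]
      _ ≤ ENNReal.ofReal Real.pi * (2 * sqSum (1 / 2) (hermiteCoeff f)) := by
          rw [sqSum, ← ENNReal.tsum_mul_left, ← ENNReal.tsum_mul_left]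
          refine ENNReal.tsum_le_tsum fun n => ?_
          have hw := wt_pos n
          rw [show (2 : ℝ≥0∞) = ENNReal.ofReal 2 by simp, ← ENNReal.ofReal_mul (by norm_num),
            ← ENNReal.ofReal_mul Real.pi_pos.le]
          refine ENNReal.ofReal_le_ofReal ?_
          rw [mul_assoc, ← Real.sqrt_eq_rpow, ← mul_assoc 2]
          have h4 : Real.sqrt (2 * wt n) ≤ 2 * Real.sqrt (wt n) := by
            rw [Real.sqrt_mul (by norm_num)]
            gcongr
            rw [Real.sqrt_le_left (by norm_num)]
            norm_num
          have := Real.pi_pos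
          gcongr
  exact (ENNReal.mul_le_mul_iff_right hpi ENNReal.ofReal_ne_top).mp h

/-- The second moment is controlled by the norm of `Σ¹`. -/
lemma lintegral_norm_sq_mul_sq_le [NeZero d] {f : Space d → ℂ} (hf : MemLp f 2 volume) :
    ∫⁻ x, ENNReal.ofReal (‖x‖ ^ 2 * ‖f x‖ ^ 2) ≤ 2 * sqSum 1 (hermiteCoeff f) := by
  have hlim : ∀ x : Space d, Tendsto (fun k : ℕ => ENNReal.ofReal
      (‖x‖ ^ 2 / (1 + (1 / ((k : ℝ) + 1)) ^ 2 * ‖x‖ ^ 2) * ‖f x‖ ^ 2)) atTop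
      (𝓝 (ENNReal.ofReal (‖x‖ ^ 2 * ‖f x‖ ^ 2))) := fun x => by
    refine (ENNReal.continuous_ofReal.tendsto _).comp ?_
    have h1 : Tendsto (fun k : ℕ => 1 / ((k : ℝ) + 1)) atTop (𝓝 0) :=
      tendsto_one_div_add_atTop_nhds_zero_nat
    have h2 : Tendsto (fun k : ℕ => ‖x‖ ^ 2 / (1 + (1 / ((k : ℝ) + 1)) ^ 2 * ‖x‖ ^ 2) * ‖f x‖ ^ 2)
        atTop (𝓝 (‖x‖ ^ 2 / (1 + 0 ^ 2 * ‖x‖ ^ 2) * ‖f x‖ ^ 2)) := by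
      refine Tendsto.mul_const _ (Tendsto.div tendsto_const_nhds
        (((h1.pow 2).mul_const _).const_add 1)
        (show (1 + 0 ^ 2 * ‖x‖ ^ 2 : ℝ) ≠ 0 by norm_num))
    simpa using h2
  have hle : ∀ k : ℕ, ∫⁻ x, ENNReal.ofReal
      (‖x‖ ^ 2 / (1 + (1 / ((k : ℝ) + 1)) ^ 2 * ‖x‖ ^ 2) * ‖f x‖ ^ 2)
      ≤ 2 * sqSum 1 (hermiteCoeff f) := fun k => by
    refine (lintegral_resolvent_weight_le hf (by positivity)).trans ?_
    rw [sqSum, ← ENNReal.tsum_mul_left]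
    refine ENNReal.tsum_le_tsum fun n => ?_
    have hw := wt_pos n
    rw [show (2 : ℝ≥0∞) = ENNReal.ofReal 2 by simp, ← ENNReal.ofReal_mul (by norm_num),
      Real.rpow_one, show 2 * (wt n * ‖hermiteCoeff f n‖ ^ 2)
        = 2 * wt n * ‖hermiteCoeff f n‖ ^ 2 by ring]
    refine ENNReal.ofReal_le_ofReal ?_
    gcongr
    refine div_le_self (show (0 : ℝ) ≤ 2 * wt n by positivity) ?_
    have : 0 ≤ (1 / ((k : ℝ) + 1)) ^ 2 * (2 * wt n) := by positivity
    linarith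
  calc ∫⁻ x, ENNReal.ofReal (‖x‖ ^ 2 * ‖f x‖ ^ 2)
      = ∫⁻ x, liminf (fun k : ℕ => ENNReal.ofReal
      (‖x‖ ^ 2 / (1 + (1 / ((k : ℝ) + 1)) ^ 2 * ‖x‖ ^ 2) * ‖f x‖ ^ 2)) atTop := by
        simp only [(hlim _).liminf_eq]
    _ ≤ liminf (fun k : ℕ => ∫⁻ x, ENNReal.ofReal
      (‖x‖ ^ 2 / (1 + (1 / ((k : ℝ) + 1)) ^ 2 * ‖x‖ ^ 2) * ‖f x‖ ^ 2)) atTop := by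
        refine lintegral_liminf_le' fun k => AEMeasurable.ennreal_ofReal (AEMeasurable.mul ?_
          (hf.1.norm.aemeasurable.pow_const 2))
        exact Measurable.aemeasurable (by fun_prop)
    _ ≤ 2 * sqSum 1 (hermiteCoeff f) := by
        refine (liminf_le_liminf (Eventually.of_forall hle)).trans ?_
        simp

/-- The moment `∫ ω |f|²` is controlled by the norm of `Σ^s`. -/
def MomentBound (d : ℕ) (s : ℝ) (ω : Space d → ℝ) : Prop :=
  ∀ f : Space d → ℂ, MemLp f 2 volume →
    ∫⁻ x, ENNReal.ofReal (ω x * ‖f x‖ ^ 2) ≤ 2 * sqSum s (hermiteCoeff f)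

section Moment
variable {s : ℝ} {ω ℓ : Space d → ℝ}

lemma MomentBound.integrable (hω : MomentBound d s ω) (hωc : Continuous ω) (h0 : ∀ x, 0 ≤ ω x)
    {f : Space d → ℂ} (hf : MemSigma s f) : Integrable fun x => ω x * ‖f x‖ ^ 2 := by
  rw [memSigma_iff] at hf
  refine ⟨hωc.aestronglyMeasurable.mul (hf.1.1.norm.pow 2), ?_⟩
  rw [hasFiniteIntegral_iff_ofReal (Eventually.of_forall fun x => mul_nonneg (h0 x) (by
    positivity))]
  exact (hω f hf.1).trans_lt (ENNReal.mul_lt_top (by simp) hf.2)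

lemma MomentBound.integrable_of_abs_le (hω : MomentBound d s ω) (hωc : Continuous ω)
    (hℓc : Continuous ℓ) (hℓ : ∀ x, |ℓ x| ≤ ω x)
    {f : Space d → ℂ} (hf : MemSigma s f) : Integrable fun x => ℓ x * ‖f x‖ ^ 2 := by
  have h0 : ∀ x, 0 ≤ ω x := fun x => (abs_nonneg _).trans (hℓ x)
  refine (hω.integrable hωc h0 hf).mono (hℓc.aestronglyMeasurable.mul (hf.1.1.norm.pow 2))
    (Eventually.of_forall fun x => ?_)
  rw [norm_mul, norm_mul, Real.norm_eq_abs, Real.norm_of_nonneg (h0 x)]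
  gcongr
  exact hℓ x

lemma abs_sq_sub_sq_le (a b : ℂ) {δ : ℝ} (hδ : 0 < δ) :
    |‖a‖ ^ 2 - ‖b‖ ^ 2| ≤ (1 + δ⁻¹) * ‖a - b‖ ^ 2 + δ * ‖b‖ ^ 2 := by
  have h1 : |‖a‖ - ‖b‖| ≤ ‖a - b‖ := abs_norm_sub_norm_le a b
  have h2 : ‖a‖ + ‖b‖ ≤ ‖a - b‖ + 2 * ‖b‖ := by
    have := norm_add_le (a - b) b
    rw [sub_add_cancel] at this
    linarith
  have h3 : |‖a‖ ^ 2 - ‖b‖ ^ 2| ≤ ‖a - b‖ * (‖a - b‖ + 2 * ‖b‖) := by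
    rw [sq_sub_sq, abs_mul, mul_comm, abs_of_nonneg (by positivity : 0 ≤ ‖a‖ + ‖b‖)]
    gcongr
  have h4 : 2 * ‖a - b‖ * ‖b‖ ≤ δ⁻¹ * ‖a - b‖ ^ 2 + δ * ‖b‖ ^ 2 := by
    have : δ⁻¹ * ‖a - b‖ ^ 2 + δ * ‖b‖ ^ 2 - 2 * ‖a - b‖ * ‖b‖
        = δ⁻¹ * (‖a - b‖ - δ * ‖b‖) ^ 2 := by field_simp; ring
    have h5 : 0 ≤ δ⁻¹ * (‖a - b‖ - δ * ‖b‖) ^ 2 := by positivity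
    linarith
  nlinarith

/-- Moments are continuous on `Σ^s`. -/
lemma MomentBound.tendsto (hω : MomentBound d s ω) (hωc : Continuous ω)
    (hℓc : Continuous ℓ) (hℓ : ∀ x, |ℓ x| ≤ ω x) {ι : Type*} {l : Filter ι} {u : ι → Space d → ℂ}
    {f : Space d → ℂ} (hu : ∀ i, MemSigma s (u i)) (hf : MemSigma s f)
    (h : Tendsto (fun i => sqSum s (fun n => hermiteCoeff (u i) n - hermiteCoeff f n)) l (𝓝 0)) :
    Tendsto (fun i => ∫ x, ℓ x * ‖u i x‖ ^ 2) l (𝓝 (∫ x, ℓ x * ‖f x‖ ^ 2)) := by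
  have h0 : ∀ x, 0 ≤ ω x := fun x => (abs_nonneg _).trans (hℓ x)
  have hcoef : ∀ i, hermiteCoeff (fun x => u i x - f x)
      = fun n => hermiteCoeff (u i) n - hermiteCoeff f n := fun i =>
    funext fun n => hermiteCoeff_sub (hu i).1 hf.1 n
  set N := ∫ x, ω x * ‖f x‖ ^ 2 with hN
  have hN0 : 0 ≤ N := integral_nonneg fun x => mul_nonneg (h0 x) (by positivity)
  have hbound : ∀ i, ∀ δ : ℝ, 0 < δ →
      sqSum s (fun n => hermiteCoeff (u i) n - hermiteCoeff f n) < ∞ →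
      |(∫ x, ℓ x * ‖u i x‖ ^ 2) - ∫ x, ℓ x * ‖f x‖ ^ 2| ≤ (1 + δ⁻¹) *
        (2 * sqSum s (fun n => hermiteCoeff (u i) n - hermiteCoeff f n)).toReal + δ * N := by
    intro i δ hδ hfin
    have hdm : MemLp (fun x => u i x - f x) 2 volume := (hu i).1.sub hf.1
    have hds : MemSigma s (fun x => u i x - f x) := by
      rw [memSigma_iff, hcoef]; exact ⟨hdm, hfin⟩
    have hid := hω.integrable hωc h0 hds
    have hif := hω.integrable hωc h0 hf
    have hD : ∫ x, ω x * ‖u i x - f x‖ ^ 2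
        ≤ (2 * sqSum s (fun n => hermiteCoeff (u i) n - hermiteCoeff f n)).toReal := by
      rw [← hcoef, integral_eq_lintegral_of_nonneg_ae
        (Eventually.of_forall fun x => mul_nonneg (h0 x) (by positivity)) hid.1]
      refine ENNReal.toReal_mono (ENNReal.mul_lt_top (by simp) ?_).ne (hω _ hdm)
      rw [hcoef]; exact hfin
    rw [← integral_sub (hω.integrable_of_abs_le hωc hℓc hℓ (hu i))
      (hω.integrable_of_abs_le hωc hℓc hℓ hf)]
    calc |∫ x, (ℓ x * ‖u i x‖ ^ 2 - ℓ x * ‖f x‖ ^ 2)|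
        ≤ ∫ x, |ℓ x * ‖u i x‖ ^ 2 - ℓ x * ‖f x‖ ^ 2| := abs_integral_le_integral_abs
      _ ≤ ∫ x, ((1 + δ⁻¹) * (ω x * ‖u i x - f x‖ ^ 2) + δ * (ω x * ‖f x‖ ^ 2)) := by
          refine integral_mono_of_nonneg (Eventually.of_forall fun x => abs_nonneg _)
            ((hid.const_mul _).add (hif.const_mul _)) (Eventually.of_forall fun x => ?_)
          simp only
          rw [← mul_sub, abs_mul]
          calc |ℓ x| * |‖u i x‖ ^ 2 - ‖f x‖ ^ 2|
              ≤ ω x * ((1 + δ⁻¹) * ‖u i x - f x‖ ^ 2 + δ * ‖f x‖ ^ 2) :=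
                mul_le_mul (hℓ x) (abs_sq_sub_sq_le _ _ hδ) (abs_nonneg _) (h0 x)
            _ = _ := by ring
      _ = (1 + δ⁻¹) * (∫ x, ω x * ‖u i x - f x‖ ^ 2) + δ * N := by
          rw [integral_add (hid.const_mul _) (hif.const_mul _), integral_const_mul,
            integral_const_mul]
      _ ≤ _ := by gcongr
  rw [Metric.tendsto_nhds]
  intro ε hε
  set δ := ε / (2 * (N + 1)) with hδ
  have hδ0 : 0 < δ := by positivity
  have hlim : Tendsto (fun i => (1 + δ⁻¹) *
      (2 * sqSum s (fun n => hermiteCoeff (u i) n - hermiteCoeff f n)).toReal) l (𝓝 0) := by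
    have h2 : Tendsto (fun i => 2 * sqSum s (fun n => hermiteCoeff (u i) n - hermiteCoeff f n)) l
        (𝓝 0) := by
      have := ENNReal.Tendsto.const_mul (a := 2) h (Or.inr (by simp))
      simpa using this
    have h3 := ((ENNReal.tendsto_toReal ENNReal.zero_ne_top).comp h2).const_mul (1 + δ⁻¹)
    simpa [Function.comp_def] using h3
  filter_upwards [hlim.eventually (gt_mem_nhds (half_pos hε)),
    h.eventually (gt_mem_nhds (ENNReal.zero_lt_top))] with i hi hfin
  rw [Real.dist_eq]
  refine (hbound i δ hδ0 hfin).trans_lt ?_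
  have h5 : δ * N ≤ ε / 2 := by
    rw [hδ, div_mul_eq_mul_div, div_le_iff₀ (by positivity)]
    nlinarith
  linarith

end Moment

lemma momentBound_norm [NeZero d] : MomentBound d (1 / 2) (fun x => ‖x‖) :=
  fun _ hf => lintegral_norm_mul_sq_le hf

lemma momentBound_norm_sq [NeZero d] : MomentBound d 1 (fun x => ‖x‖ ^ 2) :=
  fun _ hf => lintegral_norm_sq_mul_sq_le hf

/-- The first moments `∫ x_j |f|²`. -/
def moment (f : Space d → ℂ) (j : Fin d) : ℝ := ∫ x, x j * ‖f x‖ ^ 2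

lemma integrable_coord_mul_sq [NeZero d] {f : Space d → ℂ} (hf : MemSigma (1 / 2) f) (j : Fin d) :
    Integrable fun x : Space d => x j * ‖f x‖ ^ 2 :=
  momentBound_norm.integrable_of_abs_le continuous_norm (by fun_prop)
    (fun x => abs_coord_le x j) hf

lemma tendsto_moment [NeZero d] {ι : Type*} {l : Filter ι} {u : ι → Space d → ℂ}
    {f : Space d → ℂ} (hu : ∀ i, MemSigma (1 / 2) (u i)) (hf : MemSigma (1 / 2) f)
    (h : Tendsto (fun i => sqSum (1 / 2) (fun n => hermiteCoeff (u i) n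
      - hermiteCoeff f n)) l (𝓝 0))
    (j : Fin d) : Tendsto (fun i => moment (u i) j) l (𝓝 (moment f j)) :=
  momentBound_norm.tendsto continuous_norm (by fun_prop) (fun x => abs_coord_le x j) hu hf h

lemma moment_congr {f g : Space d → ℂ} (h : f =ᵐ[volume] g) (j : Fin d) :
    moment f j = moment g j := by
  refine integral_congr_ae ?_
  filter_upwards [h] with x hx
  rw [hx]

/-- Moments in a moving frame. -/
lemma Frame.moment_act [NeZero d] (θ : Frame d) {f : Space d → ℂ} (hf : MemSigma (1 / 2) f)
    (j : Fin d) : moment (θ.act f) j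
      = Real.exp (-θ.σ) * moment f j + θ.q j * ∫ x, ‖f x‖ ^ 2 := by
  have hi := (memLp_two_iff_integrable_sq_norm hf.1.1).mp hf.1
  rw [moment, θ.integral_mul_sq_act f (fun x => x j), moment, ← integral_const_mul,
    ← integral_const_mul, ← integral_add ((integrable_coord_mul_sq hf j).const_mul _)
    (hi.const_mul _)]
  refine integral_congr_ae (Eventually.of_forall fun x => ?_)
  simp only [Frame.pt, PiLp.add_apply, PiLp.smul_apply, smul_eq_mul]
  ring

/-! ### Moments under the harmonic oscillator -/

lemma memLp_coord_mul [NeZero d] {f : Space d → ℂ} (hf : MemSigma 1 f) (j : Fin d) :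
    MemLp (fun x => (x j : ℂ) * f x) 2 volume := by
  have hm : AEStronglyMeasurable (fun x : Space d => (x j : ℂ) * f x) volume :=
    AEStronglyMeasurable.mul (Continuous.aestronglyMeasurable (by fun_prop)) hf.1.1
  rw [memLp_two_iff_integrable_sq_norm hm]
  have h := momentBound_norm_sq.integrable_of_abs_le (ℓ := fun x : Space d => x j ^ 2)
    (by fun_prop) (by fun_prop) (fun x => by
      rw [abs_pow]; have := abs_coord_le x j; gcongr) hf
  refine h.congr (Eventually.of_forall fun x => ?_)
  simp only [norm_mul, mul_pow, Complex.norm_real, Real.norm_eq_abs, sq_abs]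

lemma wt_sub_single {n : Fin d → ℕ} {j : Fin d} (h : 1 ≤ n j) :
    wt (n - Pi.single j 1) = wt n - 1 := by
  have h1 := wt_add (n - Pi.single j 1) (Pi.single j 1)
  rw [tsub_add_cancel_of_le ((single_le_iff n j 1).mpr h), len_single] at h1
  push_cast at h1
  linarith

/-- Under the harmonic oscillator, position rotates in phase space (on `Σ¹`). -/
lemma moment_hoFlow_of_memSigma_one [NeZero d] {f : Space d → ℂ} (hf : MemSigma 1 f) (τ : ℝ)
    (j : Fin d) : moment (hoFlow τ f) j
      = Real.cos τ * moment f j + Real.sin τ * moment (hoFlow (Real.pi / 2) f) j := by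
  set r : ℂ := ((Real.sqrt 2 : ℝ) : ℂ)⁻¹
  set c := hermiteCoeff f with hc
  set A : (Fin d → ℕ) → ℂ := fun n =>
    (starRingEnd ℂ) (c n) * (r * ((Real.sqrt (n j + 1) : ℂ) * c (n + Pi.single j 1)))
  set B : (Fin d → ℕ) → ℂ := fun n =>
    (starRingEnd ℂ) (c n) * (r * ((Real.sqrt (n j) : ℂ) * c (n - Pi.single j 1)))
  have key : ∀ τ : ℝ, HasSum (fun n => Complex.exp (-(Complex.I * τ)) * A n
      + Complex.exp (Complex.I * τ) * B n) (moment (hoFlow τ f) j : ℂ) := fun τ => by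
    have hτ := memSigma_hoFlow τ hf
    have h := hasSum_conj_hermiteCoeff_mul hτ.1 (memLp_coord_mul hτ j)
    have hval : ∫ x, (starRingEnd ℂ) (hoFlow τ f x) * ((x j : ℂ) * hoFlow τ f x)
        = (moment (hoFlow τ f) j : ℂ) := by
      rw [moment, ← integral_complex_ofReal]
      refine integral_congr_ae (Eventually.of_forall fun x => ?_)
      simp only
      rw [mul_left_comm, Complex.conj_mul']
      push_cast; rfl
    rw [hval] at h
    have hfun : (fun n => Complex.exp (-(Complex.I * τ)) * A n + Complex.exp (Complex.I * τ) * B n)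
        = fun n => (starRingEnd ℂ) (hermiteCoeff (hoFlow τ f) n)
          * hermiteCoeff (fun x => (x j : ℂ) * hoFlow τ f x) n := by
      funext n
      simp only [hermiteCoeff_coordMul hτ.1, hermiteCoeff_hoFlow τ hf.1, map_mul,
        ← Complex.exp_conj, map_neg, Complex.conj_I, Complex.conj_ofReal, A, B]
      have e1 : wt (n + Pi.single j 1) = wt n + 1 := by rw [wt_add, len_single]; push_cast; rfl
      have e2 : Complex.exp (-(Complex.I * τ)) = Complex.exp (-(-Complex.I * ((τ * wt n : ℝ) : ℂ)))
          * Complex.exp (-(Complex.I * ((τ * wt (n + Pi.single j 1) : ℝ) : ℂ))) := by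
        rw [← Complex.exp_add, e1]
        congr 1
        push_cast; ring
      rw [e2]
      by_cases hn : 1 ≤ n j
      · have e3 : Complex.exp (Complex.I * τ) = Complex.exp (-(-Complex.I * ((τ * wt n : ℝ) : ℂ)))
            * Complex.exp (-(Complex.I * ((τ * wt (n - Pi.single j 1) : ℝ) : ℂ))) := by
          rw [← Complex.exp_add, wt_sub_single hn]
          congr 1
          push_cast; ring
        rw [e3]
        ring
      · have h0 : n j = 0 := by omega
        simp only [h0, Nat.cast_zero, Real.sqrt_zero, Complex.ofReal_zero, zero_mul, mul_zero,
          add_zero]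
        ring
    rw [hfun]
    exact h
  have h2 := ((key 0).mul_left (Real.cos τ : ℂ)).add
    ((key (Real.pi / 2)).mul_left (Real.sin τ : ℂ))
  have hfun : (fun n => Complex.exp (-(Complex.I * τ)) * A n + Complex.exp (Complex.I * τ) * B n)
      = fun n => (Real.cos τ : ℂ) * (Complex.exp (-(Complex.I * (0 : ℝ))) * A n
        + Complex.exp (Complex.I * (0 : ℝ)) * B n)
      + (Real.sin τ : ℂ) * (Complex.exp (-(Complex.I * (Real.pi / 2 : ℝ))) * A n
        + Complex.exp (Complex.I * (Real.pi / 2 : ℝ)) * B n) := by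
    funext n
    have e : ∀ x : ℝ, Complex.exp (Complex.I * x) = Real.cos x + Real.sin x * Complex.I :=
      fun x => by
      rw [mul_comm, Complex.exp_mul_I, Complex.ofReal_cos, Complex.ofReal_sin]
    have e' : ∀ x : ℝ, Complex.exp (-(Complex.I * x)) = Real.cos x - Real.sin x * Complex.I :=
      fun x => by
        have := e (-x)
        rw [Real.cos_neg, Real.sin_neg] at this
        push_cast at this ⊢
        rw [← mul_neg, this]; ring
    rw [e, e', e, e', e, e']
    simp only [Real.cos_zero, Real.sin_zero, Real.cos_pi_div_two, Real.sin_pi_div_two,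
      Complex.ofReal_zero, Complex.ofReal_one]
    ring
  have h3 := (key τ).unique (hfun ▸ h2)
  have h0 : moment (hoFlow 0 f) j = moment f j := moment_congr (hoFlow_zero hf.1) j
  rw [h0] at h3
  exact_mod_cast h3

/-- Functions in `Σ^{1/2}` are limits of functions in `Σ¹`. -/
lemma exists_tendsto_memSigma_one [NeZero d] {f : Space d → ℂ} (hf : MemSigma (1 / 2) f) :
    ∃ g : ℕ → Space d → ℂ, (∀ k, MemSigma 1 (g k)) ∧
      Tendsto (fun k => sqSum (1 / 2) (fun n => hermiteCoeff (g k) n - hermiteCoeff f n)) atTop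
        (𝓝 0) := by
  have hf' := memSigma_iff.mp hf
  set c := hermiteCoeff f with hc
  set m : ℕ → (Fin d → ℕ) → ℝ := fun k n => (1 + (1 / ((k : ℝ) + 1)) * wt n)⁻¹ with hm
  have hm0 : ∀ k n, 0 < m k n := fun k n => by have := wt_pos n; positivity
  have hm1 : ∀ k n, m k n ≤ 1 := fun k n => by
    have := wt_pos n
    refine inv_le_one_of_one_le₀ ?_
    have : 0 ≤ (1 / ((k : ℝ) + 1)) * wt n := by positivity
    linarith
  have hle : ∀ k n, ‖(m k n : ℂ) * c n‖ ≤ ‖c n‖ := fun k n => by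
    rw [norm_mul, Complex.norm_real, Real.norm_of_nonneg (hm0 k n).le]
    exact mul_le_of_le_one_left (norm_nonneg _) (hm1 k n)
  have hex : ∀ k, ∃ g : Space d → ℂ, MemLp g 2 volume ∧ ∀ n, hermiteCoeff g n = (m k n : ℂ) * c n :=
    fun k => exists_hermiteCoeff_eq (Summable.of_nonneg_of_le (fun n => by positivity)
      (fun n => by have := hle k n; gcongr) (hasSum_sq_hermiteCoeff hf.1).summable)
  choose g hg hgc using hex
  refine ⟨g, fun k => memSigma_iff.mpr ⟨hg k, ?_⟩, ?_⟩
  · have : sqSum 1 (hermiteCoeff (g k)) ≤ ENNReal.ofReal (k + 1) * sqSum (1 / 2) c := by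
      rw [sqSum, sqSum, ← ENNReal.tsum_mul_left]
      refine ENNReal.tsum_le_tsum fun n => ?_
      rw [← ENNReal.ofReal_mul (by positivity), hgc]
      refine ENNReal.ofReal_le_ofReal ?_
      have hw := wt_pos n
      rw [norm_mul, Complex.norm_real, Real.norm_of_nonneg (hm0 k n).le, mul_pow, Real.rpow_one,
        ← Real.sqrt_eq_rpow, ← mul_assoc, ← mul_assoc]
      refine mul_le_mul_of_nonneg_right ?_ (by positivity)
      -- `w (1 + w/K)⁻² ≤ K √w`
      have hs := Real.sqrt_pos.mpr hw
      have hs2 := Real.sq_sqrt hw.le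
      set S := Real.sqrt (wt n)
      have hK : (0 : ℝ) < k + 1 := by positivity
      have hK1 : (1 : ℝ) ≤ k + 1 := by linarith [(Nat.cast_nonneg k : (0 : ℝ) ≤ k)]
      set K : ℝ := k + 1
      have hmk : m k n = (1 + 1 / K * wt n)⁻¹ := rfl
      rw [hmk, ← hs2, inv_pow, ← div_eq_mul_inv, div_le_iff₀ (by positivity)]
      have h5 : (1 + 1 / K * S ^ 2) ^ 2 ≥ 1 + 1 / K * (S ^ 2) := by
        have : 0 ≤ 1 / K * S ^ 2 := by positivity
        nlinarith
      have h6 : K * S * (1 + 1 / K * S ^ 2) = S * (K + S ^ 2) := by field_simp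
      have h7 : K * S * (1 + 1 / K * S ^ 2) ≤ K * S * (1 + 1 / K * S ^ 2) ^ 2 := by gcongr
      nlinarith [sq_nonneg (S - 1), mul_pos hs hs]
    exact this.trans_lt (ENNReal.mul_lt_top ENNReal.ofReal_lt_top hf'.2)
  · refine tendsto_sqSum_sub (fun n => ?_) hf'.2 tendsto_const_nhds
      (Eventually.of_forall fun k => ?_)
    · simp only [hgc]
      have h1 : Tendsto (fun k : ℕ => 1 / ((k : ℝ) + 1)) atTop (𝓝 0) :=
        tendsto_one_div_add_atTop_nhds_zero_nat
      have h2 : Tendsto (fun k => m k n) atTop (𝓝 (1 + 0 * wt n)⁻¹) :=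
        ((h1.mul_const _).const_add 1).inv₀ (by norm_num)
      have h3 := ((Complex.continuous_ofReal.tendsto _).comp h2).mul_const (c n)
      simpa using h3
    · rw [sqSum, sqSum]
      refine ENNReal.tsum_le_tsum fun n => ENNReal.ofReal_le_ofReal ?_
      have hw := wt_pos n
      have := hle k n
      rw [hgc]
      gcongr

/-- Under the harmonic oscillator, position rotates in phase space. -/
lemma moment_hoFlow [NeZero d] {f : Space d → ℂ} (hf : MemSigma (1 / 2) f) (τ : ℝ)
    (j : Fin d) : moment (hoFlow τ f) j
      = Real.cos τ * moment f j + Real.sin τ * moment (hoFlow (Real.pi / 2) f) j := by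
  obtain ⟨g, hg, hlim⟩ := exists_tendsto_memSigma_one hf
  have hg2 : ∀ k, MemSigma (1 / 2) (g k) := fun k => (hg k).mono (by norm_num)
  have hfl : ∀ τ : ℝ, Tendsto (fun k => moment (hoFlow τ (g k)) j) atTop
      (𝓝 (moment (hoFlow τ f) j)) := fun τ =>
    tendsto_moment (fun k => memSigma_hoFlow τ (hg2 k)) (memSigma_hoFlow τ hf)
      (by simpa only [fun k => sqSum_hoFlow_sub (1 / 2) τ (hg k).1 hf.1] using hlim) j
  have h1 := ((tendsto_moment hg2 hf hlim j).const_mul (Real.cos τ)).add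
    ((hfl (Real.pi / 2)).const_mul (Real.sin τ))
  refine tendsto_nhds_unique (hfl τ) (h1.congr fun k => ?_)
  exact (moment_hoFlow_of_memSigma_one (hg k) τ j).symm

/-- A quarter turn in phase space turns a momentum shift into a translation. -/
lemma moment_hoFlow_boost [NeZero d] {g : Space d → ℂ} (hg : MemSigma (1 / 2) g) (p : Space d)
    (j : Fin d) : moment (hoFlow (Real.pi / 2) ((Frame.mk 0 p 0 0).act g)) j
      = moment (hoFlow (Real.pi / 2) g) j + p j * ∫ x, ‖g x‖ ^ 2 := by
  have hsin : ∀ t : ℝ, HasDerivAt (fun t => Real.sin t • p) (Real.cos t • p) t := fun t =>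
    (Real.hasDerivAt_sin t).smul_const p
  have hcos : ∀ t : ℝ, HasDerivAt (fun t => Real.cos t • p)
      ((0 : Space d) - (1 : ℝ) • Real.sin t • p) t :=
    fun t => by
      refine ((Real.hasDerivAt_cos t).smul_const p).congr_deriv ?_
      rw [one_smul, zero_sub, neg_smul]
  have hα : ∀ t : ℝ, HasDerivAt (fun t => Real.sin t * Real.cos t * ‖p‖ ^ 2 / 2)
      ((‖Real.cos t • p‖ ^ 2 - 1 * ‖Real.sin t • p‖ ^ 2) / 2) t := fun t => by
    refine ((((Real.hasDerivAt_sin t).mul (Real.hasDerivAt_cos t)).mul_const _).div_const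
      _).congr_deriv ?_
    rw [norm_smul, norm_smul, mul_pow, mul_pow, Real.norm_eq_abs, Real.norm_eq_abs, sq_abs, sq_abs]
    ring
  have hu := isWeakFlow_driven (F := fun _ => (0 : Space d)) zero_lt_one continuous_const hsin hcos
    hα hg.1
  have hv := isWeakFlow_hoFlow 1 ((Frame.mk 0 p 0 0).memLp_act hg.1)
  have hgen : QuadGen.driven 1 (0 : Space d) = QuadGen.harmonic d 1 := rfl
  rw [hgen] at hu
  have huv := hv.unique hu (QuadGen.locallyBounded_of_continuous continuous_const) (by
    rw [mul_zero]
    simp only [Real.log_one, zero_div, Real.sin_zero, Real.cos_zero, zero_smul, one_smul, zero_mul,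
      mul_zero]
    exact (hoFlow_zero ((Frame.mk 0 p 0 0).memLp_act hg.1)).trans
      ((Frame.mk 0 p 0 0).act_congr (hoFlow_zero hg.1)).symm) (Real.pi / 2)
  simp only [one_mul, Real.sqrt_one, Real.sin_pi_div_two, Real.cos_pi_div_two, Real.log_one,
    zero_div, one_smul, zero_smul] at huv
  rw [moment_congr huv, Frame.moment_act _ (memSigma_hoFlow _ hg), integral_sq_hoFlow _ hg.1]
  simp

/-! ### The nonlocal equations as driven oscillators -/

/-- The mass `‖f‖²` in `L²`. -/
def mass (f : Space d → ℂ) : ℝ := ∫ x, ‖f x‖ ^ 2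

/-- The vector of the first moments. -/
def momentVec (f : Space d → ℂ) : Space d := WithLp.toLp 2 (moment f)

@[simp] lemma momentVec_apply (f : Space d → ℂ) (j : Fin d) : momentVec f j = moment f j := rfl

/-- The second moment. -/
def secondMoment (f : Space d → ℂ) : ℝ := ∫ x, ‖x‖ ^ 2 * ‖f x‖ ^ 2

lemma mass_congr {f g : Space d → ℂ} (h : f =ᵐ[volume] g) : mass f = mass g := by
  refine integral_congr_ae ?_
  filter_upwards [h] with x hx
  rw [hx]

lemma momentVec_congr {f g : Space d → ℂ} (h : f =ᵐ[volume] g) : momentVec f = momentVec g := by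
  ext j
  exact moment_congr h j

lemma secondMoment_congr {f g : Space d → ℂ} (h : f =ᵐ[volume] g) :
    secondMoment f = secondMoment g := by
  refine integral_congr_ae ?_
  filter_upwards [h] with x hx
  rw [hx]

lemma memSigma_congr {s : ℝ} {f g : Space d → ℂ} (h : f =ᵐ[volume] g) (hf : MemSigma s f) :
    MemSigma s g :=
  ⟨(memLp_congr_ae h).mp hf.1, by rw [← sigmaNorm_congr h]; exact hf.2⟩

lemma momentBound_one : MomentBound d 0 (fun _ => 1) := fun f hf => by
  rw [sqSum_zero_hermiteCoeff hf]
  have hi := (memLp_two_iff_integrable_sq_norm hf.1).mp hf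
  simp only [one_mul]
  rw [← ofReal_integral_eq_lintegral_ofReal hi (Eventually.of_forall fun x => by positivity)]
  exact le_mul_of_one_le_left' (by norm_num)

lemma integral_inner_mul_sq [NeZero d] {f : Space d → ℂ} (hf : MemSigma (1 / 2) f) (x : Space d) :
    Integrable (fun y : Space d => inner ℝ x y * ‖f y‖ ^ 2) ∧
      ∫ y, inner ℝ x y * ‖f y‖ ^ 2 = inner ℝ x (momentVec f) := by
  have h1 : ∀ y : Space d, inner ℝ x y * ‖f y‖ ^ 2 = ∑ j, x j * (y j * ‖f y‖ ^ 2) := fun y => by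
    rw [PiLp.inner_apply, Finset.sum_mul]
    refine Finset.sum_congr rfl fun j _ => ?_
    simp; ring
  have hi : ∀ j, Integrable fun y : Space d => x j * (y j * ‖f y‖ ^ 2) := fun j =>
    (integrable_coord_mul_sq hf j).const_mul _
  simp only [h1]
  refine ⟨integrable_finsetSum _ fun j _ => hi j, ?_⟩
  rw [integral_finsetSum _ fun j _ => hi j, PiLp.inner_apply]
  refine Finset.sum_congr rfl fun j _ => ?_
  rw [integral_const_mul]
  simp [moment, mul_comm]

lemma potentialH'_eq [NeZero d] {f : Space d → ℂ} (hf : MemSigma (1 / 2) f) (x : Space d) :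
    potentialH' f x = mass f * ‖x‖ ^ 2 - 2 * inner ℝ x (momentVec f) := by
  have hi := (memLp_two_iff_integrable_sq_norm hf.1.1).mp hf.1
  obtain ⟨h1, h2⟩ := integral_inner_mul_sq hf x
  rw [potentialH', ← h2, mass, ← integral_mul_const, ← integral_const_mul,
    ← integral_sub (hi.mul_const _) (h1.const_mul _)]
  refine integral_congr_ae (Eventually.of_forall fun y => ?_)
  simp only
  rw [norm_sub_sq_real]
  ring

lemma potentialH_eq [NeZero d] {f : Space d → ℂ} (hf : MemSigma 1 f) (x : Space d) :
    potentialH f x = mass f * ‖x‖ ^ 2 - 2 * inner ℝ x (momentVec f) + secondMoment f := by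
  have hf2 : MemSigma (1 / 2) f := hf.mono (by norm_num)
  have h3 := momentBound_norm_sq.integrable (by fun_prop) (fun x => by positivity) hf
  have hi := (memLp_two_iff_integrable_sq_norm hf.1.1).mp hf.1
  obtain ⟨h1, -⟩ := integral_inner_mul_sq hf2 x
  have h4 : Integrable fun y : Space d => (‖x - y‖ ^ 2 - ‖y‖ ^ 2) * ‖f y‖ ^ 2 := by
    refine ((hi.mul_const (‖x‖ ^ 2)).sub (h1.const_mul 2)).congr (Eventually.of_forall fun y => ?_)
    simp only [Pi.sub_apply]
    rw [norm_sub_sq_real]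
    ring
  rw [← potentialH'_eq hf2, potentialH, potentialH', secondMoment, ← integral_add h4 h3]
  refine integral_congr_ae (Eventually.of_forall fun y => ?_)
  simp only
  ring

/-- The generator of `2i u_t = -Δ u + κ|x|² u - 2 F·x u - 2 r u`. -/
def QuadGen.schr (κ : ℝ) (F : Space d) (r : ℝ) : QuadGen d := ⟨1 / 2, -(κ / 2), 0, r, F, 0⟩

lemma QuadGen.schr_op_apply (κ : ℝ) (F : Space d) (r : ℝ) (ψ : 𝓢(Space d, ℂ)) (x : Space d) :
    2 * Complex.I * (QuadGen.schr κ F r).op ψ x = -(Laplacian.laplacian ψ) x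
      + ((κ * ‖x‖ ^ 2 - 2 * inner ℝ x F - 2 * r : ℝ) : ℂ) * ψ x := by
  have hlap : (Laplacian.laplacian ψ) x = ∑ j, partialD j (partialD j ψ) x := by
    have := SchwartzMap.laplacian_eq_sum (EuclideanSpace.basisFun (Fin d) ℝ) ψ
    have h2 := congrArg (fun χ : 𝓢(Space d, ℂ) => χ x) this
    simp only [sum_apply] at h2
    rw [h2]
    refine Finset.sum_congr rfl fun j _ => ?_
    simp [partialD]
  have hn : ((‖x‖ ^ 2 : ℝ) : ℂ) = ∑ j, (x j : ℂ) * (x j : ℂ) := by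
    rw [EuclideanSpace.real_norm_sq_eq]
    push_cast
    exact Finset.sum_congr rfl fun j _ => pow_two _
  have hin : ((inner ℝ x F : ℝ) : ℂ) = ∑ j, (F j : ℂ) * (x j : ℂ) := by
    rw [PiLp.inner_apply]
    simp
  rw [QuadGen.op_apply]
  simp only [QuadGen.schr]
  rw [Complex.ofReal_sub, Complex.ofReal_sub, Complex.ofReal_mul, Complex.ofReal_mul 2,
    Complex.ofReal_mul 2, hn, hin, hlap]
  have hL : ∀ r ψ S : ℂ, 2 * Complex.I * (Complex.I * r * ψ + S) = 2 * Complex.I * S - 2 * r * ψ :=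
    fun r ψ S => by linear_combination (2 * r * ψ) * Complex.I_mul_I
  have hR : ∀ L N E r ψ : ℂ, -L + (κ * N - 2 * E - 2 * r) * ψ
      = (-L + κ * N * ψ - 2 * E * ψ) - 2 * r * ψ := fun L N E r ψ => by ring
  push_cast
  rw [hL, hR]
  congr 1
  simp only [Finset.mul_sum, Finset.sum_mul, ← Finset.sum_neg_distrib, ← Finset.sum_add_distrib,
    ← Finset.sum_sub_distrib]
  refine Finset.sum_congr rfl fun j _ => ?_
  simp only [PiLp.zero_apply, Complex.ofReal_zero]
  linear_combination (partialD j (partialD j ψ) x - κ * ((x j : ℂ) * ((x j : ℂ) * ψ x))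
    + 2 * F j * ((x j : ℂ) * ψ x)) * Complex.I_mul_I

/-- Equations with a quadratic potential, in terms of quadratic generators. -/
lemma solvesEquation_iff {lam η : ℝ} {W : (Space d → ℂ) → Space d → ℝ} {u : ℝ → Space d → ℂ}
    {Y : ℝ → ℝ} (hW : ∀ t x, W (u t) x
      = mass (u t) * ‖x‖ ^ 2 - 2 * inner ℝ x (momentVec (u t)) + Y t) :
    SolvesEquation lam η W u ↔ ∀ (ψ : 𝓢(Space d, ℂ)) (t : ℝ),
      HasDerivAt (fun τ => ∫ x, u τ x * ψ x)
        (∫ x, u t x * (QuadGen.schr (lam + η * mass (u t)) (η • momentVec (u t))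
          (-(η * Y t / 2))).op ψ x) t := by
  have hI : 2 * Complex.I ≠ 0 := by simp
  unfold SolvesEquation
  refine forall₂_congr fun ψ t => ?_
  have hval : ∫ x, u t x * (-(Laplacian.laplacian ψ) x
        + ((lam * ‖x‖ ^ 2 + η * W (u t) x : ℝ) : ℂ) * ψ x)
      = 2 * Complex.I * ∫ x, u t x * (QuadGen.schr (lam + η * mass (u t)) (η • momentVec (u t))
          (-(η * Y t / 2))).op ψ x := by
    rw [← integral_const_mul]
    refine integral_congr_ae (Eventually.of_forall fun x => ?_)
    simp only
    rw [mul_left_comm, QuadGen.schr_op_apply, hW, inner_smul_right]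
    congr 4
    ring
  rw [hval]
  constructor
  · intro h
    have := h.const_mul (2 * Complex.I)⁻¹
    simpa only [inv_mul_cancel_left₀ hI] using this
  · intro h
    exact h.const_mul _

/-- Multiplication by a time-dependent phase changes the constant term of the generator. -/
lemma IsWeakFlow.phase {κ : ℝ → ℝ} {F : ℝ → Space d} {r β β' : ℝ → ℝ} {u : ℝ → Space d → ℂ}
    (hu : IsWeakFlow (fun t => QuadGen.schr (κ t) (F t) (r t)) u)
    (hβ : ∀ t, HasDerivAt β (β' t) t) :
    IsWeakFlow (fun t => QuadGen.schr (κ t) (F t) (r t + β' t))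
      (fun t x => Complex.exp (Complex.I * β t) * u t x) := by
  have hn : ∀ t, ‖Complex.exp (Complex.I * β t)‖ = 1 := fun t => by
    rw [mul_comm, Complex.norm_exp_ofReal_mul_I]
  refine ⟨fun t => (hu.memLp t).const_mul _, fun T => ?_, fun ψ t => ?_⟩
  · simp only [norm_mul, hn, one_mul]
    exact hu.bounded T
  · have h1 : HasDerivAt (fun τ => Complex.exp (Complex.I * β τ))
        (Complex.exp (Complex.I * β t) * (Complex.I * β' t)) t :=
      ((hβ t).ofReal_comp.const_mul Complex.I).cexp
    simp only [mul_assoc, integral_const_mul]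
    refine (h1.mul (hu.hasDerivAt ψ t)).congr_deriv ?_
    have hop : (QuadGen.schr (κ t) (F t) (r t + β' t)).op ψ
        = (QuadGen.schr (κ t) (F t) (r t)).op ψ + (Complex.I * β' t) • ψ := by
      simp only [QuadGen.op, QuadGen.schr]
      push_cast
      rw [mul_add, add_smul]
      abel
    rw [hop]
    simp only [add_apply, smul_apply, smul_eq_mul, mul_add]
    rw [integral_add (integrable_mul_of_memLp (hu.memLp t) (memLp_schwartz _))]
    · have : ∫ x, u t x * (Complex.I * β' t * ψ x) = Complex.I * β' t * ∫ x, u t x * ψ x := by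
        rw [← integral_const_mul]
        congr 1; funext x; ring
      rw [this]
      ring
    · have := integrable_mul_of_memLp (hu.memLp t) (memLp_schwartz ((Complex.I * β' t) • ψ))
      simpa only [smul_apply, smul_eq_mul] using this

lemma IsWeakFlow.congr {G : ℝ → QuadGen d} {u v : ℝ → Space d → ℂ} (hu : IsWeakFlow G u)
    (h : ∀ t, u t =ᵐ[volume] v t) : IsWeakFlow G v := by
  have hI : ∀ t (ψ : 𝓢(Space d, ℂ)), ∫ x, u t x * ψ x = ∫ x, v t x * ψ x := fun t ψ => by
    refine integral_congr_ae ?_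
    filter_upwards [h t] with x hx
    rw [hx]
  have hm : ∀ t, mass (u t) = mass (v t) := fun t => mass_congr (h t)
  refine ⟨fun t => (memLp_congr_ae (h t)).mp (hu.memLp t), fun T => ?_, fun ψ t => ?_⟩
  · obtain ⟨S, hS⟩ := hu.bounded T
    exact ⟨S, fun t ht => (hm t).symm.trans_le (hS t ht)⟩
  · have := hu.hasDerivAt ψ t
    simpa only [hI] using this

lemma QuadGen.locallyBounded_schr {κ r : ℝ → ℝ} {F : ℝ → Space d} (hκ : Continuous κ)
    (hF : Continuous F) (hr : Continuous r) :
    QuadGen.LocallyBounded fun t => QuadGen.schr (κ t) (F t) (r t) := by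
  refine QuadGen.locallyBounded_of_continuous ?_
  simp only [QuadGen.size, QuadGen.schr]
  fun_prop

section Continuity
variable [NeZero d] {u : ℝ → Space d → ℂ}

lemma ContinuousInSigma.continuous_mass {s : ℝ} (hs : 0 ≤ s) (hu : ContinuousInSigma s u) :
    Continuous fun t => mass (u t) := by
  have hu0 := continuousInSigma_iff.mp (hu.mono hs)
  refine continuous_iff_continuousAt.mpr fun t => ?_
  have := momentBound_one.tendsto (ℓ := fun _ => 1) continuous_const continuous_const
    (by simp) hu0.1 (hu0.1 t) (hu0.2 t)
  simp only [one_mul] at this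
  exact this

lemma ContinuousInSigma.continuous_momentVec (hu : ContinuousInSigma (1 / 2) u) :
    Continuous fun t => momentVec (u t) := by
  have hu0 := continuousInSigma_iff.mp hu
  refine (PiLp.continuous_toLp 2 _).comp (continuous_pi fun j => ?_)
  exact continuous_iff_continuousAt.mpr fun t => tendsto_moment hu0.1 (hu0.1 t) (hu0.2 t) j

lemma ContinuousInSigma.continuous_secondMoment (hu : ContinuousInSigma 1 u) :
    Continuous fun t => secondMoment (u t) := by
  have hu0 := continuousInSigma_iff.mp hu
  refine continuous_iff_continuousAt.mpr fun t => ?_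
  exact momentBound_norm_sq.tendsto (ℓ := fun x => ‖x‖ ^ 2) (by fun_prop) (by fun_prop)
    (fun x => by rw [abs_of_nonneg (by positivity)]) hu0.1 (hu0.1 t) (hu0.2 t)

lemma ContinuousInSigma.exists_mass_le {s : ℝ} (hs : 0 ≤ s) (hu : ContinuousInSigma s u) (T : ℝ) :
    ∃ S : ℝ, ∀ t ∈ Set.Ioo (-T) T, ∫ x, ‖u t x‖ ^ 2 ≤ S := by
  obtain ⟨B, hB⟩ := (isCompact_Icc (a := -T) (b := T)).bddAbove_image
    (hu.continuous_mass hs).continuousOn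
  exact ⟨B, fun t ht => hB (Set.mem_image_of_mem _ (Set.Ioo_subset_Icc_self ht))⟩

/-- Solutions of the modified equation are weak solutions of a driven oscillator whose
frequency is constant by conservation of mass. -/
lemma IsSolutionH'.isWeakFlow {lam η : ℝ} (hu : IsSolutionH' lam η u) :
    IsWeakFlow (fun t => QuadGen.driven (lam + η * mass (u 0)) (η • momentVec (u t))) u ∧
      ∀ t, mass (u t) = mass (u 0) := by
  obtain ⟨hc, heq⟩ := hu
  rw [solvesEquation_iff (Y := fun _ => 0)
    (fun t x => by rw [potentialH'_eq (hc.1 t), add_zero])] at heq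
  have hflow : IsWeakFlow (fun t =>
      QuadGen.driven (lam + η * mass (u t)) (η • momentVec (u t))) u :=
    ⟨fun t => (hc.1 t).1, hc.exists_mass_le (by norm_num), fun ψ t => by
      have := heq ψ t
      simp only [mul_zero, zero_div, neg_zero] at this
      exact this⟩
  have hm : ∀ t, mass (u t) = mass (u 0) := fun t =>
    hflow.integral_sq_eq (QuadGen.locallyBounded_driven
      (continuous_const.add (continuous_const.mul (hc.continuous_mass (by norm_num))))
      (hc.continuous_momentVec.const_smul η)) hc t
  refine ⟨?_, hm⟩
  simpa only [hm] using hflow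

lemma isSolutionH'_of_isWeakFlow {lam η : ℝ} (hc : ContinuousInSigma (1 / 2) u)
    (hu : IsWeakFlow (fun t => QuadGen.driven (lam + η * mass (u t)) (η • momentVec (u t))) u) :
    IsSolutionH' lam η u := by
  refine ⟨hc, ?_⟩
  rw [solvesEquation_iff (Y := fun _ => 0) (fun t x => by rw [potentialH'_eq (hc.1 t), add_zero])]
  intro ψ t
  simp only [mul_zero, zero_div, neg_zero]
  exact hu.hasDerivAt ψ t

end Continuity

/-! ### Classical trajectories -/

lemma exists_antideriv {E : Type*} [NormedAddCommGroup E] [NormedSpace ℝ E] [CompleteSpace E]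
    {h : ℝ → E} (hh : Continuous h) (a : E) :
    ∃ α : ℝ → E, α 0 = a ∧ ∀ t, HasDerivAt α (h t) t := by
  refine ⟨fun t => a + ∫ τ in (0 : ℝ)..t, h τ, by simp, fun t => ?_⟩
  exact (intervalIntegral.integral_hasDerivAt_right (hh.intervalIntegrable _ _)
    (hh.stronglyMeasurableAtFilter _ _) hh.continuousAt).const_add a

/-- A trajectory `(q, p)` in phase space of the oscillator `q'' = F - μ q`. -/
structure IsTrajectory {E : Type*} [NormedAddCommGroup E] [NormedSpace ℝ E] (μ : ℝ) (F : ℝ → E)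
    (q p : ℝ → E) : Prop where
  q_deriv : ∀ t, HasDerivAt q (p t) t
  p_deriv : ∀ t, HasDerivAt p (F t - μ • q t) t

section Trajectory
variable {E : Type*}

lemma IsTrajectory.continuous_q [NormedAddCommGroup E] [NormedSpace ℝ E] {μ : ℝ} {F q p : ℝ → E}
    (h : IsTrajectory μ F q p) : Continuous q :=
  continuous_iff_continuousAt.mpr fun t => (h.q_deriv t).continuousAt

lemma IsTrajectory.continuous_p [NormedAddCommGroup E] [NormedSpace ℝ E] {μ : ℝ} {F q p : ℝ → E}
    (h : IsTrajectory μ F q p) : Continuous p :=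
  continuous_iff_continuousAt.mpr fun t => (h.p_deriv t).continuousAt

/-- Variation of constants. -/
lemma exists_isTrajectory [NormedAddCommGroup E] [NormedSpace ℝ E] [CompleteSpace E] {μ : ℝ}
    (hμ : 0 ≤ μ) {F : ℝ → E} (hF : Continuous F) (q₀ p₀ : E) :
    ∃ q p : ℝ → E, q 0 = q₀ ∧ p 0 = p₀ ∧ IsTrajectory μ F q p := by
  rcases hμ.eq_or_lt with rfl | hμ
  · obtain ⟨p, hp0, hp⟩ := exists_antideriv hF p₀
    obtain ⟨q, hq0, hq⟩ := exists_antideriv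
      (continuous_iff_continuousAt.mpr fun t => (hp t).continuousAt) q₀
    exact ⟨q, p, hq0, hp0, hq, by simpa using hp⟩
  set ω := Real.sqrt μ
  have hω : 0 < ω := Real.sqrt_pos.mpr hμ
  have hω2 : μ = ω * ω := (Real.mul_self_sqrt hμ.le).symm
  -- the solution is `cos (ωt) A + sin (ωt) / ω B` with `A' = - sin (ωt) / ω F`, `B' = cos (ωt) F`
  obtain ⟨A, hA0, hA⟩ := exists_antideriv (h := fun t => (-(Real.sin (ω * t) / ω)) • F t)
    (by fun_prop) q₀
  obtain ⟨B, hB0, hB⟩ := exists_antideriv (h := fun t => Real.cos (ω * t) • F t)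
    (by fun_prop) p₀
  have hl : ∀ t : ℝ, HasDerivAt (fun t => ω * t) ω t := fun t => by
    simpa using (hasDerivAt_id t).const_mul ω
  have hc : ∀ t : ℝ, HasDerivAt (fun t => Real.cos (ω * t)) (-Real.sin (ω * t) * ω) t := fun t =>
    (hl t).cos
  have hs : ∀ t : ℝ, HasDerivAt (fun t => Real.sin (ω * t)) (Real.cos (ω * t) * ω) t := fun t =>
    (hl t).sin
  refine ⟨fun t => Real.cos (ω * t) • A t + (Real.sin (ω * t) / ω) • B t,
    fun t => (-Real.sin (ω * t) * ω) • A t + Real.cos (ω * t) • B t, by simp [hA0], by simp [hB0],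
    fun t => ?_, fun t => ?_⟩
  · refine (((hc t).smul (hA t)).add (((hs t).div_const ω).smul (hB t))).congr_deriv ?_
    rw [mul_div_cancel_right₀ _ hω.ne']
    module
  · refine ((((hs t).neg.mul_const ω).smul (hA t)).add ((hc t).smul (hB t))).congr_deriv ?_
    have h1 : -Real.sin (ω * t) * ω * -(Real.sin (ω * t) / ω) = 1 - Real.cos (ω * t) ^ 2 := by
      rw [← Real.sin_sq]; field_simp
    have h2 : μ * (Real.sin (ω * t) / ω) = Real.sin (ω * t) * ω := by
      rw [hω2]; field_simp
    simp only [Pi.neg_apply]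
    rw [smul_add, smul_smul, smul_smul, smul_smul, smul_smul, h1, h2, hω2]
    module

variable [NormedAddCommGroup E] [InnerProductSpace ℝ E] {μ : ℝ} {q p q' p' : ℝ → E}

lemma IsTrajectory.energy_eq (h : IsTrajectory μ (fun _ => 0) q p) (t : ℝ) :
    ‖p t‖ ^ 2 + μ * ‖q t‖ ^ 2 = ‖p 0‖ ^ 2 + μ * ‖q 0‖ ^ 2 := by
  have hd : ∀ t, HasDerivAt (fun t => ‖p t‖ ^ 2 + μ * ‖q t‖ ^ 2) 0 t := fun t => by
    refine ((h.p_deriv t).norm_sq.add ((h.q_deriv t).norm_sq.const_mul μ)).congr_deriv ?_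
    rw [zero_sub, inner_neg_right, inner_smul_right, real_inner_comm]
    ring
  exact is_const_of_deriv_eq_zero (fun t => (hd t).differentiableAt) (fun t => (hd t).deriv) t 0

lemma IsTrajectory.sq_norm_p_le (hμ : 0 ≤ μ) (h : IsTrajectory μ (fun _ => 0) q p) (t : ℝ) :
    ‖p t‖ ^ 2 ≤ ‖p 0‖ ^ 2 + μ * ‖q 0‖ ^ 2 := by
  rw [← h.energy_eq t]
  exact le_add_of_nonneg_right (by positivity)

lemma IsTrajectory.unique (hμ : 0 ≤ μ) (h : IsTrajectory μ (fun _ => 0) q p)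
    (h' : IsTrajectory μ (fun _ => 0) q' p') (hq : q 0 = q' 0) (hp : p 0 = p' 0) (t : ℝ) :
    q t = q' t := by
  have hd : IsTrajectory μ (fun _ => 0) (fun t => q t - q' t) (fun t => p t - p' t) :=
    ⟨fun t => (h.q_deriv t).sub (h'.q_deriv t), fun t =>
      ((h.p_deriv t).sub (h'.p_deriv t)).congr_deriv (by module)⟩
  have hp0 : ∀ t, p t - p' t = 0 := fun t => by
    have := hd.sq_norm_p_le hμ t
    simp only [hq, hp, sub_self, norm_zero] at this
    have h2 : ‖p t - p' t‖ ^ 2 = 0 := le_antisymm (by simpa using this) (by positivity)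
    simpa using h2
  have := is_const_of_deriv_eq_zero (fun t => (hd.q_deriv t).differentiableAt)
    (fun t => by rw [(hd.q_deriv t).deriv, hp0]) t 0
  simp only [hq, sub_self] at this
  exact sub_eq_zero.mp this

end Trajectory

/-! ### The profile at rest and the initial value problem of the modified equation -/

/-- The centre of mass. -/
def meanPos (f : Space d → ℂ) : Space d := (mass f)⁻¹ • momentVec f

/-- The function `f`, translated to its centre of mass and dilated by `e^σ`. -/
def centred (σ : ℝ) (f : Space d → ℂ) : Space d → ℂ :=
  (Frame.mk (-(Real.exp σ • meanPos f)) 0 0 (-σ)).act f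

/-- The mean momentum of `centred σ f`, defined on `Σ^{1/2}` as the centre of mass after a quarter
of a period of the harmonic oscillator. -/
def meanMom (σ : ℝ) (f : Space d → ℂ) : Space d := meanPos (hoFlow (Real.pi / 2) (centred σ f))

/-- The function `f` in the dilated frame in which its mean position and momentum vanish. -/
def restProfile (σ : ℝ) (f : Space d → ℂ) : Space d → ℂ :=
  (Frame.mk 0 (-(meanMom σ f)) 0 0).act (centred σ f)

/-- The frame that takes `restProfile σ f` back to `f`. -/
def restFrame (σ : ℝ) (f : Space d → ℂ) : Frame d :=
  ⟨meanPos f, Real.exp σ • meanMom σ f, inner ℝ (Real.exp σ • meanMom σ f) (meanPos f), σ⟩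

lemma restFrame_act (σ : ℝ) (f : Space d → ℂ) : (restFrame σ f).act (restProfile σ f) = f := by
  funext x
  have h1 : Real.exp (-σ) • (Real.exp σ • (x - meanPos f) + Real.exp σ • meanPos f) = x := by
    rw [← smul_add, smul_smul, ← Real.exp_add, neg_add_cancel, Real.exp_zero, one_smul,
      sub_add_cancel]
  have h2 : ((Real.exp (σ * d / 2) : ℝ) : ℂ) * (Real.exp (-σ * d / 2) : ℝ) = 1 := by
    rw [← Complex.ofReal_mul, ← Real.exp_add]
    norm_num [neg_mul, neg_div]
  have h3 : Complex.exp (Complex.I * ((inner ℝ (Real.exp σ • meanMom σ f) x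
      - inner ℝ (Real.exp σ • meanMom σ f) (meanPos f) : ℝ) : ℂ))
      * Complex.exp (Complex.I * ((-inner ℝ (meanMom σ f) (Real.exp σ • (x - meanPos f)) : ℝ) : ℂ))
      = 1 := by
    rw [← Complex.exp_add, ← mul_add, ← Complex.ofReal_add, ← inner_sub_right, inner_smul_left,
      inner_smul_right]
    simp
  simp only [Frame.act, restFrame, restProfile, centred, sub_zero, zero_mul, zero_div,
    Real.exp_zero,
    Complex.ofReal_one, mul_one, one_smul, inner_neg_left, inner_zero_left, sub_neg_eq_add,
    Complex.ofReal_zero, mul_zero, Complex.exp_zero, one_mul, h1]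
  linear_combination (Complex.exp (Complex.I * ((inner ℝ (Real.exp σ • meanMom σ f) x
      - inner ℝ (Real.exp σ • meanMom σ f) (meanPos f) : ℝ) : ℂ))
      * Complex.exp (Complex.I * ((-inner ℝ (meanMom σ f) (Real.exp σ • (x - meanPos f)) : ℝ) : ℂ))
      * f x) * h2 + f x * h3

lemma Frame.mass_act (θ : Frame d) (f : Space d → ℂ) : mass (θ.act f) = mass f :=
  θ.integral_sq_act f

lemma mass_hoFlow (τ : ℝ) {f : Space d → ℂ} (hf : MemLp f 2 volume) :
    mass (hoFlow τ f) = mass f := integral_sq_hoFlow τ hf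

lemma mass_restProfile (σ : ℝ) (f : Space d → ℂ) : mass (restProfile σ f) = mass f := by
  rw [restProfile, Frame.mass_act, centred, Frame.mass_act]

lemma memSigma_centred [NeZero d] {s : ℝ} (hs : 0 ≤ s) (σ : ℝ) {f : Space d → ℂ}
    (hf : MemSigma s f) : MemSigma s (centred σ f) := Frame.memSigma_act hs _ hf

lemma memSigma_restProfile [NeZero d] {s : ℝ} (hs : 0 ≤ s) (σ : ℝ) {f : Space d → ℂ}
    (hf : MemSigma s f) : MemSigma s (restProfile σ f) :=
  Frame.memSigma_act hs _ (memSigma_centred hs σ hf)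

/-- The profile at rest stays at rest under the harmonic oscillator. -/
lemma moment_hoFlow_restProfile [NeZero d] (σ : ℝ) {f : Space d → ℂ} (hf : MemSigma (1 / 2) f)
    (hm : mass f ≠ 0) (τ : ℝ) (j : Fin d) : moment (hoFlow τ (restProfile σ f)) j = 0 := by
  have hh := memSigma_centred (by norm_num) σ hf
  have h1 : moment (centred σ f) j = 0 := by
    have h := Frame.moment_act (Frame.mk (-(Real.exp σ • meanPos f)) 0 0 (-σ)) hf j
    rw [centred, h]
    change Real.exp (- -σ) * moment f j + (-(Real.exp σ * ((mass f)⁻¹ * moment f j))) * mass f = 0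
    rw [neg_neg]
    field_simp
    ring
  have h2 : moment (restProfile σ f) j = 0 := by
    rw [restProfile, Frame.moment_act _ hh, h1]
    simp
  have h3 : moment (hoFlow (Real.pi / 2) (restProfile σ f)) j = 0 := by
    rw [restProfile, moment_hoFlow_boost hh]
    change _ + (-((mass (hoFlow (Real.pi / 2) (centred σ f)))⁻¹
      * moment (hoFlow (Real.pi / 2) (centred σ f)) j)) * mass (centred σ f) = 0
    rw [mass_hoFlow _ hh.1]
    have : mass (centred σ f) ≠ 0 := by rwa [centred, Frame.mass_act]
    field_simp
    ring
  rw [moment_hoFlow (memSigma_restProfile (by norm_num) σ hf), h2, h3]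
  simp

/-- A profile at rest, transported along a trajectory, has its centre of mass on the trajectory. -/
lemma momentVec_act_hoFlow_restProfile [NeZero d] (σ : ℝ) {f : Space d → ℂ}
    (hf : MemSigma (1 / 2) f) (hm : mass f ≠ 0) (τ : ℝ) (θ : Frame d) :
    momentVec (θ.act (hoFlow τ (restProfile σ f))) = mass f • θ.q := by
  have hr := memSigma_restProfile (by norm_num) σ hf
  ext j
  rw [momentVec_apply, θ.moment_act (memSigma_hoFlow τ hr), moment_hoFlow_restProfile σ hf hm]
  change _ + _ * mass (hoFlow τ (restProfile σ f)) = _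
  rw [mass_hoFlow _ hr.1, mass_restProfile]
  simp [mul_comm]

/-- The evolution of `f` along a trajectory `(q, p)` with action `α`: the profile at rest evolves
under the harmonic oscillator, and is transported along the trajectory. -/
def transported (κ : ℝ) (q p : ℝ → Space d) (α : ℝ → ℝ) (f : Space d → ℂ) (t : ℝ) : Space d → ℂ :=
  (Frame.mk (q t) (p t) (α t) (Real.log κ / 4)).act
    (hoFlow (Real.sqrt κ * t) (restProfile (Real.log κ / 4) f))

section Transported
variable [NeZero d] {κ : ℝ} {q p : ℝ → Space d} {α : ℝ → ℝ} {f : Space d → ℂ}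

lemma mass_transported (hf : MemSigma (1 / 2) f) (t : ℝ) : mass (transported κ q p α f t) =
    mass f := by
  rw [transported, Frame.mass_act, mass_hoFlow _ (memSigma_restProfile (by norm_num) _ hf).1,
    mass_restProfile]

lemma momentVec_transported (hf : MemSigma (1 / 2) f) (hm : mass f ≠ 0) (t : ℝ) :
    momentVec (transported κ q p α f t) = mass f • q t :=
  momentVec_act_hoFlow_restProfile _ hf hm _ _

lemma transported_zero (hf : MemSigma (1 / 2) f) (hq : q 0 = meanPos f)
    (hp : p 0 = Real.exp (Real.log κ / 4) • meanMom (Real.log κ / 4) f)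
    (hα : α 0 = inner ℝ (p 0) (q 0)) : transported κ q p α f 0 =ᵐ[volume] f := by
  have h : restFrame (Real.log κ / 4) f = Frame.mk (q 0) (p 0) (α 0) (Real.log κ / 4) := by
    rw [hα, hp, hq]; rfl
  rw [transported, mul_zero, ← h]
  conv_rhs => rw [← restFrame_act (Real.log κ / 4) f]
  exact (restFrame _ f).act_congr (hoFlow_zero (memSigma_restProfile (by norm_num) _ hf).1)

lemma isWeakFlow_transported (hκ : 0 < κ) (hf : MemSigma (1 / 2) f) {F : ℝ → Space d}
    (hF : Continuous F) (h : IsTrajectory κ F q p)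
    (hα : ∀ t, HasDerivAt α ((‖p t‖ ^ 2 - κ * ‖q t‖ ^ 2) / 2) t) :
    IsWeakFlow (fun t => QuadGen.driven κ (F t)) (transported κ q p α f) :=
  isWeakFlow_driven hκ hF h.q_deriv h.p_deriv hα (memSigma_restProfile (by norm_num) _ hf).1

end Transported

lemma exists_action {κ : ℝ} {F q p : ℝ → Space d} (h : IsTrajectory κ F q p) (a : ℝ) :
    ∃ α : ℝ → ℝ, α 0 = a ∧ ∀ t, HasDerivAt α ((‖p t‖ ^ 2 - κ * ‖q t‖ ^ 2) / 2) t := by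
  have h1 := h.continuous_q
  have h2 := h.continuous_p
  exact exists_antideriv (by fun_prop) a

section Cauchy
variable [NeZero d] {lam η : ℝ} {f : Space d → ℂ}

/-- Existence for the modified equation. -/
lemma exists_isSolutionH' (hlam : 0 ≤ lam) (hf : MemSigma (1 / 2) f) (hm : mass f ≠ 0) {κ : ℝ}
    (hκ : κ = lam + η * mass f) (hκ0 : 0 < κ) :
    ∃ (q p : ℝ → Space d) (α : ℝ → ℝ), q 0 = meanPos f ∧
      p 0 = Real.exp (Real.log κ / 4) • meanMom (Real.log κ / 4) f ∧
      IsTrajectory lam (fun _ => 0) q p ∧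
      IsSolutionH' lam η (transported κ q p α f) ∧ transported κ q p α f 0 =ᵐ[volume] f ∧
      ∀ s, 0 ≤ s → MemSigma s f → ContinuousInSigma s (transported κ q p α f) := by
  obtain ⟨q, p, hq, hp, hqp⟩ := exists_isTrajectory hlam (F := fun _ => (0 : Space d))
    continuous_const (meanPos f) (Real.exp (Real.log κ / 4) • meanMom (Real.log κ / 4) f)
  have hqc := hqp.continuous_q
  -- The force `η * mass f` of the interaction cancels against the part `η * mass f` of `κ`.
  have hqp' : IsTrajectory κ (fun t => (η * mass f) • q t) q p :=
    ⟨hqp.q_deriv, fun t => (hqp.p_deriv t).congr_deriv (by rw [hκ]; module)⟩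
  obtain ⟨α, hα0, hα⟩ := exists_action hqp' (inner ℝ (p 0) (q 0))
  have hF : Continuous fun t => (η * mass f) • q t := by fun_prop
  have hflow := isWeakFlow_transported hκ0 hf hF hqp' hα
  have h0 := transported_zero (κ := κ) hf hq hp hα0
  have hc : ∀ s, 0 ≤ s → MemSigma s f → ContinuousInSigma s (transported κ q p α f) :=
    fun s hs hfs => hflow.continuousInSigma (QuadGen.locallyBounded_driven continuous_const hF) hs
      (memSigma_congr h0.symm hfs)
  refine ⟨q, p, α, hq, hp, hqp, isSolutionH'_of_isWeakFlow (hc _ (by norm_num) hf) ?_, h0, hc⟩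
  simp only [mass_transported hf, momentVec_transported hf hm, smul_smul, ← hκ]
  exact hflow

/-- The centre of mass of a solution follows a trajectory of the oscillator `q'' = -lam q`. -/
lemma IsSolutionH'.exists_isTrajectory {w : ℝ → Space d → ℂ} (hw : IsSolutionH' lam η w)
    (h0 : w 0 =ᵐ[volume] f) (hm : mass f ≠ 0) {κ : ℝ} (hκ : κ = lam + η * mass f) (hκ0 : 0 < κ) :
    ∃ q p : ℝ → Space d, q 0 = meanPos f ∧
      p 0 = Real.exp (Real.log κ / 4) • meanMom (Real.log κ / 4) f ∧
      IsTrajectory lam (fun _ => 0) q p ∧ ∀ t, momentVec (w t) = mass f • q t := by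
  have hf : MemSigma (1 / 2) f := memSigma_congr h0 (hw.1.1 0)
  obtain ⟨hflow, -⟩ := hw.isWeakFlow
  rw [mass_congr h0, ← hκ] at hflow
  have hF : Continuous fun t => η • momentVec (w t) := hw.1.continuous_momentVec.const_smul η
  obtain ⟨q, p, hq, hp, hqp⟩ := NonlocalNLS.exists_isTrajectory hκ0.le hF (meanPos f)
    (Real.exp (Real.log κ / 4) • meanMom (Real.log κ / 4) f)
  obtain ⟨α, hα0, hα⟩ := exists_action hqp (inner ℝ (p 0) (q 0))
  -- The solution coincides with the transported profile, whose moment is known.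
  have hmom : ∀ t, momentVec (w t) = mass f • q t := fun t => by
    rw [momentVec_congr (hflow.unique (isWeakFlow_transported hκ0 hf hF hqp hα)
      (QuadGen.locallyBounded_driven continuous_const hF)
      (h0.trans (transported_zero hf hq hp hα0).symm) t), momentVec_transported hf hm]
  refine ⟨q, p, hq, hp, ⟨hqp.q_deriv, fun t => (hqp.p_deriv t).congr_deriv ?_⟩, hmom⟩
  rw [hmom, hκ]
  module

/-- Uniqueness for the modified equation. -/
lemma IsSolutionH'.unique (hlam : 0 ≤ lam) {v w : ℝ → Space d → ℂ} (hv : IsSolutionH' lam η v)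
    (hw : IsSolutionH' lam η w) (h0 : v 0 =ᵐ[volume] w 0) (hm : mass (w 0) ≠ 0)
    (hκ : 0 < lam + η * mass (w 0)) (t : ℝ) : v t =ᵐ[volume] w t := by
  obtain ⟨q, p, hq, hp, hqp, hqv⟩ := hv.exists_isTrajectory h0 hm rfl hκ
  obtain ⟨q', p', hq', hp', hqp', hqw⟩ := hw.exists_isTrajectory (ae_eq_refl _) hm rfl hκ
  have hmom : ∀ t, momentVec (v t) = momentVec (w t) := fun t => by
    rw [hqv, hqw, hqp.unique hlam hqp' (hq.trans hq'.symm) (hp.trans hp'.symm)]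
  obtain ⟨hfv, -⟩ := hv.isWeakFlow
  obtain ⟨hfw, -⟩ := hw.isWeakFlow
  simp only [hmom, mass_congr h0] at hfv
  exact hfv.unique hfw (QuadGen.locallyBounded_driven continuous_const
    (hw.1.continuous_momentVec.const_smul η)) h0 t

end Cauchy

/-! ### The standing profiles -/

/-- The profile `M^{1/2} Ω_n`. -/
def eigenProfile (M : ℝ) (n : Fin d → ℕ) (x : Space d) : ℂ :=
  ((Real.sqrt M : ℝ) : ℂ) * (hermiteFun n x : ℂ)

lemma eigenProfile_eq (M : ℝ) (n : Fin d → ℕ) :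
    eigenProfile M n = ((Real.sqrt M : ℂ) • hermiteS n : 𝓢(Space d, ℂ)) := by
  funext x; simp [eigenProfile]

lemma memLp_eigenProfile (M : ℝ) (n : Fin d → ℕ) : MemLp (eigenProfile M n) 2 volume := by
  rw [eigenProfile_eq]; exact memLp_schwartz _

lemma hermiteCoeff_eigenProfile_self (M : ℝ) (n : Fin d → ℕ) :
    hermiteCoeff (eigenProfile M n) n = Real.sqrt M := by
  classical
  unfold eigenProfile
  rw [hermiteCoeff_const_mul, hermiteCoeff_hermiteFun, if_pos rfl, mul_one]

lemma hermiteCoeff_eigenProfile_of_ne (M : ℝ) {n k : Fin d → ℕ} (h : n ≠ k) :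
    hermiteCoeff (eigenProfile M n) k = 0 := by
  classical
  unfold eigenProfile
  rw [hermiteCoeff_const_mul, hermiteCoeff_hermiteFun, if_neg h, mul_zero]

lemma memSigma_eigenProfile (s M : ℝ) (n : Fin d → ℕ) : MemSigma s (eigenProfile M n) := by
  rw [memSigma_iff]
  refine ⟨memLp_eigenProfile M n, ?_⟩
  rw [sqSum, tsum_eq_single n fun k hk => by simp [hermiteCoeff_eigenProfile_of_ne M hk.symm]]
  exact ENNReal.ofReal_lt_top

lemma mass_eigenProfile {M : ℝ} (hM : 0 ≤ M) (n : Fin d → ℕ) : mass (eigenProfile M n) = M := by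
  rw [mass, ← (hasSum_sq_hermiteCoeff (memLp_eigenProfile M n)).tsum_eq,
    tsum_eq_single n fun k hk => by simp [hermiteCoeff_eigenProfile_of_ne M hk.symm],
    hermiteCoeff_eigenProfile_self, Complex.norm_real, Real.norm_eq_abs, sq_abs, Real.sq_sqrt hM]

lemma add_single_ne (n : Fin d → ℕ) (j : Fin d) {k : ℕ} (hk : k ≠ 0) : n ≠ n + Pi.single j k :=
  fun h => by
    have := congrFun h j
    simp at this
    exact hk this

/-- The coefficients of `x_j M^{1/2} Ω_n` adjacent to `n`. -/
lemma hermiteCoeff_coord_mul_eigenProfile (M : ℝ) (n : Fin d → ℕ) (j : Fin d) :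
    let c := hermiteCoeff fun x : Space d => (x j : ℂ) * eigenProfile M n x
    c n = 0 ∧ c (n + Pi.single j 1)
        = ((Real.sqrt 2 : ℝ) : ℂ)⁻¹ * (Real.sqrt (n j + 1) * Real.sqrt M) ∧
      (1 ≤ n j → c (n - Pi.single j 1)
        = ((Real.sqrt 2 : ℝ) : ℂ)⁻¹ * (Real.sqrt (n j) * Real.sqrt M)) := by
  have hg := memLp_eigenProfile M n
  refine ⟨?_, ?_, fun hn => ?_⟩
  · rw [hermiteCoeff_coordMul hg, hermiteCoeff_eigenProfile_of_ne M (add_single_ne n j one_ne_zero)]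
    rcases Nat.eq_zero_or_pos (n j) with h | h
    · simp [h]
    · have h2 : n ≠ n - Pi.single j 1 := fun h3 => by
        have := congrFun h3 j
        simp at this
        omega
      rw [hermiteCoeff_eigenProfile_of_ne M h2]
      simp
  · rw [hermiteCoeff_coordMul hg, add_tsub_cancel_right, hermiteCoeff_eigenProfile_self,
      add_assoc n, ← Pi.single_add, hermiteCoeff_eigenProfile_of_ne M
        (add_single_ne n j (by norm_num))]
    simp
  · have hs : n - Pi.single j 1 + Pi.single j 1 = n :=
      tsub_add_cancel_of_le ((single_le_iff n j 1).mpr hn)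
    have hne : n ≠ n - Pi.single j 1 - Pi.single j 1 := fun h3 => by
      have := congrFun h3 j
      simp at this
      omega
    rw [hermiteCoeff_coordMul hg, hs, hermiteCoeff_eigenProfile_self,
      hermiteCoeff_eigenProfile_of_ne M hne]
    have : (((n - Pi.single j 1 : Fin d → ℕ) j : ℕ) : ℝ) + 1 = n j := by
      simp [Nat.cast_sub hn]
    rw [this]
    simp

lemma norm_sq_eigenProfile (M : ℝ) (n : Fin d → ℕ) (x : Space d) :
    ((‖eigenProfile M n x‖ ^ 2 : ℝ) : ℂ) = Real.sqrt M * (eigenProfile M n x * hermiteFun n x) := by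
  rw [eigenProfile, ← Complex.ofReal_mul, Complex.norm_real, Real.norm_eq_abs, sq_abs]
  push_cast
  ring

lemma moment_eigenProfile (M : ℝ) (n : Fin d → ℕ) (j : Fin d) :
    moment (eigenProfile M n) j = 0 := by
  have h : ((moment (eigenProfile M n) j : ℝ) : ℂ)
      = Real.sqrt M * hermiteCoeff (fun x : Space d => (x j : ℂ) * eigenProfile M n x) n := by
    rw [moment, ← integral_complex_ofReal, hermiteCoeff, ← integral_const_mul]
    congr 1; funext x
    rw [Complex.ofReal_mul, norm_sq_eigenProfile]
    ring
  rw [(hermiteCoeff_coord_mul_eigenProfile M n j).1, mul_zero] at h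
  exact_mod_cast h

/-- The virial identity for the Hermite functions. -/
lemma secondMoment_eigenProfile [NeZero d] {M : ℝ} (hM : 0 ≤ M) (n : Fin d → ℕ) :
    secondMoment (eigenProfile M n) = M * wt n := by
  have hg := memSigma_eigenProfile 1 M n
  have hL : ∀ j, MemLp (fun x : Space d => (x j : ℂ) * eigenProfile M n x) 2 volume :=
    fun j => memLp_coord_mul hg j
  have hi : ∀ j, Integrable fun x : Space d => (x j) ^ 2 * ‖eigenProfile M n x‖ ^ 2 := fun j =>
    momentBound_norm_sq.integrable_of_abs_le (by fun_prop) (by fun_prop) (fun x => by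
      rw [abs_pow]; have := abs_coord_le x j; gcongr) hg
  have hj : ∀ j : Fin d, ∫ x : Space d, (x j) ^ 2 * ‖eigenProfile M n x‖ ^ 2
      = M * ((n j : ℝ) + 1 / 2) := fun j => by
    have h : ((∫ x : Space d, (x j) ^ 2 * ‖eigenProfile M n x‖ ^ 2 : ℝ) : ℂ) = Real.sqrt M *
        hermiteCoeff (fun x : Space d => (x j : ℂ) * ((x j : ℂ) * eigenProfile M n x)) n := by
      rw [← integral_complex_ofReal, hermiteCoeff, ← integral_const_mul]
      congr 1; funext x
      rw [Complex.ofReal_mul, norm_sq_eigenProfile]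
      push_cast
      ring
    obtain ⟨-, h1, h2⟩ := hermiteCoeff_coord_mul_eigenProfile M n j
    have hr : ((Real.sqrt 2 : ℝ) : ℂ)⁻¹ * ((Real.sqrt 2 : ℝ) : ℂ)⁻¹ = 1 / 2 := by
      rw [← mul_inv, ← Complex.ofReal_mul, Real.mul_self_sqrt (by norm_num)]; norm_num
    have hs1 : (Real.sqrt (n j + 1) : ℂ) * Real.sqrt (n j + 1) = (n j : ℂ) + 1 := by
      rw [← Complex.ofReal_mul, Real.mul_self_sqrt (by positivity)]; push_cast; rfl
    have hs0 : (Real.sqrt (n j) : ℂ) * Real.sqrt (n j) = (n j : ℂ) := by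
      rw [← Complex.ofReal_mul, Real.mul_self_sqrt (by positivity)]; push_cast; rfl
    have hsM : (Real.sqrt M : ℂ) * Real.sqrt M = (M : ℂ) := by
      rw [← Complex.ofReal_mul, Real.mul_self_sqrt hM]
    have h3 : (Real.sqrt (n j) : ℂ)
        * hermiteCoeff (fun x : Space d => (x j : ℂ) * eigenProfile M n x) (n - Pi.single j 1)
        = ((Real.sqrt 2 : ℝ) : ℂ)⁻¹ * ((n j : ℂ) * Real.sqrt M) := by
      rcases Nat.eq_zero_or_pos (n j) with h | h
      · simp [h]
      · rw [h2 h, ← hs0]; ring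
    rw [hermiteCoeff_coordMul (hL j), h1, h3] at h
    have : ((∫ x : Space d, (x j) ^ 2 * ‖eigenProfile M n x‖ ^ 2 : ℝ) : ℂ)
        = ((M * ((n j : ℝ) + 1 / 2) : ℝ) : ℂ) := by
      rw [h]
      push_cast
      linear_combination (Real.sqrt M * Real.sqrt M * (Real.sqrt (n j + 1) * Real.sqrt (n j + 1)
        + (n j : ℂ))) * hr + (1 / 2 : ℂ) * Real.sqrt M * Real.sqrt M * hs1
        + ((n j : ℂ) + 1 / 2) * hsM
    exact Complex.ofReal_injective this
  have hx : ∀ x : Space d, ‖x‖ ^ 2 * ‖eigenProfile M n x‖ ^ 2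
      = ∑ j, (x j) ^ 2 * ‖eigenProfile M n x‖ ^ 2 := fun x => by
    rw [EuclideanSpace.real_norm_sq_eq, Finset.sum_mul]
  simp only [secondMoment, hx]
  rw [integral_finsetSum _ fun j _ => hi j]
  simp only [hj]
  rw [← Finset.mul_sum, Finset.sum_add_distrib, wt, len]
  simp only [Finset.sum_const, Finset.card_univ, Fintype.card_fin, nsmul_eq_mul]
  push_cast
  ring

lemma hoFlow_eigenProfile (M τ : ℝ) (n : Fin d → ℕ) : hoFlow τ (eigenProfile M n) =ᵐ[volume]
    fun x => Complex.exp (-(Complex.I * ((τ * wt n : ℝ) : ℂ))) * eigenProfile M n x := by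
  have hg := memLp_eigenProfile M n
  refine ae_eq_of_hermiteCoeff_eq (memLp_hoFlow τ hg) (hg.const_mul _) fun k => ?_
  rw [hermiteCoeff_hoFlow τ hg, hermiteCoeff_const_mul]
  by_cases h : n = k
  · rw [h]
  · rw [hermiteCoeff_eigenProfile_of_ne M h, mul_zero, mul_zero]

lemma moment_hoFlow_eigenProfile (M τ : ℝ) (n : Fin d → ℕ) (j : Fin d) :
    moment (hoFlow τ (eigenProfile M n)) j = 0 := by
  rw [moment_congr (hoFlow_eigenProfile M τ n), ← moment_eigenProfile M n j]
  refine integral_congr_ae (Eventually.of_forall fun x => ?_)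
  simp only
  rw [norm_mul, ← mul_neg, ← Complex.ofReal_neg, mul_comm Complex.I, Complex.norm_exp_ofReal_mul_I,
    one_mul]

/-- The rescaled Hermite functions are dilated Hermite functions. -/
lemma frame_act_eigenProfile {κ : ℝ} (hκ : 0 < κ) (M : ℝ) (n : Fin d → ℕ) :
    (Frame.mk 0 0 0 (Real.log κ / 4)).act (eigenProfile M n)
      = fun x => ((Real.sqrt M * hermiteFunScaled κ n x : ℝ) : ℂ) := by
  have h1 : Real.exp (Real.log κ / 4) = κ ^ (1 / 4 : ℝ) := by
    rw [Real.rpow_def_of_pos hκ]; ring_nf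
  have h2 : Real.exp (Real.log κ / 4 * d / 2) = κ ^ ((d : ℝ) / 8) := by
    rw [Real.rpow_def_of_pos hκ]; ring_nf
  funext x
  simp only [Frame.act, eigenProfile, hermiteFunScaled, h1, h2]
  simp
  ring

/-! ### Orbital stability for the modified equation -/

lemma Frame.tendsto_dist {ι : Type*} {l : Filter ι} {θ : ι → Frame d} {θ₀ : Frame d}
    (hq : Tendsto (fun i => (θ i).q) l (𝓝 θ₀.q)) (hp : Tendsto (fun i => (θ i).p) l (𝓝 θ₀.p))
    (hα : Tendsto (fun i => (θ i).α) l (𝓝 θ₀.α)) (hσ : Tendsto (fun i => (θ i).σ) l (𝓝 θ₀.σ)) :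
    Tendsto (fun i => θ₀.dist (θ i)) l (𝓝 0) := by
  have h := (((hq.sub_const θ₀.q).norm.add (hp.sub_const θ₀.p).norm).add
    (hα.sub_const θ₀.α).abs).add (hσ.sub_const θ₀.σ).abs
  simpa [Frame.dist] using h

lemma Frame.size_le_add_dist (θ₀ θ : Frame d) : θ.size ≤ θ₀.size + θ₀.dist θ := by
  have h1 := norm_le_norm_add_norm_sub' θ.q θ₀.q
  have h2 := norm_le_norm_add_norm_sub' θ.p θ₀.p
  have h3 := abs_sub_abs_le_abs_sub θ.α θ₀.α
  have h4 := abs_sub_abs_le_abs_sub θ.σ θ₀.σ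
  unfold Frame.size Frame.dist
  linarith

lemma sqSum_hermiteCoeff_sub {s : ℝ} {f g : Space d → ℂ} (hf : MemLp f 2 volume)
    (hg : MemLp g 2 volume) : sqSum s (hermiteCoeff fun x => f x - g x)
      = sqSum s (fun n => hermiteCoeff f n - hermiteCoeff g n) :=
  congrArg _ (funext fun n => hermiteCoeff_sub hf hg n)

section Limits
variable [NeZero d] {s : ℝ} {ι : Type*} {l : Filter ι} {u : ι → Space d → ℂ} {f : Space d → ℂ}

/-- Moving frames act jointly continuously on `Σ^s`. -/
lemma Frame.tendsto_sqSum_act_sub_act [l.IsCountablyGenerated] (hs : 0 ≤ s) {θ : ι → Frame d}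
    {θ₀ : Frame d} (hθ : Tendsto (fun i => θ₀.dist (θ i)) l (𝓝 0))
    (hu : ∀ i, MemSigma s (u i)) (hf : MemSigma s f)
    (h : Tendsto (fun i => sqSum s (fun n => hermiteCoeff (u i) n - hermiteCoeff f n)) l (𝓝 0)) :
    Tendsto (fun i => sqSum s (fun n => hermiteCoeff ((θ i).act (u i)) n
      - hermiteCoeff (θ₀.act f) n)) l (𝓝 0) := by
  obtain ⟨K, hK0, hK⟩ := Frame.exists_sqSum_act_le_self (d := d) hs (θ₀.size + 1)
  have h1 := Frame.tendsto_sqSum_act_sub hs hθ (Frame.memSigma_act hs θ₀ hf) hf.1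
  have h2 : Tendsto (fun i => 2 * (ENNReal.ofReal K *
      sqSum s (fun n => hermiteCoeff (u i) n - hermiteCoeff f n))
      + 2 * sqSum s (fun n => hermiteCoeff ((θ i).act f) n - hermiteCoeff (θ₀.act f) n))
      l (𝓝 0) := by
    have := (ENNReal.Tendsto.const_mul (a := 2) (ENNReal.Tendsto.const_mul (a := ENNReal.ofReal K) h
      (Or.inr (by simp))) (Or.inr (by simp))).add (ENNReal.Tendsto.const_mul (a := 2) h1
      (Or.inr (by simp)))
    simpa using this
  refine tendsto_of_tendsto_of_tendsto_of_le_of_le' tendsto_const_nhds h2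
    (Eventually.of_forall fun _ => zero_le) ?_
  filter_upwards [hθ.eventually_le_const one_pos] with i hi
  refine (sqSum_sub_le s _ (hermiteCoeff ((θ i).act f)) _).trans ?_
  gcongr
  have h3 := hK (θ i) ((θ₀.size_le_add_dist (θ i)).trans (by gcongr)) (fun x => u i x - f x)
    ((hu i).1.sub hf.1)
  rwa [Frame.act_sub, sqSum_hermiteCoeff_sub ((θ i).memLp_act (hu i).1) ((θ i).memLp_act hf.1),
    sqSum_hermiteCoeff_sub (hu i).1 hf.1] at h3

lemma tendsto_sqSum_of_le {s s' : ℝ} (hs : s ≤ s') {c : ι → (Fin d → ℕ) → ℂ}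
    (h : Tendsto (fun i => sqSum s' (c i)) l (𝓝 0)) : Tendsto (fun i => sqSum s (c i)) l (𝓝 0) := by
  have := ENNReal.Tendsto.const_mul (a := ENNReal.ofReal (2 ^ (s' - s))) h (Or.inr (by simp))
  rw [mul_zero] at this
  exact tendsto_of_tendsto_of_tendsto_of_le_of_le tendsto_const_nhds this (fun _ => zero_le)
    fun i => sqSum_mono hs _

lemma tendsto_mass (hs : 0 ≤ s) (hu : ∀ i, MemSigma s (u i)) (hf : MemSigma s f)
    (h : Tendsto (fun i => sqSum s (fun n => hermiteCoeff (u i) n - hermiteCoeff f n)) l (𝓝 0)) :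
    Tendsto (fun i => mass (u i)) l (𝓝 (mass f)) := by
  have := momentBound_one.tendsto (ℓ := fun _ => 1) continuous_const continuous_const
    (by simp) (fun i => (hu i).mono hs) (hf.mono hs) (tendsto_sqSum_of_le hs h)
  simp only [one_mul] at this
  exact this

lemma tendsto_meanPos (hs : 1 / 2 ≤ s) (hu : ∀ i, MemSigma s (u i)) (hf : MemSigma s f)
    (hm : mass f ≠ 0)
    (h : Tendsto (fun i => sqSum s (fun n => hermiteCoeff (u i) n - hermiteCoeff f n)) l (𝓝 0)) :
    Tendsto (fun i => meanPos (u i)) l (𝓝 (meanPos f)) := by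
  refine ((tendsto_mass (by linarith) hu hf h).inv₀ hm).smul ?_
  exact ((PiLp.continuous_toLp 2 _).tendsto _).comp (tendsto_pi_nhds.mpr fun j =>
    tendsto_moment (fun i => (hu i).mono hs) (hf.mono hs) (tendsto_sqSum_of_le hs h) j)

variable [l.IsCountablyGenerated] {σ : ι → ℝ} {σ₀ : ℝ}

lemma tendsto_centred (hs : 1 / 2 ≤ s) (hu : ∀ i, MemSigma s (u i)) (hf : MemSigma s f)
    (hm : mass f ≠ 0) (hσ : Tendsto σ l (𝓝 σ₀))
    (h : Tendsto (fun i => sqSum s (fun n => hermiteCoeff (u i) n - hermiteCoeff f n)) l (𝓝 0)) :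
    Tendsto (fun i => sqSum s (fun n => hermiteCoeff (centred (σ i) (u i)) n
      - hermiteCoeff (centred σ₀ f) n)) l (𝓝 0) := by
  refine Frame.tendsto_sqSum_act_sub_act (by linarith) (Frame.tendsto_dist ?_ tendsto_const_nhds
    tendsto_const_nhds hσ.neg) hu hf h
  exact (((Real.continuous_exp.tendsto _).comp hσ).smul (tendsto_meanPos hs hu hf hm h)).neg

lemma tendsto_meanMom (hs : 1 / 2 ≤ s) (hu : ∀ i, MemSigma s (u i)) (hf : MemSigma s f)
    (hm : mass f ≠ 0) (hσ : Tendsto σ l (𝓝 σ₀))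
    (h : Tendsto (fun i => sqSum s (fun n => hermiteCoeff (u i) n - hermiteCoeff f n)) l (𝓝 0)) :
    Tendsto (fun i => meanMom (σ i) (u i)) l (𝓝 (meanMom σ₀ f)) := by
  have hs0 : 0 ≤ s := by linarith
  have hc : ∀ i, MemSigma s (centred (σ i) (u i)) := fun i => memSigma_centred hs0 _ (hu i)
  have hc0 : MemSigma s (centred σ₀ f) := memSigma_centred hs0 _ hf
  refine tendsto_meanPos hs (fun i => memSigma_hoFlow _ (hc i)) (memSigma_hoFlow _ hc0) ?_ ?_
  · rwa [mass_hoFlow _ hc0.1, centred, Frame.mass_act]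
  · simp only [sqSum_hoFlow_sub s _ (hc _).1 hc0.1]
    exact tendsto_centred hs hu hf hm hσ h

lemma tendsto_restProfile (hs : 1 / 2 ≤ s) (hu : ∀ i, MemSigma s (u i)) (hf : MemSigma s f)
    (hm : mass f ≠ 0) (hσ : Tendsto σ l (𝓝 σ₀))
    (h : Tendsto (fun i => sqSum s (fun n => hermiteCoeff (u i) n - hermiteCoeff f n)) l (𝓝 0)) :
    Tendsto (fun i => sqSum s (fun n => hermiteCoeff (restProfile (σ i) (u i)) n
      - hermiteCoeff (restProfile σ₀ f) n)) l (𝓝 0) := by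
  have hs0 : 0 ≤ s := by linarith
  exact Frame.tendsto_sqSum_act_sub_act hs0 (Frame.tendsto_dist tendsto_const_nhds
    (tendsto_meanMom hs hu hf hm hσ h).neg tendsto_const_nhds tendsto_const_nhds)
    (fun i => memSigma_centred hs0 _ (hu i)) (memSigma_centred hs0 _ hf)
    (tendsto_centred hs hu hf hm hσ h)

end Limits

section Profile
variable [NeZero d] {M : ℝ} (σ : ℝ) (n : Fin d → ℕ)

lemma meanPos_act_eigenProfile : meanPos ((Frame.mk 0 0 0 σ).act (eigenProfile M n)) = 0 := by
  have : momentVec ((Frame.mk 0 0 0 σ).act (eigenProfile M n)) = 0 := by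
    ext j
    rw [momentVec_apply, Frame.moment_act _ (memSigma_eigenProfile _ M n), moment_eigenProfile]
    simp
  rw [meanPos, this, smul_zero]

lemma centred_act_eigenProfile :
    centred σ ((Frame.mk 0 0 0 σ).act (eigenProfile M n)) = eigenProfile M n := by
  have h2 : ((Real.exp (-σ * d / 2) : ℝ) : ℂ) * (Real.exp (σ * d / 2) : ℝ) = 1 := by
    rw [← Complex.ofReal_mul, ← Real.exp_add]
    norm_num [neg_mul, neg_div]
  rw [centred, meanPos_act_eigenProfile]
  funext x
  simp only [Frame.act, smul_zero, neg_zero, sub_zero, inner_zero_left, Complex.ofReal_zero,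
    mul_zero, Complex.exp_zero, one_mul, smul_smul, ← Real.exp_add, add_neg_cancel,
    Real.exp_zero, one_smul]
  rw [← mul_assoc, h2, one_mul]

lemma meanMom_act_eigenProfile : meanMom σ ((Frame.mk 0 0 0 σ).act (eigenProfile M n)) = 0 := by
  have : momentVec (hoFlow (Real.pi / 2) (eigenProfile M n)) = 0 := by
    ext j
    rw [momentVec_apply, moment_hoFlow_eigenProfile]
    simp
  rw [meanMom, centred_act_eigenProfile, meanPos, this, smul_zero]

lemma restProfile_act_eigenProfile :
    restProfile σ ((Frame.mk 0 0 0 σ).act (eigenProfile M n)) = eigenProfile M n := by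
  rw [restProfile, meanMom_act_eigenProfile, centred_act_eigenProfile, neg_zero]
  exact Frame.one_act _

end Profile

/-- Undoing the translation and a phase in a moving frame. -/
lemma cexp_mul_act_sub_neg (q p : Space d) (α σ β : ℝ) (G : Space d → ℂ) (x : Space d) :
    Complex.exp (Complex.I * ((β + α - inner ℝ p q : ℝ) : ℂ)) * (Frame.mk q p α σ).act G (x - -q)
      = Complex.exp (Complex.I * (β : ℂ)) * (Frame.mk 0 p 0 σ).act G x := by
  simp only [Frame.act, sub_neg_eq_add, add_sub_cancel_right, sub_zero, ← mul_assoc]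
  rw [← Complex.exp_add, ← Complex.exp_add, ← mul_add, ← mul_add, ← Complex.ofReal_add,
    ← Complex.ofReal_add, inner_add_right]
  congr 5
  ring

/-- Up to a phase, the harmonic oscillator preserves the distance to a Hermite function. -/
lemma sqSum_eigenProfile_sub_hoFlow (s M τ : ℝ) (n : Fin d → ℕ) {g : Space d → ℂ}
    (hg : MemLp g 2 volume) :
    sqSum s (fun k => hermiteCoeff (eigenProfile M n) k
      - Complex.exp (Complex.I * ((τ * wt n : ℝ) : ℂ)) * hermiteCoeff (hoFlow τ g) k)
      = sqSum s (fun k => hermiteCoeff g k - hermiteCoeff (eigenProfile M n) k) := by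
  refine sqSum_congr fun k => ?_
  rw [hermiteCoeff_hoFlow τ hg, norm_sub_rev]
  by_cases h : n = k
  · rw [← h, ← mul_assoc, ← Complex.exp_add, add_neg_cancel, Complex.exp_zero, one_mul]
  · rw [hermiteCoeff_eigenProfile_of_ne M h, sub_zero, sub_zero, norm_mul, norm_mul, ← mul_neg,
      ← Complex.ofReal_neg, mul_comm Complex.I, mul_comm Complex.I, Complex.norm_exp_ofReal_mul_I,
      Complex.norm_exp_ofReal_mul_I, one_mul, one_mul]

/-- In a frame with small momentum and almost the right scale, the evolution of a profile
close to a Hermite function stays close to the rescaled Hermite function, modulo phases and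
translations. -/
lemma exists_forall_sigmaNorm_le [NeZero d] {s : ℝ} (hs : 0 ≤ s) (M σ : ℝ) (n : Fin d → ℕ) {ε : ℝ}
    (hε : 0 < ε) : ∃ ρ : ℝ, 0 < ρ ∧ ∃ r : ℝ≥0∞, 0 < r ∧ ∀ (q p : Space d) (α σ' τ : ℝ)
      (g : Space d → ℂ), MemLp g 2 volume → ‖p‖ + |σ' - σ| < ρ →
      sqSum s (fun k => hermiteCoeff g k - hermiteCoeff (eigenProfile M n) k) ≤ r →
      ∃ (θ : ℝ) (y : Space d), sigmaNorm s (fun x => (Frame.mk 0 0 0 σ).act (eigenProfile M n) x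
        - Complex.exp (Complex.I * θ) * (Frame.mk q p α σ').act (hoFlow τ g) (x - y))
        ≤ ENNReal.ofReal ε := by
  set θ₀ : Frame d := ⟨0, 0, 0, σ⟩ with hθ₀
  set G := eigenProfile M n
  have hG : MemSigma s G := memSigma_eigenProfile s M n
  set e := ENNReal.ofReal ε ^ 2 with he
  have he0 : 0 < e := by positivity
  have he4 : 0 < e / 4 := ENNReal.div_pos he0.ne' (by simp)
  obtain ⟨K, hK0, hK⟩ := Frame.exists_sqSum_act_le_self (d := d) hs (θ₀.size + 1)
  have hlim := Frame.tendsto_sqSum_act_sub (l := comap θ₀.dist (𝓝 0)) (θ := id) (θ₀ := θ₀) hs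
    tendsto_comap (Frame.memSigma_act hs θ₀ hG) hG.1
  have hev := ENNReal.tendsto_nhds_zero.mp hlim (e / 4) he4
  rw [eventually_comap, Metric.eventually_nhds_iff] at hev
  obtain ⟨ρ, hρ, hρ'⟩ := hev
  refine ⟨min ρ 1, by positivity, e / 4 / ENNReal.ofReal (K + 1), ENNReal.div_pos he4.ne' (by simp),
    fun q p α σ' τ g hg hp hr => ⟨τ * wt n + α - inner ℝ p q, -q, ?_⟩⟩
  -- After undoing the translation and the phase, only the momentum `p` and the scale remain.
  set θ : Frame d := ⟨0, p, 0, σ'⟩ with hθ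
  have hdist : θ₀.dist θ = ‖p‖ + |σ' - σ| := by simp [Frame.dist, hθ, hθ₀]
  simp only [cexp_mul_act_sub_neg]
  have hF := memLp_hoFlow τ hg
  have h1 : sqSum s (fun k => hermiteCoeff (θ.act G) k - hermiteCoeff (θ₀.act G) k) ≤ e / 4 :=
    hρ' (y := θ₀.dist θ) (by
      rw [hdist, Real.dist_eq, sub_zero, abs_of_nonneg (by positivity)]
      exact hp.trans_le (min_le_left _ _)) θ rfl
  set c : ℂ := Complex.exp (Complex.I * ((τ * wt n : ℝ) : ℂ)) with hc
  have h2 : sqSum s (fun k => hermiteCoeff (θ.act G) k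
      - hermiteCoeff (fun x => c * θ.act (hoFlow τ g) x) k) ≤ e / 4 := by
    have h3 := hK θ ((θ₀.size_le_add_dist θ).trans (by
      rw [hdist]; gcongr; exact hp.le.trans (min_le_right _ _))) (fun x => G x - c * hoFlow τ g x)
      (hG.1.sub (hF.const_mul c))
    rw [Frame.act_sub, Frame.act_const_mul, sqSum_hermiteCoeff_sub (θ.memLp_act hG.1)
      ((θ.memLp_act hF).const_mul c), sqSum_hermiteCoeff_sub hG.1 (hF.const_mul c)] at h3
    refine h3.trans ?_
    simp only [hermiteCoeff_const_mul]
    rw [sqSum_eigenProfile_sub_hoFlow s M τ n hg]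
    calc _ ≤ ENNReal.ofReal (K + 1) * (e / 4 / ENNReal.ofReal (K + 1)) := by
          gcongr; linarith
      _ = e / 4 := ENNReal.mul_div_cancel (by simp; linarith) (by simp)
  rw [sigmaNorm_sub_eq (θ₀.memLp_act hG.1) ((θ.memLp_act hF).const_mul c)]
  have h4 : sqSum s (fun k => hermiteCoeff (θ₀.act G) k
      - hermiteCoeff (fun x => c * θ.act (hoFlow τ g) x) k) ≤ e := by
    refine (sqSum_sub_le s _ (hermiteCoeff (θ.act G)) _).trans ?_
    rw [sqSum_sub_comm]
    calc _ ≤ 2 * (e / 4) + 2 * (e / 4) := by gcongr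
      _ = 4 * (e / 4) := by rw [← add_mul]; norm_num
      _ = e := ENNReal.mul_div_cancel (by simp) (by simp)
  calc _ ≤ e ^ (1 / 2 : ℝ) := ENNReal.rpow_le_rpow h4 (by norm_num)
    _ = ENNReal.ofReal ε := by
      rw [he, ← ENNReal.rpow_natCast, ← ENNReal.rpow_mul]; norm_num

/-- Solutions of the modified equation starting near `M^{1/2} Ω_{n,κ}` exist and stay near its orbit
under phases and translations. -/
lemma exists_isSolutionH'_near [NeZero d] {lam η M κ : ℝ} (hlam : 0 ≤ lam) (hM : 0 < M)
    (hκ : κ = lam + η * M) (hκ0 : 0 < κ) (n : Fin d → ℕ) {s : ℝ} (hs : 1 / 2 ≤ s) {ε : ℝ}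
    (hε : 0 < ε) : ∃ δ : ℝ, 0 < δ ∧ ∀ f : Space d → ℂ, MemSigma s f →
      sigmaNorm s (fun x => f x - (Frame.mk 0 0 0 (Real.log κ / 4)).act (eigenProfile M n) x)
        < ENNReal.ofReal δ →
      mass f ≠ 0 ∧ 0 < lam + η * mass f ∧ ∃ v : ℝ → Space d → ℂ, IsSolutionH' lam η v ∧
        v 0 =ᵐ[volume] f ∧ (∀ s', 0 ≤ s' → MemSigma s' f → ContinuousInSigma s' v) ∧
        ∀ t, ∃ (θ : ℝ) (y : Space d), sigmaNorm s (fun x =>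
          (Frame.mk 0 0 0 (Real.log κ / 4)).act (eigenProfile M n) x
            - Complex.exp (Complex.I * θ) * v t (x - y)) ≤ ENNReal.ofReal ε := by
  have hs0 : 0 ≤ s := by linarith
  set σ := Real.log κ / 4
  set φ := (Frame.mk 0 0 0 σ).act (eigenProfile M n) with hφ
  have hφs : MemSigma s φ := Frame.memSigma_act hs0 _ (memSigma_eigenProfile s M n)
  have hmφ : mass φ = M := by rw [hφ, Frame.mass_act, mass_eigenProfile hM.le]
  have hmφ0 : mass φ ≠ 0 := by rw [hmφ]; exact hM.ne'
  obtain ⟨ρ, hρ, r, hr, hnear⟩ := exists_forall_sigmaNorm_le hs0 M σ n hε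
  -- All parameters of a nearby solution are continuous along the filter `f → φ` in `Σ^s`.
  set D : {f : Space d → ℂ // MemSigma s f} → ℝ≥0∞ := fun f => sigmaNorm s (fun x => f.1 x - φ x)
  set l := comap D (𝓝 0)
  have hl : Tendsto (fun f : {f : Space d → ℂ // MemSigma s f} =>
      sqSum s (fun k => hermiteCoeff f.1 k - hermiteCoeff φ k)) l (𝓝 0) := by
    have h : Tendsto D l (𝓝 0) := tendsto_comap
    simp only [D, fun f : {f : Space d → ℂ // MemSigma s f} =>
      sigmaNorm_sub_eq (s := s) f.2.1 hφs.1]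
      at h
    exact tendsto_rpow_half_iff.mp h
  have hmem : ∀ f : {f : Space d → ℂ // MemSigma s f}, MemSigma s f.1 := fun f => f.2
  have hmass := tendsto_mass hs0 hmem hφs hl
  have hκl : Tendsto (fun f : {f : Space d → ℂ // MemSigma s f} => lam + η * mass f.1) l (𝓝 κ) := by
    have := (hmass.const_mul η).const_add lam
    rwa [hmφ, ← hκ] at this
  have hσl : Tendsto (fun f : {f : Space d → ℂ // MemSigma s f} =>
      Real.log (lam + η * mass f.1) / 4)
      l (𝓝 σ) := (hκl.log hκ0.ne').div_const 4
  have hql := tendsto_meanPos hs hmem hφs hmφ0 hl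
  have hpl := ((Real.continuous_exp.tendsto _).comp hσl).smul
    (tendsto_meanMom hs hmem hφs hmφ0 hσl hl)
  have hgl := tendsto_restProfile hs hmem hφs hmφ0 hσl hl
  rw [meanPos_act_eigenProfile] at hql
  rw [meanMom_act_eigenProfile, smul_zero] at hpl
  rw [restProfile_act_eigenProfile] at hgl
  have hdist := ((((hpl.norm.pow 2).add ((hql.norm.pow 2).const_mul lam)).sqrt).add
    (hσl.sub_const σ).abs)
  simp only [norm_zero, ne_eq, OfNat.ofNat_ne_zero, not_false_eq_true, zero_pow, mul_zero, add_zero,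
    Real.sqrt_zero, sub_self, abs_zero, Function.comp_apply] at hdist
  have hev := ((hmass.eventually_ne hmφ0).and (hκl.eventually_const_lt hκ0)).and
    ((hdist.eventually_lt_const hρ).and (ENNReal.tendsto_nhds_zero.mp hgl r hr))
  rw [eventually_comap] at hev
  obtain ⟨δ, hδ0, hδ⟩ := (ENNReal.nhds_zero_basis.eventually_iff).mp hev
  have hδ' : 0 < min δ 1 := lt_min hδ0 one_pos
  refine ⟨(min δ 1).toReal, ENNReal.toReal_pos hδ'.ne' (by simp), fun f hf hfd => ?_⟩
  rw [ENNReal.ofReal_toReal (by simp)] at hfd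
  obtain ⟨⟨h1, h2⟩, h3, h4⟩ := hδ (hfd.trans_le (min_le_left _ _)) ⟨f, hf⟩ rfl
  obtain ⟨q, p, α, hq, hp, hqp, hsol, h0, hc⟩ := exists_isSolutionH' hlam (hf.mono hs) h1 rfl h2
  refine ⟨h1, h2, _, hsol, h0, hc, fun t => ?_⟩
  refine hnear (q t) (p t) (α t) _ _ _ (memSigma_restProfile hs0 _ hf).1 ?_ h4
  refine lt_of_le_of_lt ?_ h3
  gcongr
  refine Real.le_sqrt_of_sq_le ?_
  rw [← hp, ← hq]
  exact hqp.sq_norm_p_le hlam t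

/-! ### The gauge transformation between the two equations -/

lemma norm_cexp_I_mul (r : ℝ) : ‖Complex.exp (Complex.I * r)‖ = 1 := by
  rw [mul_comm, Complex.norm_exp_ofReal_mul_I]

lemma mass_phase (r : ℝ) (f : Space d → ℂ) :
    mass (fun x => Complex.exp (Complex.I * r) * f x) = mass f := by
  simp only [mass, norm_mul, norm_cexp_I_mul, one_mul]

lemma momentVec_phase (r : ℝ) (f : Space d → ℂ) :
    momentVec (fun x => Complex.exp (Complex.I * r) * f x) = momentVec f := by
  ext j
  simp only [momentVec_apply, moment, norm_mul, norm_cexp_I_mul, one_mul]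

lemma secondMoment_phase (r : ℝ) (f : Space d → ℂ) :
    secondMoment (fun x => Complex.exp (Complex.I * r) * f x) = secondMoment f := by
  simp only [secondMoment, norm_mul, norm_cexp_I_mul, one_mul]

/-- The phase of the gauge transformation. -/
def gaugePhase (η : ℝ) (u : ℝ → Space d → ℂ) (t : ℝ) : ℝ :=
  ∫ τ in (0 : ℝ)..t, η * secondMoment (u τ) / 2

lemma gaugePhase_zero (η : ℝ) (u : ℝ → Space d → ℂ) : gaugePhase η u 0 = 0 :=
  intervalIntegral.integral_same

section Gauge
variable [NeZero d] {lam η : ℝ} {u v w : ℝ → Space d → ℂ} {β : ℝ → ℝ}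

/-- The convolution equation as a weak flow with a time-dependent constant term. -/
lemma isSolutionH_iff (hc : ContinuousInSigma 1 u) : IsSolutionH lam η u ↔
    IsWeakFlow (fun t => QuadGen.schr (lam + η * mass (u t)) (η • momentVec (u t))
      (-(η * secondMoment (u t) / 2))) u := by
  rw [IsSolutionH, and_iff_right hc, solvesEquation_iff (fun t x => potentialH_eq (hc.1 t) x)]
  exact ⟨fun h => ⟨fun t => (hc.1 t).1, hc.exists_mass_le (by norm_num), h⟩, fun h => h.hasDerivAt⟩

/-- A phase that follows the second moment turns solutions of the convolution equation into
solutions of the modified equation. -/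
lemma IsSolutionH.gauge (hu : IsSolutionH lam η u)
    (hβ : ∀ t, HasDerivAt β (η * secondMoment (u t) / 2) t) :
    IsSolutionH' lam η (fun t x => Complex.exp (Complex.I * β t) * u t x) := by
  have hc := hu.1
  have hc2 : ContinuousInSigma (1 / 2) u := hc.mono (by norm_num)
  have h := ((isSolutionH_iff hc).mp hu).phase hβ
  simp only [neg_add_cancel] at h
  have hm := hc.continuous_mass zero_le_one
  refine isSolutionH'_of_isWeakFlow ?_ ?_
  · refine h.continuousInSigma (QuadGen.locallyBounded_schr (by fun_prop)
      (hc2.continuous_momentVec.const_smul η) continuous_const) (by norm_num) ?_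
    exact ⟨(hc2.1 0).1.const_mul _, by
      rw [sigmaNorm_eq, sqSum_congr (c' := hermiteCoeff (u 0)) fun n => by
        rw [hermiteCoeff_const_mul, norm_mul, norm_cexp_I_mul, one_mul]]
      exact (hc2.1 0).2⟩
  · simp only [mass_phase, momentVec_phase]
    exact h

/-- The converse of `IsSolutionH.gauge`, with persistence of regularity. -/
lemma IsSolutionH'.gauge (hv : IsSolutionH' lam η v) (hc : ContinuousInSigma 1 v)
    (hβ : ∀ t, HasDerivAt β (η * secondMoment (v t) / 2) t) :
    IsSolutionH lam η (fun t x => Complex.exp (Complex.I * (-β t : ℝ)) * v t x) ∧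
      ∀ s, 0 ≤ s → MemSigma s (v 0) →
        ContinuousInSigma s (fun t x => Complex.exp (Complex.I * (-β t : ℝ)) * v t x) := by
  obtain ⟨hflow, hm⟩ := hv.isWeakFlow
  have h := IsWeakFlow.phase (κ := fun _ => lam + η * mass (v 0))
    (F := fun t => η • momentVec (v t))
    (r := fun _ => 0) hflow (fun t => (hβ t).neg)
  simp only [zero_add] at h
  have hsm := hc.continuous_secondMoment
  have hcs : ∀ s, 0 ≤ s → MemSigma s (v 0) →
      ContinuousInSigma s (fun t x => Complex.exp (Complex.I * (-β t : ℝ)) * v t x) :=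
        fun s hs h0 => by
    refine h.continuousInSigma (QuadGen.locallyBounded_schr continuous_const
      (hv.1.continuous_momentVec.const_smul η) (by fun_prop)) hs ?_
    exact ⟨h0.1.const_mul _, by
      rw [sigmaNorm_eq, sqSum_congr (c' := hermiteCoeff (v 0)) fun n => by
        rw [hermiteCoeff_const_mul, norm_mul, Pi.neg_apply, norm_cexp_I_mul, one_mul]]
      exact h0.2⟩
  refine ⟨(isSolutionH_iff (hcs 1 zero_le_one (hc.1 0))).mpr ?_, hcs⟩
  simp only [mass_phase, momentVec_phase, secondMoment_phase, hm]
  exact h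

lemma hasDerivAt_gaugePhase (η : ℝ) (hu : ContinuousInSigma 1 u) (t : ℝ) :
    HasDerivAt (gaugePhase η u) (η * secondMoment (u t) / 2) t := by
  have hsm := hu.continuous_secondMoment
  have hc : Continuous fun t => η * secondMoment (u t) / 2 := by fun_prop
  exact intervalIntegral.integral_hasDerivAt_right (hc.intervalIntegrable _ _)
    (hc.stronglyMeasurableAtFilter _ _) hc.continuousAt

/-- Uniqueness for the convolution equation. -/
lemma IsSolutionH.unique (hlam : 0 ≤ lam) (hu : IsSolutionH lam η u) (hw : IsSolutionH lam η w)
    (h0 : u 0 =ᵐ[volume] w 0) (hm : mass (w 0) ≠ 0) (hκ : 0 < lam + η * mass (w 0)) (t : ℝ) :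
    u t =ᵐ[volume] w t := by
  have hu' := hu.gauge (hasDerivAt_gaugePhase η hu.1)
  have hw' := hw.gauge (hasDerivAt_gaugePhase η hw.1)
  have heq := hu'.unique hlam hw' (by simpa [gaugePhase_zero] using h0)
    (by rwa [mass_phase]) (by rwa [mass_phase])
  -- the gauge preserves second moments, hence the two phases agree
  have hs : ∀ t, secondMoment (u t) = secondMoment (w t) := fun t => by
    have := secondMoment_congr (heq t)
    rwa [secondMoment_phase, secondMoment_phase] at this
  have hg : gaugePhase η u t = gaugePhase η w t := by simp only [gaugePhase, hs]
  filter_upwards [heq t] with x hx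
  rw [hg] at hx
  exact mul_left_cancel₀ (Complex.exp_ne_zero _) hx

end Gauge

/-! ### Standing waves and orbital stability -/

lemma iSup_iInf_lt {s ε : ℝ} (hε : 0 < ε) {φ : Space d → ℂ} {u : ℝ → Space d → ℂ}
    (h : ∀ t, ∃ (θ : ℝ) (y : Space d), sigmaNorm s (fun x =>
      φ x - Complex.exp (Complex.I * θ) * u t (x - y)) ≤ ENNReal.ofReal (ε / 2)) :
    (⨆ (t : ℝ) (_ : 0 < t), ⨅ (θ : ℝ) (y : Space d),
      sigmaNorm s (fun x => φ x - Complex.exp (Complex.I * θ) * u t (x - y)))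
        < ENNReal.ofReal ε := by
  have h2 : ENNReal.ofReal (ε / 2) < ENNReal.ofReal ε :=
    (ENNReal.ofReal_lt_ofReal_iff hε).mpr (half_lt_self hε)
  refine lt_of_le_of_lt ?_ h2
  refine iSup_le fun t => iSup_le fun _ => ?_
  obtain ⟨θ, y, h⟩ := h t
  exact iInf_le_of_le θ (iInf_le_of_le y h)

section Standing
variable [NeZero d] {lam η M κ : ℝ}

lemma isWeakFlow_standing (hκ : 0 < κ) (M : ℝ) (n : Fin d → ℕ) :
    IsWeakFlow (fun _ => QuadGen.driven κ 0) (fun t x =>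
      Complex.exp (Complex.I * (-(Real.sqrt κ * wt n * t) : ℝ))
        * (Frame.mk 0 0 0 (Real.log κ / 4)).act (eigenProfile M n) x) := by
  have h := isWeakFlow_driven (d := d) hκ (q := fun _ => 0) (p := fun _ => 0) (F := fun _ => 0)
    (α := fun _ => 0) continuous_const (fun t => hasDerivAt_const t _)
    (fun t => (hasDerivAt_const t _).congr_deriv (by simp))
    (fun t => (hasDerivAt_const t _).congr_deriv (by simp)) (memLp_eigenProfile M n)
  refine h.congr fun t => ?_
  refine (Frame.act_congr _ (hoFlow_eigenProfile M _ n)).trans (Eventually.of_forall fun x => ?_)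
  rw [Frame.act_const_mul, ← mul_neg, ← Complex.ofReal_neg, mul_right_comm]

lemma isSolutionH'_standing (hM : 0 < M) (hκ : κ = lam + η * M) (hκ0 : 0 < κ) (n : Fin d → ℕ) :
    IsSolutionH' lam η (fun t x => Complex.exp (Complex.I * (-(Real.sqrt κ * wt n * t) : ℝ))
        * (Frame.mk 0 0 0 (Real.log κ / 4)).act (eigenProfile M n) x) ∧
    ContinuousInSigma 1 (fun t x => Complex.exp (Complex.I * (-(Real.sqrt κ * wt n * t) : ℝ))
        * (Frame.mk 0 0 0 (Real.log κ / 4)).act (eigenProfile M n) x) := by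
  have h := isWeakFlow_standing hκ0 M n
  have hc : ContinuousInSigma 1 (fun t x =>
      Complex.exp (Complex.I * (-(Real.sqrt κ * wt n * t) : ℝ))
        * (Frame.mk 0 0 0 (Real.log κ / 4)).act (eigenProfile M n) x) := by
    refine h.continuousInSigma (QuadGen.locallyBounded_driven continuous_const continuous_const)
      zero_le_one ?_
    simpa using Frame.memSigma_act zero_le_one _ (memSigma_eigenProfile 1 M n)
  have hmv : momentVec ((Frame.mk 0 0 0 (Real.log κ / 4)).act (eigenProfile M n)) = 0 := by
    ext j
    rw [momentVec_apply, Frame.moment_act _ (memSigma_eigenProfile _ M n), moment_eigenProfile]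
    simp
  refine ⟨isSolutionH'_of_isWeakFlow (hc.mono (by norm_num)) ?_, hc⟩
  simp only [mass_phase, momentVec_phase, Frame.mass_act, mass_eigenProfile hM.le, hmv, smul_zero,
    ← hκ]
  exact h

lemma secondMoment_act_eigenProfile (hM : 0 < M) (hκ0 : 0 < κ) (n : Fin d → ℕ) :
    secondMoment ((Frame.mk 0 0 0 (Real.log κ / 4)).act (eigenProfile M n))
      = M * wt n / Real.sqrt κ := by
  rw [secondMoment, Frame.integral_mul_sq_act _ _ (fun x => ‖x‖ ^ 2)]
  have h1 : ∀ y : Space d, ‖(Frame.mk 0 0 0 (Real.log κ / 4)).pt y‖ ^ 2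
      = (Real.sqrt κ)⁻¹ * ‖y‖ ^ 2 := fun y => by
    rw [← exp_log_div_four hκ0, Frame.pt, add_zero, norm_smul,
      Real.norm_of_nonneg (Real.exp_nonneg _), mul_pow, Real.exp_neg, sq, ← mul_inv]
  simp only [h1, mul_assoc]
  rw [integral_const_mul]
  change _ * secondMoment (eigenProfile M n) = _
  rw [secondMoment_eigenProfile hM.le]
  ring

lemma isStandingWave_H' (hM : 0 < M) (hκ : κ = lam + η * M) (hκ0 : 0 < κ) (n : Fin d → ℕ) :
    IsStandingWave (IsSolutionH' lam η) (2 * Real.sqrt κ * wt n)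
      ((Frame.mk 0 0 0 (Real.log κ / 4)).act (eigenProfile M n)) := by
  unfold IsStandingWave
  have h := (isSolutionH'_standing hM hκ hκ0 n).1
  convert h using 5
  push_cast
  ring

lemma isStandingWave_H (hM : 0 < M) (hκ : κ = lam + η * M) (hκ0 : 0 < κ) (n : Fin d → ℕ) :
    IsStandingWave (IsSolutionH lam η) ((2 + η * M / κ) * Real.sqrt κ * wt n)
      ((Frame.mk 0 0 0 (Real.log κ / 4)).act (eigenProfile M n)) := by
  obtain ⟨h, hc⟩ := isSolutionH'_standing hM hκ hκ0 n
  have hs : 0 < Real.sqrt κ := Real.sqrt_pos.mpr hκ0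
  obtain ⟨h2, -⟩ := h.gauge hc (β := fun t => t * (η * (M * wt n / Real.sqrt κ) / 2)) fun t => by
    rw [secondMoment_phase, secondMoment_act_eigenProfile hM hκ0]
    simpa using (hasDerivAt_id t).mul_const (η * (M * wt n / Real.sqrt κ) / 2)
  unfold IsStandingWave
  convert h2 using 3 with t x
  rw [← mul_assoc, ← Complex.exp_add, ← mul_add, ← Complex.ofReal_add]
  congr 2
  have : (2 + η * M / κ) * Real.sqrt κ * wt n * t / 2
      = t * (η * (M * wt n / Real.sqrt κ) / 2) + Real.sqrt κ * wt n * t := by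
    have hk : κ = Real.sqrt κ * Real.sqrt κ := (Real.mul_self_sqrt hκ0.le).symm
    have : η * M / κ * Real.sqrt κ = η * M / Real.sqrt κ := by
      nth_rewrite 1 [hk]
      field_simp
    linear_combination (wt n * t / 2) * this
  rw [← neg_add, ← this]
  push_cast
  ring

lemma isOrbitallyStable_H' (hlam : 0 ≤ lam) (hM : 0 < M) (hκ : κ = lam + η * M) (hκ0 : 0 < κ)
    (n : Fin d → ℕ) {s : ℝ} (hs : 1 / 2 ≤ s) : IsOrbitallyStable (IsSolutionH' lam η) s
      ((Frame.mk 0 0 0 (Real.log κ / 4)).act (eigenProfile M n)) := by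
  refine ⟨Frame.memSigma_act (by linarith) _ (memSigma_eigenProfile s M n), fun ε hε => ?_⟩
  obtain ⟨δ, hδ, H⟩ := exists_isSolutionH'_near hlam hM hκ hκ0 n hs (half_pos hε)
  refine ⟨δ, hδ, fun f hf hfd => ?_⟩
  obtain ⟨hm, hk, v, hv, h0, hc, hnear⟩ := H f hf hfd
  refine ⟨v, hv, h0, fun w hw hw0 => ?_, hc s (by linarith) hf, iSup_iInf_lt hε hnear⟩
  exact hw.unique hlam hv (hw0.trans h0.symm) (by rwa [mass_congr h0]) (by rwa [mass_congr h0])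

lemma isOrbitallyStable_H (hlam : 0 ≤ lam) (hM : 0 < M) (hκ : κ = lam + η * M) (hκ0 : 0 < κ)
    (n : Fin d → ℕ) {s : ℝ} (hs : 1 ≤ s) : IsOrbitallyStable (IsSolutionH lam η) s
      ((Frame.mk 0 0 0 (Real.log κ / 4)).act (eigenProfile M n)) := by
  refine ⟨Frame.memSigma_act (by linarith) _ (memSigma_eigenProfile s M n), fun ε hε => ?_⟩
  have hs2 : 1 / 2 ≤ s := by linarith
  obtain ⟨δ, hδ, H⟩ := exists_isSolutionH'_near hlam hM hκ hκ0 n hs2 (half_pos hε)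
  refine ⟨δ, hδ, fun f hf hfd => ?_⟩
  obtain ⟨hm, hk, v, hv, h0, hc, hnear⟩ := H f hf hfd
  have hc1 := hc 1 zero_le_one (hf.mono hs)
  obtain ⟨hu, hcu⟩ := hv.gauge hc1 (hasDerivAt_gaugePhase η hc1)
  have hu0 : (fun x => Complex.exp (Complex.I * (-gaugePhase η v 0 : ℝ)) * v 0 x) =ᵐ[volume] f := by
    simpa [gaugePhase_zero] using h0
  have hphase : ∀ (θ r : ℝ) (z : ℂ), Complex.exp (Complex.I * (θ + r : ℝ))
      * (Complex.exp (Complex.I * (-r : ℝ)) * z) = Complex.exp (Complex.I * θ) * z :=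
        fun θ r z => by
    rw [← mul_assoc, ← Complex.exp_add, ← mul_add, ← Complex.ofReal_add, add_neg_cancel_right]
  have hnear' : ∀ t, ∃ (θ : ℝ) (y : Space d), sigmaNorm s (fun x =>
      (Frame.mk 0 0 0 (Real.log κ / 4)).act (eigenProfile M n) x - Complex.exp (Complex.I * θ)
        * (Complex.exp (Complex.I * (-gaugePhase η v t : ℝ)) * v t (x - y)))
          ≤ ENNReal.ofReal (ε / 2) := fun t => by
    obtain ⟨θ, y, h⟩ := hnear t
    refine ⟨θ + gaugePhase η v t, y, ?_⟩
    simp only [hphase]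
    exact h
  refine ⟨fun t x => Complex.exp (Complex.I * (-gaugePhase η v t : ℝ)) * v t x, hu, hu0,
    fun w hw hw0 => ?_, hcu s (by linarith) (memSigma_congr h0.symm hf), ?_⟩
  · exact hw.unique hlam hu (hw0.trans hu0.symm) (by rwa [mass_congr hu0]) (by rwa [mass_congr hu0])
  · exact iSup_iInf_lt (u := fun t x => Complex.exp (Complex.I * (-gaugePhase η v t : ℝ)) * v t x)
      hε hnear'

end Standing

end NonlocalNLS

end

theorem theorem3 (d : ℕ) (hd : 1 ≤ d) (lam η M κ : ℝ) (hlam : 0 ≤ lam) (hM : 0 < M)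
    (hκ : κ = lam + η * M) (hκpos : 0 < κ) (n : Fin d → ℕ)
    (φ : Space d → ℂ) (hφ : φ = fun x => ((Real.sqrt M * hermiteFunScaled κ n x : ℝ) : ℂ))
    (ω₁ ω₂ : ℝ)
    (hω₁ : ω₁ = (2 + η * M / κ) * Real.sqrt κ * ((len n : ℝ) + (d : ℝ) / 2))
    (hω₂ : ω₂ = 2 * Real.sqrt κ * ((len n : ℝ) + (d : ℝ) / 2)) :
    (IsStandingWave (IsSolutionH lam η) ω₁ φ ∧
      ∀ s : ℝ, 1 ≤ s → IsOrbitallyStable (IsSolutionH lam η) s φ) ∧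
    (IsStandingWave (IsSolutionH' lam η) ω₂ φ ∧
      ∀ s : ℝ, 1 / 2 ≤ s → IsOrbitallyStable (IsSolutionH' lam η) s φ) := by
  have : NeZero d := ⟨by omega⟩
  rw [← frame_act_eigenProfile hκpos M n] at hφ
  subst hφ hω₁ hω₂
  exact ⟨⟨isStandingWave_H hM hκ hκpos n, fun s hs => isOrbitallyStable_H hlam hM hκ hκpos n hs⟩,
    ⟨isStandingWave_H' hM hκ hκpos n, fun s hs => isOrbitallyStable_H' hlam hM hκ hκpos n hs⟩⟩
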